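/- **Setting.** Let $\Bbbk$ be a field of characteristic $0$, $R=\Bbbk[[\hbar]]$, $I=\{1,\dots,n\}$. Let $A=(a_{ij})$ be a generalized Cartan matrix and $D=\mathrm{diag}(d_1,\dots,d_n)$, with positive integers $d_i$, such that $DA$ is symmetric. A matrix $P=(p_{ij})\in M_n(R)$ is *of Cartan type* (for $A$) if its symmetric part $P_s=\frac12(P+P^T)$ equals $DA$. A *realization* of $P$ is a triple $\mathcal R=(\mathfrak h,\Pi,\Pi^\vee)$, where $\mathfrak h$ is a free $R$-module of finite rank (the *rank* of $\mathcal R$), $\Pi^\vee=\{T_i^+,T_i^-\}_{i\in I}\subseteq\mathfrak h$, $\Pi=\{\alpha_i\}_{i\in I}\subseteq\mathfrak h^*$, with $\alpha_j(T_i^+)=p_{ij}$, $\alpha_j(T_i^-)=p_{ji}$, and the elements $S_i=\frac12(T_i^++T_i^-)$ are $\Bbbk$-linearly independent modulo $\hbar\mathfrak h$. It is *split* if the $2n$ elements $T_i^\pm$ are $\Bbbk$-linearly independent modulo $\hbar\mathfrak h$, and *minimal* if the $T_i^\pm$ span $\mathfrak h$ over $R$. Put $q_i=e^{\hbar d_i}$,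 $q_{ij}^{1/2}=e^{\hbar p_{ij}/2}$, and let $\left[{m\atop k}\right]_q$ be the symmetric $q$-binomial coefficients. The *FoMpQUEA* $U^{\mathcal R}_{P,\hbar}(\mathfrak g)$ is the unital associative $\hbar$-adically complete $R$-algebra topologically generated by the $R$-module $\mathfrak h$ and elements $E_i,F_i$ ($i\in I$) with relations, for $T,T'\in\mathfrak h$, $$TE_j-E_jT=\alpha_j(T)E_j,\quad TF_j-F_jT=-\alpha_j(T)F_j,\quad TT'=T'T,\quad E_iF_j-F_jE_i=\delta_{ij}\frac{e^{\hbar T_i^+}-e^{-\hbar T_i^-}}{q_i-q_i^{-1}},$$ and, for $i\ne j$ and $m=1-a_{ij}$, $$\sum_{k=0}^{m}(-1)^k\left[{m\atop k}\right]_{q_i}q_{ij}^{k/2}q_{ji}^{-k/2}E_i^{m-k}E_jE_i^k=0,\qquad \sum_{k=0}^{m}(-1)^k\left[{m\atop k}\right]_{q_i}q_{ij}^{-k/2}q_{ji}^{k/2}F_i^{m-k}F_jF_i^k=0 .$$ It is a topological Hopf algebra (over $R$, with the $\hbar$-adically completed tensor product) by $$\Delta(E_i)=E_i\otimes1+e^{\hbar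 T_i^+}\otimes E_i,\quad \Delta(F_i)=F_i\otimes e^{-\hbar T_i^-}+1\otimes F_i,\quad \Delta(T)=T\otimes1+1\otimes T,$$ $\epsilon(E_i)=\epsilon(F_i)=\epsilon(T)=0$, $S(E_i)=-e^{-\hbar T_i^+}E_i$, $S(F_i)=-F_ie^{\hbar T_i^-}$, $S(T)=-T$. The *Borel FoMpQUEAs* $U^{\mathcal R}_{P,\hbar}(\mathfrak b_+)$ and $U^{\mathcal R}_{P,\hbar}(\mathfrak b_-)$ are its $\hbar$-adically closed subalgebras generated by $\mathfrak h$ and all $E_i$, respectively by $\mathfrak h$ and all $F_i$, with the Hopf structures given by the same formulas. *Toral $2$-cocycles.* Let $\mathrm{Alt}^S(\mathfrak h)$ be the set of antisymmetric $R$-bilinear forms $\chi:\mathfrak h\times\mathfrak h\to R$ with $\chi(S_i,-)=0=\chi(-,S_i)$ for all $i$. Such a $\chi$ induces a form $\bar\chi$ on $\bar{\mathfrak h}=\mathfrak h/\mathfrak s$, $\mathfrak s=\mathrm{Span}_R\{S_i\}$. Let $\tilde\chi$ be the continuous bilinear form on the completed symmetric algebra $\widehat S(\bar{\mathfrak h})$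 that equals $\bar\chi$ on $\bar{\mathfrak h}\times\bar{\mathfrak h}$ and vanishes on $S^r\times S^s$ for $(r,s)\neq(1,1)$; let $\bar\chi_U=\sum_{m\ge0}\hbar^{-m}\,\tilde\chi^{*m}/(2^m m!)$ ($*$ being convolution), and let $\sigma_\chi=\bar\chi_U\circ(\pi\times\pi)$, where $\pi$ is the Hopf algebra map from $U^{\mathcal R}_{P,\hbar}(\mathfrak g)$ (or from a Borel FoMpQUEA) to $\widehat S(\bar{\mathfrak h})$ with $\pi(T)=T+\mathfrak s$ and $\pi(E_i)=0=\pi(F_i)$. The *toral $2$-cocycle deformation* $(\,\cdot\,)_{\sigma_\chi}$ has the same unit, coproduct and counit, and the product $a\cdot b=\sigma_\chi(a_{(1)},b_{(1)})\,a_{(2)}b_{(2)}\,\sigma_\chi^{-1}(a_{(3)},b_{(3)})$, where the terms are collected by powers of $\hbar^{-1}$ and the sum converges $\hbar$-adically. **Theorem.** Let $P,P'\in M_n(R)$ be of Cartan type with the same $A$ (and $D$), that is, $P_s=P'_s=DA$. Let $\mathcal R=(\mathfrak h,\Pi,\Pi^\vee)$ be a realization of $P$. (a) If $\mathcal R$ is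 split, there exist a split realization $\mathcal R'$ of $P'$ of the same rank (indeed on the same module $\mathfrak h$), an antisymmetric matrix $\mathring X=(\mathring\chi_{ij})\in\mathfrak{so}_n(R)$ and $\chi\in\mathrm{Alt}^S(\mathfrak h)$ with $\mathring\chi_{ij}=\chi(T_i^+,T_j^+)$ and $P'=P+\mathring X$, such that there is an isomorphism of topological Hopf algebras $$U^{\mathcal R'}_{P',\hbar}(\mathfrak g)\cong\big(U^{\mathcal R}_{P,\hbar}(\mathfrak g)\big)_{\sigma_\chi}.$$ (b) Let $\mathcal R_{st}$ be the split minimal realization of $DA$ whose module $\mathfrak h_{st}$ is free on $T_1^\pm,\dots,T_n^\pm$ with $\alpha_j(T_i^\pm)=d_ia_{ij}$, and let $U_{DA,\hbar}(\mathfrak g)$ be the FoMpQUEA on it (Drinfeld's standard double QUEA). If $\mathcal R$ is split and minimal, there exists $\chi\in\mathrm{Alt}^S(\mathfrak h_{st})$ with $$U^{\mathcal R}_{P,\hbar}(\mathfrak g)\cong\big(U_{DA,\hbar}(\mathfrak g)\big)_{\sigma_\chi}$$ as topological Hopf algebras. (c) For the same $\mathcal R'$ and $\chi$, the statements in (a)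 and (b) hold with $\mathfrak g$ replaced by $\mathfrak b_+$ and by $\mathfrak b_-$. -/

import Mathlib

open PowerSeries TensorProduct
open scoped Nat

noncomputable section

namespace FoMp

variable (K : Type*) [Field K]

/-- The ideal `(ħ)` of `𝕜[[ħ]]`, where `ħ = X`. -/
abbrev hId : Ideal K⟦X⟧ := Ideal.span {X}

lemma hId_fg : (hId K).FG := Submodule.fg_span_singleton _

section Adic

variable {K}
variable {M : Type*} [AddCommGroup M] [Module K⟦X⟧ M]
variable {N : Type*} [AddCommGroup N] [Module K⟦X⟧ N]
variable {P : Type*} [AddCommGroup P] [Module K⟦X⟧ P]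

lemma mem_hpow {n : ℕ} {x : M} :
    x ∈ ((hId K) ^ n • ⊤ : Submodule K⟦X⟧ M) ↔ ∃ z : M, x = (X : K⟦X⟧) ^ n • z := by
  rw [Ideal.span_singleton_pow, Submodule.ideal_span_singleton_smul]
  constructor
  · rintro ⟨z, -, rfl⟩
    exact ⟨z, rfl⟩
  · rintro ⟨z, rfl⟩
    exact Submodule.smul_mem_pointwise_smul _ _ _ trivial

instance instCompleteCompl : IsAdicComplete (hId K) (AdicCompletion (hId K) M) :=
  AdicCompletion.isAdicComplete (hId_fg K)

lemma compl_approx (x : AdicCompletion (hId K) M) (n : ℕ) :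
    ∃ (m : M) (z : AdicCompletion (hId K) M),
      x = AdicCompletion.of (hId K) M m + (X : K⟦X⟧) ^ n • z := by
  obtain ⟨m, hm⟩ := Submodule.mkQ_surjective _ (x.val n)
  have h : x - AdicCompletion.of (hId K) M m ∈
      ((hId K) ^ n • ⊤ : Submodule K⟦X⟧ (AdicCompletion (hId K) M)) := by
    rw [AdicCompletion.pow_smul_top_eq_ker_eval (hId_fg K)]
    simp only [LinearMap.mem_ker, map_sub, AdicCompletion.eval_apply]
    rw [sub_eq_zero, ← hm]
    rfl
  obtain ⟨z, hz⟩ := mem_hpow.1 h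
  exact ⟨m, z, by rw [← hz]; abel⟩

/-- A linear map is `ħ`-adically continuous, hence determined on a dense submodule. -/
lemma compl_hom_ext [IsAdicComplete (hId K) N] {f g : AdicCompletion (hId K) M →ₗ[K⟦X⟧] N}
    (h : ∀ m, f (AdicCompletion.of (hId K) M m) = g (AdicCompletion.of (hId K) M m)) : f = g := by
  ext1
  ext1 a
  set x := AdicCompletion.mk (hId K) M a
  change f x = g x
  rw [← sub_eq_zero]
  refine IsHausdorff.haus (inferInstance : IsHausdorff (hId K) N) _ fun n => ?_
  rw [SModEq.zero]
  obtain ⟨m, z, hz⟩ := compl_approx x n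
  refine mem_hpow.2 ⟨f z - g z, ?_⟩
  rw [hz, map_add, map_add, h, map_smul, map_smul, smul_sub]
  abel

variable [IsAdicComplete (hId K) N] [IsAdicComplete (hId K) P]

/-- The continuous extension of a linear map with values in a complete module. -/
def ext₁ : (M →ₗ[K⟦X⟧] N) →ₗ[K⟦X⟧] (AdicCompletion (hId K) M →ₗ[K⟦X⟧] N) where
  toFun f := (AdicCompletion.ofLinearEquiv (hId K) N).symm.toLinearMap ∘ₗ
    (AdicCompletion.map (hId K) f).restrictScalars K⟦X⟧
  map_add' f g := compl_hom_ext fun m => by simp [AdicCompletion.map_of]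
  map_smul' c f := compl_hom_ext fun m => by simp [AdicCompletion.map_of]

@[simp] lemma ext₁_of (f : M →ₗ[K⟦X⟧] N) (m : M) :
    ext₁ f (AdicCompletion.of (hId K) M m) = f m := by
  simp [ext₁, AdicCompletion.map_of]

/-- The continuous extension of a bilinear map with values in a complete module. -/
def ext₂ (f : M →ₗ[K⟦X⟧] N →ₗ[K⟦X⟧] P) :
    AdicCompletion (hId K) M →ₗ[K⟦X⟧] AdicCompletion (hId K) N →ₗ[K⟦X⟧] P :=
  (ext₁ ∘ₗ (ext₁ ∘ₗ f).flip).flip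

variable (K) in
/-- The sum `∑ ħ ^ k • f k` in a complete module. -/
def hsum (f : ℕ → N) : N :=
  (AdicCompletion.ofLinearEquiv (hId K) N).symm
    (AdicCompletion.mk (hId K) N (AdicCompletion.AdicCauchySequence.mk (hId K) N
      (fun n => ∑ k ∈ Finset.range n, (X : K⟦X⟧) ^ k • f k) fun n => by
        rw [Finset.sum_range_succ, SModEq.comm, SModEq.sub_mem]
        exact mem_hpow.2 ⟨f n, by abel⟩))

/-- `hsum f` is the `ħ`-adic limit of the partial sums. -/
lemma hsum_spec (f : ℕ → N) (n : ℕ) :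
    ∃ z : N, hsum K f = ∑ k ∈ Finset.range n, (X : K⟦X⟧) ^ k • f k + (X : K⟦X⟧) ^ n • z := by
  have h : AdicCompletion.of (hId K) N (hsum K f) = AdicCompletion.mk (hId K) N
      (AdicCompletion.AdicCauchySequence.mk (hId K) N
      (fun n => ∑ k ∈ Finset.range n, (X : K⟦X⟧) ^ k • f k) fun n => by
        rw [Finset.sum_range_succ, SModEq.comm, SModEq.sub_mem]
        exact mem_hpow.2 ⟨f n, by abel⟩) :=
    AdicCompletion.of_ofLinearEquiv_symm (I := hId K) (M := N) _
  have h2 := congrArg (fun y => y.val n) h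
  have h3 : hsum K f - ∑ k ∈ Finset.range n, (X : K⟦X⟧) ^ k • f k ∈
      ((hId K) ^ n • ⊤ : Submodule K⟦X⟧ N) := (Submodule.Quotient.eq _).1 h2
  obtain ⟨z, hz⟩ := mem_hpow.1 h3
  exact ⟨z, by rw [← hz]; abel⟩

end Adic

@[simp] lemma ext₂_of {K : Type*} [Field K] {M N P : Type*} [AddCommGroup M] [Module K⟦X⟧ M]
    [AddCommGroup N] [Module K⟦X⟧ N] [AddCommGroup P] [Module K⟦X⟧ P] [IsAdicComplete (hId K) P]
    (f : M →ₗ[K⟦X⟧] N →ₗ[K⟦X⟧] P) (m : M) (n : N) :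
    ext₂ f (AdicCompletion.of (hId K) M m) (AdicCompletion.of (hId K) N n) = f m n := by
  simp [ext₂]

/-! ### Completed algebras -/

section Alg

variable (A : Type*) [Ring A] [Algebra K⟦X⟧ A]

/-- The `ħ`-adic completion of a `𝕜[[ħ]]`-algebra, as a `𝕜[[ħ]]`-algebra. -/
def HComp : Type _ := AdicCompletion (hId K) A

instance : AddCommGroup (HComp K A) := inferInstanceAs (AddCommGroup (AdicCompletion (hId K) A))
instance : Module K⟦X⟧ (HComp K A) := inferInstanceAs (Module K⟦X⟧ (AdicCompletion (hId K) A))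
instance : IsAdicComplete (hId K) (HComp K A) :=
  inferInstanceAs (IsAdicComplete (hId K) (AdicCompletion (hId K) A))

namespace HComp

/-- The canonical map to the completion. -/
def of : A →ₗ[K⟦X⟧] HComp K A := AdicCompletion.of (hId K) A

/-- The product of the completion: the continuous extension of the product. -/
def mulₗ : HComp K A →ₗ[K⟦X⟧] HComp K A →ₗ[K⟦X⟧] HComp K A :=
  ext₂ ((LinearMap.mul K⟦X⟧ A).compr₂ (of K A))

variable {K A}

lemma mulₗ_of (a b : A) : mulₗ K A (of K A a) (of K A b) = of K A (a * b) :=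
  ext₂_of _ a b

lemma hom_ext {N : Type*} [AddCommGroup N] [Module K⟦X⟧ N] [IsAdicComplete (hId K) N]
    {f g : HComp K A →ₗ[K⟦X⟧] N} (h : ∀ a, f (of K A a) = g (of K A a)) : f = g :=
  compl_hom_ext (M := A) h

instance : Mul (HComp K A) := ⟨fun x y => mulₗ K A x y⟩
instance : One (HComp K A) := ⟨of K A 1⟩

lemma mul_def (x y : HComp K A) : x * y = mulₗ K A x y := rfl
lemma one_def : (1 : HComp K A) = of K A 1 := rfl

lemma of_mul (a b : A) : of K A (a * b) = of K A a * of K A b := (mulₗ_of a b).symm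

lemma mul_assoc' (x y z : HComp K A) : x * y * z = x * (y * z) := by
  have e1 : ∀ b c : A, (mulₗ K A).flip (of K A c) ∘ₗ (mulₗ K A).flip (of K A b) =
      (mulₗ K A).flip (of K A b * of K A c) := fun b c => hom_ext fun a => by
    simp only [LinearMap.comp_apply, LinearMap.flip_apply, ← of_mul, mulₗ_of, mul_assoc]
  have e2 : ∀ (x : HComp K A) (c : A), (mulₗ K A).flip (of K A c) ∘ₗ (mulₗ K A x) =
      (mulₗ K A x) ∘ₗ (mulₗ K A).flip (of K A c) := fun x c => hom_ext fun b => by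
    simpa [mul_def] using LinearMap.congr_fun (e1 b c) x
  have e3 : ∀ x y : HComp K A, mulₗ K A (x * y) = (mulₗ K A x) ∘ₗ (mulₗ K A y) :=
    fun x y => hom_ext fun c => by
      simpa [mul_def] using LinearMap.congr_fun (e2 x c) y
  exact LinearMap.congr_fun (e3 x y) z

lemma one_mul' (x : HComp K A) : 1 * x = x := by
  have : mulₗ K A 1 = LinearMap.id := hom_ext fun a => by
    rw [one_def, mulₗ_of, one_mul]; rfl
  exact LinearMap.congr_fun this x

lemma mul_one' (x : HComp K A) : x * 1 = x := by
  have : (mulₗ K A).flip 1 = LinearMap.id := hom_ext fun a => by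
    rw [LinearMap.flip_apply, one_def, mulₗ_of, mul_one]; rfl
  exact LinearMap.congr_fun this x

instance : Ring (HComp K A) where
  __ := (inferInstance : AddCommGroup (HComp K A))
  left_distrib x y z := by simp only [mul_def, map_add]
  right_distrib x y z := by simp only [mul_def, map_add, LinearMap.add_apply]
  zero_mul x := by simp only [mul_def, map_zero, LinearMap.zero_apply]
  mul_zero x := by simp only [mul_def, map_zero]
  mul_assoc := mul_assoc'
  one_mul := one_mul'
  mul_one := mul_one'

instance : Algebra K⟦X⟧ (HComp K A) :=
  Algebra.ofModule (fun r x y => by simp only [mul_def, map_smul, LinearMap.smul_apply])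
    (fun r x y => by simp only [mul_def, map_smul])

end HComp

end Alg

/-! ### Exponentials -/

section Exp

variable {A : Type*} [Ring A] [Algebra K⟦X⟧ A] [IsAdicComplete (hId K) A]

/-- `e^{ħx}`. -/
def hexp (x : A) : A := hsum K fun k => (C ((k ! : K)⁻¹) : K⟦X⟧) • x ^ k

/-- `(e^{ħx} - e^{-ħy}) / ħ`. -/
def hdiff (x y : A) : A :=
  hsum K fun k => (C (((k + 1)! : K)⁻¹) : K⟦X⟧) • (x ^ (k + 1) - (-y) ^ (k + 1))

end Exp

/-! ### Closed subalgebras -/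

section Closure

variable {K}
variable {A : Type*} [Ring A] [Algebra K⟦X⟧ A]

/-- The `ħ`-adic closure of a subalgebra. -/
def adicClosure (S : Subalgebra K⟦X⟧ A) : Subalgebra K⟦X⟧ A where
  carrier := {x | ∀ n : ℕ, ∃ y ∈ S, ∃ z : A, x = y + (X : K⟦X⟧) ^ n • z}
  mul_mem' {a b} ha hb n := by
    obtain ⟨y, hy, z, rfl⟩ := ha n
    obtain ⟨y', hy', z', hz'⟩ := hb n
    refine ⟨y * y', S.mul_mem hy hy', z * b + y * z', ?_⟩
    rw [add_mul, smul_mul_assoc, smul_add, ← mul_smul_comm _ y z']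
    conv_lhs => rw [hz', mul_add]
    rw [← hz']
    abel
  add_mem' {a b} ha hb n := by
    obtain ⟨y, hy, z, rfl⟩ := ha n
    obtain ⟨y', hy', z', rfl⟩ := hb n
    exact ⟨y + y', S.add_mem hy hy', z + z', by rw [smul_add]; abel⟩
  algebraMap_mem' r n := ⟨algebraMap _ _ r, S.algebraMap_mem r, 0, by simp⟩

lemma le_adicClosure (S : Subalgebra K⟦X⟧ A) : S ≤ adicClosure S :=
  fun x hx _ => ⟨x, hx, 0, by simp⟩

lemma mem_adicClosure_of_approx {S : Subalgebra K⟦X⟧ A} {x : A}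
    (h : ∀ n : ℕ, ∃ y ∈ adicClosure S, ∃ z : A, x = y + (X : K⟦X⟧) ^ n • z) :
    x ∈ adicClosure S := fun n => by
  obtain ⟨y, hy, z, rfl⟩ := h n
  obtain ⟨y', hy', z', rfl⟩ := hy n
  exact ⟨y', hy', z' + z, by rw [smul_add]; abel⟩

variable [IsAdicComplete (hId K) A]

lemma hsum_mem {S : Subalgebra K⟦X⟧ A} {c : ℕ → A} (hc : ∀ k, c k ∈ adicClosure S) :
    hsum K c ∈ adicClosure S :=
  mem_adicClosure_of_approx fun n => by
    obtain ⟨z, hz⟩ := hsum_spec (K := K) c n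
    exact ⟨_, Subalgebra.sum_mem _ fun k _ => Subalgebra.smul_mem _ (hc k) _, z, hz⟩

lemma eq_of_approx {x y : A} (h : ∀ n : ℕ, ∃ z : A, x - y = (X : K⟦X⟧) ^ n • z) : x = y := by
  rw [← sub_eq_zero]
  refine IsHausdorff.haus (inferInstance : IsHausdorff (hId K) A) _ fun n => ?_
  rw [SModEq.zero]
  exact mem_hpow.2 (h n)

lemma hsum_split (c : ℕ → A) (n : ℕ) :
    hsum K c = ∑ k ∈ Finset.range n, (X : K⟦X⟧) ^ k • c k +
      (X : K⟦X⟧) ^ n • hsum K (fun k => c (n + k)) := by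
  refine eq_of_approx (K := K) fun m => ?_
  obtain ⟨z, hz⟩ := hsum_spec (K := K) c (n + m)
  obtain ⟨w, hw⟩ := hsum_spec (K := K) (fun k => c (n + k)) m
  refine ⟨(X : K⟦X⟧) ^ n • z - (X : K⟦X⟧) ^ n • w, ?_⟩
  rw [hz, hw, Finset.sum_range_add, smul_add, Finset.smul_sum, smul_sub]
  simp only [smul_smul, ← pow_add]
  rw [add_comm m n]
  abel

instance (S : Subalgebra K⟦X⟧ A) : IsAdicComplete (hId K) (adicClosure S) where
  haus' x hx := by
    refine Subtype.ext (eq_of_approx (K := K) fun n => ?_)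
    obtain ⟨z, hz⟩ := mem_hpow.1 (SModEq.zero.1 (hx n))
    exact ⟨z, by rw [hz]; simp⟩
  prec' f hf := by
    have h1 : ∀ k, ∃ c : adicClosure S, f (k + 1) - f k = (X : K⟦X⟧) ^ k • c := fun k =>
      mem_hpow.1 (SModEq.sub_mem.1 (hf (Nat.le_succ k)).symm)
    choose c hc using h1
    have h2 : ∀ n, f n = f 0 + ∑ k ∈ Finset.range n, (X : K⟦X⟧) ^ k • c k := fun n => by
      induction n with
      | zero => simp
      | succ n ih =>
        rw [Finset.sum_range_succ, ← add_assoc, ← ih, ← hc]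
        abel
    let t : ℕ → adicClosure S := fun n =>
      ⟨hsum K (fun k => (c (n + k) : A)), hsum_mem fun k => (c (n + k)).2⟩
    refine ⟨f 0 + t 0, fun n => (SModEq.sub_mem.2 (mem_hpow.2 ⟨-t n, ?_⟩))⟩
    rw [h2 n]
    refine Subtype.ext ?_
    have h3 := hsum_split (K := K) (fun k => (c k : A)) n
    simp only [t, zero_add, Subalgebra.coe_add, Subalgebra.coe_sub, Subalgebra.coe_smul,
      AddSubmonoidClass.coe_finsetSum, h3, Subalgebra.coe_neg, smul_neg]
    abel

end Closure

/-! ### Completed tensor products and topological Hopf algebras -/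

section CTensor

/-- The completed tensor product `M ⊗̂ N` over `𝕜[[ħ]]`. -/
abbrev CTensor (M N : Type*) [AddCommGroup M] [Module K⟦X⟧ M] [AddCommGroup N] [Module K⟦X⟧ N] :
    Type _ :=
  AdicCompletion (hId K) (M ⊗[K⟦X⟧] N)

variable {M : Type*} [AddCommGroup M] [Module K⟦X⟧ M]
variable {N : Type*} [AddCommGroup N] [Module K⟦X⟧ N]
variable {P : Type*} [AddCommGroup P] [Module K⟦X⟧ P]
variable {Q : Type*} [AddCommGroup Q] [Module K⟦X⟧ Q]
variable {W : Type*} [AddCommGroup W] [Module K⟦X⟧ W]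

/-- `m ⊗ n` in `M ⊗̂ N`. -/
def tmul : M →ₗ[K⟦X⟧] N →ₗ[K⟦X⟧] CTensor K M N :=
  (TensorProduct.mk K⟦X⟧ M N).compr₂ (AdicCompletion.of (hId K) (M ⊗[K⟦X⟧] N))

/-- The map `f ⊗̂ g`. -/
def cmap (f : M →ₗ[K⟦X⟧] P) (g : N →ₗ[K⟦X⟧] Q) : CTensor K M N →ₗ[K⟦X⟧] CTensor K P Q :=
  (AdicCompletion.map (hId K) (TensorProduct.map f g)).restrictScalars K⟦X⟧

lemma cmap_tmul (f : M →ₗ[K⟦X⟧] P) (g : N →ₗ[K⟦X⟧] Q) (m : M) (n : N) :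
    cmap K f g (tmul K m n) = tmul K (f m) (g n) := rfl

variable [IsAdicComplete (hId K) W]

variable {K} in
/-- The continuous linear map `M ⊗̂ N → W`, `m ⊗ n ↦ B m n`, for a bilinear map `B`. -/
def fold (B : M →ₗ[K⟦X⟧] N →ₗ[K⟦X⟧] W) : CTensor K M N →ₗ[K⟦X⟧] W :=
  ext₁ (TensorProduct.lift B)

/-- The associativity map `(M ⊗̂ N) ⊗̂ P → M ⊗̂ (N ⊗̂ P)`. -/
def cassoc : CTensor K (CTensor K M N) P →ₗ[K⟦X⟧] CTensor K M (CTensor K N P) :=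
  fold (ext₁ ∘ₗ (TensorProduct.curry (AdicCompletion.of (hId K) _ ∘ₗ
    TensorProduct.map .id (AdicCompletion.of (hId K) (N ⊗[K⟦X⟧] P)) ∘ₗ
    (TensorProduct.assoc K⟦X⟧ M N P).toLinearMap)).flip).flip

variable {K} in
/-- For bilinear maps `η : M × N → P`, `ϑ : M × N → Q` and `c : P × Q → W`, the continuous
bilinear map `(m₁ ⊗ m₂, n₁ ⊗ n₂) ↦ c (η m₁ n₁) (ϑ m₂ n₂)`. -/
def cross (c : P →ₗ[K⟦X⟧] Q →ₗ[K⟦X⟧] W)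
    (η : M →ₗ[K⟦X⟧] N →ₗ[K⟦X⟧] P) (ϑ : M →ₗ[K⟦X⟧] N →ₗ[K⟦X⟧] Q) :
    CTensor K M M →ₗ[K⟦X⟧] CTensor K N N →ₗ[K⟦X⟧] W :=
  ext₂ (TensorProduct.curry (TensorProduct.lift c ∘ₗ
    TensorProduct.map (TensorProduct.lift η) (TensorProduct.lift ϑ) ∘ₗ
    (TensorProduct.tensorTensorTensorComm K⟦X⟧ M M N N).toLinearMap))

@[simp] lemma fold_tmul (B : M →ₗ[K⟦X⟧] N →ₗ[K⟦X⟧] W) (m : M) (n : N) :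
    fold B (tmul K m n) = B m n := by
  simp [fold, tmul]

@[simp] lemma cross_tmul (c : P →ₗ[K⟦X⟧] Q →ₗ[K⟦X⟧] W)
    (η : M →ₗ[K⟦X⟧] N →ₗ[K⟦X⟧] P) (ϑ : M →ₗ[K⟦X⟧] N →ₗ[K⟦X⟧] Q) (m m' : M) (n n' : N) :
    cross c η ϑ (tmul K m m') (tmul K n n') = c (η m n) (ϑ m' n') := by
  simp [cross, tmul]

end CTensor

@[simp] lemma cassoc_tmul {M N P : Type*} [AddCommGroup M] [Module K⟦X⟧ M] [AddCommGroup N]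
    [Module K⟦X⟧ N] [AddCommGroup P] [Module K⟦X⟧ P] (m : M) (n : N) (p : P) :
    cassoc K (tmul K (tmul K m n) p) = tmul K m (tmul K n p) := by
  rw [cassoc, fold_tmul]
  simp [tmul]

section Hopf

/-- A topological Hopf algebra structure on the `ħ`-adically complete `𝕜[[ħ]]`-module `U`; the
coproduct takes values in `U ⊗̂ U`. -/
structure HopfStr (U : Type*) [AddCommGroup U] [Module K⟦X⟧ U] [IsAdicComplete (hId K) U] where
  /-- product -/
  mul : U →ₗ[K⟦X⟧] U →ₗ[K⟦X⟧] U
  /-- unit -/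
  one : U
  /-- coproduct -/
  comul : U →ₗ[K⟦X⟧] CTensor K U U
  /-- counit -/
  counit : U →ₗ[K⟦X⟧] K⟦X⟧
  /-- antipode -/
  antipode : U →ₗ[K⟦X⟧] U
  mul_assoc : ∀ a b c, mul (mul a b) c = mul a (mul b c)
  one_mul : ∀ a, mul one a = a
  mul_one : ∀ a, mul a one = a
  coassoc : ∀ a, cassoc K (cmap K comul .id (comul a)) = cmap K .id comul (comul a)
  counit_comul : ∀ a, fold ((LinearMap.lsmul K⟦X⟧ U).comp counit) (comul a) = a
  comul_counit : ∀ a, fold ((LinearMap.lsmul K⟦X⟧ U).comp counit).flip (comul a) = a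
  comul_one : comul one = tmul K one one
  comul_mul : ∀ a b, comul (mul a b) = cross (tmul K) mul mul (comul a) (comul b)
  counit_one : counit one = 1
  counit_mul : ∀ a b, counit (mul a b) = counit a * counit b
  antipode_left : ∀ a, fold (mul.comp antipode) (comul a) = counit a • one
  antipode_right : ∀ a, fold (mul.compl₂ antipode) (comul a) = counit a • one

/-- Isomorphisms of topological Hopf algebras (linear maps are automatically `ħ`-adically
continuous). -/
structure HopfIso {U V : Type*} [AddCommGroup U] [Module K⟦X⟧ U] [IsAdicComplete (hId K) U]
    [AddCommGroup V] [Module K⟦X⟧ V] [IsAdicComplete (hId K) V]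
    (H : HopfStr K U) (H' : HopfStr K V) where
  /-- the underlying linear isomorphism -/
  toEquiv : U ≃ₗ[K⟦X⟧] V
  map_mul : ∀ a b, toEquiv (H.mul a b) = H'.mul (toEquiv a) (toEquiv b)
  map_one : toEquiv H.one = H'.one
  map_comul : ∀ a, H'.comul (toEquiv a) =
    cmap K toEquiv.toLinearMap toEquiv.toLinearMap (H.comul a)
  map_counit : ∀ a, H'.counit (toEquiv a) = H.counit a
  map_antipode : ∀ a, toEquiv (H.antipode a) = H'.antipode (toEquiv a)

end Hopf

/-! ### Cartan matrices, multiparameters and realizations -/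

section Realizations

variable {n : ℕ}

/-- `A` is a generalized Cartan matrix, symmetrized by the positive integers `d i`. -/
structure IsSymmetrizedCartan (A : Matrix (Fin n) (Fin n) ℤ) (d : Fin n → ℕ) : Prop where
  diag : ∀ i, A i i = 2
  nonpos : ∀ i j, i ≠ j → A i j ≤ 0
  zero_symm : ∀ i j, A i j = 0 → A j i = 0
  d_pos : ∀ i, 0 < d i
  symm : ∀ i j, (d i : ℤ) * A i j = d j * A j i

/-- The matrix `D A` over `𝕜[[ħ]]`. -/
def DA (A : Matrix (Fin n) (Fin n) ℤ) (d : Fin n → ℕ) : Matrix (Fin n) (Fin n) K⟦X⟧ :=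
  Matrix.of fun i j => (((d i : ℤ) * A i j : ℤ) : K⟦X⟧)

variable {K} in
/-- `P` is of Cartan type: its symmetric part is `D A`. -/
def IsCartanType (A : Matrix (Fin n) (Fin n) ℤ) (d : Fin n → ℕ)
    (P : Matrix (Fin n) (Fin n) K⟦X⟧) : Prop :=
  (C (2⁻¹ : K) : K⟦X⟧) • (P + P.transpose) = DA K A d

/-- The family `v` is `𝕜`-linearly independent modulo `ħ`. -/
def LinIndepModH {ι M : Type*} [Fintype ι] [AddCommGroup M] [Module K⟦X⟧ M] (v : ι → M) : Prop :=
  ∀ c : ι → K, (∃ w : M, ∑ i, (C (c i) : K⟦X⟧) • v i = (X : K⟦X⟧) • w) → ∀ i, c i = 0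

variable {K} in
/-- A realization `(𝔥, Π, Π^∨)` of the matrix `P`, on a free module `𝔥` of finite rank, with
`Π^∨ = {T_i^+, T_i^-}` and `Π = {α_i}`. -/
structure Realization (P : Matrix (Fin n) (Fin n) K⟦X⟧) (𝔥 : Type*) [AddCommGroup 𝔥]
    [Module K⟦X⟧ 𝔥] [Module.Free K⟦X⟧ 𝔥] [Module.Finite K⟦X⟧ 𝔥] where
  /-- the elements `T_i^+` -/
  Tp : Fin n → 𝔥
  /-- the elements `T_i^-` -/
  Tm : Fin n → 𝔥
  /-- the simple roots -/
  α : Fin n → Module.Dual K⟦X⟧ 𝔥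
  α_Tp : ∀ i j, α j (Tp i) = P i j
  α_Tm : ∀ i j, α j (Tm i) = P j i
  indep_S : LinIndepModH K fun i => (C (2⁻¹ : K) : K⟦X⟧) • (Tp i + Tm i)

namespace Realization

variable {K}
variable {P : Matrix (Fin n) (Fin n) K⟦X⟧} {𝔥 : Type*} [AddCommGroup 𝔥]
    [Module K⟦X⟧ 𝔥] [Module.Free K⟦X⟧ 𝔥] [Module.Finite K⟦X⟧ 𝔥] (R : Realization P 𝔥)

/-- `S_i = (T_i^+ + T_i^-) / 2`. -/
def S (i : Fin n) : 𝔥 := (C (2⁻¹ : K) : K⟦X⟧) • (R.Tp i + R.Tm i)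

/-- The realization is split: the `T_i^±` are linearly independent modulo `ħ`. -/
def IsSplit : Prop := LinIndepModH K (Sum.elim R.Tp R.Tm)

/-- The realization is minimal: the `T_i^±` span `𝔥`. -/
def IsMinimal : Prop := Submodule.span K⟦X⟧ (Set.range R.Tp ∪ Set.range R.Tm) = ⊤

/-- `𝔰`, the span of the `S_i`. -/
def sSpan : Submodule K⟦X⟧ 𝔥 := Submodule.span K⟦X⟧ (Set.range R.S)

/-- `Alt^S(𝔥)`: antisymmetric bilinear forms on `𝔥` whose radical contains every `S_i`. -/
structure AltS where
  /-- the form `χ` -/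
  form : 𝔥 →ₗ[K⟦X⟧] 𝔥 →ₗ[K⟦X⟧] K⟦X⟧
  antisymm : ∀ x y, form x y = -form y x
  S_left : ∀ i x, form (R.S i) x = 0
  S_right : ∀ i x, form x (R.S i) = 0

variable {R} in
/-- The form induced by `χ` on `𝔥 / 𝔰`. -/
def AltS.bar (χ : R.AltS) : (𝔥 ⧸ R.sSpan) →ₗ[K⟦X⟧] (𝔥 ⧸ R.sSpan) →ₗ[K⟦X⟧] K⟦X⟧ :=
  R.sSpan.liftQ
    (R.sSpan.liftQ χ.form.flip (Submodule.span_le.2 (by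
      rintro _ ⟨i, rfl⟩
      exact LinearMap.ext fun x => χ.S_right i x))).flip
    (Submodule.span_le.2 (by
      rintro _ ⟨i, rfl⟩
      refine LinearMap.ext fun x => ?_
      obtain ⟨y, rfl⟩ := Submodule.mkQ_surjective _ x
      exact χ.S_left i y))

@[simp] lemma AltS.bar_mk (χ : R.AltS) (x y : 𝔥) :
    χ.bar (Submodule.Quotient.mk x) (Submodule.Quotient.mk y) = χ.form x y := rfl

end Realization

/-- The split minimal realization of `D A` of rank `2 n` underlying Drinfeld's standard double:
`𝔥` has the basis `T_1^+, …, T_n^+, T_1^-, …, T_n^-`, and `α_j (T_i^±) = d_i a_{ij}`. -/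
def drinfeldRealization [CharZero K] (A : Matrix (Fin n) (Fin n) ℤ) (d : Fin n → ℕ) :
    Realization (DA K A d) (Fin n ⊕ Fin n → K⟦X⟧) where
  Tp i := Pi.single (Sum.inl i) 1
  Tm i := Pi.single (Sum.inr i) 1
  α j := ∑ i, (DA K A d i j • LinearMap.proj (Sum.inl i) + DA K A d j i • LinearMap.proj (Sum.inr i))
  α_Tp i j := by simp [Pi.single_apply, Finset.sum_add_distrib]
  α_Tm i j := by simp [Pi.single_apply, Finset.sum_add_distrib]
  indep_S := by
    rintro c ⟨w, hw⟩ i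
    have h := congrArg PowerSeries.constantCoeff (congrFun hw (Sum.inl i))
    simpa [Pi.single_apply] using h

end Realizations

/-! ### Formal multiparameter quantum universal enveloping algebras -/

section FoMpQUEA

/-- The quantum integer `[m]_q` for `q = e^{ħd}`. -/
def qInt (d m : ℕ) : K⟦X⟧ :=
  ∑ s ∈ Finset.range m, hexp K ((((2 * s - m + 1) * d : ℤ) : K⟦X⟧))

/-- The quantum factorial `[m]_q!` for `q = e^{ħd}`. -/
def qFact (d m : ℕ) : K⟦X⟧ := ∏ s ∈ Finset.range m, qInt K d (s + 1)

/-- The quantum binomial coefficient for `q = e^{ħd}`. -/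
def qBinom (d m k : ℕ) : K⟦X⟧ := qFact K d m * (qFact K d k * qFact K d (m - k))⁻¹

variable {K} {n : ℕ} (A : Matrix (Fin n) (Fin n) ℤ) (d : Fin n → ℕ)
  {P : Matrix (Fin n) (Fin n) K⟦X⟧} {𝔥 : Type*} [AddCommGroup 𝔥]
  [Module K⟦X⟧ 𝔥] [Module.Free K⟦X⟧ 𝔥] [Module.Finite K⟦X⟧ 𝔥] (R : Realization P 𝔥)

variable (K n 𝔥) in
/-- The completed free algebra on the module `𝔥` and symbols `E_i`, `F_i`. -/
abbrev FreeAlg : Type _ :=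
  HComp K (TensorAlgebra K⟦X⟧ (𝔥 × (Fin n → K⟦X⟧) × (Fin n → K⟦X⟧)))

namespace FreeAlg

variable (n) in
/-- the inclusion of `𝔥` -/
def T : 𝔥 →ₗ[K⟦X⟧] FreeAlg K n 𝔥 := HComp.of K _ ∘ₗ TensorAlgebra.ι K⟦X⟧ ∘ₗ LinearMap.inl _ _ _

variable (K 𝔥) in
/-- the generators `E_i` -/
def E (i : Fin n) : FreeAlg K n 𝔥 := HComp.of K _ (TensorAlgebra.ι K⟦X⟧ (0, Pi.single i 1, 0))

variable (K 𝔥) in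
/-- the generators `F_i` -/
def F (i : Fin n) : FreeAlg K n 𝔥 := HComp.of K _ (TensorAlgebra.ι K⟦X⟧ (0, 0, Pi.single i 1))

end FreeAlg

/-- The left-hand side of the quantum Serre relation for the family `x` and indices `i ≠ j`:
`∑_k (-1)^k [1 - a_ij choose k]_{q_i} q_ij^{k/2} q_ji^{-k/2} x_i^{1-a_ij-k} x_j x_i^k`. -/
def serre (P : Matrix (Fin n) (Fin n) K⟦X⟧) {U : Type*} [Ring U] [Algebra K⟦X⟧ U]
    (x : Fin n → U) (i j : Fin n) : U :=
  ∑ k ∈ Finset.range ((1 - A i j).toNat + 1),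
    ((-1) ^ k * qBinom K (d i) (1 - A i j).toNat k *
      hexp K (C ((k : K) / 2) * P i j) * hexp K (-(C ((k : K) / 2) * P j i))) •
      (x i ^ ((1 - A i j).toNat - k) * x j * x i ^ k)

namespace Realization

/-- The defining relations, in an algebra `B` with a linear map `t : 𝔥 → B` and elements `e_i`, `f_i`.
Here `q_i - q_i⁻¹ = ħ u_i` with `u_i = (e^{ħ d_i} - e^{-ħ d_i}) / ħ` invertible in `𝕜[[ħ]]`, so that
`(e^{ħ T_i^+} - e^{-ħ T_i^-}) / (q_i - q_i⁻¹) = u_i⁻¹ ((e^{ħ T_i^+} - e^{-ħ T_i^-}) / ħ)`. In the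
Serre relations for the `f_i` the coefficients are `q_ij^{-k/2} q_ji^{k/2}`, the inverses of those for
the `e_i`: this is what compatibility with the coproduct and with `[e_i, f_i]` requires. -/
inductive Rel {B : Type*} [Ring B] [Algebra K⟦X⟧ B] [IsAdicComplete (hId K) B]
    (t : 𝔥 →ₗ[K⟦X⟧] B) (e f : Fin n → B) : B → B → Prop
  | TE (x : 𝔥) (j : Fin n) : Rel t e f (t x * e j - e j * t x) (R.α j x • e j)
  | TF (x : 𝔥) (j : Fin n) : Rel t e f (t x * f j - f j * t x) (-(R.α j x • f j))
  | TT (x x' : 𝔥) : Rel t e f (t x * t x') (t x' * t x)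
  | EF (i : Fin n) : Rel t e f (e i * f i - f i * e i)
      ((hdiff K (d i : K⟦X⟧) (d i : K⟦X⟧))⁻¹ • hdiff K (t (R.Tp i)) (t (R.Tm i)))
  | EF_ne (i j : Fin n) (hij : i ≠ j) : Rel t e f (e i * f j - f j * e i) 0
  | serreE (i j : Fin n) (hij : i ≠ j) : Rel t e f (serre A d P e i j) 0
  | serreF (i j : Fin n) (hij : i ≠ j) : Rel t e f (serre A d P.transpose f i j) 0

/-- The defining relations in the completed free algebra. -/
def FreeRel : FreeAlg K n 𝔥 → FreeAlg K n 𝔥 → Prop :=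
  R.Rel A d (FreeAlg.T n) (FreeAlg.E K 𝔥) (FreeAlg.F K 𝔥)

/-- The FoMpQUEA `U_{P,ħ}^R(𝔤)`: the `ħ`-adically complete algebra topologically generated by `𝔥`
and the `E_i`, `F_i` with the defining relations. -/
abbrev U : Type _ := HComp K (RingQuot (R.FreeRel A d))

/-- The canonical map from the completed free algebra. -/
def quot : FreeAlg K n 𝔥 →ₗ[K⟦X⟧] R.U A d :=
  HComp.of K _ ∘ₗ (RingQuot.mkAlgHom K⟦X⟧ (R.FreeRel A d)).toLinearMap

/-- The map `𝔥 → U`. -/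
def T : 𝔥 →ₗ[K⟦X⟧] R.U A d := R.quot A d ∘ₗ FreeAlg.T n

/-- The generators `E_i` of `U`. -/
def E (i : Fin n) : R.U A d := R.quot A d (FreeAlg.E K 𝔥 i)

/-- The generators `F_i` of `U`. -/
def F (i : Fin n) : R.U A d := R.quot A d (FreeAlg.F K 𝔥 i)

/-- The positive Borel FoMpQUEA: the closed subalgebra generated by `𝔥` and the `E_i`. -/
abbrev BorelP : Subalgebra K⟦X⟧ (R.U A d) :=
  adicClosure (Algebra.adjoin K⟦X⟧ (Set.range (R.T A d) ∪ Set.range (R.E A d)))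

/-- The negative Borel FoMpQUEA: the closed subalgebra generated by `𝔥` and the `F_i`. -/
abbrev BorelM : Subalgebra K⟦X⟧ (R.U A d) :=
  adicClosure (Algebra.adjoin K⟦X⟧ (Set.range (R.T A d) ∪ Set.range (R.F A d)))

/-- The map `𝔥 → U(𝔟_+)`. -/
def TP : 𝔥 →ₗ[K⟦X⟧] R.BorelP A d :=
  (R.T A d).codRestrict (Subalgebra.toSubmodule (R.BorelP A d)) fun t =>
    le_adicClosure _ (Algebra.subset_adjoin (Or.inl ⟨t, rfl⟩))

/-- The generators `E_i` of `U(𝔟_+)`. -/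
def EP (i : Fin n) : R.BorelP A d :=
  ⟨R.E A d i, le_adicClosure _ (Algebra.subset_adjoin (Or.inr ⟨i, rfl⟩))⟩

/-- The map `𝔥 → U(𝔟_-)`. -/
def TM : 𝔥 →ₗ[K⟦X⟧] R.BorelM A d :=
  (R.T A d).codRestrict (Subalgebra.toSubmodule (R.BorelM A d)) fun t =>
    le_adicClosure _ (Algebra.subset_adjoin (Or.inl ⟨t, rfl⟩))

/-- The generators `F_i` of `U(𝔟_-)`. -/
def FM (i : Fin n) : R.BorelM A d :=
  ⟨R.F A d i, le_adicClosure _ (Algebra.subset_adjoin (Or.inr ⟨i, rfl⟩))⟩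

/-! ### The standard Hopf structures -/

section Standard

variable {B : Type*} [Ring B] [Algebra K⟦X⟧ B] [IsAdicComplete (hId K) B] (H : HopfStr K B)

/-- `H` has the product of the algebra `B`, and the elements of the image of `t : 𝔥 → B` are
primitive. -/
def StdT (t : 𝔥 →ₗ[K⟦X⟧] B) : Prop :=
  (∀ a b, H.mul a b = a * b) ∧ H.one = 1 ∧
  ∀ x, H.comul (t x) = tmul K (t x) 1 + tmul K 1 (t x) ∧ H.counit (t x) = 0 ∧ H.antipode (t x) = -t x

/-- `Δ(E_i) = E_i ⊗ 1 + e^{ħT_i^+} ⊗ E_i`, `ε(E_i) = 0`, `S(E_i) = -e^{-ħT_i^+} E_i`. -/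
def StdE (t : 𝔥 →ₗ[K⟦X⟧] B) (e : Fin n → B) : Prop :=
  ∀ i, H.comul (e i) = tmul K (e i) 1 + tmul K (hexp K (t (R.Tp i))) (e i) ∧
    H.counit (e i) = 0 ∧ H.antipode (e i) = -(hexp K (-t (R.Tp i)) * e i)

/-- `Δ(F_i) = F_i ⊗ e^{-ħT_i^-} + 1 ⊗ F_i`, `ε(F_i) = 0`, `S(F_i) = -F_i e^{ħT_i^-}`. -/
def StdF (t : 𝔥 →ₗ[K⟦X⟧] B) (f : Fin n → B) : Prop :=
  ∀ i, H.comul (f i) = tmul K (f i) (hexp K (-t (R.Tm i))) + tmul K 1 (f i) ∧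
    H.counit (f i) = 0 ∧ H.antipode (f i) = -(f i * hexp K (t (R.Tm i)))

end Standard

end Realization

end FoMpQUEA

/-! ### Toral 2-cocycles and the deformed products -/

section Cocycles

section SymProj

variable (R : Type*) [CommRing R] (M : Type*) [AddCommGroup M] [Module R M]

/-- The projection of `S(M)` onto its degree one component `M`: the second component of the algebra
map to the square-zero extension `R ⊕ M` that is the identity on `M`. -/
def symProj : SymmetricAlgebra R M →ₗ[R] M :=
  letI : Module Rᵐᵒᵖ M := Module.compHom M ((RingHom.id R).fromOpposite mul_comm)
  haveI : IsCentralScalar R M := ⟨fun _ _ => rfl⟩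
  TrivSqZeroExt.sndHom R M ∘ₗ
    (SymmetricAlgebra.lift (TrivSqZeroExt.inrHom R M)).toLinearMap

variable {R M}

lemma symProj_one : symProj R M (1 : SymmetricAlgebra R M) = 0 := by
  let _ : Module Rᵐᵒᵖ M := Module.compHom M ((RingHom.id R).fromOpposite mul_comm)
  have _ : IsCentralScalar R M := ⟨fun _ _ => rfl⟩
  change (SymmetricAlgebra.lift (TrivSqZeroExt.inrHom R M) 1).snd = 0
  rw [map_one, TrivSqZeroExt.snd_one]

lemma symProj_ι (m : M) : symProj R M (SymmetricAlgebra.ι R M m) = m := by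
  let _ : Module Rᵐᵒᵖ M := Module.compHom M ((RingHom.id R).fromOpposite mul_comm)
  have _ : IsCentralScalar R M := ⟨fun _ _ => rfl⟩
  change (SymmetricAlgebra.lift (TrivSqZeroExt.inrHom R M) (SymmetricAlgebra.ι R M m)).snd = m
  rw [SymmetricAlgebra.lift_ι_apply]
  rfl

lemma symProj_ι_mul_ι_mul (m m' : M) (x : SymmetricAlgebra R M) :
    symProj R M (SymmetricAlgebra.ι R M m * SymmetricAlgebra.ι R M m' * x) = 0 := by
  let _ : Module Rᵐᵒᵖ M := Module.compHom M ((RingHom.id R).fromOpposite mul_comm)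
  have _ : IsCentralScalar R M := ⟨fun _ _ => rfl⟩
  change (SymmetricAlgebra.lift (TrivSqZeroExt.inrHom R M)
    (SymmetricAlgebra.ι R M m * SymmetricAlgebra.ι R M m' * x)).snd = 0
  rw [map_mul, map_mul, SymmetricAlgebra.lift_ι_apply, SymmetricAlgebra.lift_ι_apply]
  rw [TrivSqZeroExt.inrHom_apply, TrivSqZeroExt.inrHom_apply, TrivSqZeroExt.inr_mul_inr, zero_mul,
    TrivSqZeroExt.snd_zero]

end SymProj

variable {K}

section Conv

variable {U V : Type*} [AddCommGroup U] [Module K⟦X⟧ U] [AddCommGroup V] [Module K⟦X⟧ V]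
  {P Q W : Type*} [AddCommGroup P] [Module K⟦X⟧ P] [AddCommGroup Q] [Module K⟦X⟧ Q]
  [AddCommGroup W] [Module K⟦X⟧ W] [IsAdicComplete (hId K) W]

/-- The convolution `(η * ϑ)(a, b) = c (η (a₁, b₁)) (ϑ (a₂, b₂))` with respect to the coproduct
`Δ`. -/
def conv (Δ : U →ₗ[K⟦X⟧] CTensor K U U) (c : P →ₗ[K⟦X⟧] Q →ₗ[K⟦X⟧] W)
    (η : U →ₗ[K⟦X⟧] U →ₗ[K⟦X⟧] P) (ϑ : U →ₗ[K⟦X⟧] U →ₗ[K⟦X⟧] Q) : U →ₗ[K⟦X⟧] U →ₗ[K⟦X⟧] W :=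
  (cross c η ϑ).compl₁₂ Δ Δ

end Conv

section Sym

variable (M : Type*) [AddCommGroup M] [Module K⟦X⟧ M]

variable (K) in
/-- The completed symmetric algebra `Ŝ(M)`. -/
abbrev SymHat : Type _ := HComp K (SymmetricAlgebra K⟦X⟧ M)

/-- The inclusion `M → Ŝ(M)`. -/
def SymHat.ι : M →ₗ[K⟦X⟧] SymHat K M := HComp.of K _ ∘ₗ SymmetricAlgebra.ι K⟦X⟧ M

/-- The coproduct of `Ŝ(M)`, for which the elements of `M` are primitive. -/
def SymHat.comul : SymHat K M →ₗ[K⟦X⟧] CTensor K (SymHat K M) (SymHat K M) :=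
  (AdicCompletion.map (hId K) (TensorProduct.map (HComp.of K _) (HComp.of K _) ∘ₗ
    (SymmetricAlgebra.lift (R := K⟦X⟧) (M := M)
      (A := SymmetricAlgebra K⟦X⟧ M ⊗[K⟦X⟧] SymmetricAlgebra K⟦X⟧ M)
      ((TensorProduct.mk K⟦X⟧ _ _).flip 1 ∘ₗ SymmetricAlgebra.ι K⟦X⟧ M +
        TensorProduct.mk K⟦X⟧ _ _ 1 ∘ₗ SymmetricAlgebra.ι K⟦X⟧ M)).toLinearMap)).restrictScalars
    K⟦X⟧

/-- The counit of `Ŝ(M)`. -/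
def SymHat.counit : SymHat K M →ₗ[K⟦X⟧] K⟦X⟧ :=
  ext₁ (SymmetricAlgebra.algebraMapInv (R := K⟦X⟧) (M := M)).toLinearMap

variable {M}

/-- The bilinear form `χ̃` on `Ŝ(M)` attached to a bilinear form `β` on `M`: it is `β` on
`S¹ × S¹` and it vanishes on `Sʳ × Sˢ` for all other pairs `(r, s)`. -/
def chiTilde (β : M →ₗ[K⟦X⟧] M →ₗ[K⟦X⟧] K⟦X⟧) :
    SymHat K M →ₗ[K⟦X⟧] SymHat K M →ₗ[K⟦X⟧] K⟦X⟧ :=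
  ext₂ (β.compl₁₂ (symProj K⟦X⟧ M) (symProj K⟦X⟧ M))

/-- The convolution powers `χ̃^{*m}`, with `χ̃^{*0} = ε ⊗ ε`. -/
def chiTildePow (β : M →ₗ[K⟦X⟧] M →ₗ[K⟦X⟧] K⟦X⟧) :
    ℕ → (SymHat K M →ₗ[K⟦X⟧] SymHat K M →ₗ[K⟦X⟧] K⟦X⟧)
  | 0 => (LinearMap.mul K⟦X⟧ K⟦X⟧).compl₁₂ (SymHat.counit M) (SymHat.counit M)
  | m + 1 => conv (SymHat.comul M) (LinearMap.mul K⟦X⟧ K⟦X⟧) (chiTildePow β m) (chiTilde β)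

/-- For `s = 1` (resp. `s = -1`), the coefficient of `ħ^{-m}` in the exponential
`exp_*(s ħ⁻¹ χ̃ / 2) = ∑_m ħ^{-m} s^m χ̃^{*m} / (2^m m!)`, which is the `𝕜((ħ))`-valued cocycle
`χ_U` (resp. its convolution inverse). -/
def chiU (β : M →ₗ[K⟦X⟧] M →ₗ[K⟦X⟧] K⟦X⟧) (s : ℤ) (m : ℕ) :
    SymHat K M →ₗ[K⟦X⟧] SymHat K M →ₗ[K⟦X⟧] K⟦X⟧ :=
  (C ((s : K) ^ m / (2 ^ m * m !)) : K⟦X⟧) • chiTildePow β m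

end Sym

section Deform

variable {B : Type*} [Ring B] [Algebra K⟦X⟧ B] [IsAdicComplete (hId K) B]
  {M : Type*} [AddCommGroup M] [Module K⟦X⟧ M]

/-- The coefficient of `ħ^{-m}` in `σ = χ_U ∘ (π × π)` (`s = 1`) and in `σ⁻¹` (`s = -1`). -/
def sigma (π : B →ₐ[K⟦X⟧] SymHat K M) (β : M →ₗ[K⟦X⟧] M →ₗ[K⟦X⟧] K⟦X⟧) (s : ℤ) (m : ℕ) :
    B →ₗ[K⟦X⟧] B →ₗ[K⟦X⟧] K⟦X⟧ :=
  (chiU β s m).compl₁₂ π.toLinearMap π.toLinearMap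

/-- The coefficient of `ħ^{-N}` in the deformed product `σ(a₁, b₁) a₂ b₂ σ⁻¹(a₃, b₃)`. -/
def deformCoeff (H : HopfStr K B) (π : B →ₐ[K⟦X⟧] SymHat K M)
    (β : M →ₗ[K⟦X⟧] M →ₗ[K⟦X⟧] K⟦X⟧) (N : ℕ) : B →ₗ[K⟦X⟧] B →ₗ[K⟦X⟧] B :=
  ∑ kl ∈ Finset.HasAntidiagonal.antidiagonal N,
    conv H.comul (LinearMap.lsmul K⟦X⟧ B).flip
      (conv H.comul (LinearMap.lsmul K⟦X⟧ B) (sigma π β 1 kl.1) H.mul) (sigma π β (-1) kl.2)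

end Deform

namespace Realization

variable {n : ℕ} {P : Matrix (Fin n) (Fin n) K⟦X⟧} {𝔥 : Type*} [AddCommGroup 𝔥]
  [Module K⟦X⟧ 𝔥] [Module.Free K⟦X⟧ 𝔥] [Module.Finite K⟦X⟧ 𝔥] (R : Realization P 𝔥)
  {B : Type*} [Ring B] [Algebra K⟦X⟧ B] [IsAdicComplete (hId K) B]

/-- `Hσ` is the deformation of the Hopf structure `H` on `B` by the toral 2-cocycle `σ_χ`. Here
`t : 𝔥 → B` is the toral part, and the homomorphism `π : B → Ŝ(𝔥/𝔰)` is given by `T ↦ T + 𝔰` on `𝔥`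
and by `x ↦ 0` for the other generators `x ∈ X`. The unit, the coproduct and the counit do not
change, and the new product is
`a · b = σ_χ(a₁, b₁) a₂ b₂ σ_χ⁻¹(a₃, b₃) = ∑_k ħ^{-k} deformCoeff k a b`, where the convergence
is `ħ`-adic: for every `m`, the partial sums up to any large `N` agree with `a · b` modulo `ħ^m`
(both multiplied by `ħ^N` to clear the denominators). -/
def IsToralDeformation (χ : R.AltS) (t : 𝔥 →ₗ[K⟦X⟧] B) (gens : Set B) (H Hσ : HopfStr K B) : Prop :=
  ∃ π : B →ₐ[K⟦X⟧] SymHat K (𝔥 ⧸ R.sSpan),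
    (∀ x, π (t x) = SymHat.ι _ (Submodule.Quotient.mk x)) ∧ (∀ x ∈ gens, π x = 0) ∧
    Hσ.one = H.one ∧ Hσ.comul = H.comul ∧ Hσ.counit = H.counit ∧
    ∀ a b : B, ∀ m : ℕ, ∃ N₀ : ℕ, ∀ N ≥ N₀, ∃ u : B,
      (X : K⟦X⟧) ^ N • Hσ.mul a b -
        ∑ k ∈ Finset.range (N + 1), (X : K⟦X⟧) ^ (N - k) • deformCoeff H π χ.bar k a b =
      (X : K⟦X⟧) ^ (N + m) • u

end Realization

section Iso

variable {n : ℕ} (A : Matrix (Fin n) (Fin n) ℤ) (d : Fin n → ℕ)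
  {P P' : Matrix (Fin n) (Fin n) K⟦X⟧}
  {𝔥 : Type*} [AddCommGroup 𝔥] [Module K⟦X⟧ 𝔥] [Module.Free K⟦X⟧ 𝔥] [Module.Finite K⟦X⟧ 𝔥]
  {𝔥' : Type*} [AddCommGroup 𝔥'] [Module K⟦X⟧ 𝔥'] [Module.Free K⟦X⟧ 𝔥'] [Module.Finite K⟦X⟧ 𝔥']
  (R' : Realization P' 𝔥') (R : Realization P 𝔥) (χ : R.AltS)

/-- The isomorphism of topological Hopf algebras
`U_{P',ħ}^{R'}(𝔤) ≅ (U_{P,ħ}^R(𝔤))_{σ_χ}`; here `H`, `H'` are the standard Hopf structures and `Hσ`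
is the deformed one. -/
def IsoDeformG : Prop :=
  ∃ (H Hσ : HopfStr K (R.U A d)) (H' : HopfStr K (R'.U A d)),
    Realization.StdT H (R.T A d) ∧ R.StdE H (R.T A d) (R.E A d) ∧ R.StdF H (R.T A d) (R.F A d) ∧
    Realization.StdT H' (R'.T A d) ∧ R'.StdE H' (R'.T A d) (R'.E A d) ∧
      R'.StdF H' (R'.T A d) (R'.F A d) ∧
    R.IsToralDeformation χ (R.T A d) (Set.range (R.E A d) ∪ Set.range (R.F A d)) H Hσ ∧
    Nonempty (HopfIso K H' Hσ)

/-- The isomorphism `U_{P',ħ}^{R'}(𝔟_+) ≅ (U_{P,ħ}^R(𝔟_+))_{σ_χ}`. -/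
def IsoDeformP : Prop :=
  ∃ (H Hσ : HopfStr K (R.BorelP A d)) (H' : HopfStr K (R'.BorelP A d)),
    Realization.StdT H (R.TP A d) ∧ R.StdE H (R.TP A d) (R.EP A d) ∧
    Realization.StdT H' (R'.TP A d) ∧ R'.StdE H' (R'.TP A d) (R'.EP A d) ∧
    R.IsToralDeformation χ (R.TP A d) (Set.range (R.EP A d)) H Hσ ∧
    Nonempty (HopfIso K H' Hσ)

/-- The isomorphism `U_{P',ħ}^{R'}(𝔟_-) ≅ (U_{P,ħ}^R(𝔟_-))_{σ_χ}`. -/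
def IsoDeformM : Prop :=
  ∃ (H Hσ : HopfStr K (R.BorelM A d)) (H' : HopfStr K (R'.BorelM A d)),
    Realization.StdT H (R.TM A d) ∧ R.StdF H (R.TM A d) (R.FM A d) ∧
    Realization.StdT H' (R'.TM A d) ∧ R'.StdF H' (R'.TM A d) (R'.FM A d) ∧
    R.IsToralDeformation χ (R.TM A d) (Set.range (R.FM A d)) H Hσ ∧
    Nonempty (HopfIso K H' Hσ)

end Iso

end Cocycles

end FoMp

end

noncomputable section
namespace FoMp
variable {K : Type*} [Field K]

/-! ### Adically complete modules -/

section Complete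

variable {M N : Type*} [AddCommGroup M] [Module K⟦X⟧ M] [AddCommGroup N] [Module K⟦X⟧ N]

lemma eq_zero_of_forall_pow [IsAdicComplete (hId K) M] {x : M}
    (h : ∀ n : ℕ, ∃ z : M, x = (X : K⟦X⟧) ^ n • z) : x = 0 :=
  IsHausdorff.haus (inferInstance : IsHausdorff (hId K) M) _ fun n =>
    SModEq.zero.2 (mem_hpow.2 (h n))

lemma eq_of_forall_pow [IsAdicComplete (hId K) M] {x y : M}
    (h : ∀ n : ℕ, ∃ z : M, x = y + (X : K⟦X⟧) ^ n • z) : x = y := by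
  refine sub_eq_zero.1 (eq_zero_of_forall_pow (K := K) fun n => ?_)
  obtain ⟨z, hz⟩ := h n
  exact ⟨z, by rw [hz]; abel⟩

lemma eq_hsum [IsAdicComplete (hId K) M] {f : ℕ → M} {x : M}
    (h : ∀ n : ℕ, ∃ z : M, x = ∑ k ∈ Finset.range n, (X : K⟦X⟧) ^ k • f k + (X : K⟦X⟧) ^ n • z) :
    x = hsum K f := by
  refine eq_of_forall_pow (K := K) fun n => ?_
  obtain ⟨z, hz⟩ := h n
  obtain ⟨w, hw⟩ := hsum_spec (K := K) f n
  exact ⟨z - w, by rw [hz, hw, smul_sub]; abel⟩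

lemma map_hsum [IsAdicComplete (hId K) M] [IsAdicComplete (hId K) N] (g : M →ₗ[K⟦X⟧] N)
    (f : ℕ → M) : g (hsum K f) = hsum K fun k => g (f k) := by
  refine eq_hsum fun n => ?_
  obtain ⟨z, hz⟩ := hsum_spec (K := K) f n
  exact ⟨g z, by rw [hz]; simp⟩

lemma hsum_add [IsAdicComplete (hId K) M] (f g : ℕ → M) :
    hsum K f + hsum K g = hsum K fun k => f k + g k := by
  refine eq_hsum fun n => ?_
  obtain ⟨z, hz⟩ := hsum_spec (K := K) f n
  obtain ⟨w, hw⟩ := hsum_spec (K := K) g n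
  refine ⟨z + w, ?_⟩
  rw [hz, hw]
  simp only [smul_add, Finset.sum_add_distrib]
  abel

lemma hsum_succ [IsAdicComplete (hId K) M] (f : ℕ → M) :
    hsum K f = f 0 + (X : K⟦X⟧) • hsum K fun k => f (k + 1) := by
  refine (eq_hsum fun n => ?_).symm
  obtain ⟨z, hz⟩ := hsum_spec (K := K) (fun k => f (k + 1)) n
  refine ⟨(X : K⟦X⟧) • z + f n, ?_⟩
  have h := Finset.sum_range_succ (fun k => (X : K⟦X⟧) ^ k • f k) n
  rw [Finset.sum_range_succ', pow_zero, one_smul] at h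
  rw [hz, smul_add, Finset.smul_sum, smul_add, smul_smul, smul_smul]
  simp only [smul_smul, ← pow_succ', ← pow_succ]
  rw [← add_assoc, add_comm (f 0), h]
  abel

lemma hsum_zero [IsAdicComplete (hId K) M] : hsum K (fun _ => (0 : M)) = 0 :=
  (eq_hsum fun n => ⟨0, by simp⟩).symm

lemma hsum_eq_first [IsAdicComplete (hId K) M] {f : ℕ → M} (h : ∀ k, f (k + 1) = 0) :
    hsum K f = f 0 := by
  rw [hsum_succ]
  simp [h, hsum_zero]

/-- Completeness from separatedness and the convergence of the series `∑ ħ^k c_k`. -/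
lemma isAdicComplete_of (haus : ∀ x : M, (∀ n : ℕ, ∃ z : M, x = (X : K⟦X⟧) ^ n • z) → x = 0)
    (sum : ∀ c : ℕ → M, ∃ L : M, ∀ n : ℕ, ∃ z : M,
      L = ∑ k ∈ Finset.range n, (X : K⟦X⟧) ^ k • c k + (X : K⟦X⟧) ^ n • z) :
    IsAdicComplete (hId K) M where
  haus' x hx := haus x fun n => mem_hpow.1 (SModEq.zero.1 (hx n))
  prec' f hf := by
    have h1 : ∀ k, ∃ c : M, f (k + 1) - f k = (X : K⟦X⟧) ^ k • c := fun k =>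
      mem_hpow.1 (SModEq.sub_mem.1 (hf (Nat.le_succ k)).symm)
    choose c hc using h1
    have h2 : ∀ n, f n = f 0 + ∑ k ∈ Finset.range n, (X : K⟦X⟧) ^ k • c k := fun n => by
      induction n with
      | zero => simp
      | succ n ih =>
        rw [Finset.sum_range_succ, ← add_assoc, ← ih, ← hc]
        abel
    obtain ⟨L, hL⟩ := sum c
    refine ⟨f 0 + L, fun n => SModEq.sub_mem.2 ?_⟩
    obtain ⟨z, hz⟩ := hL n
    refine mem_hpow.2 ⟨-z, ?_⟩
    rw [h2 n, hz, smul_neg]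
    abel

instance [IsAdicComplete (hId K) M] [IsAdicComplete (hId K) N] :
    IsAdicComplete (hId K) (M × N) := by
  refine isAdicComplete_of (fun x hx => Prod.ext (eq_zero_of_forall_pow (K := K) fun n => ?_)
    (eq_zero_of_forall_pow (K := K) fun n => ?_)) fun c =>
      ⟨(hsum K fun k => (c k).1, hsum K fun k => (c k).2), fun n => ?_⟩
  · obtain ⟨z, hz⟩ := hx n
    exact ⟨z.1, by rw [hz]; rfl⟩
  · obtain ⟨z, hz⟩ := hx n
    exact ⟨z.2, by rw [hz]; rfl⟩
  · obtain ⟨z, hz⟩ := hsum_spec (K := K) (fun k => (c k).1) n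
    obtain ⟨w, hw⟩ := hsum_spec (K := K) (fun k => (c k).2) n
    exact ⟨(z, w), Prod.ext (by simp [hz, Prod.fst_sum]) (by simp [hw, Prod.snd_sum])⟩

instance [IsAdicComplete (hId K) N] : IsAdicComplete (hId K) (M →ₗ[K⟦X⟧] N) := by
  refine isAdicComplete_of (fun x hx => LinearMap.ext fun a =>
    eq_zero_of_forall_pow (K := K) fun n => ?_) fun c => ⟨⟨⟨fun a => hsum K fun k => c k a,
      fun a b => ?_⟩, fun r a => ?_⟩, fun n => ?_⟩
  · obtain ⟨z, hz⟩ := hx n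
    exact ⟨z a, by rw [hz]; rfl⟩
  · simp only [map_add, hsum_add]
  · simp only [map_smul, RingHom.id_apply]
    exact (map_hsum (LinearMap.lsmul K⟦X⟧ N r) _).symm
  · refine ⟨⟨⟨fun a => hsum K fun k => c (n + k) a, fun a b => ?_⟩, fun r a => ?_⟩, ?_⟩
    · simp only [map_add, hsum_add]
    · simp only [map_smul, RingHom.id_apply]
      exact (map_hsum (LinearMap.lsmul K⟦X⟧ N r) _).symm
    · refine LinearMap.ext fun a => ?_
      simp only [LinearMap.coe_mk, AddHom.coe_mk, LinearMap.add_apply, LinearMap.sum_apply,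
        LinearMap.smul_apply]
      induction n with
      | zero => simp
      | succ n ih =>
        rw [ih, Finset.sum_range_succ, hsum_succ, smul_add, smul_smul, ← pow_succ, add_assoc]
        simp only [add_zero, add_assoc, add_comm 1]

instance {A : Type*} [Ring A] [Algebra K⟦X⟧ A] [IsAdicComplete (hId K) A] :
    IsAdicComplete (hId K) Aᵐᵒᵖ := by
  refine isAdicComplete_of (fun x hx => MulOpposite.unop_injective
    (eq_zero_of_forall_pow (K := K) fun n => ?_)) fun c =>
      ⟨MulOpposite.op (hsum K fun k => (c k).unop), fun n => ?_⟩
  · obtain ⟨z, hz⟩ := hx n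
    exact ⟨z.unop, by rw [hz]; rfl⟩
  · obtain ⟨z, hz⟩ := hsum_spec (K := K) (fun k => (c k).unop) n
    exact ⟨MulOpposite.op z, MulOpposite.unop_injective (by simp [hz])⟩

instance {M : Type*} [AddCommGroup M] [Module K⟦X⟧ M] [IsAdicComplete (hId K) M] :
    IsAdicComplete (hId K) (Module.End K⟦X⟧ M) :=
  inferInstanceAs (IsAdicComplete (hId K) (M →ₗ[K⟦X⟧] M))

end Complete

/-! ### Exponentials -/

section Exponential

variable {A B : Type*} [Ring A] [Algebra K⟦X⟧ A] [IsAdicComplete (hId K) A]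
  [Ring B] [Algebra K⟦X⟧ B] [IsAdicComplete (hId K) B]

lemma hsum_mul_hsum (f g : ℕ → A) : hsum K f * hsum K g =
    hsum K fun n => ∑ ij ∈ Finset.HasAntidiagonal.antidiagonal n, f ij.1 * g ij.2 := by
  have key : ∀ f : ℕ → A, hsum K f * hsum K g -
      hsum K (fun n => ∑ ij ∈ Finset.HasAntidiagonal.antidiagonal n, f ij.1 * g ij.2) = (X : K⟦X⟧) •
      (hsum K (fun k => f (k + 1)) * hsum K g -
      hsum K (fun n => ∑ ij ∈ Finset.HasAntidiagonal.antidiagonal n, f (ij.1 + 1) * g ij.2)) := fun f => by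
    have h1 : f 0 * hsum K g = f 0 * g 0 + (X : K⟦X⟧) • hsum K fun k => f 0 * g (k + 1) := by
      conv_lhs => rw [hsum_succ]
      rw [mul_add, mul_smul_comm]
      congr 2
      exact map_hsum (LinearMap.mulLeft K⟦X⟧ (f 0)) _
    rw [hsum_succ (K := K) (fun n => ∑ ij ∈ Finset.HasAntidiagonal.antidiagonal n, f ij.1 * g ij.2)]
    simp only [Finset.Nat.sum_antidiagonal_succ]
    rw [← hsum_add (K := K), hsum_succ (K := K) f, add_mul, h1, smul_sub, smul_add, smul_mul_assoc]
    simp only [Finset.Nat.antidiagonal_zero, Finset.sum_singleton]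
    abel
  refine sub_eq_zero.1 (eq_zero_of_forall_pow (K := K) fun n => ?_)
  induction n generalizing f with
  | zero => exact ⟨_, by rw [pow_zero, one_smul]⟩
  | succ n ih =>
    obtain ⟨z, hz⟩ := ih fun k => f (k + 1)
    exact ⟨z, by rw [key, hz, smul_smul, pow_succ']⟩

lemma AlgHom.map_hexp (f : A →ₐ[K⟦X⟧] B) (x : A) : f (hexp K x) = hexp K (f x) := by
  rw [hexp, hexp]
  refine (map_hsum f.toLinearMap _).trans ?_
  simp

lemma AlgHom.map_hdiff (f : A →ₐ[K⟦X⟧] B) (x y : A) :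
    f (hdiff K x y) = hdiff K (f x) (f y) := by
  rw [hdiff, hdiff]
  refine (map_hsum f.toLinearMap _).trans ?_
  simp

lemma semiconjBy_hexp {a x y : A} (h : SemiconjBy a x y) :
    SemiconjBy a (hexp K x) (hexp K y) := by
  change a * _ = _ * a
  rw [hexp, hexp]
  refine (map_hsum (LinearMap.mulLeft K⟦X⟧ a) _).trans
    (Eq.trans ?_ (map_hsum (LinearMap.mulRight K⟦X⟧ a) _).symm)
  congr 1
  funext k
  simp only [map_smul, LinearMap.mulLeft_apply, LinearMap.mulRight_apply]
  rw [(h.pow_right k).eq]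

lemma semiconjBy_hdiff {a x x' y y' : A} (h : SemiconjBy a x x') (h' : SemiconjBy a y y') :
    SemiconjBy a (hdiff K x y) (hdiff K x' y') := by
  change a * _ = _ * a
  rw [hdiff, hdiff]
  refine (map_hsum (LinearMap.mulLeft K⟦X⟧ a) _).trans
    (Eq.trans ?_ (map_hsum (LinearMap.mulRight K⟦X⟧ a) _).symm)
  congr 1
  funext k
  simp only [map_smul, LinearMap.mulLeft_apply, LinearMap.mulRight_apply, mul_sub, sub_mul]
  rw [(h.pow_right _).eq, (h'.neg_right.pow_right _).eq]

lemma hexp_zero : hexp K (0 : A) = 1 := by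
  rw [hexp, hsum_eq_first (fun k => by simp)]
  simp

/-- `(e^{ħx} - 1) / ħ`. -/
def hexpm1 (x : A) : A := hsum K fun k => (C (((k + 1)! : K)⁻¹) : K⟦X⟧) • x ^ (k + 1)

lemma hexp_eq (x : A) : hexp K x = 1 + (X : K⟦X⟧) • hexpm1 (K := K) x := by
  rw [hexp, hsum_succ, hexpm1]
  simp

lemma hdiff_eq (x y : A) : hdiff K x y = hexpm1 (K := K) x - hexpm1 (K := K) (-y) := by
  rw [eq_sub_iff_add_eq, hdiff, hexpm1, hexpm1, hsum_add]
  congr 1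
  funext k
  rw [← smul_add, sub_add_cancel]

lemma commute_hexp {x y : A} (h : Commute x y) : Commute (hexp K x) (hexp K y) :=
  (semiconjBy_hexp (semiconjBy_hexp (K := K) h).symm).symm

lemma commute_hexpm1 {x y : A} (h : Commute x y) : Commute x (hexpm1 (K := K) y) := by
  change _ * _ = _ * _
  rw [hexpm1]
  refine (map_hsum (LinearMap.mulLeft K⟦X⟧ x) _).trans
    (Eq.trans ?_ (map_hsum (LinearMap.mulRight K⟦X⟧ x) _).symm)
  congr 1
  funext k
  simp only [map_smul, LinearMap.mulLeft_apply, LinearMap.mulRight_apply]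
  rw [(h.pow_right _).eq]

lemma X_smul_hdiff (x y : A) : (X : K⟦X⟧) • hdiff K x y = hexp K x - hexp K (-y) := by
  rw [hdiff_eq, hexp_eq x, hexp_eq (-y), smul_sub]
  abel

lemma hdiff_self_neg (x : A) : hdiff K x (-x) = 0 := by
  rw [hdiff_eq, neg_neg, sub_self]

lemma hdiff_neg_swap (x y : A) : hdiff K (-y) (-x) = -hdiff K x y := by
  rw [hdiff_eq, hdiff_eq, neg_neg]
  abel

lemma hexp_algebraMap (r : K⟦X⟧) : hexp K (algebraMap K⟦X⟧ A r) = algebraMap K⟦X⟧ A (hexp K r) :=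
  (AlgHom.map_hexp (Algebra.ofId K⟦X⟧ A) r).symm

lemma hdiff_algebraMap (r s : K⟦X⟧) : hdiff K (algebraMap K⟦X⟧ A r) (algebraMap K⟦X⟧ A s) =
    algebraMap K⟦X⟧ A (hdiff K r s) :=
  (AlgHom.map_hdiff (Algebra.ofId K⟦X⟧ A) r s).symm

lemma commute_hdiff {a x y : A} (hx : Commute a x) (hy : Commute a y) :
    Commute a (hdiff K x y) := semiconjBy_hdiff hx hy

section CharZero

variable [CharZero K]

omit [IsAdicComplete (hId K) A] in
lemma expTerm_add {x y : A} (h : Commute x y) (n : ℕ) :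
    (C ((n ! : K)⁻¹) : K⟦X⟧) • (x + y) ^ n = ∑ ij ∈ Finset.HasAntidiagonal.antidiagonal n,
      ((C ((ij.1 ! : K)⁻¹) : K⟦X⟧) • x ^ ij.1) * ((C ((ij.2 ! : K)⁻¹) : K⟦X⟧) • y ^ ij.2) := by
  rw [h.add_pow', Finset.smul_sum]
  refine Finset.sum_congr rfl fun ij hij => ?_
  have hij := Finset.HasAntidiagonal.mem_antidiagonal.1 hij
  rw [← Nat.cast_smul_eq_nsmul K⟦X⟧, smul_smul, smul_mul_smul_comm, ← map_natCast (C (R := K)),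
    ← map_mul, ← map_mul]
  congr 2
  have := Nat.add_choose_mul_factorial_mul_factorial ij.1 ij.2
  rw [hij] at this
  have h1 : (ij.1 ! : K) ≠ 0 := Nat.cast_ne_zero.2 (Nat.factorial_ne_zero _)
  have h2 : (ij.2 ! : K) ≠ 0 := Nat.cast_ne_zero.2 (Nat.factorial_ne_zero _)
  have h3 : (n ! : K) ≠ 0 := Nat.cast_ne_zero.2 (Nat.factorial_ne_zero _)
  field_simp
  rw [Nat.choose_symm_of_eq_add hij.symm]
  exact_mod_cast (by rw [← this])

lemma hexpm1_add' {x y : A} (h : Commute x y) :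
    hexpm1 (K := K) (x + y) = hexpm1 (K := K) y + hexpm1 (K := K) x * hexp K y := by
  rw [hexp, hexpm1, hexpm1, hexpm1, hsum_mul_hsum, hsum_add]
  congr 1
  funext k
  rw [expTerm_add h, Finset.Nat.sum_antidiagonal_succ]
  simp

lemma hexpm1_add {x y : A} (h : Commute x y) : hexpm1 (K := K) (x + y) =
    hexpm1 (K := K) x + hexpm1 (K := K) y + (X : K⟦X⟧) • (hexpm1 (K := K) x * hexpm1 (K := K) y) := by
  rw [hexpm1_add' h, hexp_eq, mul_add, mul_one, mul_smul_comm]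
  abel

lemma hexp_add {x y : A} (h : Commute x y) : hexp K (x + y) = hexp K x * hexp K y := by
  rw [hexp_eq (x + y), hexpm1_add' h, hexp_eq x, add_mul, one_mul, smul_add, ← add_assoc,
    ← hexp_eq, smul_mul_assoc]

lemma hexp_mul_neg (x : A) : hexp K x * hexp K (-x) = 1 := by
  rw [← hexp_add (Commute.neg_right (Commute.refl x)), add_neg_cancel, hexp_zero]

lemma hexp_neg_mul (x : A) : hexp K (-x) * hexp K x = 1 := by
  rw [← hexp_add (Commute.neg_left (Commute.refl x)), neg_add_cancel, hexp_zero]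

/-- The addition formula for `(e^{ħx} - e^{-ħy}) / ħ`. -/
lemma hdiff_add {x x' y y' : A} (hx : Commute x x') (hy : Commute y y') (hxy : Commute x y') :
    hdiff K (x + x') (y + y') =
      hdiff K x y * hexp K (-y') + hexp K x * hdiff K x' y' := by
  have h1 : Commute (-y) (-y') := hy.neg_left.neg_right
  have h2 : Commute (hexpm1 (K := K) x) (hexpm1 (K := K) (-y')) :=
    (commute_hexpm1 (commute_hexpm1 hxy.neg_right).symm).symm
  simp only [hdiff_eq]
  rw [hexpm1_add hx, neg_add, hexpm1_add h1, hexp_eq x, hexp_eq (-y')]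
  simp only [add_mul, mul_add, sub_mul, mul_sub, smul_mul_assoc, mul_smul_comm, one_mul, mul_one,
    smul_sub]
  abel

lemma hexp_add_algebraMap (x : A) (r : K⟦X⟧) :
    hexp K (x + algebraMap K⟦X⟧ A r) = hexp K r • hexp K x := by
  rw [hexp_add (Algebra.commutes r x).symm, hexp_algebraMap, ← Algebra.commutes, Algebra.smul_def]

/-- Exponentials of an element acting on `e` by the scalar `r`. -/
lemma hexp_mul_of_commutator {t e : A} {r : K⟦X⟧} (h : t * e - e * t = r • e) :
    hexp K t * e = hexp K r • (e * hexp K t) := by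
  have h1 : SemiconjBy e (t + algebraMap K⟦X⟧ A r) t := by
    change _ * _ = _ * _
    rw [mul_add, ← Algebra.commutes, ← Algebra.smul_def, ← h]
    abel
  rw [← (semiconjBy_hexp h1).eq, hexp_add_algebraMap, mul_smul_comm]

lemma hdiff_mul_of_commutator {x y e : A} {r s : K⟦X⟧} (hx : x * e - e * x = r • e) (hy : y * e - e * y = s • e) :
    hdiff K x y * e = hdiff K r s • (e * hexp K (-y)) + hexp K r • (e * hdiff K x y) := by
  have h1 : SemiconjBy e (algebraMap K⟦X⟧ A r + x) x := by
    change _ * _ = _ * _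
    rw [mul_add, ← Algebra.commutes, ← Algebra.smul_def, ← hx]
    abel
  have h2 : SemiconjBy e (algebraMap K⟦X⟧ A s + y) y := by
    change _ * _ = _ * _
    rw [mul_add, ← Algebra.commutes, ← Algebra.smul_def, ← hy]
    abel
  rw [← (semiconjBy_hdiff h1 h2).eq,
    hdiff_add (Algebra.commutes r x) (Algebra.commutes s y) (Algebra.commutes r y),
    hdiff_algebraMap, hexp_algebraMap, mul_add, ← Algebra.smul_def, ← Algebra.smul_def,
    mul_smul_comm, mul_smul_comm]

end CharZero

end Exponential

end FoMp
end

noncomputable section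
namespace FoMp
variable {K : Type*} [Field K]

/-! ### Completed algebras and tensor products of algebras -/

section CompletedAlgebra

variable {A B C D : Type*} [Ring A] [Algebra K⟦X⟧ A] [Ring B] [Algebra K⟦X⟧ B]
  [Ring C] [Algebra K⟦X⟧ C] [IsAdicComplete (hId K) C]
  [Ring D] [Algebra K⟦X⟧ D]

lemma HComp.approx (x : HComp K A) (n : ℕ) :
    ∃ (a : A) (z : HComp K A), x = HComp.of K A a + (X : K⟦X⟧) ^ n • z :=
  compl_approx (M := A) x n

/-- The extension of a linear map to the completion. -/
def HComp.liftₗ {N : Type*} [AddCommGroup N] [Module K⟦X⟧ N] [IsAdicComplete (hId K) N]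
    (f : A →ₗ[K⟦X⟧] N) : HComp K A →ₗ[K⟦X⟧] N := ext₁ (M := A) f

lemma HComp.liftₗ_of {N : Type*} [AddCommGroup N] [Module K⟦X⟧ N] [IsAdicComplete (hId K) N]
    (f : A →ₗ[K⟦X⟧] N) (a : A) : HComp.liftₗ f (HComp.of K A a) = f a :=
  ext₁_of (M := A) f a

/-- The extension of an algebra homomorphism to the completion. -/
def HComp.lift (f : A →ₐ[K⟦X⟧] C) : HComp K A →ₐ[K⟦X⟧] C :=
  AlgHom.ofLinearMap (HComp.liftₗ f.toLinearMap)
    ((HComp.liftₗ_of f.toLinearMap 1).trans (map_one f)) fun x y => by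
      have h : ∀ a : A, ∀ y : HComp K A, HComp.liftₗ f.toLinearMap (HComp.of K A a * y) =
          f a * HComp.liftₗ f.toLinearMap y := by
        intro a y
        have : HComp.liftₗ f.toLinearMap ∘ₗ LinearMap.mulLeft K⟦X⟧ (HComp.of K A a) =
            LinearMap.mulLeft K⟦X⟧ (f a) ∘ₗ HComp.liftₗ f.toLinearMap := by
          refine HComp.hom_ext fun b => ?_
          rw [LinearMap.comp_apply, LinearMap.comp_apply, LinearMap.mulLeft_apply,
            LinearMap.mulLeft_apply, ← HComp.of_mul, HComp.liftₗ_of, HComp.liftₗ_of]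
          exact map_mul f a b
        exact LinearMap.congr_fun this y
      have h2 : HComp.liftₗ f.toLinearMap ∘ₗ LinearMap.mulRight K⟦X⟧ y =
          LinearMap.mulRight K⟦X⟧ (HComp.liftₗ f.toLinearMap y) ∘ₗ
            HComp.liftₗ f.toLinearMap := by
        refine HComp.hom_ext fun b => ?_
        rw [LinearMap.comp_apply, LinearMap.comp_apply, LinearMap.mulRight_apply,
          LinearMap.mulRight_apply, h, HComp.liftₗ_of]
        rfl
      exact LinearMap.congr_fun h2 x

@[simp] lemma HComp.lift_of (f : A →ₐ[K⟦X⟧] C) (a : A) : HComp.lift f (HComp.of K A a) = f a :=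
  HComp.liftₗ_of f.toLinearMap a

variable (K A) in
/-- The canonical map to the completion, as an algebra homomorphism. -/
def HComp.ofAlg : A →ₐ[K⟦X⟧] HComp K A :=
  AlgHom.ofLinearMap (HComp.of K A) rfl HComp.of_mul

@[simp] lemma HComp.ofAlg_apply (a : A) : HComp.ofAlg K A a = HComp.of K A a := rfl

instance {M : Type*} [AddCommGroup M] [Module K⟦X⟧ M] :
    AddCommMonoid (AdicCompletion (hId K) M) :=
  AddCommGroup.toAddCommMonoid

instance (priority := 50) : Ring (AdicCompletion (hId K) (A ⊗[K⟦X⟧] B)) :=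
  { (inferInstance : AddCommGroup (AdicCompletion (hId K) (A ⊗[K⟦X⟧] B))),
    (inferInstance : Ring (HComp K (A ⊗[K⟦X⟧] B))) with }

instance : Algebra K⟦X⟧ (AdicCompletion (hId K) (A ⊗[K⟦X⟧] B)) :=
  Algebra.ofModule (smul_mul_assoc (α := K⟦X⟧) (β := HComp K (A ⊗[K⟦X⟧] B)))
    (fun r x y => mul_smul_comm (β := HComp K (A ⊗[K⟦X⟧] B)) (α := K⟦X⟧) r x y)

lemma tmul_mul_tmul (a a' : A) (b b' : B) :
    tmul K a b * tmul K a' b' = tmul K (a * a') (b * b') :=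
  (HComp.of_mul (a ⊗ₜ b) (a' ⊗ₜ b')).symm.trans
    (congrArg (HComp.of K _) (Algebra.TensorProduct.tmul_mul_tmul a a' b b'))

lemma ctensor_one : (1 : CTensor K A B) = tmul K 1 1 := rfl

end CompletedAlgebra

lemma cmap_apply_tmul {M N P Q : Type*} [AddCommGroup M] [Module K⟦X⟧ M] [AddCommGroup N]
    [Module K⟦X⟧ N] [AddCommGroup P] [Module K⟦X⟧ P] [AddCommGroup Q] [Module K⟦X⟧ Q]
    (f : M →ₗ[K⟦X⟧] P) (g : N →ₗ[K⟦X⟧] Q) (m : M) (n : N) :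
    cmap K f g (tmul K m n) = tmul K (f m) (g n) := by
  rw [cmap_tmul]

section CTensorExt

variable {M N P Q W : Type*} [AddCommGroup M] [Module K⟦X⟧ M] [AddCommGroup N] [Module K⟦X⟧ N]
  [AddCommGroup P] [Module K⟦X⟧ P] [AddCommGroup Q] [Module K⟦X⟧ Q]
  [AddCommGroup W] [Module K⟦X⟧ W] [IsAdicComplete (hId K) W]

lemma ctensor_ext {f g : CTensor K M N →ₗ[K⟦X⟧] W}
    (h : ∀ m n, f (tmul K m n) = g (tmul K m n)) : f = g := by
  refine compl_hom_ext fun x => ?_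
  induction x using TensorProduct.induction_on with
  | zero => simp
  | tmul m n => exact h m n
  | add x y hx hy => simp only [map_add, hx, hy]

lemma ctensor_ext₂ {f g : CTensor K M N →ₗ[K⟦X⟧] CTensor K P Q →ₗ[K⟦X⟧] W}
    (h : ∀ m n p q, f (tmul K m n) (tmul K p q) = g (tmul K m n) (tmul K p q)) : f = g :=
  ctensor_ext fun m n => ctensor_ext fun p q => h m n p q

lemma ctensor_ext_left {f g : CTensor K (CTensor K M N) P →ₗ[K⟦X⟧] W}
    (h : ∀ m n p, f (tmul K (tmul K m n) p) = g (tmul K (tmul K m n) p)) : f = g :=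
  ctensor_ext fun x p => by
    have : f ∘ₗ (tmul K).flip p = g ∘ₗ (tmul K).flip p := ctensor_ext fun m n => h m n p
    exact LinearMap.congr_fun this x

lemma cmap_comp {M' N' : Type*} [AddCommGroup M'] [Module K⟦X⟧ M'] [AddCommGroup N']
    [Module K⟦X⟧ N'] (f : P →ₗ[K⟦X⟧] M') (g : Q →ₗ[K⟦X⟧] N') (f' : M →ₗ[K⟦X⟧] P)
    (g' : N →ₗ[K⟦X⟧] Q) (x : CTensor K M N) :
    cmap K f g (cmap K f' g' x) = cmap K (f ∘ₗ f') (g ∘ₗ g') x := by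
  have : cmap K f g ∘ₗ cmap K f' g' = cmap K (f ∘ₗ f') (g ∘ₗ g') :=
    ctensor_ext fun m n => by simp only [LinearMap.comp_apply, cmap_apply_tmul]
  exact LinearMap.congr_fun this x

lemma cmap_id (x : CTensor K M N) : cmap K LinearMap.id LinearMap.id x = x := by
  have : cmap K LinearMap.id LinearMap.id = (LinearMap.id : CTensor K M N →ₗ[K⟦X⟧] _) :=
    ctensor_ext fun m n => by simp only [cmap_apply_tmul, LinearMap.id_apply]
  exact LinearMap.congr_fun this x

end CTensorExt

section CTensorAlg

variable {A B C D : Type*} [Ring A] [Algebra K⟦X⟧ A] [Ring B] [Algebra K⟦X⟧ B]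
  [Ring C] [Algebra K⟦X⟧ C] [Ring D] [Algebra K⟦X⟧ D]

/-- A linear map on `A ⊗̂ B` which is multiplicative on pure tensors is multiplicative. -/
lemma ctensor_map_mul [IsAdicComplete (hId K) C] (f : CTensor K A B →ₗ[K⟦X⟧] C)
    (h : ∀ a b a' b', f (tmul K a b * tmul K a' b') = f (tmul K a b) * f (tmul K a' b'))
    (x y : CTensor K A B) : f (x * y) = f x * f y := by
  have : (LinearMap.mul K⟦X⟧ (CTensor K A B)).compr₂ f =
      (LinearMap.mul K⟦X⟧ C).compl₁₂ f f := ctensor_ext₂ fun a b a' b' => h a b a' b'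
  exact LinearMap.congr_fun₂ this x y

lemma cross_mul (x y : CTensor K A A) :
    cross (tmul K) (LinearMap.mul K⟦X⟧ A) (LinearMap.mul K⟦X⟧ A) x y = x * y := by
  have : cross (tmul K) (LinearMap.mul K⟦X⟧ A) (LinearMap.mul K⟦X⟧ A) =
      LinearMap.mul K⟦X⟧ (CTensor K A A) := ctensor_ext₂ fun a b a' b' => by
    rw [cross_tmul]
    exact (tmul_mul_tmul _ _ _ _).symm
  exact LinearMap.congr_fun₂ this x y

/-- `f ⊗̂ g` as an algebra homomorphism. -/
def cmapAlg (f : A →ₐ[K⟦X⟧] C) (g : B →ₐ[K⟦X⟧] D) : CTensor K A B →ₐ[K⟦X⟧] CTensor K C D :=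
  AlgHom.ofLinearMap (cmap K f.toLinearMap g.toLinearMap)
    (by rw [ctensor_one, cmap_apply_tmul]; simp [ctensor_one])
    (ctensor_map_mul _ fun a b a' b' => by simp [cmap_apply_tmul, tmul_mul_tmul])

@[simp] lemma cmapAlg_tmul (f : A →ₐ[K⟦X⟧] C) (g : B →ₐ[K⟦X⟧] D) (a : A) (b : B) :
    cmapAlg f g (tmul K a b) = tmul K (f a) (g b) := rfl

variable (K A B) in
/-- `a ↦ a ⊗ 1`. -/
def inlAlg : A →ₐ[K⟦X⟧] CTensor K A B :=
  AlgHom.ofLinearMap ((tmul K).flip 1) rfl fun a b => by simp [tmul_mul_tmul]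

variable (K A B) in
/-- `b ↦ 1 ⊗ b`. -/
def inrAlg : B →ₐ[K⟦X⟧] CTensor K A B :=
  AlgHom.ofLinearMap (tmul K 1) rfl fun a b => by simp [tmul_mul_tmul]

lemma inlAlg_apply (a : A) : inlAlg K A B a = tmul K a 1 := rfl
lemma inrAlg_apply (b : B) : inrAlg K A B b = tmul K 1 b := rfl

end CTensorAlg

section Triple

variable {M N P W : Type*} [AddCommGroup M] [Module K⟦X⟧ M] [AddCommGroup N] [Module K⟦X⟧ N]
  [AddCommGroup P] [Module K⟦X⟧ P] [AddCommGroup W] [Module K⟦X⟧ W] [IsAdicComplete (hId K) W]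

lemma ctensor_ext_right {f g : CTensor K M (CTensor K N P) →ₗ[K⟦X⟧] W}
    (h : ∀ m n p, f (tmul K m (tmul K n p)) = g (tmul K m (tmul K n p))) : f = g :=
  ctensor_ext fun m x => by
    have : f ∘ₗ tmul K m = g ∘ₗ tmul K m := ctensor_ext fun n p => h m n p
    exact LinearMap.congr_fun this x

/-- The continuous map `(M ⊗̂ N) ⊗̂ P → W` attached to a trilinear map. -/
def foldL (τ : M →ₗ[K⟦X⟧] N →ₗ[K⟦X⟧] P →ₗ[K⟦X⟧] W) : CTensor K (CTensor K M N) P →ₗ[K⟦X⟧] W :=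
  fold (fold τ)

/-- The continuous map `M ⊗̂ (N ⊗̂ P) → W` attached to a trilinear map. -/
def foldR (τ : M →ₗ[K⟦X⟧] N →ₗ[K⟦X⟧] P →ₗ[K⟦X⟧] W) : CTensor K M (CTensor K N P) →ₗ[K⟦X⟧] W :=
  fold (ext₁ ∘ₗ (TensorProduct.lift.equiv (RingHom.id K⟦X⟧) N P W).toLinearMap ∘ₗ τ)

lemma foldL_tmul (τ : M →ₗ[K⟦X⟧] N →ₗ[K⟦X⟧] P →ₗ[K⟦X⟧] W) (m : M) (n : N) (p : P) :
    foldL τ (tmul K (tmul K m n) p) = τ m n p := by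
  rw [foldL, fold_tmul, fold_tmul]

lemma foldR_tmul (τ : M →ₗ[K⟦X⟧] N →ₗ[K⟦X⟧] P →ₗ[K⟦X⟧] W) (m : M) (n : N) (p : P) :
    foldR τ (tmul K m (tmul K n p)) = τ m n p := by
  rw [foldR, fold_tmul]
  exact ext₁_of _ _ |>.trans (TensorProduct.lift.tmul _ _)

variable {A B C T : Type*} [Ring A] [Algebra K⟦X⟧ A] [Ring B] [Algebra K⟦X⟧ B]
  [Ring C] [Algebra K⟦X⟧ C] [Ring T] [Algebra K⟦X⟧ T] [IsAdicComplete (hId K) T]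
  (τ : A →ₗ[K⟦X⟧] B →ₗ[K⟦X⟧] C →ₗ[K⟦X⟧] T)

lemma foldL_mul (hτ : ∀ a a' b b' c c', τ (a * a') (b * b') (c * c') = τ a b c * τ a' b' c')
    (x x' : CTensor K A B) (c c' : C) :
    foldL τ (tmul K (x * x') (c * c')) = foldL τ (tmul K x c) * foldL τ (tmul K x' c') := by
  have : (LinearMap.mul K⟦X⟧ (CTensor K A B)).compr₂ (foldL τ ∘ₗ (tmul K).flip (c * c')) =
      (LinearMap.mul K⟦X⟧ T).compl₁₂
      (foldL τ ∘ₗ (tmul K).flip c) (foldL τ ∘ₗ (tmul K).flip c') :=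
    ctensor_ext₂ fun a b a' b' => by
      simp only [LinearMap.compr₂_apply, LinearMap.mul_apply', LinearMap.comp_apply,
        LinearMap.compl₁₂_apply, LinearMap.flip_apply]
      rw [tmul_mul_tmul, foldL_tmul, foldL_tmul, foldL_tmul, hτ]
  exact LinearMap.congr_fun₂ this x x'

lemma foldR_mul (hτ : ∀ a a' b b' c c', τ (a * a') (b * b') (c * c') = τ a b c * τ a' b' c')
    (a a' : A) (x x' : CTensor K B C) :
    foldR τ (tmul K (a * a') (x * x')) = foldR τ (tmul K a x) * foldR τ (tmul K a' x') := by
  have : (LinearMap.mul K⟦X⟧ (CTensor K B C)).compr₂ (foldR τ ∘ₗ tmul K (a * a')) =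
      (LinearMap.mul K⟦X⟧ T).compl₁₂ (foldR τ ∘ₗ tmul K a) (foldR τ ∘ₗ tmul K a') :=
    ctensor_ext₂ fun b c b' c' => by
      simp only [LinearMap.compr₂_apply, LinearMap.mul_apply', LinearMap.comp_apply,
        LinearMap.compl₁₂_apply]
      rw [tmul_mul_tmul, foldR_tmul, foldR_tmul, foldR_tmul, hτ]
  exact LinearMap.congr_fun₂ this x x'

lemma foldL_cmap_mul {U : Type*} [Ring U] [Algebra K⟦X⟧ U] (δ : U →ₗ[K⟦X⟧] CTensor K A B)
    (hδ : ∀ a b, δ (a * b) = δ a * δ b)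
    (hτ : ∀ a a' b b' c c', τ (a * a') (b * b') (c * c') = τ a b c * τ a' b' c')
    (x y : CTensor K U C) : foldL τ (cmap K δ LinearMap.id (x * y)) =
      foldL τ (cmap K δ LinearMap.id x) * foldL τ (cmap K δ LinearMap.id y) :=
  ctensor_map_mul (foldL τ ∘ₗ cmap K δ LinearMap.id) (fun a b a' b' => by
    rw [tmul_mul_tmul, LinearMap.comp_apply, LinearMap.comp_apply, LinearMap.comp_apply,
      cmap_apply_tmul, cmap_apply_tmul, cmap_apply_tmul, hδ, LinearMap.id_apply,
      LinearMap.id_apply, LinearMap.id_apply, foldL_mul τ hτ]) x y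

lemma foldR_cmap_mul {U : Type*} [Ring U] [Algebra K⟦X⟧ U] (δ : U →ₗ[K⟦X⟧] CTensor K B C)
    (hδ : ∀ a b, δ (a * b) = δ a * δ b)
    (hτ : ∀ a a' b b' c c', τ (a * a') (b * b') (c * c') = τ a b c * τ a' b' c')
    (x y : CTensor K A U) : foldR τ (cmap K LinearMap.id δ (x * y)) =
      foldR τ (cmap K LinearMap.id δ x) * foldR τ (cmap K LinearMap.id δ y) :=
  ctensor_map_mul (foldR τ ∘ₗ cmap K LinearMap.id δ) (fun a b a' b' => by
    rw [tmul_mul_tmul, LinearMap.comp_apply, LinearMap.comp_apply, LinearMap.comp_apply,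
      cmap_apply_tmul, cmap_apply_tmul, cmap_apply_tmul, hδ, LinearMap.id_apply,
      LinearMap.id_apply, LinearMap.id_apply, foldR_mul τ hτ]) x y

end Triple

section Triple

variable {M N P W : Type*} [AddCommGroup M] [Module K⟦X⟧ M] [AddCommGroup N] [Module K⟦X⟧ N]
  [AddCommGroup P] [Module K⟦X⟧ P] [AddCommGroup W] [Module K⟦X⟧ W] [IsAdicComplete (hId K) W]

/-- Elements that agree in the triple tensor product correspond under `cassoc`. -/
lemma cassoc_eq_of_fold (τ : M →ₗ[K⟦X⟧] N →ₗ[K⟦X⟧] P →ₗ[K⟦X⟧] W)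
    (θ : W →ₗ[K⟦X⟧] CTensor K M (CTensor K N P))
    (hθ : ∀ m n p, θ (τ m n p) = tmul K m (tmul K n p))
    {x : CTensor K (CTensor K M N) P} {y : CTensor K M (CTensor K N P)}
    (h : foldL τ x = foldR τ y) : cassoc K x = y := by
  have h1 : θ ∘ₗ foldL τ = cassoc K := ctensor_ext_left fun m n p => by
    rw [LinearMap.comp_apply, foldL_tmul, cassoc_tmul, hθ]
  have h2 : θ ∘ₗ foldR τ = LinearMap.id := ctensor_ext_right fun m n p => by
    rw [LinearMap.comp_apply, foldR_tmul, LinearMap.id_apply, hθ]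
  rw [← h1, LinearMap.comp_apply, h]
  exact LinearMap.congr_fun h2 y

end Triple

section Triple

variable {M N P : Type*} [AddCommGroup M] [Module K⟦X⟧ M] [AddCommGroup N] [Module K⟦X⟧ N]
  [AddCommGroup P] [Module K⟦X⟧ P]

variable (K M N P) in
/-- The canonical map `M ⊗ (N ⊗ P) → M ⊗̂ (N ⊗̂ P)`. -/
def tripleSection : M ⊗[K⟦X⟧] (N ⊗[K⟦X⟧] P) →ₗ[K⟦X⟧] CTensor K M (CTensor K N P) :=
  TensorProduct.lift ((tmul K).compl₂ (AdicCompletion.of (hId K) (N ⊗[K⟦X⟧] P)))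

lemma tripleSection_tmul (m : M) (n : N) (p : P) :
    tripleSection K M N P (m ⊗ₜ (n ⊗ₜ p)) = tmul K m (tmul K n p) := by
  rw [tripleSection, TensorProduct.lift.tmul]
  rfl

end Triple

section Triple

variable {A B C : Type*} [Ring A] [Algebra K⟦X⟧ A] [Ring B] [Algebra K⟦X⟧ B]
  [Ring C] [Algebra K⟦X⟧ C]

variable (K A B C) in
/-- The completed triple tensor product, as an algebra. -/
abbrev CTriple : Type _ := HComp K (A ⊗[K⟦X⟧] (B ⊗[K⟦X⟧] C))

variable (K A B C) in
/-- `a ⊗ b ⊗ c` in the completed triple tensor product. -/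
def tmul₃ : A →ₗ[K⟦X⟧] B →ₗ[K⟦X⟧] C →ₗ[K⟦X⟧] CTriple K A B C :=
  LinearMap.mk₂ K⟦X⟧ (fun a b => HComp.of K _ ∘ₗ TensorProduct.mk K⟦X⟧ A (B ⊗[K⟦X⟧] C) a ∘ₗ
    TensorProduct.mk K⟦X⟧ B C b)
    (fun _ _ _ => LinearMap.ext fun _ => by simp)
    (fun _ _ _ => LinearMap.ext fun _ => by simp)
    (fun _ _ _ => LinearMap.ext fun _ => by simp [TensorProduct.tmul_add])
    (fun _ _ _ => LinearMap.ext fun _ => by simp)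

lemma tmul₃_apply (a : A) (b : B) (c : C) :
    tmul₃ K A B C a b c = HComp.of K (A ⊗[K⟦X⟧] (B ⊗[K⟦X⟧] C)) (a ⊗ₜ (b ⊗ₜ c)) := rfl

lemma tmul₃_mul (a a' : A) (b b' : B) (c c' : C) :
    tmul₃ K A B C (a * a') (b * b') (c * c') = tmul₃ K A B C a b c * tmul₃ K A B C a' b' c' := by
  rw [tmul₃_apply, tmul₃_apply, tmul₃_apply, ← HComp.of_mul, Algebra.TensorProduct.tmul_mul_tmul,
    Algebra.TensorProduct.tmul_mul_tmul]

lemma exists_triple_section : ∃ θ : CTriple K A B C →ₗ[K⟦X⟧] CTensor K A (CTensor K B C),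
    ∀ a b c, θ (tmul₃ K A B C a b c) = tmul K a (tmul K b c) :=
  ⟨HComp.liftₗ (tripleSection K A B C), fun a b c => by
    rw [tmul₃_apply, HComp.liftₗ_of, tripleSection_tmul]⟩

end Triple

end FoMp
end

noncomputable section
namespace FoMp

/-! ### Iterated braided commutators -/

section Serre

variable {R B : Type*} [CommRing R] [Ring B] [Algebra R B]

/-- The iterated braided commutators `Y ↦ x Y - c_s Y x`. -/
def serIt (c : ℕ → R) (x y : B) : ℕ → B
  | 0 => y
  | s + 1 => x * serIt c x y s - c s • (serIt c x y s * x)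

lemma serIt_comm (c : ℕ → R) (a : R) (x y : B) (s : ℕ) :
    serIt c x (x * y - a • (y * x)) s = x * serIt c x y s - a • (serIt c x y s * x) := by
  induction s with
  | zero => rfl
  | succ s ih =>
    simp only [serIt, ih, mul_sub, sub_mul, mul_smul_comm, smul_mul_assoc, smul_sub, mul_assoc]
    rw [smul_comm a (c s)]
    abel

lemma serIt_succ' (c : ℕ → R) (x y : B) (s : ℕ) : serIt c x y (s + 1) =
    serIt (fun t => c (t + 1)) x (x * y - c 0 • (y * x)) s := by
  induction s with
  | zero => rfl
  | succ s ih =>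
    rw [serIt, ih]
    rfl

lemma serIt_congr {c c' : ℕ → R} (x y : B) {s : ℕ} (h : ∀ t < s, c t = c' t) :
    serIt c x y s = serIt c' x y s := by
  induction s with
  | zero => rfl
  | succ s ih =>
    rw [serIt, serIt, ih fun t ht => h t (ht.trans s.lt_succ_self), h s s.lt_succ_self]

lemma serIt_reverse (c : ℕ → R) (x y : B) (m : ℕ) :
    serIt c x y m = serIt (fun t => c (m - 1 - t)) x y m := by
  induction m generalizing c with
  | zero => rfl
  | succ m ih =>
    rw [serIt_succ', serIt_comm, ih fun t => c (t + 1), serIt]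
    rw [serIt_congr (c' := fun t => c (m + 1 - 1 - t)) x y fun t ht => by
      congr 1; omega]
    simp

lemma serIt_add (c : ℕ → R) (x y y' : B) (s : ℕ) :
    serIt c x (y + y') s = serIt c x y s + serIt c x y' s := by
  induction s with
  | zero => rfl
  | succ s ih =>
    simp only [serIt, ih, mul_add, add_mul, smul_add]
    abel

lemma serIt_smul (c : ℕ → R) (a b : R) (x y : B) (s : ℕ) :
    serIt c (a • x) (b • y) s = (a ^ s * b) • serIt c x y s := by
  induction s with
  | zero => simp [serIt]
  | succ s ih =>
    simp only [serIt, ih, smul_sub, smul_smul, mul_smul_comm, smul_mul_assoc, pow_succ]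
    congr 2 <;> ring

/-- The braided commutators from the left, with coefficients `w p ^ s`. -/
abbrev serL (w p : R) (x y : B) (s : ℕ) : B := serIt (fun t => w * p ^ t) x y s

lemma serL_succ (w p : R) (x y : B) (s : ℕ) : serL w p x y (s + 1) =
    x * serL w p x y s - (w * p ^ s) • (serL w p x y s * x) := rfl

/-- The braided commutators from the right, with coefficients `w p ^ s`. -/
def serR (w p : R) (x y : B) : ℕ → B
  | 0 => y
  | s + 1 => serR w p x y s * x - (w * p ^ s) • (x * serR w p x y s)

lemma unop_serL (w p : R) (x y : Bᵐᵒᵖ) (s : ℕ) :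
    (serL w p x y s).unop = serR w p x.unop y.unop s := by
  induction s with
  | zero => rfl
  | succ s ih =>
    rw [serR, ← ih]
    rfl

lemma serR_eq_smul {w w' p : R} {m : ℕ} (h : w * w' * p ^ m = 1) (x y : B) :
    serR w' p x y (m + 1) = (∏ t ∈ Finset.range (m + 1), -(w' * p ^ t)) • serL w p x y (m + 1) := by
  have key : ∀ s ≤ m + 1, serR w' p x y s =
      (∏ t ∈ Finset.range s, -(w' * p ^ t)) • serIt (fun t => w * p ^ (m + 1 - 1 - t)) x y s := by
    intro s hs
    induction s with
    | zero => simp [serR, serIt]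
    | succ s ih =>
      have h1 : w' * p ^ s * (w * p ^ (m + 1 - 1 - s)) = 1 := by
        rw [← h]
        have : m = s + (m + 1 - 1 - s) := by omega
        conv_rhs => rw [this, pow_add]
        ring
      rw [serR, ih (by omega), Finset.prod_range_succ, serIt]
      simp only [smul_sub, smul_mul_assoc, mul_smul_comm, smul_smul]
      set a := ∏ t ∈ Finset.range s, -(w' * p ^ t)
      rw [show a * -(w' * p ^ s) * (w * p ^ (m + 1 - 1 - s)) =
        -(a * (w' * p ^ s * (w * p ^ (m + 1 - 1 - s)))) by ring, h1, mul_one, neg_smul, mul_neg,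
        neg_smul, mul_comm a]
      abel
  rw [key _ le_rfl, serL, serIt_reverse (fun t => w * p ^ t)]

lemma serR_eq_zero {w w' p : R} {m : ℕ} (h : w * w' * p ^ m = 1) {x y : B}
    (h0 : serL w p x y (m + 1) = 0) : serR w' p x y (m + 1) = 0 := by
  rw [serR_eq_smul h, h0, smul_zero]

lemma serL_eq_zero {w w' p : R} (hp : IsUnit p) {m : ℕ} (h : w * w' * p ^ m = 1) {x y : B}
    (h0 : serR w' p x y (m + 1) = 0) : serL w p x y (m + 1) = 0 := by
  rw [serR_eq_smul h] at h0
  have hw : IsUnit w' := IsUnit.of_mul_eq_one (w * p ^ m) (by rw [← h]; ring)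
  have hu : IsUnit (∏ t ∈ Finset.range (m + 1), -(w' * p ^ t)) :=
    Finset.prod_induction _ IsUnit (fun _ _ => IsUnit.mul) isUnit_one
      fun t _ => (hw.mul (hp.pow t)).neg
  exact hu.smul_eq_zero.1 h0

/-- The quantum Serre elements of sums of braided-commuting elements. -/
lemma serL_add_eq_zero {w w' p : R} (hp : IsUnit p) {m : ℕ} (h : w * w' * p ^ m = 1)
    {a a' b b' : B} (hba : b * a = p • (a * b)) (hba' : b * a' = w • (a' * b))
    (hb'a : b' * a = w' • (a * b')) (ha : serL w p a a' (m + 1) = 0)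
    (hb : serL w p b b' (m + 1) = 0) : serL w p (a + b) (a' + b') (m + 1) = 0 := by
  have h1 : ∀ s, b * serL w p a a' s = (w * p ^ s) • (serL w p a a' s * b) := by
    intro s
    induction s with
    | zero => simpa [serIt] using hba'
    | succ s ih =>
      simp only [serIt, mul_sub, sub_mul, mul_smul_comm, smul_mul_assoc, smul_sub, smul_smul]
      rw [← mul_assoc, hba, ← mul_assoc b, ih]
      simp only [smul_mul_assoc, mul_assoc, hba, ih, mul_smul_comm, smul_smul]
      congr 2 <;> ring
  have h2 : ∀ s, serL w p (a + b) a' s = serL w p a a' s := by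
    intro s
    induction s with
    | zero => rfl
    | succ s ih =>
      rw [serL_succ, ih, serL_succ, add_mul, mul_add, smul_add, h1]
      abel
  have h3 : ∀ s, serR w' p b b' s * a = (w' * p ^ s) • (a * serR w' p b b' s) := by
    intro s
    induction s with
    | zero => simpa [serR] using hb'a
    | succ s ih =>
      simp only [serR, mul_sub, sub_mul, mul_smul_comm, smul_mul_assoc, smul_sub, smul_smul]
      rw [mul_assoc, hba, mul_smul_comm, ← mul_assoc, ih, mul_assoc b, ih, mul_smul_comm,
        ← mul_assoc b, hba]
      simp only [smul_mul_assoc, mul_assoc, smul_smul]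
      congr 2 <;> ring
  have h4 : ∀ s, serR w' p (a + b) b' s = serR w' p b b' s := by
    intro s
    induction s with
    | zero => rfl
    | succ s ih =>
      rw [serR, ih, serR, add_mul, mul_add, smul_add, h3]
      abel
  rw [serL, serIt_add]
  change serL w p (a + b) a' (m + 1) + serL w p (a + b) b' (m + 1) = 0
  rw [h2, ha, zero_add]
  refine serL_eq_zero hp h ?_
  rw [h4]
  exact serR_eq_zero h hb

/-- The quantum Serre elements twisted by group-like elements. -/
lemma serR_twist {w w' p : R} {k l x y : B} (hxk : x * k = p • (k * x)) (hxl : x * l = w' • (l * x))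
    (hyk : y * k = w • (k * y)) (hkl : Commute k l) (s : ℕ) :
    ∃ c : R, serR w p (k * x) (l * y) s = c • (k ^ s * l * serR w' p x y s) := by
  have h1 : ∀ s, serR w' p x y s * k = (w * p ^ s) • (k * serR w' p x y s) := by
    intro s
    induction s with
    | zero => simpa [serR] using hyk
    | succ s ih =>
      simp only [serR, mul_sub, sub_mul, mul_smul_comm, smul_mul_assoc, smul_sub, smul_smul]
      rw [mul_assoc, hxk, mul_smul_comm, ← mul_assoc, ih, mul_assoc x, ih, mul_smul_comm,
        ← mul_assoc x, hxk]
      simp only [smul_mul_assoc, mul_assoc, smul_smul]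
      congr 2 <;> ring
  have h2 : ∀ s, x * (k ^ s * l) = (w' * p ^ s) • (k ^ s * l * x) := by
    intro s
    induction s with
    | zero => simpa using hxl
    | succ s ih =>
      rw [pow_succ', mul_assoc k, ← mul_assoc x, hxk, smul_mul_assoc, mul_assoc k, ih,
        mul_smul_comm, smul_smul, mul_assoc k]
      congr 1
      ring
  induction s with
  | zero => exact ⟨1, by simp [serR]⟩
  | succ s ih =>
    obtain ⟨c, hc⟩ := ih
    refine ⟨c * (w * p ^ s), ?_⟩
    have e1 : k ^ s * l * serR w' p x y s * (k * x) =
        (w * p ^ s) • (k ^ (s + 1) * l * (serR w' p x y s * x)) := by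
      rw [← mul_assoc, mul_assoc (k ^ s * l), h1, mul_smul_comm, smul_mul_assoc, pow_succ]
      simp only [mul_assoc]
      rw [← mul_assoc l k, ← hkl.eq, mul_assoc]
    have e2 : k * x * (k ^ s * l * serR w' p x y s) =
        (w' * p ^ s) • (k ^ (s + 1) * l * (x * serR w' p x y s)) := by
      rw [mul_assoc, ← mul_assoc x, h2, smul_mul_assoc, mul_smul_comm, pow_succ']
      simp only [mul_assoc]
    rw [serR, hc, smul_mul_assoc, mul_smul_comm, e1, e2, serR, mul_sub, mul_smul_comm]
    simp only [smul_smul, smul_sub]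
    congr 2
    ring

/-- A twisted derivation pairing with `x` kills the quantum Serre element. -/
lemma serre_derivation_left {w p : R} {x y κ L : B} {ν : ℕ → R} {m : ℕ} (hL : x * L = p • (L * x))
    (hκ : ∀ s, κ * serL w p x y s =
      ν s • (serL w p x y s * L) + (w * p ^ s) • (serL w p x y s * κ))
    (hν : ∑ t ∈ Finset.range (m + 1), ν t = 0) {W : ℕ → B} (h0 : W 0 = 0)
    (hW : ∀ s, W (s + 1) = (x * W s - (w * p ^ s) • (W s * x)) -
      (κ * serL w p x y s - (w * p ^ s) • (serL w p x y s * κ))) : W (m + 1) = 0 := by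
  have key : ∀ s, W (s + 1) = -((∑ t ∈ Finset.range (s + 1), ν t) • (serL w p x y s * L)) := by
    intro s
    induction s with
    | zero => simp [hW, h0, hκ]
    | succ s ih =>
      rw [hW, ih, hκ, Finset.sum_range_succ _ (s + 1), add_smul]
      set a := ∑ t ∈ Finset.range (s + 1), ν t
      have : a • (serL w p x y (s + 1) * L) = x * (a • (serL w p x y s * L)) -
          (w * p ^ (s + 1)) • (a • (serL w p x y s * L) * x) := by
        rw [serL, serIt, sub_mul, smul_mul_assoc, mul_assoc, mul_assoc _ x L, hL, mul_smul_comm,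
          smul_smul, mul_smul_comm, smul_mul_assoc, smul_sub, smul_comm a, mul_assoc _ L x]
        congr 2
        ring
      rw [this, mul_neg, neg_mul, smul_neg]
      abel
  rw [key, hν, zero_smul, neg_zero]

/-- A twisted derivation pairing with `y` kills the quantum Serre element. -/
lemma serre_derivation_right [NoZeroDivisors R] {w w' p ν η : R} {x κ L : B} {m : ℕ}
    (h : w * w' * p ^ m = 1) (hη : η ≠ 0) (hν : η * (w * ν) = w * w' - 1)
    (hκ : κ * x = ν • (x * L) + w' • (x * κ)) (hL : x * L = w • (L * x))
    {W : ℕ → B} (h0 : W 0 = -κ)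
    (hW : ∀ s, W (s + 1) = x * W s - (w * p ^ s) • (W s * x)) : W (m + 1) = 0 := by
  have key : ∀ s, ∃ a b : R, W s = x ^ s * (a • κ + b • L) ∧
      (s = m + 1 → a = 0) ∧ (0 < s → η * b = a) := by
    intro s
    induction s with
    | zero => exact ⟨-1, 0, by simp [h0], fun h => by omega, fun h => by omega⟩
    | succ s ih =>
      obtain ⟨a, b, hs, -, hl⟩ := ih
      refine ⟨a * (1 - w * w' * p ^ s), b * (1 - p ^ s) - w * p ^ s * (a * ν), ?_, ?_, ?_⟩
      · rw [hW, hs, pow_succ, ← mul_assoc x, ← pow_succ', pow_succ, mul_assoc (x ^ s) x,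
          mul_assoc (x ^ s) _ x, mul_assoc (x ^ s) x, ← mul_smul_comm, ← mul_sub]
        congr 1
        simp only [add_mul, smul_mul_assoc, hκ, mul_add, mul_smul_comm, smul_add, smul_smul, hL]
        module
      · rintro h1
        obtain rfl : s = m := by omega
        rw [h]
        ring
      · intro _
        rcases Nat.eq_zero_or_pos s with rfl | hpos
        · simp only [pow_zero, mul_one, sub_self, mul_zero, zero_sub]
          linear_combination (-a) * hν
        · linear_combination (1 - p ^ s) * hl hpos - (p ^ s * a) * hν
  obtain ⟨a, b, hs, ha, hb⟩ := key (m + 1)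
  have ha := ha rfl
  have hb := hb (Nat.succ_pos _)
  rw [ha] at hb
  rw [hs, ha, (mul_eq_zero.1 hb).resolve_left hη]
  simp

/-- The coefficients of the expansion of `serL`. -/
def gauss (w p : R) : ℕ → ℕ → R
  | _, 0 => 1
  | 0, _ + 1 => 0
  | m + 1, k + 1 => gauss w p m (k + 1) + w * p ^ m * gauss w p m k

lemma gauss_of_lt (w p : R) {m k : ℕ} (h : m < k) : gauss w p m k = 0 := by
  induction m generalizing k with
  | zero => obtain ⟨k, rfl⟩ := Nat.exists_eq_succ_of_ne_zero h.ne'; rfl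
  | succ m ih =>
    obtain ⟨k, rfl⟩ := Nat.exists_eq_succ_of_ne_zero (by omega : k ≠ 0)
    rw [Nat.succ_eq_add_one, gauss, ih (by omega), ih (by omega)]
    ring

lemma gauss_zero (w p : R) (m : ℕ) : gauss w p m 0 = 1 := by cases m <;> rfl

lemma serL_eq_sum (w p : R) (x y : B) (m : ℕ) : serL w p x y m =
    ∑ k ∈ Finset.range (m + 1), ((-1) ^ k * gauss w p m k) • (x ^ (m - k) * y * x ^ k) := by
  induction m with
  | zero => simp [serIt, gauss]
  | succ m ih =>
    rw [serL_succ, ih, Finset.sum_range_succ' _ (m + 1), Finset.mul_sum, Finset.sum_mul, Finset.smul_sum]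
    simp only [gauss, mul_add, add_smul, Finset.sum_add_distrib]
    have e1 : ∑ k ∈ Finset.range (m + 1), x * ((-1) ^ k * gauss w p m k) • (x ^ (m - k) * y * x ^ k)
        = ∑ k ∈ Finset.range (m + 1), ((-1) ^ (k + 1) * gauss w p m (k + 1)) •
          (x ^ (m + 1 - (k + 1)) * y * x ^ (k + 1)) + x ^ (m + 1) * y := by
      rw [Finset.sum_range_succ' _ m, Finset.sum_range_succ _ m, gauss_of_lt w p m.lt_succ_self]
      simp only [mul_zero, zero_smul, add_zero]
      congr 1
      · refine Finset.sum_congr rfl fun k hk => ?_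
        rw [mul_smul_comm, ← mul_assoc, ← mul_assoc, ← pow_succ']
        congr 4
        have := Finset.mem_range.1 hk
        omega
      · simp [gauss_zero, pow_succ', mul_assoc]
    rw [e1, sub_eq_add_neg, ← Finset.sum_neg_distrib]
    have e2 : ∀ k ∈ Finset.range (m + 1), -((w * p ^ m) •
        (((-1) ^ k * gauss w p m k) • (x ^ (m - k) * y * x ^ k) * x)) =
        ((-1) ^ (k + 1) * (w * p ^ m * gauss w p m k)) •
          (x ^ (m + 1 - (k + 1)) * y * x ^ (k + 1)) := by
      intro k _
      rw [smul_mul_assoc, mul_assoc _ (x ^ k), ← pow_succ, smul_smul, ← neg_smul,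
        Nat.add_sub_add_right]
      congr 1
      ring
    rw [Finset.sum_congr rfl e2]
    simp only [pow_zero, mul_one, one_smul, Nat.sub_zero]
    abel

end Serre

end FoMp
end

noncomputable section
namespace FoMp
variable {K : Type*} [Field K]

/-! ### The quantum Serre relations -/

section QBinomial

variable [CharZero K]

lemma hexp_nat_mul (k : ℕ) (r : K⟦X⟧) : hexp K ((k : K⟦X⟧) * r) = hexp K r ^ k := by
  induction k with
  | zero => simp [hexp_zero]
  | succ k ih =>
    rw [Nat.cast_succ, add_mul, one_mul, hexp_add (Commute.all _ _), ih, pow_succ]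

variable (K) in
/-- `q ^ z` for `q = e^{ħd}`. -/
def qPow (d : ℕ) (z : ℤ) : K⟦X⟧ := hexp K ((z * d : ℤ) : K⟦X⟧)

lemma qPow_add (d : ℕ) (z z' : ℤ) : qPow K d (z + z') = qPow K d z * qPow K d z' := by
  rw [qPow, add_mul, Int.cast_add, hexp_add (Commute.all _ _)]
  rfl

omit [CharZero K] in
lemma qPow_zero (d : ℕ) : qPow K d 0 = 1 := by
  simp [qPow, hexp_zero]

lemma qPow_mul_nat (d : ℕ) (z : ℤ) (k : ℕ) : qPow K d (z * k) = qPow K d z ^ k := by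
  rw [qPow, qPow, ← hexp_nat_mul]
  congr 1
  push_cast
  ring

omit [CharZero K] in
lemma constantCoeff_hexp (r : K⟦X⟧) : constantCoeff (hexp K r) = 1 := by
  rw [hexp_eq]
  simp

lemma qInt_add (d a b : ℕ) : qInt K d (a + b) =
    qPow K d (-a) * qInt K d b + qPow K d b * qInt K d a := by
  rw [qInt, add_comm a b, Finset.sum_range_add, qInt, qInt, Finset.mul_sum, Finset.mul_sum]
  congr 1
  · refine Finset.sum_congr rfl fun s _ => ?_
    change qPow K d _ = _ * qPow K d _
    rw [← qPow_add]
    congr 1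
    push_cast
    ring
  · refine Finset.sum_congr rfl fun s _ => ?_
    change qPow K d _ = _ * qPow K d _
    rw [← qPow_add]
    congr 1
    push_cast
    ring

omit [CharZero K] in
lemma constantCoeff_qInt (d m : ℕ) : constantCoeff (qInt K d m) = m := by
  simp [qInt, constantCoeff_hexp]

lemma constantCoeff_qFact (d m : ℕ) : constantCoeff (qFact K d m) ≠ 0 := by
  rw [qFact, map_prod]
  refine Finset.prod_ne_zero_iff.2 fun s _ => ?_
  rw [constantCoeff_qInt]
  exact_mod_cast s.succ_ne_zero

omit [CharZero K] in
lemma qFact_succ (d m : ℕ) : qFact K d (m + 1) = qFact K d m * qInt K d (m + 1) :=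
  Finset.prod_range_succ _ _

lemma gauss_eq_pow_mul {R : Type*} [CommRing R] (w p : R) (m k : ℕ) :
    gauss w p m k = w ^ k * gauss 1 p m k := by
  induction m generalizing k with
  | zero => cases k <;> simp [gauss]
  | succ m ih =>
    cases k with
    | zero => simp [gauss]
    | succ k =>
      rw [gauss, gauss, ih, ih k, pow_succ]
      ring

lemma gauss_mul_qFact (d : ℕ) (m k : ℕ) (hk : k ≤ m) :
    gauss 1 (qPow K d 2) m k * (qFact K d k * qFact K d (m - k)) =
      qFact K d m * qPow K d (k * (m - 1)) := by
  have hpow : ∀ m : ℕ, qPow K d 2 ^ m = qPow K d (2 * m) := fun m => (qPow_mul_nat d 2 m).symm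
  induction m generalizing k with
  | zero =>
    obtain rfl : k = 0 := by omega
    simp [gauss, qFact, qPow_zero]
  | succ m ih =>
    cases k with
    | zero => simp [gauss, qFact, qPow_zero]
    | succ k =>
      have hk' : k ≤ m := by omega
      rw [gauss, one_mul, hpow, Nat.add_sub_add_right, add_mul, qFact_succ d k]
      have e2 : qPow K d (2 * m) * gauss 1 (qPow K d 2) m k *
          (qFact K d k * qInt K d (k + 1) * qFact K d (m - k)) =
          qFact K d m * (qPow K d (2 * m + k * (m - 1)) * qInt K d (k + 1)) := by
        rw [qPow_add]
        linear_combination qPow K d (2 * m) * qInt K d (k + 1) * ih k hk'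
      rw [e2]
      rcases hk'.eq_or_lt with rfl | hlt
      · rw [gauss_of_lt _ _ (Nat.lt_succ_self _), zero_mul, zero_add, qFact_succ, mul_assoc,
          mul_comm (qPow K d _)]
        congr 3
        push_cast
        ring
      · obtain ⟨r, rfl⟩ := Nat.exists_eq_add_of_lt hlt
        have hr : k + r + 1 - k = r + 1 := by omega
        have h1 := ih (k + 1) (by omega)
        have hr' : k + r + 1 - (k + 1) = r := by omega
        rw [hr'] at h1
        rw [hr, qFact_succ d r, qFact_succ d (k + r + 1),
          show k + r + 1 + 1 = (k + 1) + (r + 1) by ring, qInt_add d (k + 1) (r + 1)]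
        rw [qFact_succ d k] at h1
        have e1 : gauss 1 (qPow K d 2) (k + r + 1) (k + 1) *
            (qFact K d k * qInt K d (k + 1) * (qFact K d r * qInt K d (r + 1))) =
            qFact K d (k + r + 1) * qPow K d (((k + 1 : ℕ) : ℤ) * ((k + r + 1 : ℕ) - 1)) *
              qInt K d (r + 1) := by
          linear_combination qInt K d (r + 1) * h1
        have q1 : qPow K d (((k + 1 : ℕ) : ℤ) * ((k + r + 1 : ℕ) - 1)) =
            qPow K d (-((k + 1 : ℕ) : ℤ)) *
              qPow K d (((k + 1 : ℕ) : ℤ) * (((k + 1 + (r + 1) : ℕ) : ℤ) - 1)) := by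
          rw [← qPow_add]
          congr 1
          push_cast
          ring
        have q2 : qPow K d (2 * ((k + r + 1 : ℕ) : ℤ) + k * (((k + r + 1 : ℕ) : ℤ) - 1)) =
            qPow K d ((r + 1 : ℕ) : ℤ) *
              qPow K d (((k + 1 : ℕ) : ℤ) * (((k + 1 + (r + 1) : ℕ) : ℤ) - 1)) := by
          rw [← qPow_add]
          congr 1
          push_cast
          ring
        rw [e1, q1, q2]
        ring

variable {n : ℕ} {A : Matrix (Fin n) (Fin n) ℤ} {d : Fin n → ℕ} {P : Matrix (Fin n) (Fin n) K⟦X⟧}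

lemma IsCartanType.add_eq (hP : IsCartanType A d P) (i j : Fin n) :
    P i j + P j i = ((2 * (d i * A i j) : ℤ) : K⟦X⟧) := by
  have h := congrFun (congrFun hP i) j
  simp only [Matrix.smul_apply, Matrix.add_apply, Matrix.transpose_apply, smul_eq_mul, DA,
    Matrix.of_apply] at h
  have h2 : (C (2⁻¹ : K) : K⟦X⟧) * 2 = 1 := by
    rw [← map_ofNat (C (R := K)) 2, ← map_mul, inv_mul_cancel₀ two_ne_zero, map_one]
  push_cast at h ⊢
  linear_combination 2 * h - (P i j + P j i) * h2

omit [CharZero K] in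
lemma IsCartanType.transpose (hP : IsCartanType A d P) : IsCartanType A d P.transpose := by
  rw [IsCartanType, Matrix.transpose_transpose, add_comm]
  exact hP

lemma serre_eq_serL (hA : IsSymmetrizedCartan A d) (hP : IsCartanType A d P)
    {B : Type*} [Ring B] [Algebra K⟦X⟧ B] (x : Fin n → B) {i j : Fin n} (hij : i ≠ j) :
    serre A d P x i j =
      serL (hexp K (P i j)) (qPow K (d i) 2) (x i) (x j) (1 - A i j).toNat := by
  rw [serL_eq_sum, serre]
  refine Finset.sum_congr rfl fun k hk => ?_
  have hk : k ≤ (1 - A i j).toNat := Nat.lt_succ_iff.1 (Finset.mem_range.1 hk)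
  congr 1
  have hm : (((1 - A i j).toNat : ℤ)) = 1 - A i j :=
    Int.toNat_of_nonneg (by have := hA.nonpos i j hij; omega)
  set m := (1 - A i j).toNat
  rw [mul_assoc, mul_assoc]
  congr 1
  have hu : IsUnit (qFact K (d i) k * qFact K (d i) (m - k)) := by
    rw [PowerSeries.isUnit_iff_constantCoeff, map_mul]
    exact (mul_ne_zero (constantCoeff_qFact _ _) (constantCoeff_qFact _ _)).isUnit
  have hinv : (qFact K (d i) k * qFact K (d i) (m - k)) *
      (qFact K (d i) k * qFact K (d i) (m - k))⁻¹ = 1 :=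
    PowerSeries.mul_inv_cancel _ (PowerSeries.isUnit_iff_constantCoeff.1 hu).ne_zero
  have h1 := gauss_mul_qFact (K := K) (d i) m k hk
  have h2 : hexp K (C ((k : K) / 2) * P i j) * hexp K (-(C ((k : K) / 2) * P j i)) =
      hexp K (P i j) ^ k * qPow K (d i) (k * (m - 1)) := by
    rw [← hexp_add (Commute.all _ _), ← hexp_nat_mul, qPow, ← hexp_add (Commute.all _ _)]
    congr 1
    have h3 := hP.add_eq i j
    have h4 : (C ((k : K) / 2) : K⟦X⟧) * 2 = k := by
      rw [← map_ofNat (C (R := K)) 2, ← map_mul, div_mul_cancel₀ _ two_ne_zero, map_natCast]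
    rw [hm]
    push_cast at h3 ⊢
    linear_combination (-C ((k : K) / 2)) * h3 + (P i j - d i * A i j) * h4
  rw [h2, qBinom, gauss_eq_pow_mul]
  set J := (qFact K (d i) k * qFact K (d i) (m - k))⁻¹
  linear_combination (-hexp K (P i j) ^ k * J) * h1 +
    gauss 1 (qPow K (d i) 2) m k * hexp K (P i j) ^ k * hinv

/-- The relation `q_ij q_ji = q_i^{2 a_ij}`. -/
lemma IsCartanType.hexp_mul (hP : IsCartanType A d P) (hA : IsSymmetrizedCartan A d)
    {i j : Fin n} (hij : i ≠ j) :
    hexp K (P i j) * hexp K (P j i) * qPow K (d i) 2 ^ (-A i j).toNat = 1 := by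
  have hm : (((-A i j).toNat : ℤ)) = -A i j :=
    Int.toNat_of_nonneg (by have := hA.nonpos i j hij; omega)
  rw [← hexp_add (Commute.all _ _), hP.add_eq, ← qPow_mul_nat, hm, qPow,
    ← hexp_add (Commute.all _ _), ← Int.cast_add,
    show 2 * (d i * A i j : ℤ) + 2 * -A i j * d i = 0 by ring, Int.cast_zero, hexp_zero]

lemma IsSymmetrizedCartan.toNat_eq (hA : IsSymmetrizedCartan A d) {i j : Fin n} (hij : i ≠ j) :
    (1 - A i j).toNat = (-A i j).toNat + 1 := by
  have := hA.nonpos i j hij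
  omega

lemma IsCartanType.diag (hP : IsCartanType A d P) (hA : IsSymmetrizedCartan A d) (i : Fin n) :
    hexp K (P i i) = qPow K (d i) 2 := by
  have h := hP.add_eq i i
  rw [hA.diag] at h
  have : P i i = ((2 * d i : ℤ) : K⟦X⟧) := by
    have h2 : (C (2⁻¹ : K) : K⟦X⟧) * 2 = 1 := by
      rw [← map_ofNat (C (R := K)) 2, ← map_mul, inv_mul_cancel₀ two_ne_zero, map_one]
    push_cast at h ⊢
    linear_combination C (2⁻¹ : K) * h + (2 * d i - P i i) * h2
  rw [this]
  rfl

lemma isUnit_hexp (r : K⟦X⟧) : IsUnit (hexp K r) :=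
  IsUnit.of_mul_eq_one _ (hexp_mul_neg r)

end QBinomial

end FoMp
end

noncomputable section
namespace FoMp
variable {K : Type*} [Field K]

/-! ### Topological generation -/

section TopGen

variable {B C N : Type*} [Ring B] [Algebra K⟦X⟧ B] [Ring C] [Algebra K⟦X⟧ C]
  [AddCommGroup N] [Module K⟦X⟧ N]

variable (K) in
/-- `s` generates the algebra `B` topologically. -/
def IsTopGen (s : Set B) : Prop := ∀ x : B, x ∈ adicClosure (Algebra.adjoin K⟦X⟧ s)

lemma IsTopGen.mono {s s' : Set B} (h : IsTopGen K s) (hs : s ⊆ Algebra.adjoin K⟦X⟧ s') :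
    IsTopGen K s' := fun x n => by
  obtain ⟨y, hy, z, hz⟩ := h x n
  exact ⟨y, Algebra.adjoin_le hs hy, z, hz⟩

lemma IsTopGen.induction_left {s : Set B} (h : IsTopGen K s) {p : B → Prop} (one : p 1)
    (add : ∀ x y, p x → p y → p (x + y)) (smul : ∀ (r : K⟦X⟧) x, p x → p (r • x))
    (mul : ∀ a ∈ s, ∀ x, p x → p (a * x))
    (closed : ∀ x, (∀ n : ℕ, ∃ y z, p y ∧ x = y + (X : K⟦X⟧) ^ n • z) → p x) (x : B) : p x := by
  let S : Subalgebra K⟦X⟧ B :=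
    { carrier := {a | ∀ x, p x → p (a * x)}
      mul_mem' := fun {a b} ha hb x hx => by rw [mul_assoc]; exact ha _ (hb _ hx)
      add_mem' := fun {a b} ha hb x hx => by rw [add_mul]; exact add _ _ (ha _ hx) (hb _ hx)
      algebraMap_mem' := fun r x hx => by rw [← Algebra.smul_def]; exact smul _ _ hx }
  have hS : Algebra.adjoin K⟦X⟧ s ≤ S := Algebra.adjoin_le mul
  refine closed x fun n => ?_
  obtain ⟨y, hy, z, rfl⟩ := h x n
  exact ⟨y, z, by simpa using hS hy 1 one, rfl⟩

/-- Linear maps that agree on `1` and whose equality locus is stable under left multiplication by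
topological generators are equal. -/
lemma IsTopGen.linearMap_ext [IsAdicComplete (hId K) N] {s : Set B} (h : IsTopGen K s)
    {f g : B →ₗ[K⟦X⟧] N} (one : f 1 = g 1)
    (mul : ∀ a ∈ s, ∀ x, f x = g x → f (a * x) = g (a * x)) : f = g := by
  refine LinearMap.ext fun x => h.induction_left (p := fun x => f x = g x) one
    (fun x y hx hy => by rw [map_add, map_add, hx, hy]) (fun r x hx => by rw [map_smul, map_smul, hx])
    mul (fun x hx => ?_) x
  refine eq_of_forall_pow (K := K) fun n => ?_
  obtain ⟨y, z, hy, rfl⟩ := hx n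
  refine ⟨f z - g z, ?_⟩
  rw [map_add, map_add, hy, map_smul, map_smul, smul_sub]
  abel

lemma IsTopGen.algHom_ext [IsAdicComplete (hId K) C] {s : Set B} (h : IsTopGen K s)
    {f g : B →ₐ[K⟦X⟧] C} (hs : ∀ a ∈ s, f a = g a) : f = g := by
  have : f.toLinearMap = g.toLinearMap := h.linearMap_ext (by simp) fun a ha x hx => by
    simp only [AlgHom.toLinearMap_apply, map_mul] at hx ⊢
    rw [hs a ha, hx]
  exact AlgHom.ext fun x => LinearMap.congr_fun this x

/-- Multiplicative linear maps are determined by topological generators. -/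
lemma IsTopGen.mul_ext [IsAdicComplete (hId K) C] {s : Set B} (h : IsTopGen K s)
    {f g : B →ₗ[K⟦X⟧] C} (one : f 1 = g 1) (hf : ∀ a b, f (a * b) = f a * f b)
    (hg : ∀ a b, g (a * b) = g a * g b) (hs : ∀ a ∈ s, f a = g a) : f = g :=
  h.linearMap_ext one fun a ha x hx => by rw [hf, hg, hs a ha, hx]

end TopGen

/-! ### Presentations of complete algebras -/

section Presentation

variable {V : Type*} [AddCommGroup V] [Module K⟦X⟧ V]
  (r : HComp K (TensorAlgebra K⟦X⟧ V) → HComp K (TensorAlgebra K⟦X⟧ V) → Prop)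
  {C : Type*} [Ring C] [Algebra K⟦X⟧ C] [IsAdicComplete (hId K) C]

/-- The homomorphism of the completed free algebra given by a linear map. -/
def freeLift (ψ : V →ₗ[K⟦X⟧] C) : HComp K (TensorAlgebra K⟦X⟧ V) →ₐ[K⟦X⟧] C :=
  HComp.lift (TensorAlgebra.lift K⟦X⟧ ψ)

lemma freeLift_of (ψ : V →ₗ[K⟦X⟧] C) (v : V) :
    freeLift ψ (HComp.of K _ (TensorAlgebra.ι K⟦X⟧ v)) = ψ v := by
  rw [freeLift, HComp.lift_of, TensorAlgebra.lift_ι_apply]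

/-- The complete algebra with generators `V` and relations `r`. -/
abbrev Pres : Type _ := HComp K (RingQuot r)

/-- The quotient map from the completed free algebra. -/
def presMk : HComp K (TensorAlgebra K⟦X⟧ V) →ₐ[K⟦X⟧] Pres r :=
  (HComp.ofAlg K (RingQuot r)).comp (RingQuot.mkAlgHom K⟦X⟧ r)

lemma presMk_rel {a b} (h : r a b) : presMk r a = presMk r b :=
  congrArg (HComp.ofAlg K (RingQuot r)) (RingQuot.mkAlgHom_rel K⟦X⟧ h)

/-- The universal property of a presentation. -/
def presLift (ψ : V →ₗ[K⟦X⟧] C) (h : ∀ a b, r a b → freeLift ψ a = freeLift ψ b) :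
    Pres r →ₐ[K⟦X⟧] C :=
  HComp.lift (RingQuot.liftAlgHom K⟦X⟧ ⟨freeLift ψ, fun {a b} => h a b⟩)

lemma presLift_mk (ψ : V →ₗ[K⟦X⟧] C) (h : ∀ a b, r a b → freeLift ψ a = freeLift ψ b)
    (x : HComp K (TensorAlgebra K⟦X⟧ V)) : presLift r ψ h (presMk r x) = freeLift ψ x := by
  rw [presLift, presMk, AlgHom.comp_apply, HComp.ofAlg_apply, HComp.lift_of,
    RingQuot.liftAlgHom_mkAlgHom_apply]

lemma isTopGen_pres : IsTopGen K
    (Set.range fun v : V => presMk r (HComp.of K _ (TensorAlgebra.ι K⟦X⟧ v))) := by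
  intro x n
  obtain ⟨q, z, rfl⟩ := HComp.approx x n
  obtain ⟨y, rfl⟩ := RingQuot.mkAlgHom_surjective K⟦X⟧ r q
  obtain ⟨a, w, rfl⟩ := HComp.approx y n
  refine ⟨presMk r (HComp.of K _ a), ?_, presMk r w + z, ?_⟩
  · induction a using TensorAlgebra.induction with
    | algebraMap c =>
      have : presMk r (HComp.of K _ (algebraMap K⟦X⟧ (TensorAlgebra K⟦X⟧ V) c)) =
          algebraMap K⟦X⟧ _ c :=
        AlgHom.commutes ((presMk r).comp (HComp.ofAlg K _)) c
      rw [this]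
      exact Subalgebra.algebraMap_mem _ _
    | ι v => exact Algebra.subset_adjoin ⟨v, rfl⟩
    | mul a b ha hb =>
      rw [HComp.of_mul, map_mul]
      exact Subalgebra.mul_mem _ ha hb
    | add a b ha hb =>
      rw [map_add, map_add]
      exact Subalgebra.add_mem _ ha hb
  · rw [smul_add, ← add_assoc, ← map_smul, ← map_add]
    rfl

end Presentation

/-! ### The defining relations -/

section Relations

variable {n : ℕ} {P : Matrix (Fin n) (Fin n) K⟦X⟧} {𝔥 : Type*} [AddCommGroup 𝔥]
  [Module K⟦X⟧ 𝔥] [Module.Free K⟦X⟧ 𝔥] [Module.Finite K⟦X⟧ 𝔥]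

namespace Realization

/-- The realization of `Pᵀ` with `T_i^+` and `T_i^-` exchanged. -/
def op (R : Realization P 𝔥) : Realization P.transpose 𝔥 where
  Tp := R.Tm
  Tm := R.Tp
  α := R.α
  α_Tp := R.α_Tm
  α_Tm := R.α_Tp
  indep_S := by simpa only [add_comm] using R.indep_S

variable (A : Matrix (Fin n) (Fin n) ℤ) (d : Fin n → ℕ) (R : Realization P 𝔥)
  {B C : Type*} [Ring B] [Algebra K⟦X⟧ B] [Ring C] [Algebra K⟦X⟧ C]

/-- The relations between the toral part and one half of the generators. -/
structure HalfSat (t : 𝔥 →ₗ[K⟦X⟧] B) (e : Fin n → B) : Prop where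
  TE : ∀ x j, t x * e j - e j * t x = R.α j x • e j
  TT : ∀ x y, Commute (t x) (t y)
  ser : ∀ i j, i ≠ j →
    serL (hexp K (P i j)) (qPow K (d i) 2) (e i) (e j) ((-A i j).toNat + 1) = 0

/-- The defining relations of the FoMpQUEA. -/
structure Sat [IsAdicComplete (hId K) B] (t : 𝔥 →ₗ[K⟦X⟧] B) (e f : Fin n → B) : Prop where
  pos : R.HalfSat A d t e
  neg : R.op.HalfSat A d (-t) f
  EF : ∀ i, e i * f i - f i * e i =
    (hdiff K (d i : K⟦X⟧) (d i : K⟦X⟧))⁻¹ • hdiff K (t (R.Tp i)) (t (R.Tm i))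
  EF_ne : ∀ i j, i ≠ j → Commute (e i) (f j)

end Realization

variable {A : Matrix (Fin n) (Fin n) ℤ} {d : Fin n → ℕ} {R : Realization P 𝔥}
  {B C : Type*} [Ring B] [Algebra K⟦X⟧ B] [Ring C] [Algebra K⟦X⟧ C]

lemma map_serL {R' B C : Type*} [CommRing R'] [Ring B] [Algebra R' B] [Ring C] [Algebra R' C]
    (ψ : B →ₐ[R'] C) (w p : R') (x y : B) (s : ℕ) :
    ψ (serL w p x y s) = serL w p (ψ x) (ψ y) s := by
  induction s with
  | zero => rfl
  | succ s ih => rw [serL_succ, serL_succ, ← ih]; simp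

namespace Realization

lemma HalfSat.map {t : 𝔥 →ₗ[K⟦X⟧] B} {e : Fin n → B} (h : R.HalfSat A d t e)
    (ψ : B →ₐ[K⟦X⟧] C) : R.HalfSat A d (ψ.toLinearMap ∘ₗ t) (fun i => ψ (e i)) where
  TE x j := by simpa using congrArg ψ (h.TE x j)
  TT x y := (h.TT x y).map ψ
  ser i j hij := by rw [← map_serL, h.ser i j hij, map_zero]

lemma HalfSat.smul {t : 𝔥 →ₗ[K⟦X⟧] B} {e : Fin n → B} (h : R.HalfSat A d t e)
    (c : Fin n → K⟦X⟧) : R.HalfSat A d t (fun i => c i • e i) where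
  TE x j := by rw [mul_smul_comm, smul_mul_assoc, ← smul_sub, h.TE, smul_comm]
  TT := h.TT
  ser i j hij := by rw [serL, serIt_smul]; exact (congrArg _ (h.ser i j hij)).trans (smul_zero _)

lemma HalfSat.hexp_mul [CharZero K] [IsAdicComplete (hId K) B] {t : 𝔥 →ₗ[K⟦X⟧] B} {e : Fin n → B}
    (h : R.HalfSat A d t e) (x : 𝔥) (j : Fin n) :
    hexp K (t x) * e j = hexp K (R.α j x) • (e j * hexp K (t x)) :=
  hexp_mul_of_commutator (h.TE x j)

lemma HalfSat.mul_hexp [CharZero K] [IsAdicComplete (hId K) B] {t : 𝔥 →ₗ[K⟦X⟧] B} {e : Fin n → B}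
    (h : R.HalfSat A d t e) (x : 𝔥) (j : Fin n) :
    e j * hexp K (t x) = hexp K (-R.α j x) • (hexp K (t x) * e j) := by
  rw [h.hexp_mul, smul_smul, hexp_neg_mul, one_smul]

lemma Sat.TF [IsAdicComplete (hId K) B] {t : 𝔥 →ₗ[K⟦X⟧] B} {e f : Fin n → B}
    (h : R.Sat A d t e f) (x : 𝔥) (j : Fin n) :
    t x * f j - f j * t x = -(R.α j x • f j) := by
  have h1 : -t x * f j - f j * -t x = R.α j x • f j := h.neg.TE x j
  rw [← h1]
  simp
  abel

lemma Sat.map [IsAdicComplete (hId K) B] [IsAdicComplete (hId K) C]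
    {t : 𝔥 →ₗ[K⟦X⟧] B} {e f : Fin n → B} (h : R.Sat A d t e f) (ψ : B →ₐ[K⟦X⟧] C) :
    R.Sat A d (ψ.toLinearMap ∘ₗ t) (fun i => ψ (e i)) (fun i => ψ (f i)) where
  pos := h.pos.map ψ
  neg := by rw [← LinearMap.comp_neg]; exact h.neg.map ψ
  EF i := by
    have := congrArg ψ (h.EF i)
    rw [map_sub, map_mul, map_mul, map_smul, AlgHom.map_hdiff] at this
    exact this
  EF_ne i j hij := (h.EF_ne i j hij).map ψ

/-- Exchanging the roles of the two halves. -/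
lemma Sat.symm [IsAdicComplete (hId K) B] {t : 𝔥 →ₗ[K⟦X⟧] B} {e f : Fin n → B}
    (h : R.Sat A d t e f) : R.op.Sat A d (-t) f e where
  pos := h.neg
  neg := by rw [neg_neg]; exact h.pos
  EF i := by
    rw [← neg_sub, h.EF, ← smul_neg, ← hdiff_neg_swap]
    rfl
  EF_ne i j hij := (h.EF_ne j i hij.symm).symm

variable [CharZero K] (hA : IsSymmetrizedCartan A d) (hP : IsCartanType A d P)

lemma sat_iff_rel [IsAdicComplete (hId K) B] (hA : IsSymmetrizedCartan A d)
    (hP : IsCartanType A d P) {t : 𝔥 →ₗ[K⟦X⟧] B} {e f : Fin n → B} :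
    R.Sat A d t e f ↔ ∀ a b, R.Rel A d t e f a b → a = b := by
  constructor
  · intro h a b hab
    cases hab with
    | TE x j => exact h.pos.TE x j
    | TF x j => exact h.TF x j
    | TT x x' => exact h.pos.TT x x'
    | EF i => exact h.EF i
    | EF_ne i j hij => exact sub_eq_zero.2 (h.EF_ne i j hij).eq
    | serreE i j hij =>
      rw [serre_eq_serL hA hP _ hij, hA.toNat_eq hij]
      exact h.pos.ser i j hij
    | serreF i j hij =>
      rw [serre_eq_serL hA hP.transpose _ hij, hA.toNat_eq hij]
      exact h.neg.ser i j hij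
  · intro h
    have hser : ∀ i j, i ≠ j → _ := fun i j hij => h _ _ (.serreE i j hij)
    have hserF : ∀ i j, i ≠ j → _ := fun i j hij => h _ _ (.serreF i j hij)
    refine ⟨⟨fun x j => h _ _ (.TE x j), fun x y => h _ _ (.TT x y), fun i j hij => ?_⟩,
      ⟨fun x j => ?_, fun x y => ?_, fun i j hij => ?_⟩, fun i => h _ _ (.EF i),
      fun i j hij => sub_eq_zero.1 (h _ _ (.EF_ne i j hij))⟩
    · rw [← hA.toNat_eq hij, ← serre_eq_serL hA hP _ hij]
      exact hser i j hij
    · have h1 := h _ _ (.TF x j)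
      change -t x * f j - f j * -t x = R.α j x • f j
      rw [← neg_inj, ← h1]
      simp
      abel
    · change Commute (-t x) (-t y)
      exact (show Commute (t x) (t y) from h _ _ (.TT x y)).neg_left.neg_right
    · rw [← hA.toNat_eq hij, ← serre_eq_serL hA hP.transpose _ hij]
      exact hserF i j hij

/-! ### The universal property of the FoMpQUEA -/

omit [CharZero K] in
lemma Rel.of_map {D : Type*} [Ring D] [Algebra K⟦X⟧ D] [IsAdicComplete (hId K) D]
    [IsAdicComplete (hId K) B] (ψ : B →ₐ[K⟦X⟧] D)
    {t : 𝔥 →ₗ[K⟦X⟧] B} {e f : Fin n → B} {t' : 𝔥 →ₗ[K⟦X⟧] D} {e' f' : Fin n → D}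
    (ht : ∀ x, ψ (t x) = t' x) (he : ∀ i, ψ (e i) = e' i) (hf : ∀ i, ψ (f i) = f' i)
    {a b : B} (h : R.Rel A d t e f a b) : R.Rel A d t' e' f' (ψ a) (ψ b) := by
  cases h with
  | TE x j =>
    have := Rel.TE (R := R) (A := A) (d := d) (t := t') (e := e') (f := f') x j
    simpa [ht, he] using this
  | TF x j =>
    have := Rel.TF (R := R) (A := A) (d := d) (t := t') (e := e') (f := f') x j
    simpa [ht, hf] using this
  | TT x x' =>
    have := Rel.TT (R := R) (A := A) (d := d) (t := t') (e := e') (f := f') x x'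
    simpa [ht] using this
  | EF i =>
    have := Rel.EF (R := R) (A := A) (d := d) (t := t') (e := e') (f := f') i
    simpa [ht, he, hf, AlgHom.map_hdiff] using this
  | EF_ne i j hij =>
    have := Rel.EF_ne (R := R) (A := A) (d := d) (t := t') (e := e') (f := f') i j hij
    simpa [he, hf] using this
  | serreE i j hij =>
    have := Rel.serreE (R := R) (A := A) (d := d) (t := t') (e := e') (f := f') i j hij
    simpa [he, serre] using this
  | serreF i j hij =>
    have := Rel.serreF (R := R) (A := A) (d := d) (t := t') (e := e') (f := f') i j hij
    simpa [hf, serre] using this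

omit [CharZero K] in
lemma Rel.map {D : Type*} [Ring D] [Algebra K⟦X⟧ D] [IsAdicComplete (hId K) D]
    [IsAdicComplete (hId K) B] (ψ : B →ₐ[K⟦X⟧] D)
    {t : 𝔥 →ₗ[K⟦X⟧] B} {e f : Fin n → B} {t' : 𝔥 →ₗ[K⟦X⟧] D} {e' f' : Fin n → D}
    (ht : ∀ x, ψ (t x) = t' x) (he : ∀ i, ψ (e i) = e' i) (hf : ∀ i, ψ (f i) = f' i)
    (h : ∀ a b, R.Rel A d t e f a b → ψ a = ψ b) {a b : D} (hab : R.Rel A d t' e' f' a b) :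
    a = b := by
  cases hab with
  | TE x j => simpa [ht, he] using h _ _ (.TE x j)
  | TF x j => simpa [ht, hf] using h _ _ (.TF x j)
  | TT x x' => simpa [ht] using h _ _ (.TT x x')
  | EF i => simpa [ht, he, hf, AlgHom.map_hdiff] using h _ _ (.EF i)
  | EF_ne i j hij => simpa [he, hf] using h _ _ (.EF_ne i j hij)
  | serreE i j hij => simpa [he, serre] using h _ _ (.serreE i j hij)
  | serreF i j hij => simpa [hf, serre] using h _ _ (.serreF i j hij)

lemma sat_U (hA : IsSymmetrizedCartan A d) (hP : IsCartanType A d P) :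
    R.Sat A d (R.T A d) (R.E A d) (R.F A d) := by
  rw [sat_iff_rel hA hP]
  intro a b hab
  exact Rel.map (presMk (R.FreeRel A d)) (fun _ => rfl) (fun _ => rfl) (fun _ => rfl)
    (fun a b h => presMk_rel _ h) hab

/-- The linear map on the generating module given by the images of the generators. -/
def genMap (t : 𝔥 →ₗ[K⟦X⟧] B) (e f : Fin n → B) :
    𝔥 × (Fin n → K⟦X⟧) × (Fin n → K⟦X⟧) →ₗ[K⟦X⟧] B :=
  t.coprod ((Fintype.linearCombination K⟦X⟧ e).coprod (Fintype.linearCombination K⟦X⟧ f))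

omit [CharZero K] [Module.Free K⟦X⟧ 𝔥] [Module.Finite K⟦X⟧ 𝔥] in
lemma freeLift_T [IsAdicComplete (hId K) B] (t : 𝔥 →ₗ[K⟦X⟧] B) (e f : Fin n → B) (x : 𝔥) :
    freeLift (genMap t e f) (FreeAlg.T n x) = t x := by
  refine (freeLift_of _ _).trans ?_
  simp [genMap]

omit [CharZero K] [Module.Free K⟦X⟧ 𝔥] [Module.Finite K⟦X⟧ 𝔥] in
lemma freeLift_E [IsAdicComplete (hId K) B] (t : 𝔥 →ₗ[K⟦X⟧] B) (e f : Fin n → B) (i : Fin n) :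
    freeLift (genMap t e f) (FreeAlg.E K 𝔥 i) = e i := by
  refine (freeLift_of _ _).trans ?_
  simp [genMap]

omit [CharZero K] [Module.Free K⟦X⟧ 𝔥] [Module.Finite K⟦X⟧ 𝔥] in
lemma freeLift_F [IsAdicComplete (hId K) B] (t : 𝔥 →ₗ[K⟦X⟧] B) (e f : Fin n → B) (i : Fin n) :
    freeLift (genMap t e f) (FreeAlg.F K 𝔥 i) = f i := by
  refine (freeLift_of _ _).trans ?_
  simp [genMap]

/-- The universal property of the FoMpQUEA. -/
def lift [IsAdicComplete (hId K) C] (hA : IsSymmetrizedCartan A d) (hP : IsCartanType A d P)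
    {t : 𝔥 →ₗ[K⟦X⟧] C} {e f : Fin n → C} (h : R.Sat A d t e f) : R.U A d →ₐ[K⟦X⟧] C :=
  presLift (R.FreeRel A d) (genMap t e f) fun _ _ hab =>
    (sat_iff_rel hA hP).1 h _ _ (Rel.of_map (freeLift (genMap t e f))
      (freeLift_T t e f) (freeLift_E t e f) (freeLift_F t e f) hab)

section

variable [IsAdicComplete (hId K) C] (hA : IsSymmetrizedCartan A d) (hP : IsCartanType A d P)
    {t : 𝔥 →ₗ[K⟦X⟧] C} {e f : Fin n → C} (h : R.Sat A d t e f)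

@[simp] lemma lift_T (x : 𝔥) : lift hA hP h (R.T A d x) = t x :=
  (presLift_mk _ _ _ _).trans (freeLift_T t e f x)

@[simp] lemma lift_E (i : Fin n) : lift hA hP h (R.E A d i) = e i :=
  (presLift_mk _ _ _ _).trans (freeLift_E t e f i)

@[simp] lemma lift_F (i : Fin n) : lift hA hP h (R.F A d i) = f i :=
  (presLift_mk _ _ _ _).trans (freeLift_F t e f i)

end

variable (A d R) in
omit [CharZero K] in
lemma isTopGen_U : IsTopGen K (Set.range (R.T A d) ∪ Set.range (R.E A d) ∪ Set.range (R.F A d)) := by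
  refine (isTopGen_pres (R.FreeRel A d)).mono ?_
  rintro _ ⟨⟨x, a, b⟩, rfl⟩
  have : ((x, a, b) : 𝔥 × (Fin n → K⟦X⟧) × (Fin n → K⟦X⟧)) = LinearMap.inl K⟦X⟧ _ _ x +
      ∑ i, a i • (0, Pi.single i 1, 0) + ∑ i, b i • (0, 0, Pi.single i 1) := by
    ext i
    · simp [Prod.fst_sum]
    · simp [Prod.snd_sum, Prod.fst_sum, Finset.sum_apply, Pi.single_apply]
    · simp [Prod.snd_sum, Finset.sum_apply, Pi.single_apply]
  rw [SetLike.mem_coe, this]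
  simp only [map_add, map_sum, map_smul]
  refine add_mem (add_mem ?_ (sum_mem fun i _ => Subalgebra.smul_mem _ ?_ _))
    (sum_mem fun i _ => Subalgebra.smul_mem _ ?_ _)
  · exact Algebra.subset_adjoin (Or.inl (Or.inl ⟨x, rfl⟩))
  · exact Algebra.subset_adjoin (Or.inl (Or.inr ⟨i, rfl⟩))
  · exact Algebra.subset_adjoin (Or.inr ⟨i, rfl⟩)

/-! ### The algebra presented by one half of the generators -/

/-- The relations of one half of the generators. -/
inductive HalfRel (A : Matrix (Fin n) (Fin n) ℤ) (d : Fin n → ℕ) (R : Realization P 𝔥)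
    (t : 𝔥 →ₗ[K⟦X⟧] B) (e : Fin n → B) : B → B → Prop
  | TE (x : 𝔥) (j : Fin n) : HalfRel A d R t e (t x * e j - e j * t x) (R.α j x • e j)
  | TT (x x' : 𝔥) : HalfRel A d R t e (t x * t x') (t x' * t x)
  | ser (i j : Fin n) (hij : i ≠ j) : HalfRel A d R t e
      (serL (hexp K (P i j)) (qPow K (d i) 2) (e i) (e j) ((-A i j).toNat + 1)) 0

omit [CharZero K] in
lemma halfSat_iff_rel {t : 𝔥 →ₗ[K⟦X⟧] B} {e : Fin n → B} :
    R.HalfSat A d t e ↔ ∀ a b, HalfRel A d R t e a b → a = b := by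
  constructor
  · intro h a b hab
    cases hab with
    | TE x j => exact h.TE x j
    | TT x x' => exact h.TT x x'
    | ser i j hij => exact h.ser i j hij
  · exact fun h => ⟨fun x j => h _ _ (.TE x j), fun x y => h _ _ (.TT x y),
      fun i j hij => h _ _ (.ser i j hij)⟩

omit [CharZero K] in
lemma HalfRel.of_map {D : Type*} [Ring D] [Algebra K⟦X⟧ D] (ψ : B →ₐ[K⟦X⟧] D)
    {t : 𝔥 →ₗ[K⟦X⟧] B} {e : Fin n → B} {t' : 𝔥 →ₗ[K⟦X⟧] D} {e' : Fin n → D}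
    (ht : ∀ x, ψ (t x) = t' x) (he : ∀ i, ψ (e i) = e' i)
    {a b : B} (h : HalfRel A d R t e a b) : HalfRel A d R t' e' (ψ a) (ψ b) := by
  cases h with
  | TE x j =>
    have := HalfRel.TE (R := R) (A := A) (d := d) (t := t') (e := e') x j
    simpa [ht, he] using this
  | TT x x' =>
    have := HalfRel.TT (R := R) (A := A) (d := d) (t := t') (e := e') x x'
    simpa [ht] using this
  | ser i j hij =>
    have := HalfRel.ser (R := R) (A := A) (d := d) (t := t') (e := e') i j hij
    simpa only [map_serL, he, map_zero] using this

variable (A d R)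

/-- The toral generators of the completed free algebra of one half. -/
def freeHalfT : 𝔥 →ₗ[K⟦X⟧] HComp K (TensorAlgebra K⟦X⟧ (𝔥 × (Fin n → K⟦X⟧))) :=
  HComp.of K _ ∘ₗ TensorAlgebra.ι K⟦X⟧ ∘ₗ LinearMap.inl _ _ _

/-- The other generators of the completed free algebra of one half. -/
def freeHalfE (i : Fin n) : HComp K (TensorAlgebra K⟦X⟧ (𝔥 × (Fin n → K⟦X⟧))) :=
  HComp.of K _ (TensorAlgebra.ι K⟦X⟧ (0, Pi.single i 1))

/-- The complete algebra presented by one half of the generators. -/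
abbrev Half : Type _ := Pres (HalfRel A d R (freeHalfT (n := n)) (freeHalfE (𝔥 := 𝔥)))

/-- The toral generators of the half algebra. -/
def halfT : 𝔥 →ₗ[K⟦X⟧] R.Half A d := (presMk _).toLinearMap ∘ₗ freeHalfT

/-- The other generators of the half algebra. -/
def halfE (i : Fin n) : R.Half A d := presMk _ (freeHalfE i)

omit [CharZero K] in
lemma sat_half : R.HalfSat A d (R.halfT A d) (R.halfE A d) where
  TE x j := by
    have := presMk_rel _ (HalfRel.TE (R := R) (A := A) (d := d) (t := freeHalfT) (e := freeHalfE) x j)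
    simp only [map_sub, map_mul, map_smul] at this
    exact this
  TT x x' := by
    have := presMk_rel _ (HalfRel.TT (R := R) (A := A) (d := d) (t := freeHalfT) (e := freeHalfE) x x')
    simp only [map_mul] at this
    exact this
  ser i j hij := by
    have := presMk_rel _
      (HalfRel.ser (R := R) (A := A) (d := d) (t := freeHalfT) (e := freeHalfE) i j hij)
    rw [map_serL, map_zero] at this
    exact this

variable {A d R}

omit [CharZero K] [Module.Free K⟦X⟧ 𝔥] [Module.Finite K⟦X⟧ 𝔥] in
lemma freeLift_halfT [IsAdicComplete (hId K) B] (t : 𝔥 →ₗ[K⟦X⟧] B) (e : Fin n → B) (x : 𝔥) :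
    freeLift (t.coprod (Fintype.linearCombination K⟦X⟧ e)) (freeHalfT x) = t x := by
  refine (freeLift_of _ _).trans ?_
  simp

omit [CharZero K] [Module.Free K⟦X⟧ 𝔥] [Module.Finite K⟦X⟧ 𝔥] in
lemma freeLift_halfE [IsAdicComplete (hId K) B] (t : 𝔥 →ₗ[K⟦X⟧] B) (e : Fin n → B) (i : Fin n) :
    freeLift (t.coprod (Fintype.linearCombination K⟦X⟧ e)) (freeHalfE i) = e i := by
  refine (freeLift_of _ _).trans ?_
  simp

/-- The universal property of the half algebra. -/
def halfLift [IsAdicComplete (hId K) C] {t : 𝔥 →ₗ[K⟦X⟧] C} {e : Fin n → C}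
    (h : R.HalfSat A d t e) : R.Half A d →ₐ[K⟦X⟧] C :=
  presLift _ (t.coprod (Fintype.linearCombination K⟦X⟧ e)) fun _ _ hab =>
    halfSat_iff_rel.1 h _ _ (HalfRel.of_map (freeLift _)
      (freeLift_halfT t e) (freeLift_halfE t e) hab)

section

variable [IsAdicComplete (hId K) C] {t : 𝔥 →ₗ[K⟦X⟧] C} {e : Fin n → C} (h : R.HalfSat A d t e)

omit [CharZero K] in
@[simp] lemma halfLift_T (x : 𝔥) : halfLift h (R.halfT A d x) = t x :=
  (presLift_mk _ _ _ _).trans (freeLift_halfT t e x)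

omit [CharZero K] in
@[simp] lemma halfLift_E (i : Fin n) : halfLift h (R.halfE A d i) = e i :=
  (presLift_mk _ _ _ _).trans (freeLift_halfE t e i)

end

variable (A d R) in
omit [CharZero K] in
lemma isTopGen_half : IsTopGen K (Set.range (R.halfT A d) ∪ Set.range (R.halfE A d)) := by
  refine (isTopGen_pres _).mono ?_
  rintro _ ⟨⟨x, a⟩, rfl⟩
  have : ((x, a) : 𝔥 × (Fin n → K⟦X⟧)) = LinearMap.inl K⟦X⟧ _ _ x +
      ∑ i, a i • (0, Pi.single i 1) := by
    ext i
    · simp [Prod.fst_sum]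
    · simp [Prod.snd_sum, Finset.sum_apply, Pi.single_apply]
  rw [SetLike.mem_coe, this]
  simp only [map_add, map_sum, map_smul]
  refine add_mem ?_ (sum_mem fun i _ => Subalgebra.smul_mem _ ?_ _)
  · exact Algebra.subset_adjoin (Or.inl ⟨x, rfl⟩)
  · exact Algebra.subset_adjoin (Or.inr ⟨i, rfl⟩)

end Realization

end Relations

end FoMp
end

noncomputable section
namespace FoMp
variable {K : Type*} [Field K]

/-! ### Hopf structures from algebra homomorphisms -/

section OfAlg

variable {B : Type*} [Ring B] [Algebra K⟦X⟧ B] [IsAdicComplete (hId K) B]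

lemma foldR_cassoc {M N P W : Type*} [AddCommGroup M] [Module K⟦X⟧ M] [AddCommGroup N]
    [Module K⟦X⟧ N] [AddCommGroup P] [Module K⟦X⟧ P] [AddCommGroup W] [Module K⟦X⟧ W]
    [IsAdicComplete (hId K) W] (τ : M →ₗ[K⟦X⟧] N →ₗ[K⟦X⟧] P →ₗ[K⟦X⟧] W)
    (x : CTensor K (CTensor K M N) P) : foldR τ (cassoc K x) = foldL τ x := by
  have : foldR τ ∘ₗ cassoc K = foldL τ := ctensor_ext_left fun m n p => by
    rw [LinearMap.comp_apply, cassoc_tmul, foldR_tmul, foldL_tmul]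
  exact LinearMap.congr_fun this x

variable (K B) in
/-- `MulOpposite.unop` as a linear map. -/
def unopₗ : Bᵐᵒᵖ →ₗ[K⟦X⟧] B where
  toFun := MulOpposite.unop
  map_add' _ _ := rfl
  map_smul' _ _ := rfl

/-- An algebra homomorphism `B → Bᵐᵒᵖ` as a linear map `B → B`. -/
def unopHom (S : B →ₐ[K⟦X⟧] Bᵐᵒᵖ) : B →ₗ[K⟦X⟧] B := unopₗ K B ∘ₗ S.toLinearMap

omit [IsAdicComplete (hId K) B] in
lemma unopHom_apply (S : B →ₐ[K⟦X⟧] Bᵐᵒᵖ) (x : B) : unopHom S x = (S x).unop := rfl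

omit [IsAdicComplete (hId K) B] in
lemma unopHom_mul (S : B →ₐ[K⟦X⟧] Bᵐᵒᵖ) (x y : B) :
    unopHom S (x * y) = unopHom S y * unopHom S x := by
  rw [unopHom_apply, map_mul, MulOpposite.unop_mul]
  rfl

omit [IsAdicComplete (hId K) B] in
lemma unopHom_one (S : B →ₐ[K⟦X⟧] Bᵐᵒᵖ) : unopHom S 1 = 1 := by
  rw [unopHom_apply, map_one, MulOpposite.unop_one]

lemma fold_mul_comp_mul (S : B →ₐ[K⟦X⟧] Bᵐᵒᵖ) (w z : CTensor K B B) (c : K⟦X⟧)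
    (h : fold ((LinearMap.mul K⟦X⟧ B).comp (unopHom S)) w = c • 1) :
    fold ((LinearMap.mul K⟦X⟧ B).comp (unopHom S)) (w * z) =
      c • fold ((LinearMap.mul K⟦X⟧ B).comp (unopHom S)) z := by
  set f := fold ((LinearMap.mul K⟦X⟧ B).comp (unopHom S)) with hf
  have key : ∀ a b, f (w * tmul K a b) = unopHom S a * f w * b := by
    intro a b
    have : f ∘ₗ LinearMap.mulRight K⟦X⟧ (tmul K a b) =
        LinearMap.mulLeft K⟦X⟧ (unopHom S a) ∘ₗ LinearMap.mulRight K⟦X⟧ b ∘ₗ f :=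
      ctensor_ext fun m n => by
        simp only [LinearMap.comp_apply, LinearMap.mulRight_apply, LinearMap.mulLeft_apply,
          tmul_mul_tmul, hf, fold_tmul, LinearMap.mul_apply', unopHom_mul, mul_assoc]
    have h2 := LinearMap.congr_fun this w
    simpa only [LinearMap.comp_apply, LinearMap.mulRight_apply, LinearMap.mulLeft_apply,
      mul_assoc] using h2
  have : f ∘ₗ LinearMap.mulLeft K⟦X⟧ w = c • f := ctensor_ext fun m n => by
    rw [LinearMap.comp_apply, LinearMap.mulLeft_apply, key, h, LinearMap.smul_apply, hf, fold_tmul]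
    simp
  exact LinearMap.congr_fun this z

lemma fold_mul_compl_mul (S : B →ₐ[K⟦X⟧] Bᵐᵒᵖ) (w z : CTensor K B B) (c : K⟦X⟧)
    (h : fold ((LinearMap.mul K⟦X⟧ B).compl₂ (unopHom S)) z = c • 1) :
    fold ((LinearMap.mul K⟦X⟧ B).compl₂ (unopHom S)) (w * z) =
      c • fold ((LinearMap.mul K⟦X⟧ B).compl₂ (unopHom S)) w := by
  set f := fold ((LinearMap.mul K⟦X⟧ B).compl₂ (unopHom S)) with hf
  have key : ∀ a b, f (tmul K a b * z) = a * f z * unopHom S b := by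
    intro a b
    have : f ∘ₗ LinearMap.mulLeft K⟦X⟧ (tmul K a b) =
        LinearMap.mulLeft K⟦X⟧ a ∘ₗ LinearMap.mulRight K⟦X⟧ (unopHom S b) ∘ₗ f :=
      ctensor_ext fun m n => by
        simp only [LinearMap.comp_apply, LinearMap.mulRight_apply, LinearMap.mulLeft_apply,
          tmul_mul_tmul, hf, fold_tmul, LinearMap.mul_apply', LinearMap.compl₂_apply, unopHom_mul,
          mul_assoc]
    have h2 := LinearMap.congr_fun this z
    simpa only [LinearMap.comp_apply, LinearMap.mulRight_apply, LinearMap.mulLeft_apply,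
      mul_assoc] using h2
  have : f ∘ₗ LinearMap.mulRight K⟦X⟧ z = c • f := ctensor_ext fun m n => by
    rw [LinearMap.comp_apply, LinearMap.mulRight_apply, key, h, LinearMap.smul_apply, hf, fold_tmul]
    simp
  exact LinearMap.congr_fun this w

omit [IsAdicComplete (hId K) B] in
lemma coassoc_of_isTopGen {s : Set B} (hs : IsTopGen K s) (δ : B →ₗ[K⟦X⟧] CTensor K B B)
    (one : δ 1 = tmul K 1 1) (mul : ∀ a b, δ (a * b) = δ a * δ b)
    (h : ∀ a ∈ s, cassoc K (cmap K δ .id (δ a)) = cmap K .id δ (δ a)) (a : B) :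
    cassoc K (cmap K δ .id (δ a)) = cmap K .id δ (δ a) := by
  obtain ⟨θ, hθ⟩ := exists_triple_section (K := K) (A := B) (B := B) (C := B)
  have : foldL (tmul₃ K B B B) ∘ₗ cmap K δ .id ∘ₗ δ =
      foldR (tmul₃ K B B B) ∘ₗ cmap K .id δ ∘ₗ δ := by
    refine hs.mul_ext ?_ (fun a b => ?_) (fun a b => ?_) fun a ha => ?_
    · rw [LinearMap.comp_apply, LinearMap.comp_apply, LinearMap.comp_apply, LinearMap.comp_apply,
        one, cmap_apply_tmul, cmap_apply_tmul, one, LinearMap.id_apply, foldL_tmul, foldR_tmul]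
    · rw [LinearMap.comp_apply, LinearMap.comp_apply, LinearMap.comp_apply, LinearMap.comp_apply,
        LinearMap.comp_apply, LinearMap.comp_apply, mul]
      exact foldL_cmap_mul _ _ mul tmul₃_mul _ _
    · rw [LinearMap.comp_apply, LinearMap.comp_apply, LinearMap.comp_apply, LinearMap.comp_apply,
        LinearMap.comp_apply, LinearMap.comp_apply, mul]
      exact foldR_cmap_mul _ _ mul tmul₃_mul _ _
    · rw [LinearMap.comp_apply, LinearMap.comp_apply, LinearMap.comp_apply, LinearMap.comp_apply,
        ← h a ha, foldR_cassoc]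
  exact cassoc_eq_of_fold _ θ hθ (LinearMap.congr_fun this a)

variable {s : Set B} (hs : IsTopGen K s) (Δ : B →ₐ[K⟦X⟧] CTensor K B B) (ε : B →ₐ[K⟦X⟧] K⟦X⟧)
  (S : B →ₐ[K⟦X⟧] Bᵐᵒᵖ)

/-- Algebra homomorphisms satisfying the Hopf algebra axioms on topological generators define a
topological Hopf algebra. -/
def HopfStr.ofAlg
    (coassoc : ∀ a ∈ s, cassoc K (cmap K Δ.toLinearMap .id (Δ a)) = cmap K .id Δ.toLinearMap (Δ a))
    (counit_comul : ∀ a ∈ s, fold ((LinearMap.lsmul K⟦X⟧ B).comp ε.toLinearMap) (Δ a) = a)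
    (comul_counit : ∀ a ∈ s, fold ((LinearMap.lsmul K⟦X⟧ B).comp ε.toLinearMap).flip (Δ a) = a)
    (antipode_left : ∀ a ∈ s,
      fold ((LinearMap.mul K⟦X⟧ B).comp (unopHom S)) (Δ a) = ε a • 1)
    (antipode_right : ∀ a ∈ s,
      fold ((LinearMap.mul K⟦X⟧ B).compl₂ (unopHom S)) (Δ a) = ε a • 1) : HopfStr K B where
  mul := LinearMap.mul K⟦X⟧ B
  one := 1
  comul := Δ.toLinearMap
  counit := ε.toLinearMap
  antipode := unopHom S
  mul_assoc := _root_.mul_assoc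
  one_mul := _root_.one_mul
  mul_one := _root_.mul_one
  coassoc := coassoc_of_isTopGen hs _ (map_one Δ) (map_mul Δ) coassoc
  counit_comul := by
    have : fold ((LinearMap.lsmul K⟦X⟧ B).comp ε.toLinearMap) ∘ₗ Δ.toLinearMap = .id := by
      refine hs.mul_ext ?_ (fun a b => ?_) (fun a b => rfl) counit_comul
      · simp [ctensor_one]
      · rw [LinearMap.comp_apply, AlgHom.toLinearMap_apply, map_mul]
        refine ctensor_map_mul _ (fun a b a' b' => ?_) _ _
        simp [tmul_mul_tmul, smul_smul, mul_comm (ε a)]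
    exact LinearMap.congr_fun this
  comul_counit := by
    have : fold ((LinearMap.lsmul K⟦X⟧ B).comp ε.toLinearMap).flip ∘ₗ Δ.toLinearMap = .id := by
      refine hs.mul_ext ?_ (fun a b => ?_) (fun a b => rfl) comul_counit
      · simp [ctensor_one]
      · rw [LinearMap.comp_apply, AlgHom.toLinearMap_apply, map_mul]
        refine ctensor_map_mul _ (fun a b a' b' => ?_) _ _
        simp [tmul_mul_tmul, smul_smul, mul_comm (ε b)]
    exact LinearMap.congr_fun this
  comul_one := map_one Δ
  comul_mul a b := (map_mul Δ a b).trans (cross_mul _ _).symm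
  counit_one := map_one ε
  counit_mul := map_mul ε
  antipode_left := by
    have : fold ((LinearMap.mul K⟦X⟧ B).comp (unopHom S)) ∘ₗ Δ.toLinearMap =
        ε.toLinearMap.smulRight 1 := by
      refine hs.linearMap_ext ?_ fun a ha x hx => ?_
      · simp [ctensor_one, unopHom_one]
      · rw [LinearMap.comp_apply, AlgHom.toLinearMap_apply] at hx ⊢
        rw [map_mul, fold_mul_comp_mul S _ _ _ (antipode_left a ha), hx, LinearMap.smulRight_apply,
          LinearMap.smulRight_apply, AlgHom.toLinearMap_apply, AlgHom.toLinearMap_apply, map_mul,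
          smul_smul]
    exact LinearMap.congr_fun this
  antipode_right := by
    have : fold ((LinearMap.mul K⟦X⟧ B).compl₂ (unopHom S)) ∘ₗ Δ.toLinearMap =
        ε.toLinearMap.smulRight 1 := by
      refine hs.linearMap_ext ?_ fun a ha x hx => ?_
      · simp [ctensor_one, unopHom_one]
      · rw [LinearMap.comp_apply, AlgHom.toLinearMap_apply] at hx ⊢
        rw [map_mul, fold_mul_compl_mul S _ _ _ hx, antipode_right a ha, LinearMap.smulRight_apply,
          smul_smul, mul_comm]
        exact congrArg (· • (1 : B)) (map_mul ε a x).symm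
    exact LinearMap.congr_fun this

end OfAlg

/-! ### Constructions with the defining relations -/

section Relations

variable {n : ℕ} {P : Matrix (Fin n) (Fin n) K⟦X⟧} {𝔥 : Type*} [AddCommGroup 𝔥]
  [Module K⟦X⟧ 𝔥] [Module.Free K⟦X⟧ 𝔥] [Module.Finite K⟦X⟧ 𝔥]
  {A : Matrix (Fin n) (Fin n) ℤ} {d : Fin n → ℕ} {R : Realization P 𝔥}
  {B C : Type*} [Ring B] [Algebra K⟦X⟧ B] [Ring C] [Algebra K⟦X⟧ C]
  [IsAdicComplete (hId K) B] [IsAdicComplete (hId K) C]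

lemma serL_zero_right {R' B : Type*} [CommRing R'] [Ring B] [Algebra R' B] (w p : R') (x : B)
    (s : ℕ) : serL w p x 0 s = 0 := by
  induction s with
  | zero => rfl
  | succ s ih => rw [serL_succ, ih]; simp

lemma unop_hexp (x : Bᵐᵒᵖ) : (hexp K x).unop = hexp K x.unop := by
  rw [hexp, hexp]
  refine (map_hsum (unopₗ K B) _).trans ?_
  rfl

lemma unop_hdiff (x y : Bᵐᵒᵖ) : (hdiff K x y).unop = hdiff K x.unop y.unop := by
  rw [hdiff, hdiff]
  refine (map_hsum (unopₗ K B) _).trans ?_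
  rfl

namespace Realization

omit [IsAdicComplete (hId K) B] in
lemma HalfSat.zero : R.HalfSat A d (0 : 𝔥 →ₗ[K⟦X⟧] B) 0 where
  TE x j := by simp
  TT x y := Commute.refl _
  ser i j _ := serL_zero_right _ _ _ _

lemma Sat.zero : R.Sat A d (0 : 𝔥 →ₗ[K⟦X⟧] B) 0 0 where
  pos := HalfSat.zero
  neg := by rw [neg_zero]; exact HalfSat.zero
  EF i := by
    have := hdiff_self_neg (K := K) (0 : B)
    rw [neg_zero] at this
    simp [this]
  EF_ne i j _ := Commute.refl _

variable [CharZero K]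

lemma HalfSat.hexp_mul' {t : 𝔥 →ₗ[K⟦X⟧] B} {e : Fin n → B}
    (h : R.HalfSat A d t e) (x : 𝔥) (j : Fin n) :
    hexp K (-t x) * e j = hexp K (-R.α j x) • (e j * hexp K (-t x)) := by
  have := h.hexp_mul (-x) j
  rwa [map_neg, map_neg] at this

lemma Sat.hexp_mul_f {t : 𝔥 →ₗ[K⟦X⟧] B} {e f : Fin n → B} (h : R.Sat A d t e f) (x : 𝔥)
    (j : Fin n) : hexp K (t x) * f j = hexp K (-R.α j x) • (f j * hexp K (t x)) := by
  have := h.neg.hexp_mul' x j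
  rwa [LinearMap.neg_apply, neg_neg] at this

/-- The relations of one half are stable under the coproduct formula. -/
lemma HalfSat.cop (hA : IsSymmetrizedCartan A d) (hP : IsCartanType A d P)
    {t : 𝔥 →ₗ[K⟦X⟧] B} {e : Fin n → B} (h : R.HalfSat A d t e) (g₁ g₂ : B →ₐ[K⟦X⟧] C)
    (hg : ∀ x y, Commute (g₁ x) (g₂ y)) :
    R.HalfSat A d (g₁.toLinearMap ∘ₗ t + g₂.toLinearMap ∘ₗ t)
      (fun i => g₁ (e i) + g₁ (hexp K (t (R.Tp i))) * g₂ (e i)) where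
  TE x j := by
    have h1 := congrArg g₁ (h.TE x j)
    have h2 := congrArg g₂ (h.TE x j)
    have h3 : Commute (g₁ (t x)) (g₁ (hexp K (t (R.Tp j)))) := by
      rw [AlgHom.map_hexp]
      exact semiconjBy_hexp ((h.TT _ _).map g₁)
    simp only [map_sub, map_mul, map_smul] at h1 h2
    simp only [LinearMap.add_apply, LinearMap.comp_apply, AlgHom.toLinearMap_apply, add_mul,
      mul_add, smul_add]
    rw [← h1, ← mul_smul_comm, ← h2, ← mul_assoc (g₁ (t x)), h3.eq, ← (hg (e j) (t x)).eq,
      ← mul_assoc (g₂ (t x)), ← (hg (hexp K (t (R.Tp j))) (t x)).eq, mul_assoc (g₁ _) (g₂ (e j)),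
      ← (hg (t x) (e j)).eq, mul_sub]
    simp only [mul_assoc]
    abel
  TT x y := by
    simp only [LinearMap.add_apply, LinearMap.comp_apply, AlgHom.toLinearMap_apply]
    exact (((h.TT x y).map g₁).add_right (hg _ _)).add_left
      ((hg _ _).symm.add_right ((h.TT x y).map g₂))
  ser i j hij := by
    have k1 : ∀ i j, g₁ (hexp K (t (R.Tp i))) * g₁ (e j) =
        hexp K (P i j) • (g₁ (e j) * g₁ (hexp K (t (R.Tp i)))) := fun i j => by
      rw [← map_mul, h.hexp_mul, map_smul, map_mul, R.α_Tp]
    refine serL_add_eq_zero (isUnit_hexp _) (hP.hexp_mul hA hij) ?_ ?_ ?_ ?_ ?_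
    · rw [mul_assoc, ← (hg (e i) (e i)).eq, ← mul_assoc, k1, hP.diag hA, smul_mul_assoc, mul_assoc]
    · rw [mul_assoc, ← (hg (e j) (e i)).eq, ← mul_assoc, k1, smul_mul_assoc, mul_assoc]
    · rw [mul_assoc, ← (hg (e i) (e j)).eq, ← mul_assoc, k1, smul_mul_assoc, mul_assoc]
    · rw [← map_serL, h.ser i j hij, map_zero]
    · have hK : Commute (g₁ (hexp K (t (R.Tp i)))) (g₁ (hexp K (t (R.Tp j)))) :=
        (commute_hexp (h.TT _ _)).map g₁
      have key : ∀ s, serL (hexp K (P i j)) (qPow K (d i) 2)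
          (g₁ (hexp K (t (R.Tp i))) * g₂ (e i)) (g₁ (hexp K (t (R.Tp j))) * g₂ (e j)) s =
          g₁ (hexp K (t (R.Tp i))) ^ s * g₁ (hexp K (t (R.Tp j))) *
            g₂ (serL (hexp K (P i j)) (qPow K (d i) 2) (e i) (e j) s) := by
        intro s
        induction s with
        | zero => simp [serIt]
        | succ s ih =>
          rw [serL_succ, serL_succ, ih]
          set k := g₁ (hexp K (t (R.Tp i)))
          set l := g₁ (hexp K (t (R.Tp j)))
          set y := serL (hexp K (P i j)) (qPow K (d i) 2) (e i) (e j) s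
          have c1 : ∀ b, Commute (k ^ s * l) (g₂ b) := fun b =>
            ((hg _ b).pow_left s).mul_left (hg _ b)
          rw [map_sub, map_smul, map_mul, map_mul, mul_sub, mul_smul_comm]
          congr 1
          · rw [mul_assoc k, ← mul_assoc (g₂ (e i)), ← (c1 (e i)).eq, ← mul_assoc k,
              ← mul_assoc k, ← mul_assoc k, ← pow_succ', mul_assoc]
          · rw [mul_assoc (k ^ s * l), ← mul_assoc (g₂ y), ← (hg _ y).eq, mul_assoc k,
              ← mul_assoc _ k, mul_assoc (k ^ s) l k, ← hK.eq, ← mul_assoc (k ^ s), ← pow_succ]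
      rw [key, h.ser i j hij, map_zero, mul_zero]

omit [IsAdicComplete (hId K) C] in
lemma Sat.cop_EF {t : 𝔥 →ₗ[K⟦X⟧] B} {e f : Fin n → B} (h : R.Sat A d t e f) (g₁ g₂ : B →ₐ[K⟦X⟧] C)
    (hg : ∀ x y, Commute (g₁ x) (g₂ y)) (i j : Fin n) :
    (g₁ (e i) + g₁ (hexp K (t (R.Tp i))) * g₂ (e i)) *
      (g₂ (f j) + g₂ (hexp K (-t (R.Tm j))) * g₁ (f j)) -
      (g₂ (f j) + g₂ (hexp K (-t (R.Tm j))) * g₁ (f j)) *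
      (g₁ (e i) + g₁ (hexp K (t (R.Tp i))) * g₂ (e i)) =
    g₁ (e i * f j - f j * e i) * g₂ (hexp K (-t (R.Tm j))) +
      g₁ (hexp K (t (R.Tp i))) * g₂ (e i * f j - f j * e i) := by
  set k := hexp K (t (R.Tp i))
  set l := hexp K (-t (R.Tm j))
  have h1 : g₁ k * g₁ (f j) = hexp K (-P i j) • (g₁ (f j) * g₁ k) := by
    rw [← map_mul, h.hexp_mul_f, map_smul, map_mul, R.α_Tp]
  have h2 : g₂ l * g₂ (e i) = hexp K (-P i j) • (g₂ (e i) * g₂ l) := by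
    rw [← map_mul, h.pos.hexp_mul', map_smul, map_mul, R.α_Tm]
  have h3 : g₁ k * g₂ (e i) * (g₂ l * g₁ (f j)) = g₂ l * g₁ (f j) * (g₁ k * g₂ (e i)) := by
    have e1 : g₁ k * g₂ (e i) * (g₂ l * g₁ (f j)) = (g₁ k * g₁ (f j)) * (g₂ (e i) * g₂ l) := by
      rw [mul_assoc, ← mul_assoc (g₂ (e i)), ← map_mul g₂, ← (hg (f j) _).eq, ← mul_assoc]
    have e2 : g₂ l * g₁ (f j) * (g₁ k * g₂ (e i)) = (g₁ (f j) * g₁ k) * (g₂ l * g₂ (e i)) := by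
      rw [mul_assoc, ← mul_assoc (g₁ (f j)), ← map_mul g₁, ← mul_assoc, ← (hg _ l).eq, ← mul_assoc]
    rw [e1, e2, h1, h2, smul_mul_assoc, mul_smul_comm]
  have h4 : g₁ (e i) * (g₂ l * g₁ (f j)) = g₁ (e i * f j) * g₂ l := by
    rw [← (hg (f j) l).eq, map_mul, mul_assoc]
  have h5 : g₂ l * g₁ (f j) * g₁ (e i) = g₁ (f j * e i) * g₂ l := by
    rw [mul_assoc, ← map_mul, (hg _ l).eq]
  have h6 : g₂ (f j) * (g₁ k * g₂ (e i)) = g₁ k * g₂ (f j * e i) := by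
    rw [← mul_assoc, ← (hg k (f j)).eq, map_mul, mul_assoc]
  rw [add_mul, mul_add, mul_add, add_mul, mul_add, mul_add, h3, h4, h5, h6, (hg (e i) (f j)).eq,
    mul_assoc (g₁ k), ← map_mul g₂, map_sub, map_sub, sub_mul, mul_sub]
  abel

/-- The relations are stable under the coproduct formula. -/
lemma Sat.cop (hA : IsSymmetrizedCartan A d) (hP : IsCartanType A d P)
    {t : 𝔥 →ₗ[K⟦X⟧] B} {e f : Fin n → B} (h : R.Sat A d t e f) (g₁ g₂ : B →ₐ[K⟦X⟧] C)
    (hg : ∀ x y, Commute (g₁ x) (g₂ y)) :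
    R.Sat A d (g₁.toLinearMap ∘ₗ t + g₂.toLinearMap ∘ₗ t)
      (fun i => g₁ (e i) + g₁ (hexp K (t (R.Tp i))) * g₂ (e i))
      (fun i => g₂ (f i) + g₂ (hexp K (-t (R.Tm i))) * g₁ (f i)) where
  pos := h.pos.cop hA hP g₁ g₂ hg
  neg := by
    have := h.neg.cop hA hP.transpose g₂ g₁ fun x y => (hg y x).symm
    rwa [LinearMap.comp_neg, LinearMap.comp_neg, ← neg_add, add_comm] at this
  EF i := by
    rw [h.cop_EF g₁ g₂ hg, h.EF, LinearMap.add_apply, LinearMap.add_apply, LinearMap.comp_apply,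
      LinearMap.comp_apply, LinearMap.comp_apply, LinearMap.comp_apply, AlgHom.toLinearMap_apply,
      AlgHom.toLinearMap_apply, AlgHom.toLinearMap_apply, AlgHom.toLinearMap_apply,
      hdiff_add (hg _ _) (hg _ _) (hg _ _), map_smul, map_smul, smul_mul_assoc, mul_smul_comm, ← smul_add, AlgHom.map_hdiff,
      AlgHom.map_hdiff, AlgHom.map_hexp, AlgHom.map_hexp, map_neg]
  EF_ne i j hij := by
    have := h.cop_EF g₁ g₂ hg i j
    rwa [sub_eq_zero.2 (h.EF_ne i j hij).eq, map_zero, map_zero, zero_mul, mul_zero, add_zero,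
      sub_eq_zero] at this

/-- The relations of one half hold for the antipode formula in the opposite algebra. -/
lemma HalfSat.anti (hA : IsSymmetrizedCartan A d) (hP : IsCartanType A d P)
    {t : 𝔥 →ₗ[K⟦X⟧] B} {e : Fin n → B} (h : R.HalfSat A d t e) (t' : 𝔥 →ₗ[K⟦X⟧] Bᵐᵒᵖ)
    (ht : ∀ x, t' x = MulOpposite.op (-t x)) :
    R.HalfSat A d t' (fun i => MulOpposite.op (hexp K (-t (R.Tp i)) * e i)) where
  TE x j := by
    have h1 := h.TE x j
    have h2 : Commute (t x) (hexp K (-t (R.Tp j))) := semiconjBy_hexp (h.TT _ _).neg_right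
    rw [ht, ← MulOpposite.op_mul, ← MulOpposite.op_mul, ← MulOpposite.op_sub,
      ← MulOpposite.op_smul, ← mul_smul_comm, ← h1, mul_sub, mul_neg, neg_mul, ← mul_assoc (t x),
      h2.eq]
    simp only [mul_assoc, neg_sub_neg]
  TT x y := by
    rw [ht, ht]
    exact ((h.TT x y).neg_left.neg_right).op
  ser i j hij := by
    apply MulOpposite.unop_injective
    rw [unop_serL]
    have k1 : ∀ i j, e j * hexp K (-t (R.Tp i)) = hexp K (P i j) • (hexp K (-t (R.Tp i)) * e j) :=
      fun i j => by
        have := h.mul_hexp (-R.Tp i) j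
        rwa [map_neg, map_neg, neg_neg, R.α_Tp] at this
    obtain ⟨c, hc⟩ := serR_twist (p := qPow K (d i) 2) (w := hexp K (P i j)) (w' := hexp K (P j i))
      (k := hexp K (-t (R.Tp i))) (l := hexp K (-t (R.Tp j))) (x := e i) (y := e j)
      (by rw [k1, hP.diag hA]) (k1 j i) (k1 i j)
      (commute_hexp (h.TT _ _).neg_left.neg_right) ((-A i j).toNat + 1)
    rw [MulOpposite.unop_op, MulOpposite.unop_op, hc,
      serR_eq_zero (hP.hexp_mul hA hij) (h.ser i j hij)]
    simp

/-- The relations hold for the antipode formula in the opposite algebra. -/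
lemma Sat.anti (hA : IsSymmetrizedCartan A d) (hP : IsCartanType A d P)
    {t : 𝔥 →ₗ[K⟦X⟧] B} {e f : Fin n → B} (h : R.Sat A d t e f) (t' : 𝔥 →ₗ[K⟦X⟧] Bᵐᵒᵖ)
    (ht : ∀ x, t' x = MulOpposite.op (-t x)) :
    R.Sat A d t' (fun i => MulOpposite.op (-(hexp K (-t (R.Tp i)) * e i)))
      (fun i => MulOpposite.op (-(f i * hexp K (t (R.Tm i))))) := by
  have key : ∀ i j, f j * hexp K (t (R.Tm j)) * (hexp K (-t (R.Tp i)) * e i) -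
      hexp K (-t (R.Tp i)) * e i * (f j * hexp K (t (R.Tm j))) =
      -(hexp K (-t (R.Tp i)) * (e i * f j - f j * e i) * hexp K (t (R.Tm j))) := by
    intro i j
    set k := hexp K (-t (R.Tp i)) with hk
    set l := hexp K (t (R.Tm j)) with hl
    have h1 : f j * k = hexp K (-P i j) • (k * f j) := by
      have := h.neg.mul_hexp (R.Tp i) j
      rwa [LinearMap.neg_apply, show R.op.α j (R.Tp i) = P i j from R.α_Tp i j] at this
    have h2 : l * e i = hexp K (P i j) • (e i * l) := by
      rw [hl, h.pos.hexp_mul, R.α_Tm]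
    have h3 : Commute k l := commute_hexp (h.pos.TT _ _).neg_left
    have h4 : f j * l * (k * e i) = k * (f j * e i) * l := by
      rw [h3.symm.mul_mul_mul_comm, h1, h2, smul_mul_assoc, mul_smul_comm, smul_smul, hexp_neg_mul,
        one_smul]
      simp only [mul_assoc]
    rw [h4, mul_sub, sub_mul]
    simp only [mul_assoc, neg_sub]
  refine ⟨?_, ?_, fun i => ?_, fun i j hij => ?_⟩
  · have := (h.pos.anti hA hP t' ht).smul (fun _ => -1)
    simpa using this
  · have := (h.neg.anti hA hP.transpose (-t') fun x => by simp [ht]).smul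
      (fun i => -hexp K (P i i))
    convert this using 2 with i
    rw [← MulOpposite.op_smul, neg_smul]
    congr 2
    rw [LinearMap.neg_apply, neg_neg]
    have := h.hexp_mul_f (R.Tm i) i
    change _ = hexp K (P i i) • (hexp K (t (R.Tm i)) * f i)
    rw [this, R.α_Tm, smul_smul, hexp_mul_neg, one_smul]
  · apply MulOpposite.unop_injective
    have e1 := key i i
    have e2 : hdiff K (-t (R.Tp i)) (-t (R.Tm i)) = -(hexp K (-t (R.Tp i)) *
        hdiff K (t (R.Tp i)) (t (R.Tm i)) * hexp K (t (R.Tm i))) := by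
      have e3 := hdiff_add (K := K) (Commute.refl (t (R.Tp i))).neg_right
        (Commute.refl (t (R.Tm i))).neg_right ((h.pos.TT (R.Tp i) (R.Tm i)).neg_right)
      have e4 := hdiff_self_neg (K := K) (0 : B)
      rw [neg_zero] at e4
      rw [add_neg_cancel, add_neg_cancel, e4, neg_neg] at e3
      rw [mul_assoc, eq_neg_of_add_eq_zero_left e3.symm, mul_neg, neg_neg, ← mul_assoc,
        hexp_neg_mul, one_mul]
    rw [MulOpposite.unop_sub, MulOpposite.unop_mul, MulOpposite.unop_mul, MulOpposite.unop_smul,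
      unop_hdiff, ht, ht]
    simp only [MulOpposite.unop_op, neg_mul_neg]
    rw [e1, h.EF, e2]
    simp
  · apply MulOpposite.unop_injective
    have e1 := key i j
    rw [sub_eq_zero.2 (h.EF_ne i j hij).eq, mul_zero, zero_mul, neg_zero, sub_eq_zero] at e1
    simpa using e1

end Realization

end Relations

instance (priority := high) instCompleteCTensor {A B : Type*} [Ring A] [Algebra K⟦X⟧ A]
    [Ring B] [Algebra K⟦X⟧ B] :
    @IsAdicComplete K⟦X⟧ _ (hId K) (CTensor K A B) Ring.toAddCommGroup Algebra.toModule :=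
  instCompleteCompl

section Relations

variable {n : ℕ} {P : Matrix (Fin n) (Fin n) K⟦X⟧} {𝔥 : Type*} [AddCommGroup 𝔥]
  [Module K⟦X⟧ 𝔥] [Module.Free K⟦X⟧ 𝔥] [Module.Finite K⟦X⟧ 𝔥]
  {A : Matrix (Fin n) (Fin n) ℤ} {d : Fin n → ℕ} {R : Realization P 𝔥}
  {B C : Type*} [Ring B] [Algebra K⟦X⟧ B] [Ring C] [Algebra K⟦X⟧ C]
  [IsAdicComplete (hId K) B] [IsAdicComplete (hId K) C]

namespace Realization
variable [CharZero K]
/-! ### The standard Hopf structure -/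

omit [Module.Free K⟦X⟧ 𝔥] [Module.Finite K⟦X⟧ 𝔥] [IsAdicComplete (hId K) B]
  [IsAdicComplete (hId K) C] [CharZero K] in
lemma commute_inl_inr (x : B) (y : C) : Commute (inlAlg K B C x) (inrAlg K B C y) := by
  rw [inlAlg_apply, inrAlg_apply, Commute, SemiconjBy, tmul_mul_tmul, tmul_mul_tmul]
  simp only [mul_one, one_mul]

omit [Module.Free K⟦X⟧ 𝔥] [Module.Finite K⟦X⟧ 𝔥] [IsAdicComplete (hId K) B] [CharZero K] in
lemma inl_add_mul (x y z : B) : inlAlg K B B x + inlAlg K B B y * inrAlg K B B z =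
    tmul K x 1 + tmul K y z := by
  rw [inlAlg_apply, inlAlg_apply, inrAlg_apply, tmul_mul_tmul, mul_one, one_mul]

omit [Module.Free K⟦X⟧ 𝔥] [Module.Finite K⟦X⟧ 𝔥] [IsAdicComplete (hId K) B] [CharZero K] in
lemma inr_add_mul (x y z : B) : inrAlg K B B x + inrAlg K B B y * inlAlg K B B z =
    tmul K z y + tmul K 1 x := by
  rw [inlAlg_apply, inrAlg_apply, inrAlg_apply, tmul_mul_tmul, mul_one, one_mul, add_comm]

omit [Module.Free K⟦X⟧ 𝔥] [Module.Finite K⟦X⟧ 𝔥] [IsAdicComplete (hId K) B] [CharZero K] in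
lemma inl_add_inr (t : 𝔥 →ₗ[K⟦X⟧] B) (x : 𝔥) :
    ((inlAlg K B B).toLinearMap ∘ₗ t + (inrAlg K B B).toLinearMap ∘ₗ t) x =
      tmul K (t x) 1 + tmul K 1 (t x) := rfl

omit [CharZero K] in
lemma unopHom_hexp (S : B →ₐ[K⟦X⟧] Bᵐᵒᵖ) (x : B) :
    unopHom S (hexp K x) = hexp K (unopHom S x) := by
  rw [unopHom_apply, AlgHom.map_hexp, unop_hexp]
  rfl

/-- Algebra homomorphisms given by the standard formulas on the generators define a Hopf
structure. -/
def hopfOf (t : 𝔥 →ₗ[K⟦X⟧] B) (e f : Fin n → B)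
    (hs : IsTopGen K (Set.range t ∪ Set.range e ∪ Set.range f))
    (Δ : B →ₐ[K⟦X⟧] CTensor K B B) (ε : B →ₐ[K⟦X⟧] K⟦X⟧) (S : B →ₐ[K⟦X⟧] Bᵐᵒᵖ)
    (ΔT : ∀ x, Δ (t x) = tmul K (t x) 1 + tmul K 1 (t x))
    (ΔE : ∀ i, Δ (e i) = tmul K (e i) 1 + tmul K (hexp K (t (R.Tp i))) (e i))
    (ΔF : ∀ i, Δ (f i) = tmul K (f i) (hexp K (-t (R.Tm i))) + tmul K 1 (f i))
    (εT : ∀ x, ε (t x) = 0) (εE : ∀ i, ε (e i) = 0) (εF : ∀ i, ε (f i) = 0)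
    (ST : ∀ x, unopHom S (t x) = -t x)
    (SE : ∀ i, unopHom S (e i) = -(hexp K (-t (R.Tp i)) * e i))
    (SF : ∀ i, unopHom S (f i) = -(f i * hexp K (t (R.Tm i)))) : HopfStr K B :=
  have Δexp : ∀ x, Δ (hexp K (t x)) = tmul K (hexp K (t x)) (hexp K (t x)) := fun x => by
    rw [AlgHom.map_hexp, ΔT, ← inlAlg_apply, ← inrAlg_apply]
    refine (hexp_add (commute_inl_inr _ _)).trans ?_
    rw [← AlgHom.map_hexp, ← AlgHom.map_hexp, inlAlg_apply, inrAlg_apply, tmul_mul_tmul, mul_one,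
      one_mul]
  have εexp : ∀ x, ε (hexp K (t x)) = 1 := fun x => by rw [AlgHom.map_hexp, εT, hexp_zero]
  have tneg : ∀ i, -t (R.Tm i) = t (-R.Tm i) := fun i => (map_neg _ _).symm
  HopfStr.ofAlg hs Δ ε S
    (by
      rintro _ ((⟨x, rfl⟩ | ⟨i, rfl⟩) | ⟨i, rfl⟩)
      · simp only [ΔT, map_add, cmap_apply_tmul, AlgHom.toLinearMap_apply, map_one,
          LinearMap.id_apply, ctensor_one, LinearMap.add_apply, cassoc_tmul]
        abel
      · simp only [ΔE, Δexp, map_add, cmap_apply_tmul, AlgHom.toLinearMap_apply,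
          map_one, LinearMap.id_apply, ctensor_one, LinearMap.add_apply, cassoc_tmul]
        abel
      · simp only [ΔF, tneg, Δexp, map_add, cmap_apply_tmul,
          AlgHom.toLinearMap_apply, map_one, LinearMap.id_apply, ctensor_one, LinearMap.add_apply,
          cassoc_tmul]
        abel)
    (by
      rintro _ ((⟨x, rfl⟩ | ⟨i, rfl⟩) | ⟨i, rfl⟩)
      · simp [ΔT, εT]
      · simp [ΔE, εE, εexp]
      · rw [ΔF]
        simp [εF])
    (by
      rintro _ ((⟨x, rfl⟩ | ⟨i, rfl⟩) | ⟨i, rfl⟩)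
      · simp [ΔT, εT]
      · simp [ΔE, εE]
      · rw [ΔF]
        simp [εF, tneg, εexp, -map_neg])
    (by
      rintro _ ((⟨x, rfl⟩ | ⟨i, rfl⟩) | ⟨i, rfl⟩)
      · simp [ΔT, εT, ST, unopHom_one]
      · simp [ΔE, εE, SE, unopHom_hexp, ST]
      · rw [ΔF]
        simp [εF, SF, unopHom_one, mul_assoc, hexp_mul_neg])
    (by
      rintro _ ((⟨x, rfl⟩ | ⟨i, rfl⟩) | ⟨i, rfl⟩)
      · simp [ΔT, εT, ST, unopHom_one]
      · simp [ΔE, εE, SE, unopHom_one, ← mul_assoc, hexp_mul_neg]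
      · rw [ΔF]
        simp [εF, SF, unopHom_hexp, ST])

variable (hA : IsSymmetrizedCartan A d) (hP : IsCartanType A d P)

lemma sat_comul (hA : IsSymmetrizedCartan A d) (hP : IsCartanType A d P) : R.Sat A d
    ((inlAlg K (R.U A d) (R.U A d)).toLinearMap ∘ₗ R.T A d +
      (inrAlg K (R.U A d) (R.U A d)).toLinearMap ∘ₗ R.T A d)
    (fun i => inlAlg K (R.U A d) (R.U A d) (R.E A d i) +
      inlAlg K (R.U A d) (R.U A d) (hexp K (R.T A d (R.Tp i))) *
        inrAlg K (R.U A d) (R.U A d) (R.E A d i))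
    (fun i => inrAlg K (R.U A d) (R.U A d) (R.F A d i) +
      inrAlg K (R.U A d) (R.U A d) (hexp K (-R.T A d (R.Tm i))) *
        inlAlg K (R.U A d) (R.U A d) (R.F A d i)) :=
  (sat_U (R := R) hA hP).cop hA hP (inlAlg K _ _) (inrAlg K _ _) commute_inl_inr

lemma sat_antipode (hA : IsSymmetrizedCartan A d) (hP : IsCartanType A d P) : R.Sat A d
    (-((MulOpposite.opLinearEquiv K⟦X⟧).toLinearMap ∘ₗ R.T A d))
    (fun i => MulOpposite.op (-(hexp K (-R.T A d (R.Tp i)) * R.E A d i)))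
    (fun i => MulOpposite.op (-(R.F A d i * hexp K (R.T A d (R.Tm i))))) :=
  (sat_U (R := R) hA hP).anti hA hP (-((MulOpposite.opLinearEquiv K⟦X⟧).toLinearMap ∘ₗ
    R.T A d)) fun x => by simp

variable (R) in
/-- The coproduct. -/
def comulAlg : R.U A d →ₐ[K⟦X⟧] CTensor K (R.U A d) (R.U A d) := lift hA hP (sat_comul hA hP)

variable (R) in
/-- The counit. -/
def counitAlg : R.U A d →ₐ[K⟦X⟧] K⟦X⟧ := lift hA hP Sat.zero

variable (R) in
/-- The antipode. -/
def antipodeAlg : R.U A d →ₐ[K⟦X⟧] (R.U A d)ᵐᵒᵖ := lift hA hP (sat_antipode hA hP)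

lemma comulAlg_T (x : 𝔥) : R.comulAlg hA hP (R.T A d x) =
    tmul K (R.T A d x) 1 + tmul K 1 (R.T A d x) :=
  (lift_T hA hP (sat_comul hA hP) x).trans (inl_add_inr _ _)

lemma comulAlg_E (i : Fin n) : R.comulAlg hA hP (R.E A d i) =
    tmul K (R.E A d i) 1 + tmul K (hexp K (R.T A d (R.Tp i))) (R.E A d i) :=
  (lift_E hA hP (sat_comul hA hP) i).trans (inl_add_mul _ _ _)

lemma comulAlg_F (i : Fin n) : R.comulAlg hA hP (R.F A d i) =
    tmul K (R.F A d i) (hexp K (-R.T A d (R.Tm i))) + tmul K 1 (R.F A d i) :=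
  (lift_F hA hP (sat_comul hA hP) i).trans (inr_add_mul _ _ _)

lemma counitAlg_T (x : 𝔥) : R.counitAlg hA hP (R.T A d x) = 0 := lift_T hA hP Sat.zero x
lemma counitAlg_E (i : Fin n) : R.counitAlg hA hP (R.E A d i) = 0 := lift_E hA hP Sat.zero i
lemma counitAlg_F (i : Fin n) : R.counitAlg hA hP (R.F A d i) = 0 := lift_F hA hP Sat.zero i

lemma unopHom_antipode_T (x : 𝔥) : unopHom (R.antipodeAlg hA hP) (R.T A d x) = -R.T A d x :=
  congrArg MulOpposite.unop (lift_T hA hP (sat_antipode hA hP) x)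

lemma unopHom_antipode_E (i : Fin n) : unopHom (R.antipodeAlg hA hP) (R.E A d i) =
    -(hexp K (-R.T A d (R.Tp i)) * R.E A d i) :=
  congrArg MulOpposite.unop (lift_E hA hP (sat_antipode hA hP) i)

lemma unopHom_antipode_F (i : Fin n) : unopHom (R.antipodeAlg hA hP) (R.F A d i) =
    -(R.F A d i * hexp K (R.T A d (R.Tm i))) :=
  congrArg MulOpposite.unop (lift_F hA hP (sat_antipode hA hP) i)

/-- The standard Hopf structure on the FoMpQUEA. -/
def hopfU (R : Realization P 𝔥) : HopfStr K (R.U A d) :=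
  hopfOf (R := R) (R.T A d) (R.E A d) (R.F A d) (isTopGen_U A d R) (R.comulAlg hA hP)
    (R.counitAlg hA hP) (R.antipodeAlg hA hP) (comulAlg_T hA hP) (comulAlg_E hA hP)
    (comulAlg_F hA hP) (counitAlg_T hA hP) (counitAlg_E hA hP) (counitAlg_F hA hP)
    (unopHom_antipode_T hA hP) (unopHom_antipode_E hA hP) (unopHom_antipode_F hA hP)

lemma stdT_hopfU : StdT (R.hopfU hA hP) (R.T A d) :=
  ⟨fun _ _ => rfl, rfl, fun x =>
    ⟨comulAlg_T hA hP x, counitAlg_T hA hP x, unopHom_antipode_T hA hP x⟩⟩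

lemma stdE_hopfU : R.StdE (R.hopfU hA hP) (R.T A d) (R.E A d) := fun i =>
  ⟨comulAlg_E hA hP i, counitAlg_E hA hP i, unopHom_antipode_E hA hP i⟩

lemma stdF_hopfU : R.StdF (R.hopfU hA hP) (R.T A d) (R.F A d) := fun i =>
  ⟨comulAlg_F hA hP i, counitAlg_F hA hP i, unopHom_antipode_F hA hP i⟩

end Realization

end Relations

end FoMp
end

noncomputable section
namespace FoMp
variable {K : Type*} [Field K]

/-! ### Retractions of the FoMpQUEA onto its Borel subalgebras -/

lemma constantCoeff_hdiff (r s : K⟦X⟧) :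
    constantCoeff (hdiff K r s) = constantCoeff r + constantCoeff s := by
  obtain ⟨z, hz⟩ := hsum_spec (K := K) (fun k => (C (((k + 1)! : K)⁻¹) : K⟦X⟧) •
    (r ^ (k + 1) - (-s) ^ (k + 1))) 1
  rw [hdiff, hz]
  simp

section Retraction

variable {n : ℕ} {P : Matrix (Fin n) (Fin n) K⟦X⟧} {𝔥 : Type*} [AddCommGroup 𝔥]
  [Module K⟦X⟧ 𝔥] [Module.Free K⟦X⟧ 𝔥] [Module.Finite K⟦X⟧ 𝔥]
  {A : Matrix (Fin n) (Fin n) ℤ} {d : Fin n → ℕ} {R : Realization P 𝔥}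
  {C : Type*} [Ring C] [Algebra K⟦X⟧ C]

lemma serL_weight {t x y : C} {a b : K⟦X⟧} (hx : t * x - x * t = a • x) (hy : t * y - y * t = b • y)
    (w p : K⟦X⟧) (s : ℕ) :
    t * serL w p x y s - serL w p x y s * t = (s * a + b) • serL w p x y s := by
  induction s with
  | zero => simpa [serIt] using hy
  | succ s ih =>
    rw [serL_succ]
    set Y := serL w p x y s
    have e : t * (x * Y - (w * p ^ s) • (Y * x)) - (x * Y - (w * p ^ s) • (Y * x)) * t =
        ((t * x - x * t) * Y + x * (t * Y - Y * t)) -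
          (w * p ^ s) • ((t * Y - Y * t) * x + Y * (t * x - x * t)) := by
      simp only [mul_sub, sub_mul, mul_smul_comm, smul_mul_assoc, mul_assoc, smul_sub, smul_add]
      abel
    rw [e, hx, ih]
    simp only [smul_mul_assoc, mul_smul_comm, smul_sub]
    push_cast
    generalize w * p ^ s = c
    generalize (s : K⟦X⟧) = z
    simp only [add_mul, add_smul, smul_add, mul_smul, one_mul, smul_comm c]
    abel

namespace Realization

variable (d R) in
/-- The right-hand side of the commutation relation between `E_i` and `F_i`. -/
def kap [IsAdicComplete (hId K) C] (t : 𝔥 →ₗ[K⟦X⟧] C) (i : Fin n) : C :=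
  (hdiff K (d i : K⟦X⟧) (d i : K⟦X⟧))⁻¹ • hdiff K (t (R.Tp i)) (t (R.Tm i))

variable [CharZero K] [IsAdicComplete (hId K) C]

omit [IsAdicComplete (hId K) C] in
lemma hdiff_mul_inv (hA : IsSymmetrizedCartan A d) (i : Fin n) :
    hdiff K (d i : K⟦X⟧) (d i : K⟦X⟧) * (hdiff K (d i : K⟦X⟧) (d i : K⟦X⟧))⁻¹ = 1 := by
  refine PowerSeries.mul_inv_cancel _ ?_
  have h : ((d i : K⟦X⟧)) = (PowerSeries.C (d i : K)) := by simp
  rw [constantCoeff_hdiff, h, constantCoeff_C, ← two_mul]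
  exact mul_ne_zero two_ne_zero (Nat.cast_ne_zero.2 (hA.d_pos i).ne')

/-- A twisted derivation with respect to one half of the generators kills the quantum Serre
elements. -/
lemma serre_derivation (hA : IsSymmetrizedCartan A d) (hP : IsCartanType A d P)
    {t : 𝔥 →ₗ[K⟦X⟧] C} {e : Fin n → C} (TE : ∀ x j, t x * e j - e j * t x = R.α j x • e j)
    {i j : Fin n} (hij : i ≠ j) (k : Fin n) {W : ℕ → C}
    (h0 : W 0 = if j = k then -kap d R t k else 0)
    (hW : ∀ s, W (s + 1) = e i * W s - (hexp K (P i j) * qPow K (d i) 2 ^ s) • (W s * e i) -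
      if i = k then kap d R t k * serL (hexp K (P i j)) (qPow K (d i) 2) (e i) (e j) s -
        (hexp K (P i j) * qPow K (d i) 2 ^ s) •
          (serL (hexp K (P i j)) (qPow K (d i) 2) (e i) (e j) s * kap d R t k) else 0) :
    W ((-A i j).toNat + 1) = 0 := by
  have hX : (X : K⟦X⟧) ≠ 0 := X_ne_zero
  have mulL : ∀ i j, e i * hexp K (-t (R.Tm j)) = hexp K (P i j) • (hexp K (-t (R.Tm j)) * e i) := by
    intro i j
    have h1 := TE (-R.Tm j) i
    rw [map_neg, map_neg, R.α_Tm] at h1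
    rw [hexp_mul_of_commutator h1, smul_smul, hexp_mul_neg, one_smul]
  by_cases hik : i = k
  · subst hik
    rw [if_neg (Ne.symm hij)] at h0
    simp only [if_true] at hW
    set u := (hdiff K (d i : K⟦X⟧) (d i : K⟦X⟧))⁻¹ with hu
    have hpw : ∀ s : ℕ, hexp K ((s : K⟦X⟧) * P i i + P i j) = hexp K (P i j) * qPow K (d i) 2 ^ s :=
      fun s => by rw [hexp_add (Commute.all _ _), hexp_nat_mul, hP.diag hA, mul_comm]
    refine serre_derivation_left (w := hexp K (P i j)) (p := qPow K (d i) 2) (x := e i) (y := e j)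
      (κ := kap d R t i) (L := hexp K (-t (R.Tm i)))
      (ν := fun s => u * hdiff K ((s : K⟦X⟧) * P i i + P i j) ((s : K⟦X⟧) * P i i + P j i))
      (by rw [mulL, hP.diag hA]) (fun s => ?_) ?_ h0 hW
    · have h1 := serL_weight (TE (R.Tp i) i) (TE (R.Tp i) j) (hexp K (P i j)) (qPow K (d i) 2) s
      have h2 := serL_weight (TE (R.Tm i) i) (TE (R.Tm i) j) (hexp K (P i j)) (qPow K (d i) 2) s
      rw [R.α_Tp, R.α_Tp] at h1
      rw [R.α_Tm, R.α_Tm] at h2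
      rw [kap, smul_mul_assoc, hdiff_mul_of_commutator h1 h2, hpw, smul_add, smul_smul,
        mul_smul_comm, smul_comm u]
    · rw [← Finset.mul_sum]
      have : (∑ t ∈ Finset.range ((-A i j).toNat + 1),
          hdiff K ((t : K⟦X⟧) * P i i + P i j) ((t : K⟦X⟧) * P i i + P j i)) = 0 := by
        refine mul_left_cancel₀ hX ?_
        rw [mul_zero, Finset.mul_sum]
        have hd : ∀ r s : K⟦X⟧, X * hdiff K r s = hexp K r - hexp K (-s) :=
          fun r s => X_smul_hdiff (K := K) r s
        simp only [hd]
        rw [Finset.sum_sub_distrib, sub_eq_zero,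
          ← Finset.sum_range_reflect (fun t : ℕ => hexp K (-((t : K⟦X⟧) * P i i + P j i)))]
        refine Finset.sum_congr rfl fun s hs => ?_
        have hs' : s ≤ (-A i j).toNat := Nat.lt_succ_iff.1 (Finset.mem_range.1 hs)
        have h3 := hP.hexp_mul hA hij
        rw [hpw, Nat.add_sub_cancel]
        have h4 : hexp K (((((-A i j).toNat - s : ℕ) : K⟦X⟧)) * P i i + P j i) =
            hexp K (P j i) * qPow K (d i) 2 ^ ((-A i j).toNat - s) := by
          rw [hexp_add (Commute.all _ _), hexp_nat_mul, hP.diag hA, mul_comm]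
        have h5 := hexp_neg_mul (K := K) (((((-A i j).toNat - s : ℕ) : K⟦X⟧)) * P i i + P j i)
        rw [h4] at h5
        rw [show qPow K (d i) 2 ^ (-A i j).toNat = qPow K (d i) 2 ^ s *
          qPow K (d i) 2 ^ ((-A i j).toNat - s) by rw [← pow_add, Nat.add_sub_cancel' hs']] at h3
        set E := hexp K (-(((((-A i j).toNat - s : ℕ) : K⟦X⟧)) * P i i + P j i))
        linear_combination (-(hexp K (P i j) * qPow K (d i) 2 ^ s)) * h5 + E * h3
      rw [this, mul_zero]
  · simp only [if_neg hik, sub_zero] at hW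
    by_cases hjk : j = k
    · subst hjk
      rw [if_pos rfl] at h0
      have hinv := hdiff_mul_inv (K := K) hA j
      set u := hdiff K (d j : K⟦X⟧) (d j : K⟦X⟧) with hu
      have h1 := TE (R.Tp j) i
      have h2 := TE (R.Tm j) i
      rw [R.α_Tp] at h1
      rw [R.α_Tm] at h2
      refine serre_derivation_right (w := hexp K (P i j)) (w' := hexp K (P j i))
        (p := qPow K (d i) 2) (κ := kap d R t j) (L := hexp K (-t (R.Tm j)))
        (ν := u⁻¹ * hdiff K (P j i) (P i j)) (η := X * u) (x := e i)
        (hP.hexp_mul hA hij) (mul_ne_zero hX (left_ne_zero_of_mul_eq_one hinv)) ?_ ?_ (mulL i j) h0 hW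
      · have h3 := X_smul_hdiff (K := K) (P j i) (P i j)
        rw [smul_eq_mul] at h3
        have h4 := hexp_mul_neg (K := K) (P i j)
        linear_combination (X * hexp K (P i j) * hdiff K (P j i) (P i j)) * hinv +
          hexp K (P i j) * h3 - h4
      · rw [kap, smul_mul_assoc, hdiff_mul_of_commutator h1 h2, smul_add, smul_smul, mul_smul_comm,
          smul_comm u⁻¹]
    · rw [if_neg hjk] at h0
      have : ∀ s, W s = 0 := fun s => by
        induction s with
        | zero => exact h0
        | succ s ih => rw [hW, ih]; simp
      exact this _

omit [CharZero K] in
lemma commute_kap {t : 𝔥 →ₗ[K⟦X⟧] C} {a : C} (h : ∀ x, Commute a (t x)) (i : Fin n) :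
    Commute a (kap d R t i) :=
  (commute_hdiff (h _) (h _)).smul_right _

omit [CharZero K] in
lemma map_kap {D : Type*} [Ring D] [Algebra K⟦X⟧ D] [IsAdicComplete (hId K) D] (g : C →ₐ[K⟦X⟧] D)
    (t : 𝔥 →ₗ[K⟦X⟧] C) (i : Fin n) : g (kap d R t i) = kap d R (g.toLinearMap ∘ₗ t) i := by
  rw [kap, map_smul, AlgHom.map_hdiff]
  rfl

omit [CharZero K] [IsAdicComplete (hId K) C] in
lemma serL_commutator (c z x y : C) (w p : K⟦X⟧) (s : ℕ) (hz : c * x - x * c = z) :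
    c * serL w p x y (s + 1) - serL w p x y (s + 1) * c =
      (x * (c * serL w p x y s - serL w p x y s * c) -
        (w * p ^ s) • ((c * serL w p x y s - serL w p x y s * c) * x)) +
      (z * serL w p x y s - (w * p ^ s) • (serL w p x y s * z)) := by
  rw [serL_succ, ← hz]
  set Y := serL w p x y s
  simp only [mul_sub, sub_mul, mul_smul_comm, smul_mul_assoc, mul_assoc, smul_sub]
  abel

omit [CharZero K] [IsAdicComplete (hId K) C] in
lemma neg_twisted_commutator (a y : C) (c : K⟦X⟧) :
    a * y - c • (y * a) = -(-a * y - c • (y * -a)) := by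
  rw [neg_mul, mul_neg, smul_neg]
  abel

/-- Twisted derivations of an algebra generated by one half of the generators extend its left
regular representation to a representation of the FoMpQUEA. -/
lemma sat_end (hA : IsSymmetrizedCartan A d) (hP : IsCartanType A d P) {t : 𝔥 →ₗ[K⟦X⟧] C}
    {e : Fin n → C} (h : R.HalfSat A d t e) (hs : IsTopGen K (Set.range t ∪ Set.range e))
    (D : Fin n → Module.End K⟦X⟧ C) (D1 : ∀ k, D k 1 = 0)
    (DT : ∀ k y x, D k (t y * x) = (t y + algebraMap K⟦X⟧ C (R.α k y)) * D k x)
    (DE : ∀ k j x, D k (e j * x) = e j * D k x - if j = k then kap d R t k * x else 0) :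
    R.Sat A d ((Algebra.lmul K⟦X⟧ C).toLinearMap ∘ₗ t) (fun i => Algebra.lmul K⟦X⟧ C (e i)) D := by
  have pos := h.map (Algebra.lmul K⟦X⟧ C)
  have hTD : ∀ x j, (-((Algebra.lmul K⟦X⟧ C).toLinearMap ∘ₗ t)) x * D j -
      D j * (-((Algebra.lmul K⟦X⟧ C).toLinearMap ∘ₗ t)) x = R.op.α j x • D j := fun x j => by
    refine LinearMap.ext fun y => ?_
    change -(t x * D j y) - D j (-(t x * y)) = R.α j x • D j y
    rw [map_neg, DT, add_mul, ← Algebra.smul_def]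
    abel
  have hED : ∀ k j, Algebra.lmul K⟦X⟧ C (e k) * D j - D j * Algebra.lmul K⟦X⟧ C (e k) =
      if k = j then kap d R ((Algebra.lmul K⟦X⟧ C).toLinearMap ∘ₗ t) j else 0 := by
    intro k j
    refine LinearMap.ext fun y => ?_
    change e k * D j y - D j (e k * y) = _
    rw [DE, sub_sub_cancel]
    split_ifs with h
    · rw [← map_kap]
      rfl
    · rfl
  have hkap : ∀ i, kap d R.op (-((Algebra.lmul K⟦X⟧ C).toLinearMap ∘ₗ t)) i =
      -kap d R ((Algebra.lmul K⟦X⟧ C).toLinearMap ∘ₗ t) i := fun i => by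
    rw [kap, kap, ← smul_neg]
    exact congrArg _ (hdiff_neg_swap _ _)
  refine ⟨pos, ⟨hTD, fun x y => ?_, fun i j hij => ?_⟩, fun i => ?_, fun i j hij => ?_⟩
  · exact (pos.TT x y).neg_left.neg_right
  · have hcomm : ∀ k, Algebra.lmul K⟦X⟧ C (e k) * serL (hexp K (P.transpose i j)) (qPow K (d i) 2)
          (D i) (D j) ((-A i j).toNat + 1) -
        serL (hexp K (P.transpose i j)) (qPow K (d i) 2) (D i) (D j) ((-A i j).toNat + 1) *
          Algebra.lmul K⟦X⟧ C (e k) = 0 := by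
      intro k
      refine serre_derivation hA hP.transpose hTD hij k
        (W := fun s => Algebra.lmul K⟦X⟧ C (e k) *
          serL (hexp K (P.transpose i j)) (qPow K (d i) 2) (D i) (D j) s -
          serL (hexp K (P.transpose i j)) (qPow K (d i) 2) (D i) (D j) s *
            Algebra.lmul K⟦X⟧ C (e k)) ?_ fun s => ?_
      · refine (hED k j).trans ?_
        rw [hkap, neg_neg]
        by_cases hkj : k = j
        · rw [if_pos hkj, if_pos hkj.symm, hkj]
        · rw [if_neg hkj, if_neg (Ne.symm hkj)]
      · refine (serL_commutator _ _ _ _ _ _ s (hED k i)).trans ?_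
        rw [hkap, sub_eq_add_neg _ (ite _ _ _)]
        congr 1
        by_cases hki : k = i
        · rw [if_pos hki, if_pos hki.symm, hki]
          exact neg_twisted_commutator _ _ _
        · rw [if_neg hki, if_neg (Ne.symm hki), zero_mul, mul_zero, smul_zero, sub_zero, neg_zero]
    have hT := fun x => serL_weight (hTD x i) (hTD x j) (hexp K (P.transpose i j)) (qPow K (d i) 2)
      ((-A i j).toNat + 1)
    have h1 : ∀ s, serL (hexp K (P.transpose i j)) (qPow K (d i) 2) (D i) (D j) s 1 = 0 :=
      fun s => by
        induction s with
        | zero => exact D1 j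
        | succ s ih =>
          rw [serL_succ, LinearMap.sub_apply, LinearMap.smul_apply, Module.End.mul_apply,
            Module.End.mul_apply, ih, D1, map_zero, map_zero, smul_zero, sub_zero]
    change serL (hexp K (P.transpose i j)) (qPow K (d i) 2) (D i) (D j) ((-A i j).toNat + 1) = 0
    replace h1 := h1 ((-A i j).toNat + 1)
    generalize serL (hexp K (P.transpose i j)) (qPow K (d i) 2) (D i) (D j) ((-A i j).toNat + 1) = Z
      at hcomm hT h1
    refine hs.linearMap_ext h1 ?_
    rintro _ (⟨y, rfl⟩ | ⟨k, rfl⟩) x hx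
    · have h2 := LinearMap.congr_fun (hT y) x
      rw [LinearMap.sub_apply, Module.End.mul_apply, Module.End.mul_apply, LinearMap.smul_apply, hx,
        LinearMap.zero_apply, smul_zero, map_zero, zero_sub, neg_eq_zero, LinearMap.neg_apply,
        LinearMap.neg_apply, map_neg, neg_eq_zero] at h2
      exact h2
    · have h2 := LinearMap.congr_fun (hcomm k) x
      rw [LinearMap.sub_apply, Module.End.mul_apply, Module.End.mul_apply, hx,
        LinearMap.zero_apply, map_zero, zero_sub, neg_eq_zero] at h2
      exact h2
  · rw [hED, if_pos rfl]
    rfl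
  · exact sub_eq_zero.1 ((hED i j).trans (if_neg hij))

section Derivation

variable {t : 𝔥 →ₗ[K⟦X⟧] C} {e : Fin n → C}

variable (K) in
/-- The operator `(a, b) ↦ (x a, y b + z a)`. -/
def pairOp (x y z : C) : Module.End K⟦X⟧ (C × C) :=
  (LinearMap.mulLeft K⟦X⟧ x ∘ₗ LinearMap.fst K⟦X⟧ C C).prod
    (LinearMap.mulLeft K⟦X⟧ y ∘ₗ LinearMap.snd K⟦X⟧ C C +
      LinearMap.mulLeft K⟦X⟧ z ∘ₗ LinearMap.fst K⟦X⟧ C C)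

omit [IsAdicComplete (hId K) C] [CharZero K] in
lemma pairOp_apply (x y z a b : C) : pairOp K x y z (a, b) = (x * a, y * b + z * a) := rfl

omit [IsAdicComplete (hId K) C] [CharZero K] in
lemma pairOp_mul (x y z x' y' z' : C) : pairOp K x y z * pairOp K x' y' z' =
    pairOp K (x * x') (y * y') (y * z' + z * x') := by
  refine LinearMap.ext fun a => ?_
  obtain ⟨a, b⟩ := a
  rw [Module.End.mul_apply, pairOp_apply, pairOp_apply, pairOp_apply]
  simp only [mul_assoc, mul_add, add_mul, add_assoc]

omit [IsAdicComplete (hId K) C] [CharZero K] in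
lemma pairOp_sub (x y z x' y' z' : C) : pairOp K x y z - pairOp K x' y' z' =
    pairOp K (x - x') (y - y') (z - z') := by
  refine LinearMap.ext fun a => ?_
  obtain ⟨a, b⟩ := a
  rw [LinearMap.sub_apply, pairOp_apply, pairOp_apply, pairOp_apply, Prod.mk_sub_mk, sub_mul,
    sub_mul, sub_mul]
  congr 1
  abel

omit [IsAdicComplete (hId K) C] [CharZero K] in
lemma smul_pairOp (c : K⟦X⟧) (x y z : C) : c • pairOp K x y z = pairOp K (c • x) (c • y) (c • z) := by
  refine LinearMap.ext fun a => ?_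
  obtain ⟨a, b⟩ := a
  rw [LinearMap.smul_apply, pairOp_apply, pairOp_apply, Prod.smul_mk, smul_add]
  simp only [smul_mul_assoc]

/-- The toral operators of the representation defining the twisted derivation `F_i`. -/
def pairT (R : Realization P 𝔥) (t : 𝔥 →ₗ[K⟦X⟧] C) (k : Fin n) :
    𝔥 →ₗ[K⟦X⟧] Module.End K⟦X⟧ (C × C) where
  toFun x := pairOp K (t x) (t x + algebraMap K⟦X⟧ C (R.α k x)) 0
  map_add' x y := by
    refine LinearMap.ext fun a => ?_
    obtain ⟨a, b⟩ := a
    rw [LinearMap.add_apply, pairOp_apply, pairOp_apply, pairOp_apply]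
    simp only [map_add, add_mul, Prod.mk_add_mk, zero_mul, add_zero]
    congr 1
    abel
  map_smul' c x := by
    rw [RingHom.id_apply, smul_pairOp, smul_zero, smul_add, map_smul, map_smul, smul_eq_mul,
      map_mul, Algebra.smul_def c (algebraMap _ _ _)]

lemma pairSat (hA : IsSymmetrizedCartan A d) (hP : IsCartanType A d P) (h : R.HalfSat A d t e)
    (k : Fin n) : R.HalfSat A d (pairT R t k)
      (fun j => pairOp K (e j) (e j) (if j = k then -kap d R t k else 0)) where
  TE x j := by
    change pairOp K _ _ _ * pairOp K _ _ _ - pairOp K _ _ _ * pairOp K _ _ _ = _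
    rw [pairOp_mul, pairOp_mul, pairOp_sub, smul_pairOp, ← h.TE]
    congr 1
    · rw [add_mul, mul_add, Algebra.commutes, add_sub_add_right_eq_sub]
    · rw [zero_mul, add_zero, mul_zero, zero_add]
      split_ifs with hjk
      · subst hjk
        have := commute_kap (d := d) (R := R) (a := t x) (h.TT x) j
        rw [add_mul, mul_neg, this.eq, neg_mul, Algebra.smul_def]
        abel
      · simp
  TT x y := by
    change pairOp K _ _ _ * pairOp K _ _ _ = pairOp K _ _ _ * pairOp K _ _ _
    rw [pairOp_mul, pairOp_mul, (h.TT x y).eq]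
    congr 1
    · exact ((h.TT x y).add_right (Algebra.commute_algebraMap_right _ _)).add_left
        (Algebra.commute_algebraMap_left _ _)
    · simp
  ser i j hij := by
    set w := hexp K (P i j)
    set p := qPow K (d i) 2
    set V : C := if i = k then -kap d R t k else 0 with hV
    let W : ℕ → C := fun s => Nat.rec (if j = k then -kap d R t k else 0)
      (fun s W => (e i * W + V * serL w p (e i) (e j) s) -
        (w * p ^ s) • (serL w p (e i) (e j) s * V + W * e i)) s
    have key : ∀ s, serL w p (pairOp K (e i) (e i) V)
        (pairOp K (e j) (e j) (if j = k then -kap d R t k else 0)) s =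
        pairOp K (serL w p (e i) (e j) s) (serL w p (e i) (e j) s) (W s) := by
      intro s
      induction s with
      | zero => rfl
      | succ s ih => rw [serL_succ, ih, pairOp_mul, pairOp_mul, smul_pairOp, pairOp_sub]; rfl
    rw [key, h.ser i j hij, serre_derivation hA hP h.TE hij k (W := W) rfl fun s => ?_]
    · refine LinearMap.ext fun a => ?_
      obtain ⟨a, b⟩ := a
      rw [pairOp_apply]
      simp
    · change (e i * W s + V * serL w p (e i) (e j) s) -
        (w * p ^ s) • (serL w p (e i) (e j) s * V + W s * e i) = _
      rw [hV]
      split_ifs with hik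
      · rw [neg_mul, mul_neg, smul_add, smul_neg]
        abel
      · simp only [zero_mul, mul_zero, zero_add, add_zero, sub_zero]
        rfl

end Derivation

variable (R) in
/-- The twisted derivations by which the `F_i` act on the half algebra. -/
def der (hA : IsSymmetrizedCartan A d) (hP : IsCartanType A d P) (k : Fin n) :
    R.Half A d →ₗ[K⟦X⟧] R.Half A d :=
  LinearMap.snd K⟦X⟧ _ _ ∘ₗ (LinearMap.applyₗ ((1, 0) : R.Half A d × R.Half A d)) ∘ₗ
    (halfLift (pairSat hA hP (R.sat_half A d) k)).toLinearMap

section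

variable (hA : IsSymmetrizedCartan A d) (hP : IsCartanType A d P)

lemma halfLift_pair_fst (k : Fin n) (x : R.Half A d) :
    (halfLift (pairSat hA hP (R.sat_half A d) k) x (1, 0)).1 = x := by
  have : LinearMap.fst K⟦X⟧ _ _ ∘ₗ (LinearMap.applyₗ ((1, 0) : R.Half A d × R.Half A d)) ∘ₗ
      (halfLift (pairSat hA hP (R.sat_half A d) k)).toLinearMap = .id := by
    refine (isTopGen_half A d R).linearMap_ext (by simp) ?_
    rintro _ (⟨y, rfl⟩ | ⟨j, rfl⟩) x hx
    · change (halfLift (pairSat hA hP (R.sat_half A d) k) x (1, 0)).1 = x at hx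
      change (halfLift (pairSat hA hP (R.sat_half A d) k) (_ * x) (1, 0)).1 = _ * x
      rw [map_mul, halfLift_T, Module.End.mul_apply]
      exact congrArg (_ * ·) hx
    · change (halfLift (pairSat hA hP (R.sat_half A d) k) x (1, 0)).1 = x at hx
      change (halfLift (pairSat hA hP (R.sat_half A d) k) (_ * x) (1, 0)).1 = _ * x
      rw [map_mul, halfLift_E, Module.End.mul_apply]
      exact congrArg (_ * ·) hx
  exact LinearMap.congr_fun this x

lemma der_apply (k : Fin n) (x : R.Half A d) : der R hA hP k x =
    (halfLift (pairSat hA hP (R.sat_half A d) k) x (1, 0)).2 := rfl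

lemma der_one (k : Fin n) : der R hA hP k 1 = 0 := by
  rw [der_apply, map_one]
  rfl

lemma der_T (k : Fin n) (y : 𝔥) (x : R.Half A d) : der R hA hP k (R.halfT A d y * x) =
    (R.halfT A d y + algebraMap K⟦X⟧ _ (R.α k y)) * der R hA hP k x := by
  rw [der_apply, der_apply, map_mul, halfLift_T, Module.End.mul_apply]
  set a := halfLift (pairSat hA hP (R.sat_half A d) k) x (1, 0)
  obtain ⟨a, b⟩ := a
  change (pairOp K _ _ _ (a, b)).2 = _
  rw [pairOp_apply, zero_mul, add_zero]

lemma der_E (k j : Fin n) (x : R.Half A d) : der R hA hP k (R.halfE A d j * x) =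
    R.halfE A d j * der R hA hP k x - if j = k then kap d R (R.halfT A d) k * x else 0 := by
  have h := halfLift_pair_fst hA hP k x
  rw [der_apply, der_apply, map_mul, halfLift_E, Module.End.mul_apply]
  set a := halfLift (pairSat hA hP (R.sat_half A d) k) x (1, 0)
  obtain ⟨a, b⟩ := a
  change a = x at h
  subst h
  rw [pairOp_apply]
  split_ifs <;> simp [sub_eq_add_neg]

/-- The half algebra is a module over the FoMpQUEA. -/
lemma sat_end_half : R.Sat A d ((Algebra.lmul K⟦X⟧ (R.Half A d)).toLinearMap ∘ₗ R.halfT A d)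
    (fun i => Algebra.lmul K⟦X⟧ (R.Half A d) (R.halfE A d i)) (der R hA hP) :=
  sat_end hA hP (R.sat_half A d) (isTopGen_half A d R) _ (der_one hA hP) (der_T hA hP) (der_E hA hP)

end

/-! ### The retractions -/

omit [CharZero K] in
lemma adicClosure_induction {B : Type*} [Ring B] [Algebra K⟦X⟧ B] [IsAdicComplete (hId K) B]
    {s : Set B} {N : Type*} [AddCommGroup N] [Module K⟦X⟧ N] [IsAdicComplete (hId K) N]
    {f g : B →ₗ[K⟦X⟧] N} (h : ∀ x ∈ Algebra.adjoin K⟦X⟧ s, f x = g x) {x : B}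
    (hx : x ∈ adicClosure (Algebra.adjoin K⟦X⟧ s)) : f x = g x := by
  refine eq_of_forall_pow (K := K) fun n => ?_
  obtain ⟨y, hy, z, rfl⟩ := hx n
  refine ⟨f z - g z, ?_⟩
  rw [map_add, map_add, h y hy, map_smul, map_smul, smul_sub]
  abel

omit [CharZero K] in
/-- A closed subalgebra whose left regular representation extends is a linear retract. -/
lemma exists_retraction {U : Type*} [Ring U] [Algebra K⟦X⟧ U] [IsAdicComplete (hId K) U]
    {s : Set C} (hs : IsTopGen K s) {s' : Set U} (j : C →ₐ[K⟦X⟧] U)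
    (hj : ∀ a ∈ s, j a ∈ Algebra.adjoin K⟦X⟧ s') (hj' : ∀ b ∈ s', ∃ a, j a = b)
    (act : U →ₐ[K⟦X⟧] Module.End K⟦X⟧ C)
    (hact : ∀ a ∈ s, act (j a) = Algebra.lmul K⟦X⟧ C a) :
    ∃ ρ : U →ₗ[K⟦X⟧] adicClosure (Algebra.adjoin K⟦X⟧ s'),
      ∀ x : adicClosure (Algebra.adjoin K⟦X⟧ s'), ρ x = x := by
  have h1 : act.comp j = Algebra.lmul K⟦X⟧ C := hs.algHom_ext hact
  have hmem : ∀ x, j x ∈ adicClosure (Algebra.adjoin K⟦X⟧ s') := fun x => by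
    refine mem_adicClosure_of_approx fun n => ?_
    obtain ⟨y, hy, z, rfl⟩ := hs x n
    refine ⟨j y, le_adicClosure _ ?_, j z, by rw [map_add, map_smul]⟩
    have : Algebra.adjoin K⟦X⟧ s ≤ (Algebra.adjoin K⟦X⟧ s').comap j := Algebra.adjoin_le hj
    exact this hy
  let r : U →ₗ[K⟦X⟧] C := LinearMap.applyₗ (1 : C) ∘ₗ act.toLinearMap
  have hr : ∀ x, r (j x) = x := fun x => by
    have := LinearMap.congr_fun (AlgHom.congr_fun h1 x) 1
    simpa [r] using this
  refine ⟨(j.toLinearMap ∘ₗ r).codRestrict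
    (Subalgebra.toSubmodule (adicClosure (Algebra.adjoin K⟦X⟧ s'))) fun x => hmem (r x),
    fun x => Subtype.ext ?_⟩
  change (j.toLinearMap ∘ₗ r) x = LinearMap.id (R := K⟦X⟧) (x : U)
  refine adicClosure_induction (fun y hy => ?_) x.2
  have h2 : Algebra.adjoin K⟦X⟧ s' ≤ j.range := Algebra.adjoin_le hj'
  obtain ⟨z, rfl⟩ := h2 hy
  exact congrArg j (hr z)

lemma exists_retractionP (hA : IsSymmetrizedCartan A d) (hP : IsCartanType A d P) :
    ∃ ρ : R.U A d →ₗ[K⟦X⟧] R.BorelP A d, ∀ x : R.BorelP A d, ρ x = x := by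
  have hj := (sat_U (R := R) hA hP).pos
  have ha := sat_end_half (R := R) hA hP
  refine exists_retraction (isTopGen_half A d R) (halfLift hj) ?_ ?_ (lift hA hP ha) ?_
  · rintro _ (⟨x, rfl⟩ | ⟨i, rfl⟩)
    · rw [halfLift_T hj]
      exact Algebra.subset_adjoin (Or.inl ⟨x, rfl⟩)
    · rw [halfLift_E hj]
      exact Algebra.subset_adjoin (Or.inr ⟨i, rfl⟩)
  · rintro _ (⟨x, rfl⟩ | ⟨i, rfl⟩)
    · exact ⟨_, halfLift_T hj x⟩
    · exact ⟨_, halfLift_E hj i⟩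
  · rintro _ (⟨x, rfl⟩ | ⟨i, rfl⟩)
    · rw [halfLift_T hj, lift_T hA hP ha]
      rfl
    · rw [halfLift_E hj, lift_E hA hP ha]

lemma exists_retractionM (hA : IsSymmetrizedCartan A d) (hP : IsCartanType A d P) :
    ∃ ρ : R.U A d →ₗ[K⟦X⟧] R.BorelM A d, ∀ x : R.BorelM A d, ρ x = x := by
  have hj := (sat_U (R := R) hA hP).neg
  have ha : R.Sat A d _ _ _ := (sat_end_half (R := R.op) hA hP.transpose).symm
  refine exists_retraction (isTopGen_half A d R.op) (halfLift hj) ?_ ?_ (lift hA hP ha) ?_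
  · rintro _ (⟨x, rfl⟩ | ⟨i, rfl⟩)
    · rw [halfLift_T hj]
      exact neg_mem (Algebra.subset_adjoin (Or.inl ⟨x, rfl⟩))
    · rw [halfLift_E hj]
      exact Algebra.subset_adjoin (Or.inr ⟨i, rfl⟩)
  · rintro _ (⟨x, rfl⟩ | ⟨i, rfl⟩)
    · exact ⟨R.op.halfT A d (-x), by rw [halfLift_T hj, LinearMap.neg_apply, map_neg, neg_neg]⟩
    · exact ⟨_, halfLift_E hj i⟩
  · rintro _ (⟨x, rfl⟩ | ⟨i, rfl⟩)
    · rw [halfLift_T hj, LinearMap.neg_apply, map_neg, lift_T hA hP ha, LinearMap.neg_apply, neg_neg]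
      rfl
    · rw [halfLift_E hj, lift_F hA hP ha]

end Realization

end Retraction

end FoMp
end

noncomputable section
namespace FoMp
variable {K : Type*} [Field K]

/-! ### Restriction of Hopf structures to linear retracts -/

section Restrict

variable {U V : Type*} [AddCommGroup U] [Module K⟦X⟧ U] [IsAdicComplete (hId K) U]
  [AddCommGroup V] [Module K⟦X⟧ V] [IsAdicComplete (hId K) V]

lemma cassoc_cmap {M N Q M' N' Q' : Type*} [AddCommGroup M] [Module K⟦X⟧ M] [AddCommGroup N]
    [Module K⟦X⟧ N] [AddCommGroup Q] [Module K⟦X⟧ Q] [AddCommGroup M'] [Module K⟦X⟧ M']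
    [AddCommGroup N'] [Module K⟦X⟧ N'] [AddCommGroup Q'] [Module K⟦X⟧ Q'] (f : M →ₗ[K⟦X⟧] M')
    (g : N →ₗ[K⟦X⟧] N') (h : Q →ₗ[K⟦X⟧] Q') (x : CTensor K (CTensor K M N) Q) :
    cassoc K (cmap K (cmap K f g) h x) = cmap K f (cmap K g h) (cassoc K x) := by
  have : cassoc K ∘ₗ cmap K (cmap K f g) h = cmap K f (cmap K g h) ∘ₗ cassoc K :=
    ctensor_ext_left fun m n q => by
      simp only [LinearMap.comp_apply, cmap_apply_tmul, cassoc_tmul]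
  exact LinearMap.congr_fun this x

lemma fold_cmap {M N M' N' W : Type*} [AddCommGroup M] [Module K⟦X⟧ M] [AddCommGroup N]
    [Module K⟦X⟧ N] [AddCommGroup M'] [Module K⟦X⟧ M'] [AddCommGroup N'] [Module K⟦X⟧ N']
    [AddCommGroup W] [Module K⟦X⟧ W] [IsAdicComplete (hId K) W] (f : M →ₗ[K⟦X⟧] M')
    (g : N →ₗ[K⟦X⟧] N') (B : M' →ₗ[K⟦X⟧] N' →ₗ[K⟦X⟧] W) (x : CTensor K M N) :
    fold B (cmap K f g x) = fold (B.compl₁₂ f g) x := by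
  have : fold B ∘ₗ cmap K f g = fold (B.compl₁₂ f g) := ctensor_ext fun m n => by
    simp only [LinearMap.comp_apply, cmap_apply_tmul, fold_tmul, LinearMap.compl₁₂_apply]
  exact LinearMap.congr_fun this x

lemma map_fold {M N W W' : Type*} [AddCommGroup M] [Module K⟦X⟧ M] [AddCommGroup N]
    [Module K⟦X⟧ N] [AddCommGroup W] [Module K⟦X⟧ W] [IsAdicComplete (hId K) W]
    [AddCommGroup W'] [Module K⟦X⟧ W'] [IsAdicComplete (hId K) W']
    (B : M →ₗ[K⟦X⟧] N →ₗ[K⟦X⟧] W) (f : W →ₗ[K⟦X⟧] W') (x : CTensor K M N) :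
    f (fold B x) = fold (B.compr₂ f) x := by
  have : f ∘ₗ fold B = fold (B.compr₂ f) := ctensor_ext fun m n => by
    simp only [LinearMap.comp_apply, fold_tmul, LinearMap.compr₂_apply]
  exact LinearMap.congr_fun this x

variable (H : HopfStr K U) (ι : V →ₗ[K⟦X⟧] U) (ρ : U →ₗ[K⟦X⟧] V)

/-- The restriction of a Hopf structure to a linear retract that is closed under the structure
maps. -/
def HopfStr.restrict (h : ∀ x, ρ (ι x) = x) (hone : ι (ρ H.one) = H.one)
    (hmul : ∀ a b, ι (ρ (H.mul (ι a) (ι b))) = H.mul (ι a) (ι b))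
    (hcomul : ∀ a, cmap K ι ι (cmap K ρ ρ (H.comul (ι a))) = H.comul (ι a))
    (hS : ∀ a, ι (ρ (H.antipode (ι a))) = H.antipode (ι a)) : HopfStr K V :=
  have inj : Function.Injective ι := Function.LeftInverse.injective h
  have h' : ρ ∘ₗ ι = .id := LinearMap.ext h
  have inj₂ : Function.Injective (cmap K ι ι) :=
    Function.LeftInverse.injective (g := cmap K ρ ρ) fun x => by rw [cmap_comp, h', cmap_id]
  have h₂ : cmap K ρ ρ ∘ₗ cmap K ι ι = .id := LinearMap.ext fun x => by
    rw [LinearMap.comp_apply, cmap_comp, h', cmap_id, LinearMap.id_apply]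
  have inj₃ : Function.Injective (cmap K ι (cmap K ι ι)) :=
    Function.LeftInverse.injective (g := cmap K ρ (cmap K ρ ρ)) fun x => by
      rw [cmap_comp, h', h₂, cmap_id]
  have hδ : cmap K ι ι ∘ₗ (cmap K ρ ρ ∘ₗ H.comul ∘ₗ ι) = H.comul ∘ₗ ι := LinearMap.ext hcomul
  { mul := (H.mul.compl₁₂ ι ι).compr₂ ρ
    one := ρ H.one
    comul := cmap K ρ ρ ∘ₗ H.comul ∘ₗ ι
    counit := H.counit ∘ₗ ι
    antipode := ρ ∘ₗ H.antipode ∘ₗ ι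
    mul_assoc := fun a b c => inj (by
      simp only [LinearMap.compr₂_apply, LinearMap.compl₁₂_apply, hmul, H.mul_assoc])
    one_mul := fun a => inj (by
      simp only [LinearMap.compr₂_apply, LinearMap.compl₁₂_apply, hone, H.one_mul, h])
    mul_one := fun a => inj (by
      simp only [LinearMap.compr₂_apply, LinearMap.compl₁₂_apply, hone, H.mul_one, h])
    coassoc := fun a => inj₃ (by
      have e1 : cmap K (cmap K ι ι) ι (cmap K (cmap K ρ ρ ∘ₗ H.comul ∘ₗ ι) .id
          (cmap K ρ ρ (H.comul (ι a)))) = cmap K H.comul .id (H.comul (ι a)) := by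
        rw [cmap_comp, hδ]
        conv_rhs => rw [← hcomul a, cmap_comp]
        rfl
      have e2 : cmap K ι (cmap K ι ι) (cmap K .id (cmap K ρ ρ ∘ₗ H.comul ∘ₗ ι)
          (cmap K ρ ρ (H.comul (ι a)))) = cmap K .id H.comul (H.comul (ι a)) := by
        rw [cmap_comp, hδ]
        conv_rhs => rw [← hcomul a, cmap_comp]
        rfl
      rw [← cassoc_cmap]
      exact (congrArg _ e1).trans ((H.coassoc _).trans e2.symm))
    counit_comul := fun a => inj (by
      have := H.counit_comul (ι a)
      rw [← hcomul a, fold_cmap] at this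
      rw [map_fold]
      refine Eq.trans ?_ this
      congr 1
      refine congrArg _ (LinearMap.ext₂ fun x y => ?_)
      simp)
    comul_counit := fun a => inj (by
      have := H.comul_counit (ι a)
      rw [← hcomul a, fold_cmap] at this
      rw [map_fold]
      refine Eq.trans ?_ this
      congr 1
      refine congrArg _ (LinearMap.ext₂ fun x y => ?_)
      simp)
    comul_one := by
      rw [LinearMap.comp_apply, LinearMap.comp_apply, hone, H.comul_one, cmap_apply_tmul]
    comul_mul := fun a b => inj₂ (by
      have e : (cross (tmul K) ((H.mul.compl₁₂ ι ι).compr₂ ρ)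
          ((H.mul.compl₁₂ ι ι).compr₂ ρ)).compr₂ (cmap K ι ι) =
          (cross (tmul K) H.mul H.mul).compl₁₂ (cmap K ι ι) (cmap K ι ι) :=
        ctensor_ext₂ fun m n p q => by
          simp only [LinearMap.compr₂_apply, cross_tmul, LinearMap.compl₁₂_apply, cmap_apply_tmul,
            hmul]
      have e2 := LinearMap.congr_fun₂ e (cmap K ρ ρ (H.comul (ι a))) (cmap K ρ ρ (H.comul (ι b)))
      simp only [LinearMap.compr₂_apply, LinearMap.compl₁₂_apply, hcomul] at e2
      simp only [LinearMap.comp_apply, LinearMap.compr₂_apply, LinearMap.compl₁₂_apply]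
      rw [e2, hcomul, hmul, H.comul_mul])
    counit_one := by rw [LinearMap.comp_apply, hone, H.counit_one]
    counit_mul := fun a b => by
      simp only [LinearMap.comp_apply, LinearMap.compr₂_apply, LinearMap.compl₁₂_apply, hmul,
        H.counit_mul]
    antipode_left := fun a => inj (by
      have := H.antipode_left (ι a)
      rw [← hcomul a, fold_cmap] at this
      rw [map_fold, map_smul, hone]
      refine Eq.trans ?_ this
      refine congrArg (fun f => fold f _) (LinearMap.ext₂ fun x y => ?_)
      simp only [LinearMap.comp_apply, LinearMap.compr₂_apply, LinearMap.compl₁₂_apply]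
      rw [hmul, hS])
    antipode_right := fun a => inj (by
      have := H.antipode_right (ι a)
      rw [← hcomul a, fold_cmap] at this
      rw [map_fold, map_smul, hone]
      refine Eq.trans ?_ this
      refine congrArg (fun f => fold f _) (LinearMap.ext₂ fun x y => ?_)
      simp only [LinearMap.comp_apply, LinearMap.compr₂_apply, LinearMap.compl₁₂_apply,
        LinearMap.compl₂_apply]
      rw [hmul, hS]) }

/-- `ι` embeds the Hopf structure `H'` into `H` as a linear retract. -/
structure HopfStr.Embeds {U V : Type*} [AddCommGroup U] [Module K⟦X⟧ U] [IsAdicComplete (hId K) U]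
    [AddCommGroup V] [Module K⟦X⟧ V] [IsAdicComplete (hId K) V] (H' : HopfStr K V)
    (H : HopfStr K U) (ι : V →ₗ[K⟦X⟧] U) (ρ : U →ₗ[K⟦X⟧] V) : Prop where
  left_inv : ∀ a, ρ (ι a) = a
  mul : ∀ a b, ι (H'.mul a b) = H.mul (ι a) (ι b)
  one : ι H'.one = H.one
  comul : ∀ a, cmap K ι ι (H'.comul a) = H.comul (ι a)
  counit : ∀ a, H'.counit a = H.counit (ι a)
  antipode : ∀ a, ι (H'.antipode a) = H.antipode (ι a)

lemma HopfStr.Embeds.cmap_left_inv {H' : HopfStr K V} {H : HopfStr K U} {ι : V →ₗ[K⟦X⟧] U}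
    {ρ : U →ₗ[K⟦X⟧] V} (h : H'.Embeds H ι ρ) (x : CTensor K V V) :
    cmap K ρ ρ (cmap K ι ι x) = x := by
  rw [cmap_comp, show ρ ∘ₗ ι = .id from LinearMap.ext h.left_inv, cmap_id]

/-- Transport of a Hopf structure along a linear isomorphism. -/
def HopfStr.transport (ψ : U ≃ₗ[K⟦X⟧] V) : HopfStr K V :=
  H.restrict ψ.symm.toLinearMap ψ.toLinearMap (fun x => by simp) (by simp) (fun _ _ => by simp)
    (fun _ => by
      have : ψ.symm.toLinearMap ∘ₗ ψ.toLinearMap = .id := LinearMap.ext fun x => by simp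
      rw [cmap_comp, this, cmap_id]) (fun _ => by simp)

/-- A linear isomorphism is an isomorphism onto the transported structure. -/
def HopfStr.transportIso (ψ : U ≃ₗ[K⟦X⟧] V) : HopfIso K H (H.transport ψ) where
  toEquiv := ψ
  map_mul a b := by simp [HopfStr.transport, HopfStr.restrict]
  map_one := rfl
  map_comul a := by simp [HopfStr.transport, HopfStr.restrict]
  map_counit a := by simp [HopfStr.transport, HopfStr.restrict]
  map_antipode a := by simp [HopfStr.transport, HopfStr.restrict]

end Restrict

/-! ### Closed Hopf subalgebras -/

section Subalgebra

variable {U : Type*} [Ring U] [Algebra K⟦X⟧ U] [IsAdicComplete (hId K) U] {s : Set U}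
  (H : HopfStr K U) (ρ : U →ₗ[K⟦X⟧] adicClosure (Algebra.adjoin K⟦X⟧ s))

variable (s) in
/-- The inclusion of a closed subalgebra as a linear map. -/
abbrev incl : adicClosure (Algebra.adjoin K⟦X⟧ s) →ₗ[K⟦X⟧] U :=
  (adicClosure (Algebra.adjoin K⟦X⟧ s)).val.toLinearMap

lemma antipode_closed (hρ : ∀ x : adicClosure (Algebra.adjoin K⟦X⟧ s), ρ x = x)
    (S1 : H.antipode 1 = 1) (Smul : ∀ a b, H.antipode (a * b) = H.antipode b * H.antipode a)
    (hS : ∀ g ∈ s, H.antipode g ∈ adicClosure (Algebra.adjoin K⟦X⟧ s))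
    (a : adicClosure (Algebra.adjoin K⟦X⟧ s)) :
    incl s (ρ (H.antipode (incl s a))) = H.antipode (incl s a) := by
  have hi : ∀ y : U, y ∈ adicClosure (Algebra.adjoin K⟦X⟧ s) → incl s (ρ y) = y := fun y hy =>
    congrArg Subtype.val (hρ ⟨y, hy⟩)
  refine Realization.adicClosure_induction (f := incl s ∘ₗ ρ ∘ₗ H.antipode) (g := H.antipode) (fun x hx => ?_)
    a.2
  refine hi _ ?_
  induction hx using Algebra.adjoin_induction with
  | mem x hx => exact hS x hx
  | algebraMap r =>
    rw [Algebra.algebraMap_eq_smul_one, map_smul, S1]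
    exact Subalgebra.smul_mem _ (one_mem _) _
  | add x y _ _ hx hy => rw [map_add]; exact add_mem hx hy
  | mul x y _ _ hx hy => rw [Smul]; exact mul_mem hy hx

lemma comul_closed (hρ : ∀ x : adicClosure (Algebra.adjoin K⟦X⟧ s), ρ x = x)
    (h1 : H.one = 1) (hmul : ∀ a b, H.mul a b = a * b)
    (hΔ : ∀ g ∈ s, ∃ w, cmap K (incl s) (incl s) w = H.comul g)
    (a : adicClosure (Algebra.adjoin K⟦X⟧ s)) :
    cmap K (incl s) (incl s) (cmap K ρ ρ (H.comul (incl s a))) = H.comul (incl s a) := by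
  have hρ' : ρ ∘ₗ incl s = .id := LinearMap.ext hρ
  have hm : H.mul = LinearMap.mul K⟦X⟧ U := LinearMap.ext₂ hmul
  refine Realization.adicClosure_induction (f := cmap K (incl s) (incl s) ∘ₗ cmap K ρ ρ ∘ₗ H.comul)
    (g := H.comul) (fun x hx => ?_) a.2
  have key : ∃ w, cmapAlg (adicClosure (Algebra.adjoin K⟦X⟧ s)).val
      (adicClosure (Algebra.adjoin K⟦X⟧ s)).val w = H.comul x := by
    induction hx using Algebra.adjoin_induction with
    | mem x hx => exact hΔ x hx
    | algebraMap r =>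
      refine ⟨r • tmul K 1 1, ?_⟩
      rw [map_smul, Algebra.algebraMap_eq_smul_one, map_smul, ← h1, H.comul_one, h1]
      rfl
    | add x y _ _ hx hy =>
      obtain ⟨w, hw⟩ := hx
      obtain ⟨w', hw'⟩ := hy
      exact ⟨w + w', by rw [map_add, map_add, hw, hw']⟩
    | mul x y _ _ hx hy =>
      obtain ⟨w, hw⟩ := hx
      obtain ⟨w', hw'⟩ := hy
      exact ⟨w * w', by rw [map_mul, ← hmul, H.comul_mul, hm, cross_mul, hw, hw']⟩
  obtain ⟨w, hw⟩ := key
  change cmap K (incl s) (incl s) (cmap K ρ ρ (H.comul x)) = H.comul x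
  rw [← hw]
  change cmap K (incl s) (incl s) (cmap K ρ ρ (cmap K (incl s) (incl s) w)) =
    cmap K (incl s) (incl s) w
  rw [cmap_comp ρ ρ, hρ', cmap_id]

/-- A closed Hopf subalgebra which is a linear retract inherits the Hopf structure. -/
theorem HopfStr.exists_sub (hρ : ∀ x : adicClosure (Algebra.adjoin K⟦X⟧ s), ρ x = x)
    (h1 : H.one = 1) (hmul : ∀ a b, H.mul a b = a * b)
    (S1 : H.antipode 1 = 1) (Smul : ∀ a b, H.antipode (a * b) = H.antipode b * H.antipode a)
    (h : ∀ g ∈ s, H.antipode g ∈ adicClosure (Algebra.adjoin K⟦X⟧ s) ∧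
      ∃ w, cmap K (incl s) (incl s) w = H.comul g) :
    ∃ H' : HopfStr K (adicClosure (Algebra.adjoin K⟦X⟧ s)), H'.Embeds H (incl s) ρ := by
  have e1 : incl s (ρ H.one) = H.one := by rw [h1]; exact congrArg Subtype.val (hρ 1)
  have e2 : ∀ a b, incl s (ρ (H.mul (incl s a) (incl s b))) = H.mul (incl s a) (incl s b) :=
    fun a b => by rw [hmul]; exact congrArg Subtype.val (hρ (a * b))
  have e3 := comul_closed H ρ hρ h1 hmul fun g hg => (h g hg).2
  have e4 := antipode_closed H ρ hρ S1 Smul fun g hg => (h g hg).1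
  exact ⟨H.restrict (incl s) ρ hρ e1 e2 e3 e4, hρ, e2, e1, e3, fun _ => rfl, e4⟩

end Subalgebra

/-! ### The Hopf structures of the Borel subalgebras -/

namespace Realization

variable {n : ℕ} {A : Matrix (Fin n) (Fin n) ℤ} {d : Fin n → ℕ}
  {P : Matrix (Fin n) (Fin n) K⟦X⟧} {𝔥 : Type*} [AddCommGroup 𝔥] [Module K⟦X⟧ 𝔥]

section Embeds

variable {U V : Type*} [Ring U] [Algebra K⟦X⟧ U] [IsAdicComplete (hId K) U] [Ring V]
  [Algebra K⟦X⟧ V] [IsAdicComplete (hId K) V] {H : HopfStr K U} {H' : HopfStr K V}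
  {ι : V →ₐ[K⟦X⟧] U} {ρ : U →ₗ[K⟦X⟧] V} {t : 𝔥 →ₗ[K⟦X⟧] U} {t' : 𝔥 →ₗ[K⟦X⟧] V} {e : Fin n → U}
  {e' : Fin n → V}

lemma StdT.of_embeds (hE : H'.Embeds H ι.toLinearMap ρ) (h : StdT H t) (ht : ∀ x, ι (t' x) = t x) :
    StdT H' t' := by
  have inj : Function.Injective ι := Function.LeftInverse.injective hE.left_inv
  refine ⟨fun a b => inj ((hE.mul a b).trans ((h.1 _ _).trans (map_mul ι a b).symm)),
    inj (hE.one.trans (h.2.1.trans (map_one ι).symm)), fun x => ⟨?_, ?_, inj ?_⟩⟩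
  · refine Function.LeftInverse.injective hE.cmap_left_inv ?_
    rw [hE.comul, map_add, cmap_apply_tmul, cmap_apply_tmul]
    simp only [AlgHom.toLinearMap_apply, map_one, ht, (h.2.2 x).1]
  · rw [hE.counit]
    simp only [AlgHom.toLinearMap_apply, ht, (h.2.2 x).2.1]
  · refine (hE.antipode _).trans ?_
    simp only [AlgHom.toLinearMap_apply, ht, (h.2.2 x).2.2, map_neg]

variable [Module.Free K⟦X⟧ 𝔥] [Module.Finite K⟦X⟧ 𝔥] {R : Realization P 𝔥}

lemma StdE.of_embeds (hE : H'.Embeds H ι.toLinearMap ρ) (h : R.StdE H t e)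
    (ht : ∀ x, ι (t' x) = t x) (he : ∀ i, ι (e' i) = e i) : R.StdE H' t' e' := by
  have inj : Function.Injective ι := Function.LeftInverse.injective hE.left_inv
  refine fun i => ⟨?_, ?_, inj ?_⟩
  · refine Function.LeftInverse.injective hE.cmap_left_inv ?_
    rw [hE.comul, map_add, cmap_apply_tmul, cmap_apply_tmul]
    simp only [AlgHom.toLinearMap_apply, map_one, AlgHom.map_hexp, ht, he, (h i).1]
  · rw [hE.counit]
    simp only [AlgHom.toLinearMap_apply, he, (h i).2.1]
  · refine (hE.antipode _).trans ?_
    simp only [AlgHom.toLinearMap_apply, ht, he, (h i).2.2, map_neg, map_mul, AlgHom.map_hexp]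

lemma StdF.of_embeds (hE : H'.Embeds H ι.toLinearMap ρ) (h : R.StdF H t e)
    (ht : ∀ x, ι (t' x) = t x) (he : ∀ i, ι (e' i) = e i) : R.StdF H' t' e' := by
  have inj : Function.Injective ι := Function.LeftInverse.injective hE.left_inv
  refine fun i => ⟨?_, ?_, inj ?_⟩
  · refine Function.LeftInverse.injective hE.cmap_left_inv ?_
    rw [hE.comul, map_add, cmap_apply_tmul, cmap_apply_tmul]
    simp only [AlgHom.toLinearMap_apply, map_one, map_neg, AlgHom.map_hexp, ht, he, (h i).1]
  · rw [hE.counit]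
    simp only [AlgHom.toLinearMap_apply, he, (h i).2.1]
  · refine (hE.antipode _).trans ?_
    simp only [AlgHom.toLinearMap_apply, ht, he, (h i).2.2, map_neg, map_mul, AlgHom.map_hexp]

end Embeds

section Closed

variable {U V : Type*} [Ring U] [Algebra K⟦X⟧ U] [IsAdicComplete (hId K) U] [Ring V]
  [Algebra K⟦X⟧ V] [IsAdicComplete (hId K) V] {H : HopfStr K U}
  {ι : V →ₐ[K⟦X⟧] U} {t : 𝔥 →ₗ[K⟦X⟧] U} {t' : 𝔥 →ₗ[K⟦X⟧] V} {e : Fin n → U} {e' : Fin n → V}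

omit [IsAdicComplete (hId K) V] in
lemma StdT.closed (h : StdT H t) (ht : ∀ x, ι (t' x) = t x) (x : 𝔥) :
    H.antipode (t x) ∈ ι.range ∧
      ∃ w, cmap K ι.toLinearMap ι.toLinearMap w = H.comul (t x) := by
  refine ⟨⟨-t' x, ?_⟩, tmul K (t' x) 1 + tmul K 1 (t' x), ?_⟩
  · exact (map_neg ι _).trans (by rw [(h.2.2 x).2.2, ht])
  · rw [(h.2.2 x).1, map_add, cmap_apply_tmul, cmap_apply_tmul]
    simp only [AlgHom.toLinearMap_apply, map_one, ht]

variable [Module.Free K⟦X⟧ 𝔥] [Module.Finite K⟦X⟧ 𝔥] {R : Realization P 𝔥}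

lemma StdE.closed (h : R.StdE H t e) (ht : ∀ x, ι (t' x) = t x) (he : ∀ i, ι (e' i) = e i)
    (i : Fin n) : H.antipode (e i) ∈ ι.range ∧
      ∃ w, cmap K ι.toLinearMap ι.toLinearMap w = H.comul (e i) := by
  refine ⟨⟨-(hexp K (-t' (R.Tp i)) * e' i), ?_⟩,
    tmul K (e' i) 1 + tmul K (hexp K (t' (R.Tp i))) (e' i), ?_⟩
  · refine (map_neg ι _).trans ?_
    rw [(h i).2.2, map_mul, AlgHom.map_hexp, map_neg, ht, he]
  · rw [(h i).1, map_add, cmap_apply_tmul, cmap_apply_tmul]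
    simp only [AlgHom.toLinearMap_apply, map_one, AlgHom.map_hexp, ht, he]

lemma StdF.closed (h : R.StdF H t e) (ht : ∀ x, ι (t' x) = t x) (he : ∀ i, ι (e' i) = e i)
    (i : Fin n) : H.antipode (e i) ∈ ι.range ∧
      ∃ w, cmap K ι.toLinearMap ι.toLinearMap w = H.comul (e i) := by
  refine ⟨⟨-(e' i * hexp K (t' (R.Tm i))), ?_⟩,
    tmul K (e' i) (hexp K (-t' (R.Tm i))) + tmul K 1 (e' i), ?_⟩
  · refine (map_neg ι _).trans ?_
    rw [(h i).2.2, map_mul, AlgHom.map_hexp, ht, he]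
  · rw [(h i).1, map_add, cmap_apply_tmul, cmap_apply_tmul]
    simp only [AlgHom.toLinearMap_apply, map_one, map_neg, AlgHom.map_hexp, ht, he]

end Closed

variable [CharZero K] [Module.Free K⟦X⟧ 𝔥] [Module.Finite K⟦X⟧ 𝔥] {R : Realization P 𝔥}
  (hA : IsSymmetrizedCartan A d) (hP : IsCartanType A d P)

lemma exists_hopfP : ∃ (H : HopfStr K (R.BorelP A d)) (ρ : R.U A d →ₗ[K⟦X⟧] R.BorelP A d),
    H.Embeds (R.hopfU hA hP) (R.BorelP A d).val.toLinearMap ρ := by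
  obtain ⟨ρ, hρ⟩ := exists_retractionP (R := R) hA hP
  refine (HopfStr.exists_sub _ ρ hρ (stdT_hopfU hA hP).2.1 (stdT_hopfU hA hP).1
    (unopHom_one (R.antipodeAlg hA hP)) (unopHom_mul (R.antipodeAlg hA hP)) ?_).imp
    fun _ h => ⟨ρ, h⟩
  rintro _ (⟨x, rfl⟩ | ⟨i, rfl⟩)
  · have h := (stdT_hopfU hA hP).closed (ι := (R.BorelP A d).val) (t' := R.TP A d) (fun _ => rfl) x
    rwa [Subalgebra.range_val] at h
  · have h := (stdE_hopfU hA hP).closed (ι := (R.BorelP A d).val) (t' := R.TP A d) (e' := R.EP A d)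
      (fun _ => rfl) (fun _ => rfl) i
    rwa [Subalgebra.range_val] at h

lemma exists_hopfM : ∃ (H : HopfStr K (R.BorelM A d)) (ρ : R.U A d →ₗ[K⟦X⟧] R.BorelM A d),
    H.Embeds (R.hopfU hA hP) (R.BorelM A d).val.toLinearMap ρ := by
  obtain ⟨ρ, hρ⟩ := exists_retractionM (R := R) hA hP
  refine (HopfStr.exists_sub _ ρ hρ (stdT_hopfU hA hP).2.1 (stdT_hopfU hA hP).1
    (unopHom_one (R.antipodeAlg hA hP)) (unopHom_mul (R.antipodeAlg hA hP)) ?_).imp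
    fun _ h => ⟨ρ, h⟩
  rintro _ (⟨x, rfl⟩ | ⟨i, rfl⟩)
  · have h := (stdT_hopfU hA hP).closed (ι := (R.BorelM A d).val) (t' := R.TM A d) (fun _ => rfl) x
    rwa [Subalgebra.range_val] at h
  · have h := (stdF_hopfU hA hP).closed (ι := (R.BorelM A d).val) (t' := R.TM A d) (e' := R.FM A d)
      (fun _ => rfl) (fun _ => rfl) i
    rwa [Subalgebra.range_val] at h

end Realization

end FoMp
end

noncomputable section
namespace FoMp

/-! ### Twisted families of generators -/

section SerTwist

variable {R B : Type*} [CommRing R] [Ring B] [Algebra R B]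

lemma serL_twist {w w' p a a' : R} (haa : w' * a' = w * a) {x y k l : B} (hkx : k * x = x * k)
    (hky : k * y = a • (y * k)) (hlx : l * x = a' • (x * l)) (hkl : k * l = l * k) (s : ℕ) :
    serL w' p (x * k) (y * l) s = a ^ s • (serL w p x y s * (k ^ s * l)) := by
  have hks : ∀ s, k * serL w p x y s = a • (serL w p x y s * k) := fun s => by
    induction s with
    | zero => exact hky
    | succ s ih =>
      rw [serL_succ, mul_sub, mul_smul_comm, ← mul_assoc, hkx, mul_assoc, ih, ← mul_assoc k, ih,
        sub_mul, smul_sub, smul_mul_assoc, smul_mul_assoc, mul_smul_comm, mul_assoc _ k, hkx,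
        smul_comm a]
      simp only [mul_assoc]
  have hkxs : ∀ s, k ^ s * x = x * k ^ s := fun s =>
    (Commute.pow_left (show Commute k x from hkx) s).eq
  have hkls : ∀ s, k ^ s * l = l * k ^ s := fun s =>
    (Commute.pow_left (show Commute k l from hkl) s).eq
  induction s with
  | zero => simp [serIt]
  | succ s ih =>
    have e1 : x * k * (serL w p x y s * (k ^ s * l)) =
        a • (x * serL w p x y s * (k ^ (s + 1) * l)) := by
      rw [mul_assoc, ← mul_assoc k, hks, smul_mul_assoc, mul_smul_comm, pow_succ']
      simp only [mul_assoc]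
    have e2 : serL w p x y s * (k ^ s * l) * (x * k) =
        a' • (serL w p x y s * x * (k ^ (s + 1) * l)) := by
      have : k ^ s * l * (x * k) = a' • (x * (k ^ (s + 1) * l)) := by
        rw [← mul_assoc, mul_assoc _ l, hlx, mul_smul_comm, smul_mul_assoc, ← mul_assoc, hkxs,
          mul_assoc, mul_assoc, ← hkl, pow_succ]
        simp only [mul_assoc]
      rw [mul_assoc, this, mul_smul_comm, mul_assoc]
    rw [serL_succ, ih, smul_mul_assoc, mul_smul_comm, e1, e2, serL_succ, sub_mul, smul_sub,
      smul_mul_assoc, smul_smul, smul_smul, smul_smul, smul_smul, pow_succ]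
    congr 2
    · ring
    · linear_combination (p ^ s * a ^ s) * haa

end SerTwist

variable {K : Type*} [Field K]

namespace Realization

variable {n : ℕ} {A : Matrix (Fin n) (Fin n) ℤ} {d : Fin n → ℕ}
  {P P' : Matrix (Fin n) (Fin n) K⟦X⟧} {𝔥 𝔥' : Type*} [AddCommGroup 𝔥]
  [Module K⟦X⟧ 𝔥] [Module.Free K⟦X⟧ 𝔥] [Module.Finite K⟦X⟧ 𝔥] [AddCommGroup 𝔥']
  [Module K⟦X⟧ 𝔥'] [Module.Free K⟦X⟧ 𝔥'] [Module.Finite K⟦X⟧ 𝔥'] {R : Realization P 𝔥}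
  {R' : Realization P' 𝔥'}

variable (K) in
/-- The scalar `1/2`. -/
def half : K⟦X⟧ := C (2⁻¹ : K)

lemma half_add_half [CharZero K] (r : K⟦X⟧) : half K * r + half K * r = r := by
  rw [← add_mul, half, ← map_add, ← two_mul, mul_inv_cancel₀ two_ne_zero, map_one, one_mul]

lemma AltS.Tm_right [CharZero K] (χ : R.AltS) (x : 𝔥) (i : Fin n) :
    χ.form x (R.Tm i) = -χ.form x (R.Tp i) := by
  have h := χ.S_right i x
  rw [S, map_smul, smul_eq_mul, map_add, mul_add] at h
  have h2 := half_add_half (χ.form x (R.Tp i) + χ.form x (R.Tm i))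
  rw [half, mul_add, h, zero_add] at h2
  exact eq_neg_of_add_eq_zero_right h2.symm

lemma AltS.Tm_left [CharZero K] (χ : R.AltS) (x : 𝔥) (i : Fin n) :
    χ.form (R.Tm i) x = -χ.form (R.Tp i) x := by
  rw [χ.antisymm, χ.Tm_right, χ.antisymm (R.Tp i)]

lemma AltS.self [CharZero K] (χ : R.AltS) (x : 𝔥) : χ.form x x = 0 := by
  have h := half_add_half (χ.form x x)
  conv at h => enter [1, 2]; rw [χ.antisymm]
  rw [← h]; ring

/-- A twist of realizations: an isomorphism of the underlying modules, compatible with the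
coroots, that changes the roots by a toral form. -/
structure Twist (R' : Realization P' 𝔥') (R : Realization P 𝔥) where
  /-- the isomorphism of modules -/
  f : 𝔥' ≃ₗ[K⟦X⟧] 𝔥
  /-- the form -/
  χ : R.AltS
  Tp : ∀ i, f (R'.Tp i) = R.Tp i
  Tm : ∀ i, f (R'.Tm i) = R.Tm i
  α : ∀ j x, R'.α j x = R.α j (f x) + χ.form (f x) (R.Tp j)

lemma Twist.P_eq (D : Twist R' R) (i j : Fin n) :
    P' i j = P i j + D.χ.form (R.Tp i) (R.Tp j) := by
  rw [← R'.α_Tp, D.α, D.Tp, R.α_Tp]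

/-- The twist of the opposite realizations. -/
def Twist.op [CharZero K] (D : Twist R' R) : Twist R'.op R.op where
  f := D.f
  χ :=
    { form := -D.χ.form
      antisymm := fun x y => by
        rw [LinearMap.neg_apply, LinearMap.neg_apply, LinearMap.neg_apply, LinearMap.neg_apply,
          D.χ.antisymm]
      S_left := fun i x => by
        have := D.χ.S_left i x
        rw [S, add_comm] at this
        exact neg_eq_zero.2 this
      S_right := fun i x => by
        have := D.χ.S_right i x
        rw [S, add_comm] at this
        exact neg_eq_zero.2 this }
  Tp := D.Tm
  Tm := D.Tp
  α j x := by
    refine (D.α j x).trans (congrArg _ ?_)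
    change _ = -D.χ.form (D.f x) (R.Tm j)
    rw [D.χ.Tm_right, neg_neg]

/-- The trivial twist. -/
def Twist.refl (R : Realization P 𝔥) : Twist R R where
  f := .refl _ _
  χ := ⟨0, fun _ _ => by simp, fun _ _ => rfl, fun _ _ => rfl⟩
  Tp _ := rfl
  Tm _ := rfl
  α j x := by simp

variable {B : Type*} [Ring B] [Algebra K⟦X⟧ B] [CharZero K]

lemma HalfSat.twist [IsAdicComplete (hId K) B] (D : Twist R' R) {t : 𝔥 →ₗ[K⟦X⟧] B} {e : Fin n → B}
    (h : R.HalfSat A d t e) {θ : 𝔥' →ₗ[K⟦X⟧] B} {k : Fin n → B}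
    (θθ : ∀ x y, θ x * θ y = θ y * θ x) (θt : ∀ x y, θ x * t y = t y * θ x)
    (θe : ∀ x i, θ x * e i = e i * θ x + (half K * D.χ.form (D.f x) (R.Tp i)) • e i)
    (θk : ∀ x i, θ x * k i = k i * θ x)
    (kt : ∀ i y, k i * t y = t y * k i + (half K * D.χ.form (R.Tp i) y) • k i)
    (kk : ∀ i j, k i * k j = k j * k i)
    (ke : ∀ i j, k i * e j = hexp K (half K * D.χ.form (R.Tp i) (R.Tp j)) • (e j * k i)) :
    R'.HalfSat A d (t ∘ₗ D.f.toLinearMap + θ) (fun i => e i * k i) where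
  TE x j := by
    have h1 := h.TE (D.f x) j
    rw [sub_eq_iff_eq_add] at h1
    have h2 := half_add_half (D.χ.form (D.f x) (R.Tp j))
    have h3 := θe x j
    have h4 := kt j (D.f x)
    rw [D.χ.antisymm (R.Tp j), mul_neg] at h4
    generalize half K * D.χ.form (D.f x) (R.Tp j) = u at h2 h3 h4
    rw [LinearMap.add_apply, LinearMap.comp_apply, LinearEquiv.coe_coe, add_mul, ← mul_assoc,
      ← mul_assoc, h3, h1, mul_add, mul_assoc _ _ (t _), h4, mul_assoc _ _ (θ x), ← θk, D.α, ← h2]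
    simp only [add_mul, mul_add, smul_mul_assoc, mul_smul_comm, add_smul, mul_assoc, mul_neg,
      neg_smul]
    abel
  TT x y := by
    change (t (D.f x) + θ x) * (t (D.f y) + θ y) = (t (D.f y) + θ y) * (t (D.f x) + θ x)
    rw [add_mul, mul_add, mul_add, add_mul, mul_add, mul_add, θθ, θt, θt, (h.TT _ _).eq]
    abel
  ser i j hij := by
    have hii : k i * e i = e i * k i := by
      rw [ke, D.χ.self, mul_zero, hexp_zero, one_smul]
    have haa : hexp K (P' i j) * hexp K (half K * D.χ.form (R.Tp j) (R.Tp i)) =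
        hexp K (P i j) * hexp K (half K * D.χ.form (R.Tp i) (R.Tp j)) := by
      rw [D.P_eq, D.χ.antisymm (R.Tp j), ← hexp_add (Commute.all _ _),
        ← hexp_add (Commute.all _ _)]
      congr 1
      linear_combination -half_add_half (D.χ.form (R.Tp i) (R.Tp j))
    have := serL_twist haa (p := qPow K (d i) 2) hii (ke i j) (ke j i) (kk i j) ((-A i j).toNat + 1)
    rw [this]
    refine (congrArg _ (congrArg (· * _) (h.ser i j hij))).trans ?_
    rw [zero_mul, smul_zero]

lemma Sat.twist [IsAdicComplete (hId K) B] (D : Twist R' R) {t : 𝔥 →ₗ[K⟦X⟧] B} {e f : Fin n → B}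
    (h : R.Sat A d t e f) {θ : 𝔥' →ₗ[K⟦X⟧] B} {k l : Fin n → B}
    (θθ : ∀ x y, θ x * θ y = θ y * θ x) (θt : ∀ x y, θ x * t y = t y * θ x)
    (θe : ∀ x i, θ x * e i = e i * θ x + (half K * D.χ.form (D.f x) (R.Tp i)) • e i)
    (θf : ∀ x i, θ x * f i = f i * θ x - (half K * D.χ.form (D.f x) (R.Tp i)) • f i)
    (θk : ∀ x i, θ x * k i = k i * θ x) (θl : ∀ x i, θ x * l i = l i * θ x)
    (kt : ∀ i y, k i * t y = t y * k i + (half K * D.χ.form (R.Tp i) y) • k i)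
    (lt : ∀ i y, l i * t y = t y * l i - (half K * D.χ.form (R.Tp i) y) • l i)
    (kk : ∀ i j, k i * k j = k j * k i) (ll : ∀ i j, l i * l j = l j * l i)
    (kl : ∀ i j, k i * l j = l j * k i)
    (ke : ∀ i j, k i * e j = hexp K (half K * D.χ.form (R.Tp i) (R.Tp j)) • (e j * k i))
    (kf : ∀ i j, k i * f j = f j * k i) (le : ∀ i j, l i * e j = e j * l i)
    (lf : ∀ i j, l i * f j = hexp K (-(half K * D.χ.form (R.Tp i) (R.Tp j))) • (f j * l i))
    (θTm : ∀ i, θ (R'.Tm i) = -θ (R'.Tp i)) (hkl : ∀ i, k i * l i = hexp K (θ (R'.Tp i))) :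
    R'.Sat A d (t ∘ₗ D.f.toLinearMap + θ) (fun i => e i * k i) (fun i => f i * l i) where
  pos := h.pos.twist D θθ θt θe θk kt kk ke
  neg := by
    have h1 : ∀ x i, D.op.χ.form x (R.op.Tp i) = D.χ.form x (R.Tp i) := fun x i => by
      change -D.χ.form x (R.Tm i) = _
      rw [D.χ.Tm_right, neg_neg]
    have h2 : ∀ i x, D.op.χ.form (R.op.Tp i) x = D.χ.form (R.Tp i) x := fun i x => by
      change -D.χ.form (R.Tm i) x = _
      rw [D.χ.Tm_left, neg_neg]
    have h3 : ∀ i j, D.op.χ.form (R.op.Tp i) (R.op.Tp j) = -D.χ.form (R.Tp i) (R.Tp j) :=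
      fun i j => by
        change -D.χ.form (R.Tm i) (R.Tm j) = _
        rw [D.χ.Tm_left, neg_neg, D.χ.Tm_right]
    have := h.neg.twist D.op (θ := -θ) (k := l)
      (fun x y => by rw [LinearMap.neg_apply, LinearMap.neg_apply, neg_mul_neg, neg_mul_neg, θθ])
      (fun x y => by rw [LinearMap.neg_apply, LinearMap.neg_apply, neg_mul_neg, neg_mul_neg, θt])
      (fun x i => by
        rw [LinearMap.neg_apply, neg_mul, mul_neg, θf, h1]
        change _ = _ + (half K * D.χ.form (D.f x) (R.Tp i)) • f i
        abel)
      (fun x i => by rw [LinearMap.neg_apply, neg_mul, mul_neg, θl])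
      (fun i y => by rw [LinearMap.neg_apply, neg_mul, mul_neg, lt, h2]; abel) ll
      (fun i j => by rw [lf, h3, mul_neg])
    rwa [LinearMap.neg_comp, ← neg_add] at this
  EF i := by
    have e1 : e i * k i * (f i * l i) - f i * l i * (e i * k i) =
        (e i * f i - f i * e i) * (k i * l i) := by
      rw [mul_assoc, ← mul_assoc (k i), kf, mul_assoc (f i) (l i), ← mul_assoc (l i), le,
        mul_assoc (e i) (l i), ← kl, sub_mul]
      simp only [mul_assoc]
    have e2 : hdiff K (t (R.Tp i) + θ (R'.Tp i)) (t (R.Tm i) + θ (R'.Tm i)) =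
        hdiff K (t (R.Tp i)) (t (R.Tm i)) * hexp K (θ (R'.Tp i)) := by
      rw [θTm, hdiff_add (show Commute _ _ from (θt _ _).symm)
        (show Commute _ _ from (θt _ _).symm).neg_right
        (show Commute _ _ from (θt _ _).symm).neg_right, neg_neg, hdiff_self_neg, mul_zero,
        add_zero]
    rw [e1, h.EF, hkl, LinearMap.add_apply, LinearMap.add_apply, LinearMap.comp_apply,
      LinearMap.comp_apply, LinearEquiv.coe_coe, D.Tp, D.Tm, e2, smul_mul_assoc]
  EF_ne i j hij := by
    change e i * k i * (f j * l j) = f j * l j * (e i * k i)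
    rw [mul_assoc, ← mul_assoc (k i), kf, mul_assoc (f j) (l j), ← mul_assoc (l j), le,
      mul_assoc (e i) (l j), ← kl, mul_assoc, ← mul_assoc, (h.EF_ne i j hij).eq]
    simp only [mul_assoc]

end Realization

end FoMp
end

noncomputable section
namespace FoMp
variable {K : Type*} [Field K]

namespace Realization

variable {n : ℕ} {A : Matrix (Fin n) (Fin n) ℤ} {d : Fin n → ℕ}
  {P P' : Matrix (Fin n) (Fin n) K⟦X⟧} {𝔥 𝔥' : Type*} [AddCommGroup 𝔥]
  [Module K⟦X⟧ 𝔥] [Module.Free K⟦X⟧ 𝔥] [Module.Finite K⟦X⟧ 𝔥] [AddCommGroup 𝔥']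
  [Module K⟦X⟧ 𝔥'] [Module.Free K⟦X⟧ 𝔥'] [Module.Finite K⟦X⟧ 𝔥'] {R : Realization P 𝔥}
  {R' : Realization P' 𝔥'}

/-! ### Torus automorphisms and weight derivations -/

variable (R) in
/-- The functionals that vanish on the `S_i`. -/
def antiDual : Submodule K⟦X⟧ (Module.Dual K⟦X⟧ 𝔥) where
  carrier := {ξ | ∀ i, ξ (R.Tm i) = -ξ (R.Tp i)}
  add_mem' h h' i := by simp [h i, h' i, add_comm]
  zero_mem' i := by simp
  smul_mem' c ξ h i := by simp [h i]

/-- Contraction with a toral form. -/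
def AltS.contract [CharZero K] (χ : R.AltS) : 𝔥 →ₗ[K⟦X⟧] R.antiDual :=
  χ.form.codRestrict _ fun x i => χ.Tm_right x i

variable {B : Type*} [Ring B] [Algebra K⟦X⟧ B]

lemma Sat.scale [CharZero K] [IsAdicComplete (hId K) B] {t : 𝔥 →ₗ[K⟦X⟧] B} {e f : Fin n → B}
    (h : R.Sat A d t e f) {c : Module.Dual K⟦X⟧ 𝔥} (hc : c ∈ R.antiDual) {z w : Fin n → B}
    (zt : ∀ i x, Commute (z i) (t x)) (wt : ∀ i x, Commute (w i) (t x))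
    (ze : ∀ i j, Commute (z i) (e j)) (zf : ∀ i j, Commute (z i) (f j))
    (we : ∀ i j, Commute (w i) (e j)) (wf : ∀ i j, Commute (w i) (f j))
    (zz : ∀ i j, Commute (z i) (z j)) (zw : ∀ i j, Commute (z i) (w j))
    (ww : ∀ i j, Commute (w i) (w j))
    (hzw : ∀ i, z i * w i = algebraMap K⟦X⟧ B (hexp K (c (R.Tp i)))) :
    R.Sat A d (t + Algebra.linearMap K⟦X⟧ B ∘ₗ c) (fun i => e i * z i) (fun i => f i * w i) := by
  have hc' : ∀ (x : 𝔥) (b : B), (Algebra.linearMap K⟦X⟧ B ∘ₗ c) x * b =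
      b * (Algebra.linearMap K⟦X⟧ B ∘ₗ c) x := fun x b => Algebra.commutes _ _
  have h0 : ∀ x y, (Twist.refl R).χ.form x y = 0 := fun _ _ => rfl
  refine h.twist (Twist.refl R) (fun x y => hc' x _) (fun x y => hc' x _) (fun x i => ?_)
    (fun x i => ?_) (fun x i => hc' x _) (fun x i => hc' x _) (fun i y => ?_) (fun i y => ?_)
    (fun i j => zz i j) (fun i j => ww i j) (fun i j => zw i j) (fun i j => ?_)
    (fun i j => zf i j) (fun i j => we i j) (fun i j => ?_) (fun i => ?_) (fun i => ?_)
  · rw [h0, mul_zero, zero_smul, add_zero, hc']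
  · rw [h0, mul_zero, zero_smul, sub_zero, hc']
  · rw [h0, mul_zero, zero_smul, add_zero, zt]
  · rw [h0, mul_zero, zero_smul, sub_zero, wt]
  · rw [h0, mul_zero, hexp_zero, one_smul, ze]
  · rw [h0, mul_zero, neg_zero, hexp_zero, one_smul, wf]
  · rw [LinearMap.comp_apply, hc i, map_neg]
    rfl
  · rw [hzw, ← hexp_algebraMap]
    rfl

lemma exists_aut [CharZero K] (hA : IsSymmetrizedCartan A d) (hP : IsCartanType A d P)
    {c : Module.Dual K⟦X⟧ 𝔥} (hc : c ∈ R.antiDual) {z w : Fin n → K⟦X⟧}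
    (hzw : ∀ i, z i * w i = hexp K (c (R.Tp i))) :
    ∃ g : R.U A d →ₐ[K⟦X⟧] R.U A d, (∀ x, g (R.T A d x) = R.T A d x + c x • 1) ∧
      (∀ i, g (R.E A d i) = z i • R.E A d i) ∧ ∀ i, g (R.F A d i) = w i • R.F A d i := by
  have hz : ∀ (r : K⟦X⟧) (b : R.U A d), Commute (algebraMap K⟦X⟧ (R.U A d) r) b :=
    fun r b => Algebra.commutes r b
  have h := (sat_U (R := R) hA hP).scale hc (z := fun i => algebraMap K⟦X⟧ _ (z i))
    (w := fun i => algebraMap K⟦X⟧ _ (w i)) (fun i x => hz _ _) (fun i x => hz _ _)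
    (fun i x => hz _ _) (fun i x => hz _ _) (fun i x => hz _ _) (fun i x => hz _ _)
    (fun i x => hz _ _) (fun i x => hz _ _) (fun i x => hz _ _)
    (fun i => (map_mul (algebraMap K⟦X⟧ (R.U A d)) _ _).symm.trans (congrArg _ (hzw i)))
  refine ⟨lift hA hP h, fun x => ?_, fun i => ?_, fun i => ?_⟩
  · rw [lift_T hA hP h, ← Algebra.algebraMap_eq_smul_one]
    rfl
  · rw [lift_E hA hP h, Algebra.smul_def, Algebra.commutes]
  · rw [lift_F hA hP h, Algebra.smul_def, Algebra.commutes]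

section Weight

variable [IsAdicComplete (hId K) B] {t : 𝔥 →ₗ[K⟦X⟧] B} {e f : Fin n → B}

/-- The diagonal representation on pairs. -/
def diagRep (B : Type*) [Ring B] [Algebra K⟦X⟧ B] : B →ₐ[K⟦X⟧] Module.End K⟦X⟧ (B × B) :=
  Algebra.lsmul K⟦X⟧ K⟦X⟧ (B × B)

omit [IsAdicComplete (hId K) B] in
lemma diagRep_apply (x a b : B) : diagRep (K := K) B x (a, b) = (x * a, x * b) := rfl

/-- The operator `(a, b) ↦ (a, c a + b)`. -/
def shear (B : Type*) [Ring B] [Algebra K⟦X⟧ B] (c : K⟦X⟧) : Module.End K⟦X⟧ (B × B) :=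
  (LinearMap.fst K⟦X⟧ B B).prod (c • LinearMap.fst K⟦X⟧ B B + LinearMap.snd K⟦X⟧ B B)

omit [IsAdicComplete (hId K) B] in
lemma shear_apply (c : K⟦X⟧) (a b : B) : shear B c (a, b) = (a, c • a + b) := rfl

omit [IsAdicComplete (hId K) B] in
lemma shear_mul (c c' : K⟦X⟧) : shear B c * shear B c' = shear B (c + c') := by
  refine LinearMap.ext fun ⟨a, b⟩ => ?_
  rw [Module.End.mul_apply, shear_apply, shear_apply, shear_apply, add_smul, add_assoc]

omit [IsAdicComplete (hId K) B] in
lemma commute_shear_diagRep (c : K⟦X⟧) (x : B) : Commute (shear B c) (diagRep B x) := by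
  refine LinearMap.ext fun ⟨a, b⟩ => ?_
  rw [Module.End.mul_apply, Module.End.mul_apply, shear_apply, diagRep_apply, diagRep_apply,
    shear_apply, mul_add, mul_smul_comm]

lemma Sat.shear [CharZero K] (h : R.Sat A d t e f) (c : Fin n → K⟦X⟧) :
    R.Sat A d ((diagRep B).toLinearMap ∘ₗ t) (fun i => diagRep B (e i) * shear B (c i))
      (fun i => diagRep B (f i) * shear B (-c i)) := by
  have hz : ∀ r b, Commute (FoMp.Realization.shear (K := K) B r) (diagRep B b) := commute_shear_diagRep
  have hs : ∀ r r', Commute (FoMp.Realization.shear (K := K) B r) (FoMp.Realization.shear B r') :=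
    fun r r' => by rw [Commute, SemiconjBy, shear_mul, shear_mul, add_comm]
  have := (h.map (diagRep B)).scale (Submodule.zero_mem R.antiDual)
    (z := fun i => FoMp.Realization.shear B (c i)) (w := fun i => FoMp.Realization.shear B (-c i))
    (fun i x => hz _ _) (fun i x => hz _ _)
    (fun i x => hz _ _) (fun i x => hz _ _) (fun i x => hz _ _) (fun i x => hz _ _)
    (fun i x => hs _ _) (fun i x => hs _ _) (fun i x => hs _ _) (fun i => by
      rw [shear_mul, add_neg_cancel, LinearMap.zero_apply, hexp_zero, map_one]
      refine LinearMap.ext fun ⟨a, b⟩ => ?_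
      rw [shear_apply, zero_smul, zero_add]
      rfl)
  rwa [LinearMap.comp_zero, add_zero] at this

omit [Module.Free K⟦X⟧ 𝔥] [Module.Finite K⟦X⟧ 𝔥] in
lemma weight_of_rep {U : Type*} [Ring U] [Algebra K⟦X⟧ U] [IsAdicComplete (hId K) U]
    {t : 𝔥 →ₗ[K⟦X⟧] U} {e f : Fin n → U}
    (hs : IsTopGen K (Set.range t ∪ Set.range e ∪ Set.range f)) (c : Fin n → K⟦X⟧)
    (g : U →ₐ[K⟦X⟧] Module.End K⟦X⟧ (U × U)) (ht : ∀ x, g (t x) = diagRep U (t x))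
    (he : ∀ i, g (e i) = diagRep U (e i) * shear U (c i))
    (hf : ∀ i, g (f i) = diagRep U (f i) * shear U (-c i)) :
    ∃ Θ : Module.End K⟦X⟧ U, Θ 1 = 0 ∧ (∀ x b, Θ (t x * b) = t x * Θ b) ∧
      (∀ i b, Θ (e i * b) = e i * (Θ b + c i • b)) ∧
      ∀ i b, Θ (f i * b) = f i * (Θ b - c i • b) := by
  have h1 : ∀ b, (g b (1, 0)).1 = b := fun b => by
    have : LinearMap.fst K⟦X⟧ U U ∘ₗ LinearMap.applyₗ (1, 0) ∘ₗ g.toLinearMap = .id := by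
      refine hs.linearMap_ext ?_ ?_
      · simp
      · rintro _ ((⟨x, rfl⟩ | ⟨i, rfl⟩) | ⟨i, rfl⟩) b hb <;>
          change (g (_ * b) (1, 0)).1 = _ * b <;> change (g b (1, 0)).1 = b at hb <;>
          rw [map_mul, Module.End.mul_apply, ← Prod.mk.eta (p := g b (1, 0)), hb]
        · rw [ht, diagRep_apply]
        · rw [he, Module.End.mul_apply, shear_apply, diagRep_apply]
        · rw [hf, Module.End.mul_apply, shear_apply, diagRep_apply]
    exact LinearMap.congr_fun this b
  refine ⟨LinearMap.snd K⟦X⟧ U U ∘ₗ LinearMap.applyₗ (1, 0) ∘ₗ g.toLinearMap, ?_, fun x b => ?_,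
    fun i b => ?_, fun i b => ?_⟩
  · simp
  · change (g (_ * b) (1, 0)).2 = _ * (g b (1, 0)).2
    rw [map_mul, Module.End.mul_apply, ← Prod.mk.eta (p := g b (1, 0)), ht, diagRep_apply]
  · change (g (_ * b) (1, 0)).2 = _ * ((g b (1, 0)).2 + _)
    rw [map_mul, Module.End.mul_apply, ← Prod.mk.eta (p := g b (1, 0)), he, Module.End.mul_apply,
      shear_apply, diagRep_apply, h1, add_comm]
  · change (g (_ * b) (1, 0)).2 = _ * ((g b (1, 0)).2 - _)
    rw [map_mul, Module.End.mul_apply, ← Prod.mk.eta (p := g b (1, 0)), hf, Module.End.mul_apply,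
      shear_apply, diagRep_apply, h1, neg_smul, neg_add_eq_sub]

end Weight

lemma exists_weight [CharZero K] (hA : IsSymmetrizedCartan A d) (hP : IsCartanType A d P)
    (c : Fin n → K⟦X⟧) :
    ∃ Θ : Module.End K⟦X⟧ (R.U A d), Θ 1 = 0 ∧ (∀ x b, Θ (R.T A d x * b) = R.T A d x * Θ b) ∧
      (∀ i b, Θ (R.E A d i * b) = R.E A d i * (Θ b + c i • b)) ∧
      ∀ i b, Θ (R.F A d i * b) = R.F A d i * (Θ b - c i • b) := by
  have h := (sat_U (R := R) hA hP).shear c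
  exact weight_of_rep (isTopGen_U A d R) c (lift hA hP h) (fun x => lift_T hA hP h x)
    (fun i => lift_E hA hP h i) (fun i => lift_F hA hP h i)

/-- The weight derivations and the torus automorphisms of an algebra topologically generated by
`t`, `e`, `f`: `lam ξ` (resp. `rho ξ`) is the automorphism that shifts `t` by `ξ / 2` and rescales
only the `e_i` (resp. the `f_i`). -/
structure TorusOps (R : Realization P 𝔥) {B : Type*} [Ring B] [Algebra K⟦X⟧ B]
    [IsAdicComplete (hId K) B] (t : 𝔥 →ₗ[K⟦X⟧] B) (e f : Fin n → B) where
  gen : IsTopGen K (Set.range t ∪ Set.range e ∪ Set.range f)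
  /-- the weight derivations -/
  Θ : Module.Dual K⟦X⟧ 𝔥 →ₗ[K⟦X⟧] Module.End K⟦X⟧ B
  Θ_one : ∀ ξ, Θ ξ 1 = 0
  Θ_t : ∀ ξ x b, Θ ξ (t x * b) = t x * Θ ξ b
  Θ_e : ∀ ξ i b, Θ ξ (e i * b) = e i * (Θ ξ b + ξ (R.Tp i) • b)
  Θ_f : ∀ ξ i b, Θ ξ (f i * b) = f i * (Θ ξ b - ξ (R.Tp i) • b)
  /-- the automorphisms rescaling the `e_i` -/
  lam : R.antiDual → B →ₐ[K⟦X⟧] B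
  lam_t : ∀ ξ x, lam ξ (t x) = t x + (half K * ξ.1 x) • 1
  lam_e : ∀ ξ i, lam ξ (e i) = hexp K (half K * ξ.1 (R.Tp i)) • e i
  lam_f : ∀ ξ i, lam ξ (f i) = f i
  /-- the automorphisms rescaling the `f_i` -/
  rho : R.antiDual → B →ₐ[K⟦X⟧] B
  rho_t : ∀ ξ x, rho ξ (t x) = t x + (half K * ξ.1 x) • 1
  rho_e : ∀ ξ i, rho ξ (e i) = e i
  rho_f : ∀ ξ i, rho ξ (f i) = hexp K (half K * ξ.1 (R.Tp i)) • f i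

lemma nonempty_torusOps [CharZero K] (hA : IsSymmetrizedCartan A d) (hP : IsCartanType A d P) :
    Nonempty (R.TorusOps (R.T A d) (R.E A d) (R.F A d)) := by
  choose Θ h1 ht he hf using fun i => exists_weight (R := R) hA hP (Pi.single i 1)
  have hl := fun ξ : R.antiDual => exists_aut (R := R) hA hP (c := half K • ξ.1)
    (Submodule.smul_mem _ _ ξ.2) (z := fun i => hexp K (half K * ξ.1 (R.Tp i))) (w := fun _ => 1)
    (fun i => mul_one _)
  have hr := fun ξ : R.antiDual => exists_aut (R := R) hA hP (c := half K • ξ.1)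
    (Submodule.smul_mem _ _ ξ.2) (z := fun _ => 1) (w := fun i => hexp K (half K * ξ.1 (R.Tp i)))
    (fun i => one_mul _)
  choose lam hl1 hl2 hl3 using hl
  choose rho hr1 hr2 hr3 using hr
  have hT : ∀ (ξ : Module.Dual K⟦X⟧ 𝔥) (x : R.U A d),
      (∑ i, (Module.Dual.eval K⟦X⟧ 𝔥 (R.Tp i)).smulRight (Θ i)) ξ x =
        ∑ i, ξ (R.Tp i) • Θ i x := fun ξ x => by
    simp only [LinearMap.sum_apply, LinearMap.smulRight_apply, LinearMap.smul_apply,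
      Module.Dual.eval_apply]
  refine ⟨{
    gen := isTopGen_U A d R
    Θ := ∑ i, (Module.Dual.eval K⟦X⟧ 𝔥 (R.Tp i)).smulRight (Θ i)
    Θ_one := fun ξ => by simp only [hT, h1, smul_zero, Finset.sum_const_zero]
    Θ_t := fun ξ x b => by simp only [hT, ht, Finset.mul_sum, mul_smul_comm]
    Θ_e := fun ξ i b => ?_
    Θ_f := fun ξ i b => ?_
    lam := lam
    lam_t := hl1
    lam_e := hl2
    lam_f := fun ξ i => (hl3 ξ i).trans (one_smul _ _)
    rho := rho
    rho_t := hr1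
    rho_e := fun ξ i => (hr2 ξ i).trans (one_smul _ _)
    rho_f := hr3 }⟩
  · rw [hT, hT]
    simp only [he, Pi.single_apply, ite_smul, one_smul, zero_smul]
    simp only [mul_add, smul_add, Finset.sum_add_distrib, Finset.mul_sum, mul_smul_comm]
    congr 1
    rw [Finset.sum_eq_single i (fun j _ hj => by rw [if_neg hj.symm, mul_zero, smul_zero])
      (fun h => absurd (Finset.mem_univ i) h), if_pos rfl]
  · rw [hT, hT]
    simp only [hf, Pi.single_apply, ite_smul, one_smul, zero_smul]
    simp only [mul_sub, smul_sub, Finset.sum_sub_distrib, Finset.mul_sum, mul_smul_comm]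
    congr 1
    rw [Finset.sum_eq_single i (fun j _ hj => by rw [if_neg hj.symm, mul_zero, smul_zero])
      (fun h => absurd (Finset.mem_univ i) h), if_pos rfl]

end Realization

end FoMp
end

noncomputable section
namespace FoMp
variable {K : Type*} [Field K]

lemma hexp_apply_of_apply_eq_zero {M : Type*} [AddCommGroup M] [Module K⟦X⟧ M]
    [IsAdicComplete (hId K) M] {D : Module.End K⟦X⟧ M} {m : M} (hD : D m = 0) :
    hexp K D m = m := by
  rw [hexp_eq, LinearMap.add_apply, LinearMap.smul_apply, Module.End.one_apply, hexpm1]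
  have h : ∀ (f : ℕ → Module.End K⟦X⟧ M), (∀ k, f k m = 0) → hsum K f m = 0 := fun f hf => by
    refine eq_of_forall_pow (K := K) fun n => ?_
    obtain ⟨z, hz⟩ := hsum_spec (K := K) f n
    refine ⟨z m, ?_⟩
    rw [hz, LinearMap.add_apply, LinearMap.sum_apply, LinearMap.smul_apply,
      Finset.sum_eq_zero fun k _ => by rw [LinearMap.smul_apply, hf, smul_zero]]
  rw [h _ fun k => by rw [LinearMap.smul_apply, pow_succ, Module.End.mul_apply, hD, map_zero,
    smul_zero], smul_zero, add_zero]

namespace Realization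

variable {n : ℕ} {A : Matrix (Fin n) (Fin n) ℤ} {d : Fin n → ℕ}
  {P P' : Matrix (Fin n) (Fin n) K⟦X⟧} {𝔥 𝔥' : Type*} [AddCommGroup 𝔥]
  [Module K⟦X⟧ 𝔥] [Module.Free K⟦X⟧ 𝔥] [Module.Finite K⟦X⟧ 𝔥] [AddCommGroup 𝔥']
  [Module K⟦X⟧ 𝔥'] [Module.Free K⟦X⟧ 𝔥'] [Module.Finite K⟦X⟧ 𝔥'] {R : Realization P 𝔥}
  {R' : Realization P' 𝔥'} {B : Type*} [Ring B] [Algebra K⟦X⟧ B] [IsAdicComplete (hId K) B]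
  {t : 𝔥 →ₗ[K⟦X⟧] B} {e f : Fin n → B} (O : R.TorusOps t e f)

namespace TorusOps

/-! ### Relations between the torus operators -/

include O in
lemma linearMap_ext {N : Type*} [AddCommGroup N] [Module K⟦X⟧ N] [IsAdicComplete (hId K) N]
    {F G : B →ₗ[K⟦X⟧] N} (one : F 1 = G 1)
    (ht : ∀ x b, F b = G b → F (t x * b) = G (t x * b))
    (he : ∀ i b, F b = G b → F (e i * b) = G (e i * b))
    (hf : ∀ i b, F b = G b → F (f i * b) = G (f i * b)) (b : B) : F b = G b := by
  refine LinearMap.congr_fun (O.gen.linearMap_ext one ?_) b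
  rintro _ ((⟨x, rfl⟩ | ⟨i, rfl⟩) | ⟨i, rfl⟩) b hb
  exacts [ht x b hb, he i b hb, hf i b hb]

lemma Θ_Θ (ξ η : Module.Dual K⟦X⟧ 𝔥) (b : B) : O.Θ ξ (O.Θ η b) = O.Θ η (O.Θ ξ b) := by
  refine O.linearMap_ext (F := O.Θ ξ ∘ₗ O.Θ η) (G := O.Θ η ∘ₗ O.Θ ξ) ?_ (fun x b h => ?_)
    (fun i b h => ?_) (fun i b h => ?_) b <;> simp only [LinearMap.comp_apply] at *
  · simp only [O.Θ_one, map_zero]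
  · simp only [O.Θ_t, h]
  · simp only [O.Θ_e, h, map_add, map_smul, smul_add, smul_comm (η _)]
    abel_nf
  · simp only [O.Θ_f, h, map_sub, map_smul, smul_sub, smul_comm (η _)]
    abel_nf

lemma Θ_lam (ξ : Module.Dual K⟦X⟧ 𝔥) (η : R.antiDual) (b : B) :
    O.Θ ξ (O.lam η b) = O.lam η (O.Θ ξ b) := by
  refine O.linearMap_ext (F := O.Θ ξ ∘ₗ (O.lam η).toLinearMap) (G := (O.lam η).toLinearMap ∘ₗ O.Θ ξ)
    ?_ (fun x b h => ?_) (fun i b h => ?_) (fun i b h => ?_) b <;>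
    simp only [LinearMap.comp_apply, AlgHom.toLinearMap_apply] at *
  · simp only [map_one, O.Θ_one, map_zero]
  · simp only [map_mul, O.lam_t, O.Θ_t, h, add_mul, map_add, smul_mul_assoc, map_smul, one_mul]
  · simp only [map_mul, O.lam_e, O.Θ_e, h, map_add, smul_mul_assoc, map_smul]
  · simp only [map_mul, O.lam_f, O.Θ_f, h, map_sub, map_smul]

lemma Θ_rho (ξ : Module.Dual K⟦X⟧ 𝔥) (η : R.antiDual) (b : B) :
    O.Θ ξ (O.rho η b) = O.rho η (O.Θ ξ b) := by
  refine O.linearMap_ext (F := O.Θ ξ ∘ₗ (O.rho η).toLinearMap) (G := (O.rho η).toLinearMap ∘ₗ O.Θ ξ)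
    ?_ (fun x b h => ?_) (fun i b h => ?_) (fun i b h => ?_) b <;>
    simp only [LinearMap.comp_apply, AlgHom.toLinearMap_apply] at *
  · simp only [map_one, O.Θ_one, map_zero]
  · simp only [map_mul, O.rho_t, O.Θ_t, h, add_mul, map_add, smul_mul_assoc, map_smul, one_mul]
  · simp only [map_mul, O.rho_e, O.Θ_e, h, map_add, map_smul]
  · simp only [map_mul, O.rho_f, O.Θ_f, h, map_sub, smul_mul_assoc, map_smul]

lemma lam_lam (ξ η : R.antiDual) (b : B) : O.lam ξ (O.lam η b) = O.lam η (O.lam ξ b) := by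
  refine O.linearMap_ext (F := ((O.lam ξ).comp (O.lam η)).toLinearMap)
    (G := ((O.lam η).comp (O.lam ξ)).toLinearMap)
    ?_ (fun x b h => ?_) (fun i b h => ?_) (fun i b h => ?_) b <;>
    simp only [AlgHom.toLinearMap_apply, AlgHom.comp_apply] at *
  · simp only [map_one]
  · simp only [map_mul, O.lam_t, h, map_add, map_smul, map_one, add_right_comm]
  · simp only [map_mul, O.lam_e, h, map_smul]
    rw [smul_comm]
  · simp only [map_mul, O.lam_f, h]

lemma rho_rho (ξ η : R.antiDual) (b : B) : O.rho ξ (O.rho η b) = O.rho η (O.rho ξ b) := by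
  refine O.linearMap_ext (F := ((O.rho ξ).comp (O.rho η)).toLinearMap)
    (G := ((O.rho η).comp (O.rho ξ)).toLinearMap)
    ?_ (fun x b h => ?_) (fun i b h => ?_) (fun i b h => ?_) b <;>
    simp only [AlgHom.toLinearMap_apply, AlgHom.comp_apply] at *
  · simp only [map_one]
  · simp only [map_mul, O.rho_t, h, map_add, map_smul, map_one, add_right_comm]
  · simp only [map_mul, O.rho_e, h]
  · simp only [map_mul, O.rho_f, h, map_smul]
    rw [smul_comm]

lemma lam_rho (ξ η : R.antiDual) (b : B) : O.lam ξ (O.rho η b) = O.rho η (O.lam ξ b) := by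
  refine O.linearMap_ext (F := ((O.lam ξ).comp (O.rho η)).toLinearMap)
    (G := ((O.rho η).comp (O.lam ξ)).toLinearMap)
    ?_ (fun x b h => ?_) (fun i b h => ?_) (fun i b h => ?_) b <;>
    simp only [AlgHom.toLinearMap_apply, AlgHom.comp_apply] at *
  · simp only [map_one]
  · simp only [map_mul, O.rho_t, O.lam_t, h, map_add, map_smul, map_one, add_right_comm]
  · simp only [map_mul, O.rho_e, O.lam_e, h, map_smul]
  · simp only [map_mul, O.rho_f, O.lam_f, h, map_smul]

variable [CharZero K]

lemma lam_neg (ξ : R.antiDual) (b : B) : O.lam (-ξ) (O.lam ξ b) = b := by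
  refine O.linearMap_ext (F := ((O.lam (-ξ)).comp (O.lam ξ)).toLinearMap) (G := .id)
    ?_ (fun x b h => ?_) (fun i b h => ?_) (fun i b h => ?_) b <;>
    simp only [AlgHom.toLinearMap_apply, AlgHom.comp_apply, LinearMap.id_apply] at *
  · simp only [map_one]
  · simp only [map_mul, O.lam_t, h, map_add, map_smul, map_one, Submodule.coe_neg,
      LinearMap.neg_apply, mul_neg, neg_smul, neg_add_cancel_right]
  · simp only [map_mul, O.lam_e, h, map_smul, smul_smul, Submodule.coe_neg,
      LinearMap.neg_apply, mul_neg, hexp_mul_neg, one_smul]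
  · simp only [map_mul, O.lam_f, h]

lemma rho_neg (ξ : R.antiDual) (b : B) : O.rho (-ξ) (O.rho ξ b) = b := by
  refine O.linearMap_ext (F := ((O.rho (-ξ)).comp (O.rho ξ)).toLinearMap) (G := .id)
    ?_ (fun x b h => ?_) (fun i b h => ?_) (fun i b h => ?_) b <;>
    simp only [AlgHom.toLinearMap_apply, AlgHom.comp_apply, LinearMap.id_apply] at *
  · simp only [map_one]
  · simp only [map_mul, O.rho_t, h, map_add, map_smul, map_one, Submodule.coe_neg,
      LinearMap.neg_apply, mul_neg, neg_smul, neg_add_cancel_right]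
  · simp only [map_mul, O.rho_e, h]
  · simp only [map_mul, O.rho_f, h, map_smul, smul_smul, Submodule.coe_neg,
      LinearMap.neg_apply, mul_neg, hexp_mul_neg, one_smul]

omit [CharZero K] in
lemma Θ_mul (ξ : Module.Dual K⟦X⟧ 𝔥) (a b : B) : O.Θ ξ (a * b) = O.Θ ξ a * b + a * O.Θ ξ b := by
  refine O.linearMap_ext (F := O.Θ ξ ∘ₗ LinearMap.mulRight K⟦X⟧ b)
    (G := LinearMap.mulRight K⟦X⟧ b ∘ₗ O.Θ ξ + LinearMap.mulRight K⟦X⟧ (O.Θ ξ b))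
    ?_ (fun x a h => ?_) (fun i a h => ?_) (fun i a h => ?_) a <;>
    simp only [LinearMap.comp_apply, LinearMap.add_apply, LinearMap.mulRight_apply] at *
  · simp only [O.Θ_one, one_mul, zero_mul, zero_add]
  · simp only [O.Θ_t, mul_assoc, h, mul_add]
  · simp only [O.Θ_e, mul_assoc, h, mul_add, add_mul, smul_mul_assoc, add_right_comm]
  · simp only [O.Θ_f, mul_assoc, h, mul_add, sub_mul, smul_mul_assoc, mul_sub]
    abel

lemma hexp_Θ (ξ : R.antiDual) (b : B) :
    hexp K (half K • O.Θ ξ.1) b = O.lam ξ (O.rho (-ξ) b) := by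
  have hc : ∀ (D : Module.End K⟦X⟧ B) (x : B) (r : K⟦X⟧), (∀ b, D (x * b) = x * (D b + r • b)) →
      ∀ b, hexp K D (x * b) = hexp K r • (x * hexp K D b) := fun D x r h b => by
    have := hexp_mul_of_commutator (A := Module.End K⟦X⟧ B) (t := D)
      (e := LinearMap.mulLeft K⟦X⟧ x) (r := r) (LinearMap.ext fun b => by
        simp only [LinearMap.sub_apply, Module.End.mul_apply, LinearMap.mulLeft_apply,
          LinearMap.smul_apply, h, mul_add, mul_smul_comm, add_sub_cancel_left])
    exact LinearMap.congr_fun this b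
  refine O.linearMap_ext (F := hexp K (half K • O.Θ ξ.1))
    (G := ((O.lam ξ).comp (O.rho (-ξ))).toLinearMap)
    ?_ (fun x b h => ?_) (fun i b h => ?_) (fun i b h => ?_) b <;>
    simp only [AlgHom.toLinearMap_apply, AlgHom.comp_apply] at *
  · rw [hexp_apply_of_apply_eq_zero (by simp [O.Θ_one]), map_one (O.rho _), map_one (O.lam _)]
  · rw [hc _ _ 0 (fun b => by simp [O.Θ_t]), h, hexp_zero, one_smul, map_mul, map_mul, O.rho_t,
      map_add, O.lam_t, map_smul, map_one]
    simp
  · rw [hc _ _ (half K * ξ.1 (R.Tp i)) (fun b => by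
      simp [O.Θ_e, mul_add, smul_smul]), h, map_mul, map_mul, O.rho_e, O.lam_e, smul_mul_assoc]
  · rw [hc _ _ (half K * -ξ.1 (R.Tp i)) (fun b => by
      simp [O.Θ_f, mul_add, smul_smul, sub_eq_add_neg]), h, map_mul, map_mul, O.rho_f,
      map_smul, O.lam_f, smul_mul_assoc]
    rfl

/-! ### The twisted representation -/

/-- The toral operators of the twisted representation. -/
def twT (D : Twist R' R) : 𝔥' →ₗ[K⟦X⟧] Module.End K⟦X⟧ B :=
  (LinearMap.mul K⟦X⟧ B ∘ₗ t) ∘ₗ D.f.toLinearMap + half K • O.Θ ∘ₗ D.χ.form ∘ₗ D.f.toLinearMap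

/-- The positive generators of the twisted representation. -/
def twE (D : Twist R' R) (i : Fin n) : Module.End K⟦X⟧ B :=
  LinearMap.mulLeft K⟦X⟧ (e i) * (O.lam (D.χ.contract (R.Tp i))).toLinearMap

/-- The negative generators of the twisted representation. -/
def twF (D : Twist R' R) (i : Fin n) : Module.End K⟦X⟧ B :=
  LinearMap.mulLeft K⟦X⟧ (f i) * (O.rho (-D.χ.contract (R.Tp i))).toLinearMap

lemma sat_tw (D : Twist R' R) (h : R.Sat A d t e f) :
    R'.Sat A d (O.twT D) (O.twE D) (O.twF D) := by
  have hneg : ∀ (ξ : R.antiDual) x, (-ξ).1 x = -ξ.1 x := fun _ _ => rfl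
  have hcon : ∀ x y, (D.χ.contract x).1 y = D.χ.form x y := fun _ _ => rfl
  refine (h.map (Algebra.lmul K⟦X⟧ B)).twist D
    (θ := half K • O.Θ ∘ₗ D.χ.form ∘ₗ D.f.toLinearMap)
    (k := fun i => (O.lam (D.χ.contract (R.Tp i))).toLinearMap)
    (l := fun i => (O.rho (-D.χ.contract (R.Tp i))).toLinearMap) ?_ ?_ ?_ ?_ ?_ ?_ ?_ ?_ ?_ ?_ ?_ ?_
    ?_ ?_ ?_ ?_ ?_
  · exact fun x y => LinearMap.ext fun b => by simp [O.Θ_Θ (D.χ.form (D.f x))]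
  · exact fun x y => LinearMap.ext fun b => by simp [O.Θ_t]
  · exact fun x i => LinearMap.ext fun b => by simp [O.Θ_e, mul_add, smul_smul]
  · exact fun x i => LinearMap.ext fun b => by simp [O.Θ_f, mul_sub, smul_smul, smul_sub]
  · exact fun x i => LinearMap.ext fun b => by simp [O.Θ_lam]
  · exact fun x i => LinearMap.ext fun b => by simp [O.Θ_rho]
  · exact fun i y => LinearMap.ext fun b => by simp [O.lam_t, add_mul, hcon]
  · exact fun i y => LinearMap.ext fun b => by simp [O.rho_t, add_mul, hcon, sub_eq_add_neg]
  · exact fun i j => LinearMap.ext fun b => O.lam_lam _ _ b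
  · exact fun i j => LinearMap.ext fun b => O.rho_rho _ _ b
  · exact fun i j => LinearMap.ext fun b => O.lam_rho _ _ b
  · exact fun i j => LinearMap.ext fun b => by simp [O.lam_e, hcon]
  · exact fun i j => LinearMap.ext fun b => by simp [O.lam_f]
  · exact fun i j => LinearMap.ext fun b => by simp [O.rho_e]
  · exact fun i j => LinearMap.ext fun b => by simp [O.rho_f, hcon]
  · intro i
    simp only [LinearMap.smul_apply, LinearMap.comp_apply, LinearEquiv.coe_coe, D.Tm, D.Tp]
    rw [← smul_neg, ← map_neg]
    congr 2
    exact LinearMap.ext fun y => D.χ.Tm_left y i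
  · intro i
    refine LinearMap.ext fun b => ?_
    simp only [LinearMap.smul_apply, LinearMap.comp_apply, LinearEquiv.coe_coe, D.Tp]
    exact (O.hexp_Θ (D.χ.contract (R.Tp i)) b).symm

end TorusOps

end Realization

end FoMp
end

noncomputable section
namespace FoMp
variable {K : Type*} [Field K]

section CmapLinear

variable {M N P Q : Type*} [AddCommGroup M] [Module K⟦X⟧ M] [AddCommGroup N] [Module K⟦X⟧ N]
  [AddCommGroup P] [Module K⟦X⟧ P] [AddCommGroup Q] [Module K⟦X⟧ Q]

variable (K M N P Q) in
/-- `f ⊗̂ g` as a bilinear function of `f` and `g`. -/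
def cmapₗ : (M →ₗ[K⟦X⟧] P) →ₗ[K⟦X⟧] (N →ₗ[K⟦X⟧] Q) →ₗ[K⟦X⟧]
    CTensor K M N →ₗ[K⟦X⟧] CTensor K P Q :=
  LinearMap.mk₂ K⟦X⟧ (cmap K)
    (fun f f' g => ctensor_ext fun m n => by
      simp only [cmap_apply_tmul, LinearMap.add_apply, map_add])
    (fun c f g => ctensor_ext fun m n => by
      simp only [cmap_apply_tmul, LinearMap.smul_apply, map_smul])
    (fun f g g' => ctensor_ext fun m n => by
      simp only [cmap_apply_tmul, LinearMap.add_apply, map_add])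
    (fun c f g => ctensor_ext fun m n => by
      simp only [cmap_apply_tmul, LinearMap.smul_apply, map_smul])

lemma cmapₗ_apply (f : M →ₗ[K⟦X⟧] P) (g : N →ₗ[K⟦X⟧] Q) : cmapₗ K M N P Q f g = cmap K f g := rfl

end CmapLinear

section

variable {A B : Type*} [Ring A] [Algebra K⟦X⟧ A] [Ring B] [Algebra K⟦X⟧ B]

lemma tmul_mul_eq_cmap (a : A) (b : B) (w : CTensor K A B) :
    tmul K a b * w = cmap K (LinearMap.mulLeft K⟦X⟧ a) (LinearMap.mulLeft K⟦X⟧ b) w := by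
  have : LinearMap.mulLeft K⟦X⟧ (tmul K a b) =
      cmap K (LinearMap.mulLeft K⟦X⟧ a) (LinearMap.mulLeft K⟦X⟧ b) := ctensor_ext fun m n => by
    rw [LinearMap.mulLeft_apply, tmul_mul_tmul, cmap_apply_tmul]
    rfl
  exact LinearMap.congr_fun this w

/-- `F ⊗̂ 1 + 1 ⊗̂ G`. -/
abbrev cmapDer (F : A →ₗ[K⟦X⟧] A) (G : B →ₗ[K⟦X⟧] B) : CTensor K A B →ₗ[K⟦X⟧] CTensor K A B :=
  cmap K F .id + cmap K .id G

/-- A derivation of a tensor factor extends to a derivation of the completed tensor product. -/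
lemma cmap_derivation {F : A →ₗ[K⟦X⟧] A} {G : B →ₗ[K⟦X⟧] B}
    (hF : ∀ a b, F (a * b) = F a * b + a * F b) (hG : ∀ a b, G (a * b) = G a * b + a * G b)
    (x y : CTensor K A B) :
    cmapDer F G (x * y) =
      cmapDer F G x * y + x * cmapDer F G y := by
  have : (LinearMap.mul K⟦X⟧ (CTensor K A B)).compr₂ (cmapDer F G) =
      (LinearMap.mul K⟦X⟧ (CTensor K A B)).comp (cmapDer F G) +
      (LinearMap.mul K⟦X⟧ (CTensor K A B)).compl₂ (cmapDer F G) :=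
    ctensor_ext₂ fun m n p q => by
      simp only [LinearMap.compr₂_apply, LinearMap.mul_apply', LinearMap.add_apply,
        LinearMap.comp_apply, LinearMap.compl₂_apply, tmul_mul_tmul, cmap_apply_tmul, hF, hG,
        map_add, LinearMap.id_apply]
      abel
  exact LinearMap.congr_fun₂ this x y

variable [IsAdicComplete (hId K) B]

/-- The coproduct as an algebra homomorphism. -/
def HopfStr.comulHom (H : HopfStr K B) (hmul : ∀ a b, H.mul a b = a * b) (hone : H.one = 1) :
    B →ₐ[K⟦X⟧] CTensor K B B :=
  AlgHom.ofLinearMap H.comul (by rw [← hone, H.comul_one]; rw [hone]; rfl) fun a b => by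
    rw [← hmul, H.comul_mul, ← cross_mul, show H.mul = LinearMap.mul K⟦X⟧ B from LinearMap.ext₂ hmul]

end

namespace Realization

variable {n : ℕ} {P P' : Matrix (Fin n) (Fin n) K⟦X⟧} {𝔥 𝔥' : Type*} [AddCommGroup 𝔥]
  [Module K⟦X⟧ 𝔥] [Module.Free K⟦X⟧ 𝔥] [Module.Finite K⟦X⟧ 𝔥] [AddCommGroup 𝔥']
  [Module K⟦X⟧ 𝔥'] [Module.Free K⟦X⟧ 𝔥'] [Module.Finite K⟦X⟧ 𝔥'] {R : Realization P 𝔥}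
  {R' : Realization P' 𝔥'} {B B' : Type*} [Ring B] [Algebra K⟦X⟧ B] [IsAdicComplete (hId K) B]
  [Ring B'] [Algebra K⟦X⟧ B'] [IsAdicComplete (hId K) B']
  {t : 𝔥 →ₗ[K⟦X⟧] B} {e f : Fin n → B} {t' : 𝔥' →ₗ[K⟦X⟧] B'} {e' f' : Fin n → B'}

/-- `Ψ` is the twisted representation. -/
structure TorusOps.IsTwRep (O : R.TorusOps t e f) (D : Twist R' R) (t' : 𝔥' →ₗ[K⟦X⟧] B')
    (e' f' : Fin n → B') [CharZero K] (Ψ : B' →ₐ[K⟦X⟧] Module.End K⟦X⟧ B) : Prop where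
  T : ∀ x b, Ψ (t' x) b = t (D.f x) * b + half K • O.Θ (D.χ.form (D.f x)) b
  E : ∀ i b, Ψ (e' i) b = e i * O.lam (D.χ.contract (R.Tp i)) b
  F : ∀ i b, Ψ (f' i) b = f i * O.rho (-D.χ.contract (R.Tp i)) b

/-- The orbit map `x ↦ Ψ(x) 1`. -/
def orbit (Ψ : B' →ₐ[K⟦X⟧] Module.End K⟦X⟧ B) : B' →ₗ[K⟦X⟧] B :=
  LinearMap.applyₗ (1 : B) ∘ₗ Ψ.toLinearMap

omit [IsAdicComplete (hId K) B] [IsAdicComplete (hId K) B'] in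
lemma orbit_mul (Ψ : B' →ₐ[K⟦X⟧] Module.End K⟦X⟧ B) (x y : B') :
    orbit Ψ (x * y) = Ψ x (orbit Ψ y) := by
  change Ψ (x * y) 1 = Ψ x (Ψ y 1)
  rw [map_mul, Module.End.mul_apply]

omit [IsAdicComplete (hId K) B] [IsAdicComplete (hId K) B'] in
lemma orbit_one (Ψ : B' →ₐ[K⟦X⟧] Module.End K⟦X⟧ B) : orbit Ψ 1 = 1 := by
  change Ψ 1 1 = 1
  rw [map_one Ψ, Module.End.one_apply]

variable [CharZero K] {O : R.TorusOps t e f} {O' : R'.TorusOps t' e' f'} {D : Twist R' R}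
  {D' : Twist R R'} {Ψ : B' →ₐ[K⟦X⟧] Module.End K⟦X⟧ B} {Ψ' : B →ₐ[K⟦X⟧] Module.End K⟦X⟧ B'}

/-! ### The orbit maps of a twist and of its inverse are inverse to each other -/

section Inverse

variable (D) in
/-- Pull-back of functionals along a twist. -/
def Twist.pull (ξ : R.antiDual) : R'.antiDual :=
  ⟨ξ.1 ∘ₗ D.f.toLinearMap, fun i => by
    simp only [LinearMap.comp_apply, LinearEquiv.coe_coe, D.Tm, D.Tp, ξ.2 i]⟩

lemma orbit_Θ (hΨ : O'.IsTwRep D' t e f Ψ') (ξ : Module.Dual K⟦X⟧ 𝔥) (b : B) :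
    orbit Ψ' (O.Θ ξ b) = O'.Θ (ξ ∘ₗ D.f.toLinearMap) (orbit Ψ' b) := by
  have hξ : ∀ i, (ξ ∘ₗ D.f.toLinearMap) (R'.Tp i) = ξ (R.Tp i) := fun i => by
    rw [LinearMap.comp_apply, LinearEquiv.coe_coe, D.Tp]
  refine O.linearMap_ext (F := orbit Ψ' ∘ₗ O.Θ ξ) (G := O'.Θ (ξ ∘ₗ D.f.toLinearMap) ∘ₗ orbit Ψ') ?_
    (fun x b h => ?_) (fun i b h => ?_) (fun i b h => ?_) b <;> simp only [LinearMap.comp_apply] at *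
  · rw [O.Θ_one, map_zero, orbit_one, O'.Θ_one]
  · simp only [O.Θ_t, orbit_mul, hΨ.T, h, map_add, map_smul, O'.Θ_t]
    rw [O'.Θ_Θ]
  · simp only [O.Θ_e, orbit_mul, hΨ.E, h, map_add, map_smul, O'.Θ_e, O'.Θ_lam, LinearMap.comp_apply, hξ]
  · simp only [O.Θ_f, orbit_mul, hΨ.F, h, map_sub, map_smul, O'.Θ_f, O'.Θ_rho, LinearMap.comp_apply, hξ]

lemma orbit_lam (hΨ : O'.IsTwRep D' t e f Ψ') (hf : ∀ x, D'.f (D.f x) = x) (ξ : R.antiDual) (b : B) :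
    orbit Ψ' (O.lam ξ b) = O'.lam (D.pull ξ) (orbit Ψ' b) := by
  have hξ : ∀ i, (D.pull ξ).1 (R'.Tp i) = ξ.1 (R.Tp i) := fun i => congrArg ξ.1 (D.Tp i)
  have hξ' : ∀ y, (D.pull ξ).1 (D'.f y) = ξ.1 y := fun y => by
    obtain ⟨x, rfl⟩ := D.f.surjective y
    rw [hf]
    rfl
  refine O.linearMap_ext (F := orbit Ψ' ∘ₗ (O.lam ξ).toLinearMap)
    (G := (O'.lam (D.pull ξ)).toLinearMap ∘ₗ orbit Ψ') ?_
    (fun x b h => ?_) (fun i b h => ?_) (fun i b h => ?_) b <;>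
    simp only [LinearMap.comp_apply, AlgHom.toLinearMap_apply] at *
  · rw [map_one, orbit_one, map_one]
  · simp only [map_mul, O.lam_t, add_mul, map_add, orbit_mul, hΨ.T, h, map_smul, O'.lam_t,
      O'.Θ_lam, smul_mul_assoc, one_mul, hξ']
    abel
  · simp only [map_mul, O.lam_e, smul_mul_assoc, map_smul, orbit_mul, hΨ.E, h, O'.lam_e, hξ]
    rw [O'.lam_lam]
  · simp only [map_mul, O.lam_f, orbit_mul, hΨ.F, h, O'.lam_f, O'.lam_rho]

lemma orbit_rho (hΨ : O'.IsTwRep D' t e f Ψ') (hf : ∀ x, D'.f (D.f x) = x) (ξ : R.antiDual) (b : B) :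
    orbit Ψ' (O.rho ξ b) = O'.rho (D.pull ξ) (orbit Ψ' b) := by
  have hξ : ∀ i, (D.pull ξ).1 (R'.Tp i) = ξ.1 (R.Tp i) := fun i => congrArg ξ.1 (D.Tp i)
  have hξ' : ∀ y, (D.pull ξ).1 (D'.f y) = ξ.1 y := fun y => by
    obtain ⟨x, rfl⟩ := D.f.surjective y
    rw [hf]
    rfl
  refine O.linearMap_ext (F := orbit Ψ' ∘ₗ (O.rho ξ).toLinearMap)
    (G := (O'.rho (D.pull ξ)).toLinearMap ∘ₗ orbit Ψ') ?_
    (fun x b h => ?_) (fun i b h => ?_) (fun i b h => ?_) b <;>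
    simp only [LinearMap.comp_apply, AlgHom.toLinearMap_apply] at *
  · rw [map_one, orbit_one, map_one]
  · simp only [map_mul, O.rho_t, add_mul, map_add, orbit_mul, hΨ.T, h, map_smul, O'.rho_t,
      O'.Θ_rho, smul_mul_assoc, one_mul, hξ']
    abel
  · simp only [map_mul, O.rho_e, orbit_mul, hΨ.E, h, O'.rho_e, O'.lam_rho]
  · simp only [map_mul, O.rho_f, smul_mul_assoc, map_smul, orbit_mul, hΨ.F, h, O'.rho_f, hξ]
    rw [O'.rho_rho]

include O' in
lemma orbit_orbit (hΨ : O.IsTwRep D t' e' f' Ψ) (hΨ' : O'.IsTwRep D' t e f Ψ')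
    (hf : ∀ x, D'.f (D.f x) = x) (hχ : ∀ x y, D'.χ.form x y = -D.χ.form (D.f x) (D.f y)) (x : B') :
    orbit Ψ' (orbit Ψ x) = x := by
  have hcon : ∀ i, D'.χ.contract (R'.Tp i) = -D.pull (D.χ.contract (R.Tp i)) := fun i =>
    Subtype.ext (LinearMap.ext fun y => by
      refine (hχ _ _).trans ?_
      rw [D.Tp]
      rfl)
  have hcon' : ∀ x, D'.χ.form x + D.χ.form (D.f x) ∘ₗ D.f.toLinearMap = 0 := fun x =>
    LinearMap.ext fun y => by
      rw [LinearMap.add_apply, hχ]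
      exact neg_add_cancel _
  refine O'.linearMap_ext (F := orbit Ψ' ∘ₗ orbit Ψ) (G := .id) ?_
    (fun x b h => ?_) (fun i b h => ?_) (fun i b h => ?_) x <;>
    simp only [LinearMap.comp_apply, LinearMap.id_apply] at *
  · rw [orbit_one, orbit_one]
  · rw [orbit_mul, hΨ.T, map_add, orbit_mul, hΨ'.T, map_smul, orbit_Θ (D := D) hΨ', h, hf, add_assoc,
      ← smul_add, ← LinearMap.add_apply, ← map_add, hcon', map_zero, LinearMap.zero_apply, smul_zero,
      add_zero]
  · rw [orbit_mul, hΨ.E, orbit_mul, hΨ'.E, orbit_lam hΨ' hf, h, hcon, O'.lam_neg]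
  · have : ∀ ξ : R.antiDual, D.pull (-ξ) = -D.pull ξ := fun _ => rfl
    rw [orbit_mul, hΨ.F, orbit_mul, hΨ'.F, orbit_rho hΨ' hf, h, hcon, this, O'.rho_neg]

end Inverse

/-! ### Compatibility with the coalgebra structures -/

section Coalgebra

variable {H : HopfStr K B} (hT : StdT H t) (hE : R.StdE H t e) (hF : R.StdF H t f)

include hT hE in
omit [CharZero K] in
lemma counit_Θ (ξ : Module.Dual K⟦X⟧ 𝔥) (hF : ∀ i, H.counit (f i) = 0) (b : B) :
    H.counit (O.Θ ξ b) = 0 := by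
  have hm : ∀ a b, H.counit (a * b) = H.counit a * H.counit b := fun a b => by
    rw [← hT.1, H.counit_mul]
  refine O.linearMap_ext (F := H.counit ∘ₗ O.Θ ξ) (G := 0) ?_
    (fun x b h => ?_) (fun i b h => ?_) (fun i b h => ?_) b <;>
    simp only [LinearMap.comp_apply, LinearMap.zero_apply] at *
  · rw [O.Θ_one, map_zero]
  · rw [O.Θ_t, hm, (hT.2.2 x).2.1, zero_mul]
  · rw [O.Θ_e, hm, (hE i).2.1, zero_mul]
  · rw [O.Θ_f, hm, hF, zero_mul]

omit [CharZero K] in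
lemma TorusOps.Θ_hexp (O : R.TorusOps t e f) (ξ : Module.Dual K⟦X⟧ 𝔥) (x : 𝔥) :
    O.Θ ξ (hexp K (t x)) = 0 := by
  have h1 : SemiconjBy (O.Θ ξ) (Algebra.lmul K⟦X⟧ B (t x)) (Algebra.lmul K⟦X⟧ B (t x)) :=
    LinearMap.ext fun b => O.Θ_t ξ x b
  have h2 := LinearMap.congr_fun (semiconjBy_hexp (K := K) h1).eq 1
  rw [← AlgHom.map_hexp] at h2
  simpa [O.Θ_one] using h2

include hT hE hF in
omit [CharZero K] in
lemma comul_Θ (ξ : Module.Dual K⟦X⟧ 𝔥) (b : B) :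
    H.comul (O.Θ ξ b) = cmapDer (O.Θ ξ) (O.Θ ξ) (H.comul b) := by
  have hm : ∀ a b, H.comul (a * b) = H.comul a * H.comul b :=
    map_mul (H.comulHom hT.1 hT.2.1)
  have hd := cmap_derivation (O.Θ_mul ξ) (O.Θ_mul ξ)
  have ht : ∀ x, O.Θ ξ (t x) = 0 := fun x => by
    rw [← mul_one (t x), O.Θ_t, O.Θ_one, mul_zero]
  have he : ∀ i, O.Θ ξ (e i) = ξ (R.Tp i) • e i := fun i => by
    rw [← mul_one (e i), O.Θ_e, O.Θ_one, zero_add, mul_one, mul_smul_comm, mul_one]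
  have hf : ∀ i, O.Θ ξ (f i) = -(ξ (R.Tp i) • f i) := fun i => by
    rw [← mul_one (f i), O.Θ_f, O.Θ_one, zero_sub, mul_one, mul_neg, mul_smul_comm, mul_one]
  refine O.linearMap_ext (F := H.comul ∘ₗ O.Θ ξ)
    (G := cmapDer (O.Θ ξ) (O.Θ ξ) ∘ₗ H.comul) ?_
    (fun x b h => ?_) (fun i b h => ?_) (fun i b h => ?_) b <;>
    simp only [LinearMap.comp_apply] at *
  · rw [O.Θ_one, map_zero, ← hT.2.1, H.comul_one, LinearMap.add_apply, cmap_apply_tmul,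
      cmap_apply_tmul, hT.2.1, O.Θ_one, map_zero, map_zero, LinearMap.zero_apply, add_zero]
  · have : cmapDer (O.Θ ξ) (O.Θ ξ) (H.comul (t x)) = 0 := by
      rw [(hT.2.2 x).1]
      simp only [LinearMap.add_apply, map_add, cmap_apply_tmul, ht, O.Θ_one, map_zero,
        LinearMap.zero_apply, add_zero]
    rw [O.Θ_t, hm, hm, hd, this, h, zero_mul, zero_add]
  · have : cmapDer (O.Θ ξ) (O.Θ ξ) (H.comul (e i)) =
        ξ (R.Tp i) • H.comul (e i) := by
      rw [(hE i).1]
      simp only [LinearMap.add_apply, map_add, cmap_apply_tmul, he, O.Θ_hexp, O.Θ_one, map_zero,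
        LinearMap.zero_apply, add_zero, zero_add, map_smul, LinearMap.smul_apply,
        LinearMap.id_apply, smul_add]
    rw [O.Θ_e, hm, hm, hd, this, map_add, h, map_smul, mul_add, smul_mul_assoc, mul_smul_comm,
      add_comm]
  · have : cmapDer (O.Θ ξ) (O.Θ ξ) (H.comul (f i)) =
        -(ξ (R.Tp i) • H.comul (f i)) := by
      have hL : O.Θ ξ (hexp K (-t (R.Tm i))) = 0 := by rw [← map_neg, O.Θ_hexp]
      rw [(hF i).1]
      simp only [LinearMap.add_apply, map_add, cmap_apply_tmul, hf, hL, O.Θ_one, map_zero,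
        LinearMap.zero_apply, add_zero, zero_add, map_smul, LinearMap.smul_apply, map_neg,
        LinearMap.neg_apply, LinearMap.id_apply, smul_add, neg_add]
    rw [O.Θ_f, hm, hm, hd, this, map_sub, h, map_smul, mul_sub, neg_mul, smul_mul_assoc,
      mul_smul_comm, neg_add_eq_sub]

omit [CharZero K] in
lemma map_hexp_of_shift {B C : Type*} [Ring B] [Algebra K⟦X⟧ B] [IsAdicComplete (hId K) B]
    [Ring C] [Algebra K⟦X⟧ C] [IsAdicComplete (hId K) C] [CharZero K] (g : B →ₐ[K⟦X⟧] C) {x : B}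
    {y : C} {c : K⟦X⟧} (h : g x = y + c • 1) : g (hexp K x) = hexp K c • hexp K y := by
  rw [AlgHom.map_hexp, h, ← Algebra.algebraMap_eq_smul_one, hexp_add_algebraMap]

include hT hE hF in
/-- The coproduct intertwines diagonal-compatible torus automorphisms. -/
lemma comul_aut (O : R.TorusOps t e f) {g g₁ g₂ : B →ₐ[K⟦X⟧] B} {c c₁ c₂ : 𝔥 → K⟦X⟧}
    {a a₂ b₁ b₂ : Fin n → K⟦X⟧} (hg : ∀ x, g (t x) = t x + c x • 1)
    (h₁ : ∀ x, g₁ (t x) = t x + c₁ x • 1) (h₂ : ∀ x, g₂ (t x) = t x + c₂ x • 1)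
    (hc : ∀ x, c x = c₁ x + c₂ x) (hge : ∀ i, g (e i) = a i • e i)
    (h₁e : ∀ i, g₁ (e i) = a i • e i) (h₂e : ∀ i, g₂ (e i) = a₂ i • e i)
    (hgf : ∀ i, g (f i) = b₂ i • f i) (h₁f : ∀ i, g₁ (f i) = b₁ i • f i)
    (h₂f : ∀ i, g₂ (f i) = b₂ i • f i) (ha : ∀ i, hexp K (c₁ (R.Tp i)) * a₂ i = a i)
    (hb : ∀ i, b₁ i * hexp K (-c₂ (R.Tm i)) = b₂ i) (x : B) :
    H.comul (g x) = cmap K g₁.toLinearMap g₂.toLinearMap (H.comul x) := by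
  have hK : ∀ i, g₁ (hexp K (t (R.Tp i))) = hexp K (c₁ (R.Tp i)) • hexp K (t (R.Tp i)) := fun i =>
    map_hexp_of_shift g₁ (h₁ _)
  have hL : ∀ i, g₂ (hexp K (-t (R.Tm i))) = hexp K (-c₂ (R.Tm i)) • hexp K (-t (R.Tm i)) :=
    fun i => map_hexp_of_shift g₂ (by rw [map_neg, h₂, neg_add, neg_smul])
  have : (H.comulHom hT.1 hT.2.1).comp g = (cmapAlg g₁ g₂).comp (H.comulHom hT.1 hT.2.1) := by
    refine O.gen.algHom_ext ?_
    rintro _ ((⟨x, rfl⟩ | ⟨i, rfl⟩) | ⟨i, rfl⟩) <;>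
      change H.comul (g _) = cmapAlg g₁ g₂ (H.comul _)
    · have h1 : H.comul 1 = tmul K 1 1 := by rw [← hT.2.1, H.comul_one]
      rw [hg, H.comul.map_add, H.comul.map_smul, h1, (hT.2.2 x).1, map_add, cmapAlg_tmul,
        cmapAlg_tmul, map_one g₁, map_one g₂, h₁, h₂, hc, (tmul K).map_add, (tmul K).map_smul,
        (tmul K 1).map_add, (tmul K 1).map_smul, LinearMap.add_apply, LinearMap.smul_apply, add_smul]
      abel
    · rw [hge, H.comul.map_smul, (hE i).1, map_add, cmapAlg_tmul, cmapAlg_tmul, map_one g₂, hK, h₁e,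
        h₂e, (tmul K).map_smul, (tmul K).map_smul, LinearMap.smul_apply, LinearMap.smul_apply,
        (tmul K _).map_smul, smul_smul, ha, smul_add]
    · rw [hgf, H.comul.map_smul, (hF i).1, map_add, cmapAlg_tmul, cmapAlg_tmul, map_one g₁, hL, h₁f,
        h₂f, (tmul K).map_smul, LinearMap.smul_apply, (tmul K _).map_smul, (tmul K _).map_smul,
        smul_smul, hb, smul_add]
  exact congrArg (fun F => F x) this

end Coalgebra

end Realization

end FoMp
end

noncomputable section
namespace FoMp
variable {K : Type*} [Field K]

namespace Realization

variable {n : ℕ} {P P' : Matrix (Fin n) (Fin n) K⟦X⟧} {𝔥 𝔥' : Type*} [AddCommGroup 𝔥]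
  [Module K⟦X⟧ 𝔥] [Module.Free K⟦X⟧ 𝔥] [Module.Finite K⟦X⟧ 𝔥] [AddCommGroup 𝔥']
  [Module K⟦X⟧ 𝔥'] [Module.Free K⟦X⟧ 𝔥'] [Module.Finite K⟦X⟧ 𝔥'] {R : Realization P 𝔥}
  {R' : Realization P' 𝔥'} {B B' : Type*} [Ring B] [Algebra K⟦X⟧ B] [IsAdicComplete (hId K) B]
  [Ring B'] [Algebra K⟦X⟧ B'] [IsAdicComplete (hId K) B']
  {t : 𝔥 →ₗ[K⟦X⟧] B} {e f : Fin n → B} {t' : 𝔥' →ₗ[K⟦X⟧] B'} {e' f' : Fin n → B'}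
  [CharZero K] {O : R.TorusOps t e f} {O' : R'.TorusOps t' e' f'} {D : Twist R' R}
  {Ψ : B' →ₐ[K⟦X⟧] Module.End K⟦X⟧ B} {H : HopfStr K B} {H' : HopfStr K B'}

lemma TorusOps.IsTwRep.hexp (hΨ : O.IsTwRep D t' e' f' Ψ) {x : 𝔥'} {ξ : R.antiDual}
    (hξ : D.χ.form (D.f x) = ξ.1) (b : B) :
    Ψ (hexp K (t' x)) b = FoMp.hexp K (t (D.f x)) * O.lam ξ (O.rho (-ξ) b) := by
  have h1 : Ψ (t' x) = Algebra.lmul K⟦X⟧ B (t (D.f x)) + half K • O.Θ ξ.1 :=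
    LinearMap.ext fun b => by rw [hΨ.T, hξ]; rfl
  have h2 : Commute (Algebra.lmul K⟦X⟧ B (t (D.f x))) (half K • O.Θ ξ.1) :=
    Commute.smul_right (LinearMap.ext fun b => (O.Θ_t ξ.1 (D.f x) b).symm) _
  rw [AlgHom.map_hexp, h1, hexp_add h2, ← AlgHom.map_hexp, Module.End.mul_apply, O.hexp_Θ]
  rfl

/-- The action of `B' ⊗̂ B'` on `B ⊗̂ B` defined by a representation of `B'` on `B`. -/
def tensorRep (Ψ : B' →ₐ[K⟦X⟧] Module.End K⟦X⟧ B) :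
    CTensor K B' B' →ₗ[K⟦X⟧] Module.End K⟦X⟧ (CTensor K B B) :=
  fold ((cmapₗ K B B B B).compl₁₂ Ψ.toLinearMap Ψ.toLinearMap)

omit [IsAdicComplete (hId K) B] [IsAdicComplete (hId K) B'] [CharZero K] in
lemma tensorRep_tmul (x y : B') (w : CTensor K B B) :
    tensorRep Ψ (tmul K x y) w = cmap K (Ψ x) (Ψ y) w := by
  rw [tensorRep, fold_tmul]
  rfl

omit [IsAdicComplete (hId K) B] [IsAdicComplete (hId K) B'] [CharZero K] in
lemma tensorRep_mul (x y : CTensor K B' B') (w : CTensor K B B) :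
    tensorRep Ψ (x * y) w = tensorRep Ψ x (tensorRep Ψ y w) := by
  have := ctensor_map_mul (tensorRep Ψ) (fun a b a' b' => LinearMap.ext fun w => by
    rw [tmul_mul_tmul, tensorRep_tmul, Module.End.mul_apply, tensorRep_tmul, tensorRep_tmul,
      cmap_comp, map_mul, map_mul]
    rfl) x y
  rw [this, Module.End.mul_apply]

variable (hT : StdT H t) (hE : R.StdE H t e) (hF : R.StdF H t f)
  (hT' : StdT H' t') (hE' : R'.StdE H' t' e') (hF' : R'.StdF H' t' f')

include O' hT hE hF hT' hE' hF' in
lemma comul_rep (hΨ : O.IsTwRep D t' e' f' Ψ) (x : B') (b : B) :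
    H.comul (Ψ x b) = tensorRep Ψ (H'.comul x) (H.comul b) := by
  have hm : ∀ a b, H.comul (a * b) = H.comul a * H.comul b :=
    map_mul (H.comulHom hT.1 hT.2.1)
  have hm' : ∀ a b, H'.comul (a * b) = H'.comul a * H'.comul b :=
    map_mul (H'.comulHom hT'.1 hT'.2.1)
  have hΨ1 : Ψ 1 = .id := map_one Ψ
  have hanti : ∀ (ξ : R.antiDual) i, ξ.1 (R.Tm i) = -ξ.1 (R.Tp i) := fun ξ i => ξ.2 i
  -- the torus automorphisms
  have c1 : ∀ (ξ : R.antiDual) b, H.comul (O.lam ξ b) =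
      cmap K (O.lam ξ).toLinearMap .id (H.comul b) := fun ξ b =>
    comul_aut hT hE hF O (g₂ := .id _ _) (c₂ := fun _ => 0) (a₂ := fun _ => 1) (b₁ := fun _ => 1)
      (b₂ := fun _ => 1) (O.lam_t ξ) (O.lam_t ξ) (fun x => by simp) (fun x => by simp) (O.lam_e ξ)
      (O.lam_e ξ) (fun i => by simp) (fun i => by simp [O.lam_f]) (fun i => by simp [O.lam_f])
      (fun i => by simp) (fun i => by simp) (fun i => by simp [hexp_zero]) b
  have c2 : ∀ (ξ : R.antiDual) b, H.comul (O.lam ξ b) =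
      cmap K ((O.lam ξ).comp (O.rho (-ξ))).toLinearMap (O.lam ξ).toLinearMap (H.comul b) :=
    fun ξ b => comul_aut hT hE hF O (c₁ := fun _ => 0)
      (b₁ := fun i => FoMp.hexp K (-(half K * ξ.1 (R.Tp i))))
      (b₂ := fun _ => 1) (O.lam_t ξ) (fun x => by simp [O.rho_t, O.lam_t]) (O.lam_t ξ)
      (fun x => by simp) (O.lam_e ξ) (fun i => by simp [O.rho_e, O.lam_e]) (O.lam_e ξ)
      (fun i => by simp [O.lam_f]) (fun i => by simp [O.rho_f, O.lam_f])
      (fun i => by simp [O.lam_f]) (fun i => by simp [hexp_zero])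
      (fun i => by simp [hanti, hexp_neg_mul]) b
  have c3 : ∀ (ξ : R.antiDual) b, H.comul (O.rho ξ b) =
      cmap K .id (O.rho ξ).toLinearMap (H.comul b) := fun ξ b =>
    comul_aut hT hE hF O (g₁ := .id _ _) (c₁ := fun _ => 0) (a := fun _ => 1) (a₂ := fun _ => 1)
      (b₁ := fun _ => 1) (O.rho_t ξ) (fun x => by simp) (O.rho_t ξ) (fun x => by simp)
      (fun i => by simp [O.rho_e]) (fun i => by simp) (fun i => by simp [O.rho_e]) (O.rho_f ξ)
      (fun i => by simp) (O.rho_f ξ) (fun i => by simp [hexp_zero])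
      (fun i => by simp [hanti]) b
  have c4 : ∀ (ξ : R.antiDual) b, H.comul (O.rho (-ξ) b) =
      cmap K (O.rho (-ξ)).toLinearMap ((O.lam ξ).comp (O.rho (-ξ))).toLinearMap (H.comul b) :=
    fun ξ b => comul_aut hT hE hF O (c₂ := fun _ => 0) (a := fun _ => 1)
      (a₂ := fun i => FoMp.hexp K (half K * ξ.1 (R.Tp i)))
      (O.rho_t _) (O.rho_t _) (fun x => by simp [O.rho_t, O.lam_t])
      (fun x => by simp) (fun i => by simp [O.rho_e]) (fun i => by simp [O.rho_e])
      (fun i => by simp [O.rho_e, O.lam_e]) (O.rho_f _) (O.rho_f _)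
      (fun i => by simp [O.rho_f, O.lam_f]) (fun i => by simp [hexp_neg_mul])
      (fun i => by simp [hexp_zero]) b
  refine O'.linearMap_ext (F := H.comul ∘ₗ LinearMap.applyₗ b ∘ₗ Ψ.toLinearMap)
    (G := LinearMap.applyₗ (H.comul b) ∘ₗ tensorRep Ψ ∘ₗ H'.comul) ?_
    (fun y x h => ?_) (fun i x h => ?_) (fun i x h => ?_) x <;>
    simp only [LinearMap.comp_apply, LinearMap.applyₗ_apply_apply, AlgHom.toLinearMap_apply] at *
  · rw [← hT'.2.1, H'.comul_one, hT'.2.1, tensorRep_tmul, hΨ1, cmap_id]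
    rfl
  · have key : ∀ w, tensorRep Ψ (H'.comul (t' y)) w =
        (tmul K (t (D.f y)) 1 + tmul K 1 (t (D.f y))) * w +
          half K • cmapDer (O.Θ (D.χ.form (D.f y))) (O.Θ (D.χ.form (D.f y))) w := fun w => by
      have e1 : Ψ (t' y) = LinearMap.mulLeft K⟦X⟧ (t (D.f y)) +
          half K • O.Θ (D.χ.form (D.f y)) := LinearMap.ext fun b => hΨ.T y b
      have e2 : LinearMap.mulLeft K⟦X⟧ (1 : B) = .id := LinearMap.mulLeft_one _ _
      rw [(hT'.2.2 y).1, map_add, LinearMap.add_apply, tensorRep_tmul, tensorRep_tmul, hΨ1, e1,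
        ← cmapₗ_apply, ← cmapₗ_apply, add_mul, tmul_mul_eq_cmap, tmul_mul_eq_cmap, e2,
        ← cmapₗ_apply, ← cmapₗ_apply, LinearMap.add_apply, ← cmapₗ_apply, ← cmapₗ_apply]
      simp only [map_add, map_smul, LinearMap.add_apply, LinearMap.smul_apply, smul_add]
      abel
    rw [map_mul, Module.End.mul_apply, hΨ.T, map_add, hm, (hT.2.2 _).1, map_smul,
      comul_Θ (O := O) hT hE hF, h, hm', tensorRep_mul, key]
  · have key : ∀ b, tensorRep Ψ (H'.comul (e' i)) (H.comul b) =
        H.comul (e i) * H.comul (O.lam (D.χ.contract (R.Tp i)) b) := fun b => by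
      rw [(hE' i).1, (hE i).1, map_add, LinearMap.add_apply, tensorRep_tmul, tensorRep_tmul, hΨ1,
        add_mul]
      congr 1
      · rw [c1, tmul_mul_eq_cmap, cmap_comp]
        congr 1
        · congr 1
          · exact LinearMap.ext fun b => hΨ.E i b
          · exact (LinearMap.ext fun b => (one_mul b).symm)
      · rw [c2, tmul_mul_eq_cmap, cmap_comp]
        congr 1
        · congr 1
          · refine LinearMap.ext fun b => ?_
            rw [hΨ.hexp (ξ := D.χ.contract (R.Tp i)) (by rw [D.Tp]; rfl), D.Tp]
            rfl
          · exact LinearMap.ext fun b => hΨ.E i b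
    rw [map_mul, Module.End.mul_apply, hΨ.E, hm, ← key, hm', tensorRep_mul, ← h, key]
  · have key : ∀ b, tensorRep Ψ (H'.comul (f' i)) (H.comul b) =
        H.comul (f i) * H.comul (O.rho (-D.χ.contract (R.Tp i)) b) := fun b => by
      rw [(hF' i).1, (hF i).1, map_add, LinearMap.add_apply, tensorRep_tmul, tensorRep_tmul, hΨ1,
        add_mul]
      congr 1
      · rw [c4, tmul_mul_eq_cmap, cmap_comp]
        congr 1
        · congr 1
          · exact LinearMap.ext fun b => hΨ.F i b
          · refine LinearMap.ext fun b => ?_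
            have h1 : D.χ.form (D.f (-R'.Tm i)) = (D.χ.contract (R.Tp i)).1 := by
              refine LinearMap.ext fun y => ?_
              rw [map_neg, D.Tm, map_neg, LinearMap.neg_apply, D.χ.Tm_left, neg_neg]
              rfl
            rw [← map_neg t', hΨ.hexp h1, map_neg D.f, D.Tm, map_neg t]
            rfl
      · rw [c3, tmul_mul_eq_cmap, cmap_comp]
        congr 1
        · congr 1
          · exact (LinearMap.ext fun b => (one_mul b).symm)
          · exact LinearMap.ext fun b => hΨ.F i b
    rw [map_mul, Module.End.mul_apply, hΨ.F, hm, ← key, hm', tensorRep_mul, ← h, key]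

include O' hT hE hF hT' hE' hF' in
/-- The orbit map of the twisted representation is a homomorphism of coalgebras. -/
lemma comul_orbit (hΨ : O.IsTwRep D t' e' f' Ψ) (x : B') :
    H.comul (orbit Ψ x) = cmap K (orbit Ψ) (orbit Ψ) (H'.comul x) := by
  have h1 : LinearMap.applyₗ (tmul K (1 : B) (1 : B)) ∘ₗ tensorRep Ψ =
      cmap K (orbit Ψ) (orbit Ψ) := ctensor_ext fun a b => by
    rw [LinearMap.comp_apply, LinearMap.applyₗ_apply_apply, tensorRep_tmul, cmap_apply_tmul,
      cmap_apply_tmul]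
    rfl
  refine (comul_rep (O' := O') hT hE hF hT' hE' hF' hΨ x 1).trans ?_
  rw [← hT.2.1, H.comul_one, hT.2.1, ← h1]
  rfl

include O' hT hE hF hT' hE' hF' in
lemma counit_orbit (hΨ : O.IsTwRep D t' e' f' Ψ) (x : B') :
    H.counit (orbit Ψ x) = H'.counit x := by
  have hm : ∀ a b, H.counit (a * b) = H.counit a * H.counit b := fun a b => by
    rw [← hT.1, H.counit_mul]
  have hm' : ∀ a b, H'.counit (a * b) = H'.counit a * H'.counit b := fun a b => by
    rw [← hT'.1, H'.counit_mul]
  refine O'.linearMap_ext (F := H.counit ∘ₗ orbit Ψ) (G := H'.counit) ?_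
    (fun y x h => ?_) (fun i x h => ?_) (fun i x h => ?_) x <;>
    simp only [LinearMap.comp_apply] at *
  · rw [orbit_one, ← hT.2.1, H.counit_one, ← hT'.2.1, H'.counit_one]
  · rw [orbit_mul, hΨ.T, map_add, hm, map_smul, counit_Θ (O := O) hT hE _ (fun i => (hF i).2.1), hm',
      (hT.2.2 _).2.1, (hT'.2.2 _).2.1, zero_mul, zero_mul, smul_zero, add_zero]
  · rw [orbit_mul, hΨ.E, hm, hm', (hE i).2.1, (hE' i).2.1, zero_mul, zero_mul]
  · rw [orbit_mul, hΨ.F, hm, hm', (hF i).2.1, (hF' i).2.1, zero_mul, zero_mul]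

end Realization

end FoMp
end

noncomputable section
namespace FoMp
variable {K : Type*} [Field K]

/-! ### Convergent series -/

section Sums

variable {M N : Type*} [AddCommGroup M] [Module K⟦X⟧ M] [AddCommGroup N] [Module K⟦X⟧ N]

variable (K M) in
/-- `ħ^m M`. -/
def hpow (m : ℕ) : Submodule K⟦X⟧ M := LinearMap.range (LinearMap.lsmul K⟦X⟧ M (X ^ m))

lemma smul_mem_hpow (m : ℕ) (z : M) : (X : K⟦X⟧) ^ m • z ∈ hpow K M m := ⟨z, rfl⟩

lemma map_mem_hpow (g : M →ₗ[K⟦X⟧] N) {m : ℕ} {x : M} (h : x ∈ hpow K M m) : g x ∈ hpow K N m := by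
  obtain ⟨z, rfl⟩ := h
  exact ⟨g z, by simp⟩

variable (K) in
/-- The series `∑ u k` converges `ħ`-adically to `x`. -/
def Sums (u : ℕ → M) (x : M) : Prop :=
  ∀ m, ∃ N₀, ∀ n ≥ N₀, x - ∑ k ∈ Finset.range n, u k ∈ hpow K M m

namespace Sums

variable {u v : ℕ → M} {x y : M}

lemma add (hu : Sums K u x) (hv : Sums K v y) : Sums K (fun k => u k + v k) (x + y) := fun m => by
  obtain ⟨n₁, h₁⟩ := hu m
  obtain ⟨n₂, h₂⟩ := hv m
  refine ⟨max n₁ n₂, fun n hn => ?_⟩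
  rw [Finset.sum_add_distrib, add_sub_add_comm]
  exact add_mem (h₁ n (le_of_max_le_left hn)) (h₂ n (le_of_max_le_right hn))

lemma map (hu : Sums K u x) (g : M →ₗ[K⟦X⟧] N) : Sums K (fun k => g (u k)) (g x) := fun m => by
  obtain ⟨n₁, h₁⟩ := hu m
  refine ⟨n₁, fun n hn => ?_⟩
  rw [← map_sum, ← map_sub]
  exact map_mem_hpow g (h₁ n hn)

lemma eventually_mem (hu : Sums K u x) (m : ℕ) : ∃ J, ∀ j ≥ J, u j ∈ hpow K M m := by
  obtain ⟨n₁, h₁⟩ := hu m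
  refine ⟨n₁, fun j hj => ?_⟩
  have := sub_mem (h₁ j hj) (h₁ (j + 1) (by omega))
  rwa [Finset.sum_range_succ, sub_sub_sub_cancel_left, add_sub_cancel_left] at this

/-- The series `0 + u 0 + u 1 + ⋯`. -/
lemma shift (hu : Sums K u x) : Sums K (fun k => Nat.casesOn k 0 u) x := fun m => by
  obtain ⟨n₁, h₁⟩ := hu m
  refine ⟨n₁ + 1, fun n hn => ?_⟩
  obtain ⟨n, rfl⟩ : ∃ n', n = n' + 1 := ⟨n - 1, by omega⟩
  rw [Finset.sum_range_succ']
  simpa using h₁ n (by omega)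

lemma of_first (h : ∀ k, u (k + 1) = 0) : Sums K u (u 0) := fun m =>
  ⟨1, fun n hn => by
    obtain ⟨n, rfl⟩ : ∃ n', n = n' + 1 := ⟨n - 1, by omega⟩
    rw [Finset.sum_range_succ', Finset.sum_eq_zero fun k _ => h k, zero_add, sub_self]
    exact zero_mem _⟩

lemma closed (h : ∀ n : ℕ, ∃ v y, Sums K v y ∧ x - y ∈ hpow K M n ∧ ∀ k, u k - v k ∈ hpow K M n) :
    Sums K u x := fun m => by
  obtain ⟨v, y, hv, hx, hu⟩ := h m
  obtain ⟨n₁, h₁⟩ := hv m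
  refine ⟨n₁, fun n hn => ?_⟩
  have := sub_mem (add_mem (h₁ n hn) hx) (Submodule.sum_mem _ fun k (_ : k ∈ Finset.range n) => hu k)
  rw [Finset.sum_sub_distrib] at this
  convert this using 1
  abel

lemma conv {w : ℕ → ℕ → M} {y : ℕ → M} (h₁ : ∀ j, Sums K (w j) (y j))
    (h₂ : ∀ m, ∃ J, ∀ j ≥ J, ∀ k, w j k ∈ hpow K M m) (h₃ : Sums K y x) :
    Sums K (fun k => ∑ p ∈ Finset.HasAntidiagonal.antidiagonal k, w p.1 p.2) x := fun m => by
  obtain ⟨J, hJ⟩ := h₂ m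
  obtain ⟨n₃, hn₃⟩ := h₃ m
  choose N₁ hN₁ using fun j => h₁ j m
  set J' := max J n₃
  refine ⟨J' + (Finset.range J').sup N₁, fun n hn => ?_⟩
  have e : ∑ k ∈ Finset.range n, ∑ p ∈ Finset.HasAntidiagonal.antidiagonal k, w p.1 p.2 =
      ∑ i ∈ Finset.range n, ∑ j ∈ Finset.range (n - i), w i j := by
    rw [← Finset.sum_range_diag_flip]
    exact Finset.sum_congr rfl fun k _ =>
      Finset.Nat.sum_antidiagonal_eq_sum_range_succ_mk (fun p => w p.1 p.2) k
  have e2 : ∑ i ∈ Finset.range n, ∑ j ∈ Finset.range (n - i), w i j =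
      ∑ i ∈ Finset.range J', ∑ j ∈ Finset.range (n - i), w i j +
      ∑ i ∈ Finset.Ico J' n, ∑ j ∈ Finset.range (n - i), w i j :=
    (Finset.sum_range_add_sum_Ico _ (by omega)).symm
  have m1 : ∑ i ∈ Finset.Ico J' n, ∑ j ∈ Finset.range (n - i), w i j ∈ hpow K M m :=
    Submodule.sum_mem _ fun i hi => Submodule.sum_mem _ fun j _ =>
      hJ i (le_trans (le_max_left _ _) (Finset.mem_Ico.1 hi).1) j
  have m2 : ∑ i ∈ Finset.range J', (y i - ∑ j ∈ Finset.range (n - i), w i j) ∈ hpow K M m :=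
    Submodule.sum_mem _ fun i hi => hN₁ i _ (by
      have h1 : N₁ i ≤ (Finset.range J').sup N₁ := Finset.le_sup hi
      have h2 := Finset.mem_range.1 hi
      omega)
  have m3 := hn₃ J' (le_max_right _ _)
  have := sub_mem (add_mem m2 m3) m1
  rw [Finset.sum_sub_distrib] at this
  convert this using 1
  rw [e, e2]
  abel

end Sums

end Sums

/-! ### Divided powers -/

section DividedPowers

variable {A : Type*} [Ring A] [Algebra K⟦X⟧ A]

variable (K) in
open Realization in
/-- The `k`-th term of the series of `e^{x/2}`. -/
def dpow (x : A) (k : ℕ) : A := (C ((k ! : K)⁻¹) : K⟦X⟧) • (half K • x) ^ k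

open Realization in
lemma dpow_zero (x : A) : dpow K x 0 = 1 := by simp [dpow]

lemma dpow_map {A' : Type*} [Ring A'] [Algebra K⟦X⟧ A'] (g : A →ₐ[K⟦X⟧] A') (x : A) (k : ℕ) :
    g (dpow K x k) = dpow K (g x) k := by
  simp [dpow]

lemma commute_dpow {x y : A} (h : Commute x y) (k : ℕ) : Commute x (dpow K y k) :=
  ((h.smul_right _).pow_right k).smul_right _

variable [CharZero K]

lemma dpow_mul_of_shift [IsAdicComplete (hId K) A] {x y g : A} (h : x * g = g * (x + y)) (hxy : Commute x y) (k : ℕ) :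
    dpow K x k * g = g * ∑ p ∈ Finset.HasAntidiagonal.antidiagonal k, dpow K y p.1 * dpow K x p.2 := by
  have h1 : SemiconjBy g ((Realization.half K • (y + x)) ^ k) ((Realization.half K • x) ^ k) := by
    refine SemiconjBy.pow_right ?_ k
    rw [SemiconjBy, mul_smul_comm, smul_mul_assoc, h, add_comm]
  have h2 := expTerm_add (K := K) (x := Realization.half K • y) (y := Realization.half K • x)
    ((hxy.symm.smul_left _).smul_right _) k
  rw [← smul_add] at h2
  rw [dpow, smul_mul_assoc, ← h1.eq, ← mul_smul_comm, h2]
  rfl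

lemma dpow_mul_of_add {x y g : A} (h : x * g = g * x + y) (hxy : Commute x y) (k : ℕ) :
    dpow K x (k + 1) * g = g * dpow K x (k + 1) + Realization.half K • (y * dpow K x k) := by
  have h1 : ∀ k : ℕ, x ^ (k + 1) * g = g * x ^ (k + 1) + ((k + 1 : ℕ) : K⟦X⟧) • (y * x ^ k) := by
    intro k
    induction k with
    | zero => simp [h]
    | succ k ih =>
      rw [pow_succ' x (k + 1), mul_assoc, ih, mul_add, ← mul_assoc, h, mul_smul_comm, ← mul_assoc,
        hxy.eq, add_mul, mul_assoc, mul_assoc y x, ← pow_succ', ← pow_succ',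
        Nat.cast_add (k + 1) 1, Nat.cast_one, add_smul, one_smul]
      abel
  have h2 : (C (((k + 1)! : K)⁻¹) : K⟦X⟧) * ((k + 1 : ℕ) : K⟦X⟧) = C ((k ! : K)⁻¹) := by
    rw [← map_natCast (C : K →+* K⟦X⟧), ← map_mul, Nat.factorial_succ, Nat.cast_mul, mul_inv, mul_comm,
      ← mul_assoc, mul_inv_cancel₀ (by exact_mod_cast Nat.succ_ne_zero k), one_mul]
  simp only [dpow, smul_pow, smul_mul_assoc, mul_smul_comm, h1, smul_add, smul_smul]
  congr 2
  rw [← h2]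
  ring

end DividedPowers

end FoMp
end

noncomputable section
namespace FoMp
variable {K : Type*} [Field K]

/-- The series `∑ (r/2)^k ħ^k / k!` converges to `e^{ħ r / 2}`. -/
lemma sums_dpow_smul {M : Type*} [AddCommGroup M] [Module K⟦X⟧ M] (r : K⟦X⟧) (y : M) :
    Sums K (fun k => dpow K ((X : K⟦X⟧) * r) k • y) (hexp K (Realization.half K * r) • y) := fun m => by
  refine ⟨m, fun n hn => ?_⟩
  obtain ⟨z, hz⟩ := hsum_spec (K := K) (fun k => (C ((k ! : K)⁻¹) : K⟦X⟧) • (Realization.half K * r) ^ k) n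
  refine ⟨((X : K⟦X⟧) ^ (n - m) * z) • y, ?_⟩
  have h : ∀ k, (X : K⟦X⟧) ^ k • (C ((k ! : K)⁻¹) : K⟦X⟧) • (Realization.half K * r) ^ k =
      dpow K ((X : K⟦X⟧) * r) k := fun k => by
    simp only [dpow, smul_eq_mul]
    ring
  rw [hexp, hz, ← Finset.sum_smul, ← sub_smul, Finset.sum_congr rfl fun k _ => h k,
    add_sub_cancel_left, LinearMap.lsmul_apply, smul_smul, ← mul_assoc, ← pow_add,
    Nat.add_sub_cancel' hn]
  rfl

namespace Realization

variable {n : ℕ} {P P' : Matrix (Fin n) (Fin n) K⟦X⟧} {𝔥 𝔥' : Type*} [AddCommGroup 𝔥]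
  [Module K⟦X⟧ 𝔥] [Module.Free K⟦X⟧ 𝔥] [Module.Finite K⟦X⟧ 𝔥] [AddCommGroup 𝔥']
  [Module K⟦X⟧ 𝔥'] [Module.Free K⟦X⟧ 𝔥'] [Module.Finite K⟦X⟧ 𝔥'] {R : Realization P 𝔥}
  {R' : Realization P' 𝔥'} {B : Type*} [Ring B] [Algebra K⟦X⟧ B] [IsAdicComplete (hId K) B]
  {t : 𝔥 →ₗ[K⟦X⟧] B} {e f : Fin n → B} (O : R.TorusOps t e f)

include O in
lemma TorusOps.sums_ext {ι W : Type*} [AddCommGroup W] [Module K⟦X⟧ W] {F : ι → ℕ → B →ₗ[K⟦X⟧] W}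
    {G : ι → B →ₗ[K⟦X⟧] W} (one : ∀ c, Sums K (fun k => F c k 1) (G c 1))
    (ht : ∀ x b, (∀ c, Sums K (fun k => F c k b) (G c b)) →
      ∀ c, Sums K (fun k => F c k (t x * b)) (G c (t x * b)))
    (he : ∀ i b, (∀ c, Sums K (fun k => F c k b) (G c b)) →
      ∀ c, Sums K (fun k => F c k (e i * b)) (G c (e i * b)))
    (hf : ∀ i b, (∀ c, Sums K (fun k => F c k b) (G c b)) →
      ∀ c, Sums K (fun k => F c k (f i * b)) (G c (f i * b))) (b : B) (c : ι) :
    Sums K (fun k => F c k b) (G c b) := by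
  refine O.gen.induction_left (p := fun b => ∀ c, Sums K (fun k => F c k b) (G c b)) one
    (fun x y hx hy c => ?_) (fun r x hx c => ?_) ?_ (fun x hx c => ?_) b c
  · simpa only [map_add] using (hx c).add (hy c)
  · simpa only [map_smul, LinearMap.lsmul_apply] using (hx c).map (LinearMap.lsmul K⟦X⟧ W r)
  · rintro _ ((⟨x, rfl⟩ | ⟨i, rfl⟩) | ⟨i, rfl⟩) b hb
    exacts [ht x b hb, he i b hb, hf i b hb]
  · refine Sums.closed fun m => ?_
    obtain ⟨y, z, hy, rfl⟩ := hx m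
    refine ⟨_, _, hy c, ?_, fun k => ?_⟩
    · rw [map_add, add_sub_cancel_left]
      exact map_mem_hpow _ (smul_mem_hpow m z)
    · rw [map_add, add_sub_cancel_left]
      exact map_mem_hpow _ (smul_mem_hpow m z)

variable (R) in
/-- Pull-back of functionals on `𝔥 / 𝔰`. -/
def liftDual [CharZero K] : Module.Dual K⟦X⟧ (𝔥 ⧸ R.sSpan) →ₗ[K⟦X⟧] R.antiDual :=
  (R.sSpan.mkQ.dualMap).codRestrict _ fun ξ i => by
    have h : ξ (R.sSpan.mkQ (R.S i)) = 0 := by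
      have h0 : R.sSpan.mkQ (R.S i) = 0 :=
        (Submodule.Quotient.mk_eq_zero _).2 (Submodule.subset_span ⟨i, rfl⟩)
      rw [h0, map_zero]
    rw [S, map_smul, map_smul, smul_eq_mul, map_add, map_add] at h
    have h2 := half_add_half (ξ (R.sSpan.mkQ (R.Tp i)) + ξ (R.sSpan.mkQ (R.Tm i)))
    rw [half, h, zero_add] at h2
    exact eq_neg_of_add_eq_zero_right h2.symm

lemma liftDual_apply [CharZero K] (ξ : Module.Dual K⟦X⟧ (𝔥 ⧸ R.sSpan)) (x : 𝔥) :
    (R.liftDual ξ).1 x = ξ (Submodule.Quotient.mk x) := rfl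

variable (R t e f) in
/-- The derivations obtained by applying the infinitesimal characters of `𝔥 / 𝔰` to the first or
to the second tensor factor of the coproduct. -/
structure ToralDer where
  /-- contraction of the first factor -/
  dl : Module.Dual K⟦X⟧ (𝔥 ⧸ R.sSpan) →ₗ[K⟦X⟧] Module.End K⟦X⟧ B
  dl_one : ∀ ξ, dl ξ 1 = 0
  dl_t : ∀ ξ x b, dl ξ (t x * b) = t x * dl ξ b + ξ (Submodule.Quotient.mk x) • b
  dl_e : ∀ ξ i b, dl ξ (e i * b) =
    e i * (dl ξ b + (X * ξ (Submodule.Quotient.mk (R.Tp i))) • b)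
  dl_f : ∀ ξ i b, dl ξ (f i * b) = f i * dl ξ b
  /-- contraction of the second factor -/
  dr : Module.Dual K⟦X⟧ (𝔥 ⧸ R.sSpan) →ₗ[K⟦X⟧] Module.End K⟦X⟧ B
  dr_one : ∀ ξ, dr ξ 1 = 0
  dr_t : ∀ ξ x b, dr ξ (t x * b) = t x * dr ξ b + ξ (Submodule.Quotient.mk x) • b
  dr_e : ∀ ξ i b, dr ξ (e i * b) = e i * dr ξ b
  dr_f : ∀ ξ i b, dr ξ (f i * b) =
    f i * (dr ξ b + (X * ξ (Submodule.Quotient.mk (R.Tp i))) • b)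

namespace ToralDer

variable (T : R.ToralDer t e f) (ξ η : Module.Dual K⟦X⟧ (𝔥 ⧸ R.sSpan))

include O

lemma dr_dr (b : B) : T.dr ξ (T.dr η b) = T.dr η (T.dr ξ b) := by
  refine O.linearMap_ext (F := T.dr ξ ∘ₗ T.dr η) (G := T.dr η ∘ₗ T.dr ξ) ?_ (fun x b h => ?_)
    (fun i b h => ?_) (fun i b h => ?_) b <;> simp only [LinearMap.comp_apply] at *
  · simp only [T.dr_one, map_zero]
  · simp only [T.dr_t, map_add, map_smul, h]
    abel
  · simp only [T.dr_e, h]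
  · simp only [T.dr_f, h, map_add, map_smul, smul_add, smul_comm (X * η _)]
    abel_nf

lemma dr_Θ (ζ : Module.Dual K⟦X⟧ 𝔥) (b : B) : T.dr ξ (O.Θ ζ b) = O.Θ ζ (T.dr ξ b) := by
  refine O.linearMap_ext (F := T.dr ξ ∘ₗ O.Θ ζ) (G := O.Θ ζ ∘ₗ T.dr ξ) ?_ (fun x b h => ?_)
    (fun i b h => ?_) (fun i b h => ?_) b <;> simp only [LinearMap.comp_apply] at *
  · simp only [T.dr_one, O.Θ_one, map_zero]
  · simp only [T.dr_t, O.Θ_t, map_add, map_smul, h]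
  · simp only [T.dr_e, O.Θ_e, h, map_add, map_smul]
  · simp only [T.dr_f, O.Θ_f, h, map_add, map_sub, map_smul, mul_add, mul_sub]
    rw [smul_comm (X * ξ _)]
    abel

section

variable [CharZero K]

lemma dl_eq : T.dl ξ = T.dr ξ + (X : K⟦X⟧) • O.Θ (R.liftDual ξ).1 := by
  refine LinearMap.ext fun b => ?_
  refine O.linearMap_ext (F := T.dl ξ) (G := T.dr ξ + (X : K⟦X⟧) • O.Θ (R.liftDual ξ).1) ?_
    (fun x b h => ?_) (fun i b h => ?_) (fun i b h => ?_) b <;>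
    simp only [LinearMap.add_apply, LinearMap.smul_apply] at *
  · simp only [T.dl_one, T.dr_one, O.Θ_one, smul_zero, add_zero]
  · simp only [T.dl_t, T.dr_t, O.Θ_t, h, mul_add, mul_smul_comm]
    abel
  · simp only [T.dl_e, T.dr_e, O.Θ_e, h, mul_add, mul_smul_comm, smul_add, smul_smul, add_assoc,
      liftDual_apply]
  · simp only [T.dl_f, T.dr_f, O.Θ_f, h, mul_add, mul_sub, mul_smul_comm, smul_sub, smul_smul,
      liftDual_apply]
    abel

end

lemma dr_rho (ζ : R.antiDual) (b : B) : T.dr ξ (O.rho ζ b) = O.rho ζ (T.dr ξ b) := by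
  refine O.linearMap_ext (F := T.dr ξ ∘ₗ (O.rho ζ).toLinearMap) (G := (O.rho ζ).toLinearMap ∘ₗ T.dr ξ)
    ?_ (fun x b h => ?_) (fun i b h => ?_) (fun i b h => ?_) b <;>
    simp only [LinearMap.comp_apply, AlgHom.toLinearMap_apply] at *
  · simp only [map_one, T.dr_one, map_zero]
  · simp only [map_mul, O.rho_t, T.dr_t, h, add_mul, map_add, smul_mul_assoc, map_smul, one_mul]
    abel
  · simp only [map_mul, O.rho_e, T.dr_e, h]
  · simp only [map_mul, O.rho_f, T.dr_f, h, map_add, smul_mul_assoc, map_smul]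

lemma dr_lam (ζ : R.antiDual) (b : B) : T.dr ξ (O.lam ζ b) = O.lam ζ (T.dr ξ b) := by
  refine O.linearMap_ext (F := T.dr ξ ∘ₗ (O.lam ζ).toLinearMap) (G := (O.lam ζ).toLinearMap ∘ₗ T.dr ξ)
    ?_ (fun x b h => ?_) (fun i b h => ?_) (fun i b h => ?_) b <;>
    simp only [LinearMap.comp_apply, AlgHom.toLinearMap_apply] at *
  · simp only [map_one, T.dr_one, map_zero]
  · simp only [map_mul, O.lam_t, T.dr_t, h, add_mul, map_add, smul_mul_assoc, map_smul, one_mul]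
    abel
  · simp only [map_mul, O.lam_e, T.dr_e, h, smul_mul_assoc, map_smul]
  · simp only [map_mul, O.lam_f, T.dr_f, h, map_add, map_smul]

variable [CharZero K]

lemma dl_Θ (ζ : Module.Dual K⟦X⟧ 𝔥) (b : B) : T.dl ξ (O.Θ ζ b) = O.Θ ζ (T.dl ξ b) := by
  simp only [T.dl_eq O, LinearMap.add_apply, LinearMap.smul_apply, map_add, map_smul, T.dr_Θ O, O.Θ_Θ ζ]

lemma dl_dr (b : B) : T.dl ξ (T.dr η b) = T.dr η (T.dl ξ b) := by
  simp only [T.dl_eq O, LinearMap.add_apply, LinearMap.smul_apply, map_add, map_smul, T.dr_dr O η,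
    T.dr_Θ O η]

lemma dl_dl (b : B) : T.dl ξ (T.dl η b) = T.dl η (T.dl ξ b) := by
  rw [T.dl_eq O η]
  simp only [LinearMap.add_apply, LinearMap.smul_apply, map_add, map_smul, T.dl_dr O, T.dl_Θ O]

lemma dl_lam (ζ : R.antiDual) (b : B) : T.dl ξ (O.lam ζ b) = O.lam ζ (T.dl ξ b) := by
  simp only [T.dl_eq O, LinearMap.add_apply, LinearMap.smul_apply, map_add, map_smul, T.dr_lam O, O.Θ_lam]

lemma dl_rho (ζ : R.antiDual) (b : B) : T.dl ξ (O.rho ζ b) = O.rho ζ (T.dl ξ b) := by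
  simp only [T.dl_eq O, LinearMap.add_apply, LinearMap.smul_apply, map_add, map_smul, T.dr_rho O, O.Θ_rho]

/-! ### The torus automorphisms as exponentials of toral derivations -/

omit O in
lemma _root_.FoMp.sums_of_shift {D : Module.End K⟦X⟧ B} {x : B} {r : K⟦X⟧}
    (h : ∀ b, D (x * b) = x * (D b + (X * r) • b)) {b y : B}
    (hb : Sums K (fun k => dpow K D k b) y) :
    Sums K (fun k => dpow K D k (x * b)) (hexp K (half K * r) • (x * y)) := by
  have h1 : D * LinearMap.mulLeft K⟦X⟧ x =
      LinearMap.mulLeft K⟦X⟧ x * (D + algebraMap K⟦X⟧ (Module.End K⟦X⟧ B) (X * r)) :=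
    LinearMap.ext fun b => h b
  have h2 : ∀ k, dpow K D k (x * b) = ∑ p ∈ Finset.HasAntidiagonal.antidiagonal k,
      dpow K (X * r) p.1 • (x * dpow K D p.2 b) := fun k => by
    have := LinearMap.congr_fun (dpow_mul_of_shift (K := K) h1 (Algebra.commutes _ _).symm k) b
    refine this.trans ?_
    rw [Module.End.mul_apply, LinearMap.sum_apply, map_sum]
    refine Finset.sum_congr rfl fun p _ => ?_
    have h3 := dpow_map (Algebra.ofId K⟦X⟧ (Module.End K⟦X⟧ B)) (X * r) p.1
    rw [Algebra.ofId_apply, Algebra.ofId_apply] at h3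
    rw [← h3]
    exact mul_smul_comm _ _ _
  simp only [h2]
  refine Sums.conv (w := fun i j => dpow K (X * r) i • (x * dpow K D j b))
    (y := fun i => dpow K (X * r) i • (x * y))
    (fun i => by
      exact (hb.map (LinearMap.mulLeft K⟦X⟧ x)).map (LinearMap.lsmul K⟦X⟧ B (dpow K (X * r) i)))
    (fun m => ?_) (sums_dpow_smul r (x * y))
  obtain ⟨J, hJ⟩ := (sums_dpow_smul r (1 : K⟦X⟧)).eventually_mem m
  refine ⟨J, fun i hi k => ?_⟩
  have := map_mem_hpow (LinearMap.toSpanSingleton K⟦X⟧ B (x * dpow K D k b)) (hJ i hi)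
  rwa [LinearMap.toSpanSingleton_apply, smul_assoc, one_smul] at this

omit O [IsAdicComplete (hId K) B] in
lemma _root_.FoMp.sums_of_add {D : Module.End K⟦X⟧ B} {x : B} {r : K⟦X⟧}
    (h : ∀ b, D (x * b) = x * D b + r • b) {b y : B} (hb : Sums K (fun k => dpow K D k b) y) :
    Sums K (fun k => dpow K D k (x * b)) (x * y + (half K * r) • y) := by
  have h1 : D * LinearMap.mulLeft K⟦X⟧ x =
      LinearMap.mulLeft K⟦X⟧ x * D + algebraMap K⟦X⟧ (Module.End K⟦X⟧ B) r :=
    LinearMap.ext fun b => h b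
  have h2 : ∀ k, dpow K D k (x * b) =
      x * dpow K D k b + Nat.casesOn k 0 fun k => (half K * r) • dpow K D k b := fun k => by
    cases k with
    | zero => simp [dpow_zero]
    | succ k =>
      refine (LinearMap.congr_fun (dpow_mul_of_add (K := K) h1 (Algebra.commutes _ _).symm k) b).trans ?_
      rw [LinearMap.add_apply, LinearMap.smul_apply, Module.End.mul_apply, Module.End.mul_apply,
        Module.algebraMap_end_apply, smul_smul]
      rfl
  simp only [h2]
  exact (hb.map (LinearMap.mulLeft K⟦X⟧ x)).add
    (hb.map (LinearMap.lsmul K⟦X⟧ B (half K * r))).shift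

lemma sums_dl (b : B) :
    Sums K (fun k => dpow K (T.dl ξ) k b) (O.lam (R.liftDual ξ) b) := by
  refine O.sums_ext (ι := Unit) (F := fun _ k => dpow K (T.dl ξ) k)
    (G := fun _ => (O.lam (R.liftDual ξ)).toLinearMap)
    (fun _ => ?_) (fun x b h _ => ?_) (fun i b h _ => ?_) (fun i b h _ => ?_) b () <;>
    simp only [AlgHom.toLinearMap_apply, map_mul] at *
  · rw [map_one]
    convert Sums.of_first (K := K) (u := fun k => dpow K (T.dl ξ) k (1 : B)) fun k => ?_
    · rw [dpow_zero, Module.End.one_apply]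
    · rw [dpow, pow_succ, LinearMap.smul_apply, Module.End.mul_apply, LinearMap.smul_apply,
        T.dl_one, smul_zero, map_zero, smul_zero]
  · rw [O.lam_t, add_mul, smul_mul_assoc, one_mul]
    exact sums_of_add (T.dl_t ξ x) (h ())
  · rw [O.lam_e, smul_mul_assoc]
    exact sums_of_shift (T.dl_e ξ i) (h ())
  · rw [O.lam_f]
    have := sums_of_shift (r := 0) (fun b => by rw [T.dl_f, mul_zero, zero_smul, add_zero]) (h ())
      (D := T.dl ξ) (x := f i)
    rwa [mul_zero, hexp_zero, one_smul] at this

lemma sums_dr (b : B) :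
    Sums K (fun k => dpow K (T.dr ξ) k b) (O.rho (R.liftDual ξ) b) := by
  refine O.sums_ext (ι := Unit) (F := fun _ k => dpow K (T.dr ξ) k)
    (G := fun _ => (O.rho (R.liftDual ξ)).toLinearMap)
    (fun _ => ?_) (fun x b h _ => ?_) (fun i b h _ => ?_) (fun i b h _ => ?_) b () <;>
    simp only [AlgHom.toLinearMap_apply, map_mul] at *
  · rw [map_one]
    convert Sums.of_first (K := K) (u := fun k => dpow K (T.dr ξ) k (1 : B)) fun k => ?_
    · rw [dpow_zero, Module.End.one_apply]
    · rw [dpow, pow_succ, LinearMap.smul_apply, Module.End.mul_apply, LinearMap.smul_apply,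
        T.dr_one, smul_zero, map_zero, smul_zero]
  · rw [O.rho_t, add_mul, smul_mul_assoc, one_mul]
    exact sums_of_add (T.dr_t ξ x) (h ())
  · rw [O.rho_e]
    have := sums_of_shift (r := 0) (fun b => by rw [T.dr_e, mul_zero, zero_smul, add_zero]) (h ())
      (D := T.dr ξ) (x := e i)
    rwa [mul_zero, hexp_zero, one_smul] at this
  · rw [O.rho_f, smul_mul_assoc]
    exact sums_of_shift (T.dr_f ξ i) (h ())

end ToralDer

end Realization

end FoMp
end

noncomputable section
namespace FoMp
variable {K : Type*} [Field K]

section TensorEnd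

variable {B : Type*} [Ring B] [Algebra K⟦X⟧ B]

variable (K B) in
/-- Endomorphisms of the completed tensor square. -/
abbrev cm : Module.End K⟦X⟧ B →ₗ[K⟦X⟧] Module.End K⟦X⟧ B →ₗ[K⟦X⟧]
    Module.End K⟦X⟧ (CTensor K B B) := cmapₗ K B B B B

lemma cm_tmul (F G : Module.End K⟦X⟧ B) (a b : B) :
    cm K B F G (tmul K a b) = tmul K (F a) (G b) := cmap_apply_tmul F G a b

lemma cm_mul (F G F' G' : Module.End K⟦X⟧ B) :
    cm K B F G * cm K B F' G' = cm K B (F * F') (G * G') :=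
  LinearMap.ext fun w => cmap_comp F G F' G' w

lemma cm_one : cm K B 1 1 = 1 := LinearMap.ext cmap_id

lemma cm_commute {F G F' G' : Module.End K⟦X⟧ B} (h : Commute F F') (h' : Commute G G') :
    Commute (cm K B F G) (cm K B F' G') := by
  rw [Commute, SemiconjBy, cm_mul, cm_mul, h.eq, h'.eq]

variable (K B) in
/-- The action on the second tensor factor. -/
def cmRight : Module.End K⟦X⟧ B →ₐ[K⟦X⟧] Module.End K⟦X⟧ (CTensor K B B) :=
  AlgHom.ofLinearMap (cm K B 1) cm_one fun F G => by rw [cm_mul, one_mul]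

lemma cm_dpow (F : Module.End K⟦X⟧ B) (k : ℕ) : dpow K (cm K B 1 F) k = cm K B 1 (dpow K F k) :=
  (dpow_map (cmRight K B) F k).symm

variable [IsAdicComplete (hId K) B]

variable (K B) in
/-- The product, as a map on the completed tensor square. -/
def mulT : CTensor K B B →ₗ[K⟦X⟧] B := fold (LinearMap.mul K⟦X⟧ B)

lemma mulT_tmul (a b : B) : mulT K B (tmul K a b) = a * b := fold_tmul K _ a b

lemma mulT_mulLeft (x : B) (w : CTensor K B B) :
    mulT K B (cm K B (LinearMap.mulLeft K⟦X⟧ x) 1 w) = x * mulT K B w := by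
  have : mulT K B ∘ₗ cm K B (LinearMap.mulLeft K⟦X⟧ x) 1 = LinearMap.mulLeft K⟦X⟧ x ∘ₗ mulT K B :=
    ctensor_ext fun a b => by
      rw [LinearMap.comp_apply, LinearMap.comp_apply, cm_tmul, mulT_tmul, mulT_tmul]
      exact mul_assoc _ _ _
  exact LinearMap.congr_fun this w

lemma mulT_algHom (g : B →ₐ[K⟦X⟧] B) (w : CTensor K B B) :
    mulT K B (cm K B g.toLinearMap g.toLinearMap w) = g (mulT K B w) := by
  have : mulT K B ∘ₗ cm K B g.toLinearMap g.toLinearMap = g.toLinearMap ∘ₗ mulT K B :=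
    ctensor_ext fun a b => by
      rw [LinearMap.comp_apply, LinearMap.comp_apply, cm_tmul, mulT_tmul, mulT_tmul]
      exact (map_mul g _ _).symm
  exact LinearMap.congr_fun this w

lemma mulT_derivation {F : Module.End K⟦X⟧ B} (hF : ∀ a b, F (a * b) = F a * b + a * F b)
    (w : CTensor K B B) :
    F (mulT K B w) = mulT K B (cm K B F 1 w) + mulT K B (cm K B 1 F w) := by
  have : F ∘ₗ mulT K B = mulT K B ∘ₗ cm K B F 1 + mulT K B ∘ₗ cm K B 1 F :=
    ctensor_ext fun a b => by
      rw [LinearMap.add_apply, LinearMap.comp_apply, LinearMap.comp_apply, LinearMap.comp_apply,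
        cm_tmul, cm_tmul, mulT_tmul, mulT_tmul, mulT_tmul, hF]
      rfl
  exact LinearMap.congr_fun this w

/-- The terms of the deformed product. -/
def starTerm (D : Module.End K⟦X⟧ (CTensor K B B)) (k : ℕ) : B →ₗ[K⟦X⟧] B →ₗ[K⟦X⟧] B :=
  (tmul K).compr₂ (mulT K B ∘ₗ dpow K D k)

lemma starTerm_apply (D : Module.End K⟦X⟧ (CTensor K B B)) (k : ℕ) (a b : B) :
    starTerm D k a b = mulT K B (dpow K D k (tmul K a b)) := rfl

variable [CharZero K] {D : Module.End K⟦X⟧ (CTensor K B B)}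

omit [CharZero K] in
lemma starTerm_right {F : Module.End K⟦X⟧ B} (h : Commute (cm K B 1 F) D) (k : ℕ) (a b : B) :
    mulT K B (cm K B 1 F (dpow K D k (tmul K a b))) = starTerm D k a (F b) := by
  have := LinearMap.congr_fun (commute_dpow (K := K) h k).eq (tmul K a b)
  rw [Module.End.mul_apply, Module.End.mul_apply, cm_tmul] at this
  rw [this]
  rfl

/-- A generator that shifts `D` by `1 ⊗ F`, where `exp(F/2) = g` and `g ⊗ g` commutes with `D`. -/
lemma sums_starTerm_of_shift {x a : B} {F y : Module.End K⟦X⟧ B} {g g' : B →ₐ[K⟦X⟧] B}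
    (hx : D * cm K B (LinearMap.mulLeft K⟦X⟧ x) 1 =
      cm K B (LinearMap.mulLeft K⟦X⟧ x) 1 * (D + cm K B 1 F)) (hF : Commute (cm K B 1 F) D)
    (hg : Commute (cm K B g.toLinearMap g.toLinearMap) D) (hgg : ∀ b, g (g' b) = b)
    (hgg' : ∀ b, g' (g b) = b) (hFg : ∀ c, Sums K (fun k => dpow K F k c) (g c))
    (ha : ∀ c, Sums K (fun k => starTerm D k a c) (y c)) (c : B) :
    Sums K (fun k => starTerm D k (x * g a) c) (x * g (y c)) := by
  set w : ℕ → ℕ → B := fun i j => x * g (starTerm D j a (g' (dpow K F i c))) with hw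
  have h1 : ∀ k, starTerm D k (x * g a) c =
      ∑ p ∈ Finset.HasAntidiagonal.antidiagonal k, w p.1 p.2 := fun k => by
    have e1 : tmul K (x * g a) c =
        cm K B (LinearMap.mulLeft K⟦X⟧ x) 1 (tmul K (g a) c) := by
      rw [cm_tmul, LinearMap.mulLeft_apply, Module.End.one_apply]
    have e2 := LinearMap.congr_fun (dpow_mul_of_shift (K := K) hx hF.symm k) (tmul K (g a) c)
    rw [Module.End.mul_apply, Module.End.mul_apply, LinearMap.sum_apply] at e2
    rw [starTerm_apply, e1, e2, mulT_mulLeft, map_sum, Finset.mul_sum]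
    refine Finset.sum_congr rfl fun p _ => congrArg (x * ·) ?_
    have h2 : Commute (cm K B 1 (dpow K F p.1)) D := by
      rw [← cm_dpow]
      exact (commute_dpow hF.symm p.1).symm
    have e3 := LinearMap.congr_fun (commute_dpow (K := K) hg p.2).eq (tmul K a (g' (dpow K F p.1 c)))
    rw [Module.End.mul_apply, Module.End.mul_apply, cm_tmul, AlgHom.toLinearMap_apply,
      AlgHom.toLinearMap_apply, hgg] at e3
    rw [cm_dpow, Module.End.mul_apply, starTerm_right h2, starTerm_apply, starTerm_apply,
      ← mulT_algHom, e3]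
  simp only [h1]
  refine Sums.conv (y := fun i => x * g (y (g' (dpow K F i c))))
    (fun i => (ha _).map (LinearMap.mulLeft K⟦X⟧ x ∘ₗ g.toLinearMap)) (fun m => ?_) ?_
  · obtain ⟨J, hJ⟩ := (hFg c).eventually_mem m
    exact ⟨J, fun i hi k => map_mem_hpow (LinearMap.mulLeft K⟦X⟧ x ∘ₗ g.toLinearMap ∘ₗ
      starTerm D k a ∘ₗ g'.toLinearMap) (hJ i hi)⟩
  · have := (hFg c).map (LinearMap.mulLeft K⟦X⟧ x ∘ₗ g.toLinearMap ∘ₗ y ∘ₗ g'.toLinearMap)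
    simpa only [LinearMap.comp_apply, AlgHom.toLinearMap_apply, hgg', LinearMap.mulLeft_apply]
      using this

end TensorEnd

namespace Realization

variable {n : ℕ} {P P' : Matrix (Fin n) (Fin n) K⟦X⟧} {𝔥 𝔥' : Type*} [AddCommGroup 𝔥]
  [Module K⟦X⟧ 𝔥] [Module.Free K⟦X⟧ 𝔥] [Module.Finite K⟦X⟧ 𝔥] [AddCommGroup 𝔥']
  [Module K⟦X⟧ 𝔥'] [Module.Free K⟦X⟧ 𝔥'] [Module.Finite K⟦X⟧ 𝔥'] {R : Realization P 𝔥}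
  {R' : Realization P' 𝔥'}

/-- A bilinear form on `𝔥 / 𝔰` is a sum of products of linear forms. -/
lemma exists_decomposition
    (β : (𝔥 ⧸ R.sSpan) →ₗ[K⟦X⟧] (𝔥 ⧸ R.sSpan) →ₗ[K⟦X⟧] K⟦X⟧) :
    ∃ (m : ℕ) (ξ θ : Fin m → Module.Dual K⟦X⟧ (𝔥 ⧸ R.sSpan)),
      ∀ x, ∑ s, ξ s x • θ s = β x := by
  have hinj : Function.Injective (R.sSpan.mkQ.dualMap) :=
    LinearMap.dualMap_injective_of_surjective (Submodule.mkQ_surjective _)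
  have : Module.Finite K⟦X⟧ (Module.Dual K⟦X⟧ (𝔥 ⧸ R.sSpan)) := Module.Finite.of_injective _ hinj
  have : Module.IsTorsionFree K⟦X⟧ (Module.Dual K⟦X⟧ (𝔥 ⧸ R.sSpan)) := inferInstance
  have : Module.Free K⟦X⟧ (Module.Dual K⟦X⟧ (𝔥 ⧸ R.sSpan)) := inferInstance
  let b := Module.finBasis K⟦X⟧ (Module.Dual K⟦X⟧ (𝔥 ⧸ R.sSpan))
  exact ⟨_, fun s => b.coord s ∘ₗ β, b, fun x => b.sum_repr (β x)⟩

variable {B B' : Type*} [Ring B] [Algebra K⟦X⟧ B] [IsAdicComplete (hId K) B]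
  [Ring B'] [Algebra K⟦X⟧ B'] [IsAdicComplete (hId K) B']
  {t : 𝔥 →ₗ[K⟦X⟧] B} {e f : Fin n → B} {t' : 𝔥' →ₗ[K⟦X⟧] B'} {e' f' : Fin n → B'}
  [CharZero K] (O : R.TorusOps t e f) (O' : R'.TorusOps t' e' f') {D : Twist R' R}
  {Ψ : B' →ₐ[K⟦X⟧] Module.End K⟦X⟧ B} (T : R.ToralDer t e f)

namespace ToralDer

variable {m : ℕ} (ξ θ : Fin m → Module.Dual K⟦X⟧ (𝔥 ⧸ R.sSpan))

/-- The operator `ħ⁻¹ ∑ (L_ξ ⊗ L_θ - R_ξ ⊗ R_θ)`. -/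
def casimir : Module.End K⟦X⟧ (CTensor K B B) :=
  ∑ s, (cm K B (O.Θ (R.liftDual (ξ s)).1) (T.dl (θ s)) +
    cm K B (T.dr (ξ s)) (O.Θ (R.liftDual (θ s)).1))

lemma X_smul_casimir : (X : K⟦X⟧) • T.casimir O ξ θ =
    ∑ s, cm K B (T.dl (ξ s)) (T.dl (θ s)) - ∑ s, cm K B (T.dr (ξ s)) (T.dr (θ s)) := by
  rw [casimir, Finset.smul_sum, ← Finset.sum_sub_distrib]
  refine Finset.sum_congr rfl fun s _ => ?_
  rw [T.dl_eq O (θ s), T.dl_eq O (ξ s)]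
  simp only [map_add, map_smul, LinearMap.add_apply, LinearMap.smul_apply, smul_add]
  abel

lemma commute_casimir {F G : Module.End K⟦X⟧ B} (hF : ∀ ζ, Commute F (O.Θ ζ))
    (hG : ∀ ζ, Commute G (O.Θ ζ)) (hFR : ∀ ζ, Commute F (T.dr ζ)) (hGL : ∀ ζ, Commute G (T.dl ζ)) :
    Commute (cm K B F G) (T.casimir O ξ θ) :=
  Commute.sum_right _ _ _ fun _ _ =>
    (cm_commute (hF _) (hGL _)).add_right (cm_commute (hFR _) (hG _))

variable {ξ θ} {χ : R.AltS} (hχ : ∀ x, ∑ s, ξ s x • θ s = χ.bar x)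

lemma casimir_one (c : B) : T.casimir O ξ θ (tmul K 1 c) = 0 := by
  rw [casimir, LinearMap.sum_apply]
  refine Finset.sum_eq_zero fun s _ => ?_
  rw [LinearMap.add_apply, cm_tmul, cm_tmul, O.Θ_one, T.dr_one, map_zero, LinearMap.zero_apply,
    LinearMap.zero_apply, add_zero]

include hχ in
lemma casimir_t (x : 𝔥) : T.casimir O ξ θ * cm K B (LinearMap.mulLeft K⟦X⟧ (t x)) 1 =
    cm K B (LinearMap.mulLeft K⟦X⟧ (t x)) 1 * T.casimir O ξ θ + cm K B 1 (O.Θ (χ.form x)) := by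
  have h1 : χ.form x = (R.liftDual (χ.bar (Submodule.Quotient.mk x))).1 := rfl
  have h2 : ∀ ζ, O.Θ ζ * LinearMap.mulLeft K⟦X⟧ (t x) = LinearMap.mulLeft K⟦X⟧ (t x) * O.Θ ζ :=
    fun ζ => LinearMap.ext (O.Θ_t ζ x)
  have h3 : ∀ ζ, T.dr ζ * LinearMap.mulLeft K⟦X⟧ (t x) =
      LinearMap.mulLeft K⟦X⟧ (t x) * T.dr ζ + ζ (Submodule.Quotient.mk x) • 1 :=
    fun ζ => LinearMap.ext (T.dr_t ζ x)
  rw [h1, ← hχ, casimir, Finset.sum_mul, Finset.mul_sum]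
  simp only [add_mul, mul_add, cm_mul, h2, h3, one_mul, mul_one, map_add, map_smul, map_sum,
    LinearMap.add_apply, LinearMap.smul_apply, Submodule.coe_sum, Submodule.coe_smul,
    Finset.sum_add_distrib]
  abel

include hχ in
lemma casimir_e (i : Fin n) : T.casimir O ξ θ * cm K B (LinearMap.mulLeft K⟦X⟧ (e i)) 1 =
    cm K B (LinearMap.mulLeft K⟦X⟧ (e i)) 1 * (T.casimir O ξ θ +
      cm K B 1 (T.dl (χ.bar (Submodule.Quotient.mk (R.Tp i))))) := by
  have h2 : ∀ ζ, O.Θ ζ * LinearMap.mulLeft K⟦X⟧ (e i) =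
      LinearMap.mulLeft K⟦X⟧ (e i) * (O.Θ ζ + ζ (R.Tp i) • 1) :=
    fun ζ => LinearMap.ext (O.Θ_e ζ i)
  have h3 : ∀ ζ, T.dr ζ * LinearMap.mulLeft K⟦X⟧ (e i) = LinearMap.mulLeft K⟦X⟧ (e i) * T.dr ζ :=
    fun ζ => LinearMap.ext (T.dr_e ζ i)
  rw [← hχ, casimir, Finset.sum_mul, mul_add, Finset.mul_sum]
  simp only [add_mul, mul_add, cm_mul, h2, h3, one_mul, mul_one, map_add, map_smul, map_sum,
    LinearMap.add_apply, LinearMap.smul_apply, Finset.mul_sum, mul_smul_comm, liftDual_apply,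
    Finset.sum_add_distrib]
  abel

include hχ in
lemma casimir_f (i : Fin n) : T.casimir O ξ θ * cm K B (LinearMap.mulLeft K⟦X⟧ (f i)) 1 =
    cm K B (LinearMap.mulLeft K⟦X⟧ (f i)) 1 * (T.casimir O ξ θ +
      cm K B 1 (T.dr (-χ.bar (Submodule.Quotient.mk (R.Tp i))))) := by
  have h2 : ∀ ζ, O.Θ ζ * LinearMap.mulLeft K⟦X⟧ (f i) =
      LinearMap.mulLeft K⟦X⟧ (f i) * (O.Θ ζ - ζ (R.Tp i) • 1) :=
    fun ζ => LinearMap.ext (O.Θ_f ζ i)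
  have h3 : ∀ ζ, T.dr ζ * LinearMap.mulLeft K⟦X⟧ (f i) = LinearMap.mulLeft K⟦X⟧ (f i) *
      (T.dr ζ + (X * ζ (Submodule.Quotient.mk (R.Tp i))) • 1) :=
    fun ζ => LinearMap.ext (T.dr_f ζ i)
  rw [← hχ, casimir, Finset.sum_mul, mul_add, Finset.mul_sum]
  simp only [T.dl_eq O, add_mul, mul_add, mul_sub, cm_mul, h2, h3, one_mul, mul_one, map_add, map_sub,
    map_neg, map_smul, map_sum, LinearMap.add_apply, LinearMap.sub_apply, LinearMap.smul_apply,
    Finset.mul_sum, mul_neg, mul_smul_comm, liftDual_apply, Finset.sum_add_distrib,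
    Finset.sum_sub_distrib, smul_mul_assoc, smul_sub, smul_smul, mul_comm (X : K⟦X⟧)]
  abel

include O' in
/-- The terms of the deformed product add up to the twisted representation. -/
lemma sums_starTerm (hΨ : O.IsTwRep D t' e' f' Ψ) (hχ : ∀ x, ∑ s, ξ s x • θ s = D.χ.bar x)
    (x : B') (c : B) :
    Sums K (fun k => starTerm (T.casimir O ξ θ) k (orbit Ψ x) c) (Ψ x c) := by
  have hneg : ∀ {ζ : R.antiDual} b, O.lam ζ (O.lam (-ζ) b) = b := fun {ζ} b => by
    have := O.lam_neg (-ζ) b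
    rwa [show - -ζ = ζ from neg_neg ζ] at this
  have hneg' : ∀ {ζ : R.antiDual} b, O.rho ζ (O.rho (-ζ) b) = b := fun {ζ} b => by
    have := O.rho_neg (-ζ) b
    rwa [show - -ζ = ζ from neg_neg ζ] at this
  have hcΘ : ∀ ζ ζ', Commute (O.Θ ζ) (O.Θ ζ') := fun ζ ζ' => LinearMap.ext (O.Θ_Θ ζ ζ')
  have hrΘ : ∀ ζ ζ', Commute (T.dr ζ) (O.Θ ζ') := fun ζ ζ' => LinearMap.ext (T.dr_Θ O ζ ζ')
  have hlΘ : ∀ ζ ζ', Commute (T.dl ζ) (O.Θ ζ') := fun ζ ζ' => LinearMap.ext (T.dl_Θ O ζ ζ')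
  have hll : ∀ ζ ζ', Commute (T.dl ζ) (T.dl ζ') := fun ζ ζ' => LinearMap.ext (T.dl_dl O ζ ζ')
  have hlr : ∀ ζ ζ', Commute (T.dl ζ) (T.dr ζ') := fun ζ ζ' => LinearMap.ext (T.dl_dr O ζ ζ')
  have h1 : ∀ F : Module.End K⟦X⟧ B, Commute 1 F := Commute.one_left
  refine O'.sums_ext (ι := B)
    (F := fun c k => (starTerm (T.casimir O ξ θ) k).flip c ∘ₗ orbit Ψ)
    (G := fun c => LinearMap.applyₗ c ∘ₗ Ψ.toLinearMap)
    (fun c => ?_) (fun y b h c => ?_) (fun i b h c => ?_) (fun i b h c => ?_) x c <;>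
    simp only [LinearMap.comp_apply, LinearMap.flip_apply, LinearMap.applyₗ_apply_apply,
      AlgHom.toLinearMap_apply] at *
  · have h0 : Ψ 1 c = starTerm (T.casimir O ξ θ) 0 (orbit Ψ 1) c := by
      rw [starTerm_apply, dpow_zero, Module.End.one_apply, mulT_tmul, orbit_one, one_mul, map_one Ψ,
        Module.End.one_apply]
    rw [h0]
    refine Sums.of_first fun k => ?_
    rw [starTerm_apply, orbit_one, dpow, pow_succ, LinearMap.smul_apply, Module.End.mul_apply,
      LinearMap.smul_apply, T.casimir_one, smul_zero, map_zero, smul_zero, map_zero]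
  · set a := orbit Ψ b with ha
    set Dd := T.casimir O ξ θ with hDd
    set Θ := O.Θ (D.χ.form (D.f y)) with hΘ
    have c1 : Commute (cm K B 1 Θ) Dd := T.commute_casimir O ξ θ (fun _ => h1 _) (hcΘ _)
      (fun _ => h1 _) (fun _ => (hlΘ _ _).symm)
    have c2 : Commute (cm K B Θ 1) Dd := T.commute_casimir O ξ θ (hcΘ _) (fun _ => h1 _)
      (fun _ => (hrΘ _ _).symm) (fun _ => h1 _)
    have e1 : ∀ k, starTerm Dd k (t (D.f y) * a) c = t (D.f y) * starTerm Dd k a c +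
        Nat.casesOn k 0 fun k => half K • starTerm Dd k a (Θ c) := fun k => by
      have e0 : tmul K (t (D.f y) * a) c =
        cm K B (LinearMap.mulLeft K⟦X⟧ (t (D.f y))) 1 (tmul K a c) := by
        rw [cm_tmul, LinearMap.mulLeft_apply, Module.End.one_apply]
      cases k with
      | zero =>
        rw [starTerm_apply, starTerm_apply, dpow_zero, Module.End.one_apply, Module.End.one_apply,
          mulT_tmul, mulT_tmul, mul_assoc]
        exact (add_zero _).symm
      | succ k =>
        have := LinearMap.congr_fun (dpow_mul_of_add (K := K) (T.casimir_t O hχ (D.f y)) c1.symm k)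
          (tmul K a c)
        rw [Module.End.mul_apply, LinearMap.add_apply, LinearMap.smul_apply, Module.End.mul_apply,
          Module.End.mul_apply] at this
        rw [starTerm_apply, e0, this, map_add, map_smul, mulT_mulLeft, starTerm_right c1]
        rfl
    have e2 : ∀ k, starTerm Dd k (Θ a) c = Θ (starTerm Dd k a c) - starTerm Dd k a (Θ c) :=
      fun k => by
        have := LinearMap.congr_fun (commute_dpow (K := K) c2 k).eq (tmul K a c)
        rw [Module.End.mul_apply, Module.End.mul_apply, cm_tmul] at this
        rw [starTerm_apply _ _ (Θ a), ← starTerm_right c1, starTerm_apply,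
          mulT_derivation (O.Θ_mul _), add_sub_cancel_right]
        exact congrArg _ this.symm
    have e3 := (((h c).map (LinearMap.mulLeft K⟦X⟧ (t (D.f y)))).add
      ((h (Θ c)).map (LinearMap.lsmul K⟦X⟧ B (half K))).shift).add
      ((((h c).map Θ).add ((h (Θ c)).map (-LinearMap.id))).map (LinearMap.lsmul K⟦X⟧ B (half K)))
    have e4 : ∀ k, starTerm Dd k (orbit Ψ (t' y * b)) c =
        t (D.f y) * starTerm Dd k a c + (Nat.casesOn k 0 fun k => half K • starTerm Dd k a (Θ c)) +
          half K • (Θ (starTerm Dd k a c) + -starTerm Dd k a (Θ c)) := fun k => by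
      rw [orbit_mul, hΨ.T, map_add, LinearMap.add_apply, e1, map_smul, LinearMap.smul_apply, e2,
        sub_eq_add_neg]
    simp only [e4]
    have e5 : Ψ (t' y * b) c = t (D.f y) * Ψ b c + half K • Ψ b (Θ c) +
        half K • (Θ (Ψ b c) + -Ψ b (Θ c)) := by
      rw [map_mul, Module.End.mul_apply, hΨ.T, smul_add, smul_neg]
      abel
    rw [e5]
    exact e3
  · have hx := T.casimir_e O hχ i
    simp only [orbit_mul, hΨ.E, map_mul, Module.End.mul_apply]
    refine sums_starTerm_of_shift hx ?_ ?_ hneg (O.lam_neg _) (fun c => T.sums_dl O _ c) h c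
    · exact T.commute_casimir O ξ θ (fun _ => h1 _) (hlΘ _) (fun _ => h1 _) (hll _)
    · exact T.commute_casimir O ξ θ (fun _ => LinearMap.ext fun b => (O.Θ_lam _ _ b).symm)
        (fun _ => LinearMap.ext fun b => (O.Θ_lam _ _ b).symm)
        (fun _ => LinearMap.ext fun b => (T.dr_lam O _ _ b).symm)
        (fun _ => LinearMap.ext fun b => (T.dl_lam O _ _ b).symm)
  · have hx := T.casimir_f O hχ i
    simp only [orbit_mul, hΨ.F, map_mul, Module.End.mul_apply]
    refine sums_starTerm_of_shift hx ?_ ?_ hneg' (O.rho_neg _) (fun c => T.sums_dr O _ c) h c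
    · exact T.commute_casimir O ξ θ (fun _ => h1 _) (hrΘ _) (fun _ => h1 _) fun _ => (hlr _ _).symm
    · exact T.commute_casimir O ξ θ (fun _ => LinearMap.ext fun b => (O.Θ_rho _ _ b).symm)
        (fun _ => LinearMap.ext fun b => (O.Θ_rho _ _ b).symm)
        (fun _ => LinearMap.ext fun b => (T.dr_rho O _ _ b).symm)
        (fun _ => LinearMap.ext fun b => (T.dl_rho O _ _ b).symm)

end ToralDer

end Realization

end FoMp
end

noncomputable section
namespace FoMp
variable {K : Type*} [Field K]

/-! ### Convolution with a functional -/

section Conv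

variable {B W : Type*} [Ring B] [Algebra K⟦X⟧ B] [IsAdicComplete (hId K) B] [AddCommGroup W]
  [Module K⟦X⟧ W] [IsAdicComplete (hId K) W] (H : HopfStr K B)

lemma fold_ext {M N : Type*} [AddCommGroup M] [Module K⟦X⟧ M] [AddCommGroup N] [Module K⟦X⟧ N]
    {F : CTensor K M N →ₗ[K⟦X⟧] W} {ω : M →ₗ[K⟦X⟧] N →ₗ[K⟦X⟧] W} (h : ∀ a b, F (tmul K a b) = ω a b) :
    F = fold ω :=
  ctensor_ext fun a b => by rw [h, fold_tmul]

/-- Convolution of bilinear maps from the left with functionals on the tensor square. -/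
def convL (ω : B →ₗ[K⟦X⟧] B →ₗ[K⟦X⟧] W) :
    (CTensor K B B →ₗ[K⟦X⟧] K⟦X⟧) →ₗ[K⟦X⟧] CTensor K B B →ₗ[K⟦X⟧] W where
  toFun s := fold (conv H.comul (LinearMap.lsmul K⟦X⟧ W) ((tmul K).compr₂ s) ω)
  map_add' s s' := ctensor_ext fun a b => by
    have : cross (LinearMap.lsmul K⟦X⟧ W) ((tmul K).compr₂ (s + s')) ω =
        cross (LinearMap.lsmul K⟦X⟧ W) ((tmul K).compr₂ s) ω +
          cross (LinearMap.lsmul K⟦X⟧ W) ((tmul K).compr₂ s') ω :=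
      ctensor_ext₂ fun m n p q => by
        simp only [LinearMap.add_apply, cross_tmul, LinearMap.compr₂_apply, map_add]
    simp only [LinearMap.add_apply, fold_tmul, conv, LinearMap.compl₁₂_apply, this]
  map_smul' c s := ctensor_ext fun a b => by
    have : cross (LinearMap.lsmul K⟦X⟧ W) ((tmul K).compr₂ (c • s)) ω =
        c • cross (LinearMap.lsmul K⟦X⟧ W) ((tmul K).compr₂ s) ω :=
      ctensor_ext₂ fun m n p q => by
        simp only [LinearMap.smul_apply, cross_tmul, LinearMap.compr₂_apply, map_smul]
    simp only [LinearMap.smul_apply, fold_tmul, conv, LinearMap.compl₁₂_apply, this, RingHom.id_apply]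

/-- Convolution of bilinear maps from the right with functionals on the tensor square. -/
def convR (ω : B →ₗ[K⟦X⟧] B →ₗ[K⟦X⟧] W) :
    (CTensor K B B →ₗ[K⟦X⟧] K⟦X⟧) →ₗ[K⟦X⟧] CTensor K B B →ₗ[K⟦X⟧] W where
  toFun s := fold (conv H.comul (LinearMap.lsmul K⟦X⟧ W).flip ω ((tmul K).compr₂ s))
  map_add' s s' := ctensor_ext fun a b => by
    have : cross (LinearMap.lsmul K⟦X⟧ W).flip ω ((tmul K).compr₂ (s + s')) =
        cross (LinearMap.lsmul K⟦X⟧ W).flip ω ((tmul K).compr₂ s) +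
          cross (LinearMap.lsmul K⟦X⟧ W).flip ω ((tmul K).compr₂ s') :=
      ctensor_ext₂ fun m n p q => by
        simp only [LinearMap.add_apply, cross_tmul, LinearMap.compr₂_apply, map_add]
    simp only [LinearMap.add_apply, fold_tmul, conv, LinearMap.compl₁₂_apply, this]
  map_smul' c s := ctensor_ext fun a b => by
    have : cross (LinearMap.lsmul K⟦X⟧ W).flip ω ((tmul K).compr₂ (c • s)) =
        c • cross (LinearMap.lsmul K⟦X⟧ W).flip ω ((tmul K).compr₂ s) :=
      ctensor_ext₂ fun m n p q => by
        simp only [LinearMap.smul_apply, cross_tmul, LinearMap.compr₂_apply, map_smul]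
    simp only [LinearMap.smul_apply, fold_tmul, conv, LinearMap.compl₁₂_apply, this, RingHom.id_apply]

variable {H}

lemma convL_tmul (ω : B →ₗ[K⟦X⟧] B →ₗ[K⟦X⟧] W) (s : CTensor K B B →ₗ[K⟦X⟧] K⟦X⟧) (a b : B) :
    convL H ω s (tmul K a b) =
      cross (LinearMap.lsmul K⟦X⟧ W) ((tmul K).compr₂ s) ω (H.comul a) (H.comul b) :=
  fold_tmul K _ a b

lemma convR_tmul (ω : B →ₗ[K⟦X⟧] B →ₗ[K⟦X⟧] W) (s : CTensor K B B →ₗ[K⟦X⟧] K⟦X⟧) (a b : B) :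
    convR H ω s (tmul K a b) =
      cross (LinearMap.lsmul K⟦X⟧ W).flip ω ((tmul K).compr₂ s) (H.comul a) (H.comul b) :=
  fold_tmul K _ a b

variable (H) in
/-- `ε ⊗̂ ε`. -/
def epsT : CTensor K B B →ₗ[K⟦X⟧] K⟦X⟧ :=
  fold ((LinearMap.mul K⟦X⟧ K⟦X⟧).compl₁₂ H.counit H.counit)

lemma epsT_tmul (a b : B) : epsT H (tmul K a b) = H.counit a * H.counit b := fold_tmul K _ a b

lemma convL_epsT (ω : B →ₗ[K⟦X⟧] B →ₗ[K⟦X⟧] W) : convL H ω (epsT H) = fold ω :=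
  fold_ext fun a b => by
    have : cross (LinearMap.lsmul K⟦X⟧ W) ((tmul K).compr₂ (epsT H)) ω =
        ω.compl₁₂ (fold ((LinearMap.lsmul K⟦X⟧ B).comp H.counit))
          (fold ((LinearMap.lsmul K⟦X⟧ B).comp H.counit)) := ctensor_ext₂ fun m n p q => by
      simp only [cross_tmul, LinearMap.compr₂_apply, epsT_tmul, LinearMap.compl₁₂_apply, fold_tmul,
        LinearMap.comp_apply, LinearMap.lsmul_apply, map_smul, LinearMap.smul_apply, smul_smul,
        mul_comm]
    rw [convL_tmul, this, LinearMap.compl₁₂_apply, H.counit_comul, H.counit_comul]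

lemma convR_epsT (ω : B →ₗ[K⟦X⟧] B →ₗ[K⟦X⟧] W) : convR H ω (epsT H) = fold ω :=
  fold_ext fun a b => by
    have : cross (LinearMap.lsmul K⟦X⟧ W).flip ω ((tmul K).compr₂ (epsT H)) =
        ω.compl₁₂ (fold ((LinearMap.lsmul K⟦X⟧ B).comp H.counit).flip)
          (fold ((LinearMap.lsmul K⟦X⟧ B).comp H.counit).flip) := ctensor_ext₂ fun m n p q => by
      simp only [cross_tmul, LinearMap.compr₂_apply, epsT_tmul, LinearMap.compl₁₂_apply, fold_tmul,
        LinearMap.comp_apply, LinearMap.flip_apply, LinearMap.lsmul_apply, map_smul,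
        LinearMap.smul_apply, smul_smul, mul_comm]
    rw [convR_tmul, this, LinearMap.compl₁₂_apply, H.comul_counit, H.comul_counit]

variable (H) in
/-- The operators that commute with left convolutions. -/
def leftOps (ω : B →ₗ[K⟦X⟧] B →ₗ[K⟦X⟧] W) : Subalgebra K⟦X⟧ (Module.End K⟦X⟧ (CTensor K B B)) where
  carrier := {Φ | ∀ s, convL H ω (s ∘ₗ Φ) = convL H ω s ∘ₗ Φ}
  mul_mem' {Φ Φ'} h h' s := by
    have := h' (s ∘ₗ Φ)
    rw [h] at this
    exact this
  add_mem' {Φ Φ'} h h' s := by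
    rw [LinearMap.comp_add, map_add, h, h', LinearMap.comp_add]
  algebraMap_mem' r s := by
    rw [Algebra.algebraMap_eq_smul_one, LinearMap.comp_smul, map_smul, LinearMap.comp_smul]
    rfl

variable (H) in
/-- The operators that commute with right convolutions. -/
def rightOps (ω : B →ₗ[K⟦X⟧] B →ₗ[K⟦X⟧] W) : Subalgebra K⟦X⟧ (Module.End K⟦X⟧ (CTensor K B B)) where
  carrier := {Φ | ∀ s, convR H ω (s ∘ₗ Φ) = convR H ω s ∘ₗ Φ}
  mul_mem' {Φ Φ'} h h' s := by
    have := h' (s ∘ₗ Φ)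
    rw [h] at this
    exact this
  add_mem' {Φ Φ'} h h' s := by
    rw [LinearMap.comp_add, map_add, h, h', LinearMap.comp_add]
  algebraMap_mem' r s := by
    rw [Algebra.algebraMap_eq_smul_one, LinearMap.comp_smul, map_smul, LinearMap.comp_smul]
    rfl

lemma cm_mem_leftOps (ω : B →ₗ[K⟦X⟧] B →ₗ[K⟦X⟧] W) {F G : Module.End K⟦X⟧ B}
    (hF : ∀ b, H.comul (F b) = cmap K F .id (H.comul b))
    (hG : ∀ b, H.comul (G b) = cmap K G .id (H.comul b)) : cm K B F G ∈ leftOps H ω := fun s =>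
  ctensor_ext fun a b => by
    have : cross (LinearMap.lsmul K⟦X⟧ W) ((tmul K).compr₂ (s ∘ₗ cm K B F G)) ω =
        (cross (LinearMap.lsmul K⟦X⟧ W) ((tmul K).compr₂ s) ω).compl₁₂ (cmap K F .id) (cmap K G .id) :=
      ctensor_ext₂ fun m n p q => by
        rw [LinearMap.compl₁₂_apply, cmap_apply_tmul, cmap_apply_tmul, cross_tmul, cross_tmul,
          LinearMap.compr₂_apply, LinearMap.compr₂_apply, LinearMap.comp_apply, cm_tmul]
        rfl
    rw [convL_tmul, this, LinearMap.compl₁₂_apply, ← hF, ← hG, LinearMap.comp_apply, cm_tmul,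
      convL_tmul]

lemma cm_mem_rightOps (ω : B →ₗ[K⟦X⟧] B →ₗ[K⟦X⟧] W) {F G : Module.End K⟦X⟧ B}
    (hF : ∀ b, H.comul (F b) = cmap K .id F (H.comul b))
    (hG : ∀ b, H.comul (G b) = cmap K .id G (H.comul b)) : cm K B F G ∈ rightOps H ω := fun s =>
  ctensor_ext fun a b => by
    have : cross (LinearMap.lsmul K⟦X⟧ W).flip ω ((tmul K).compr₂ (s ∘ₗ cm K B F G)) =
        (cross (LinearMap.lsmul K⟦X⟧ W).flip ω ((tmul K).compr₂ s)).compl₁₂ (cmap K .id F)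
          (cmap K .id G) :=
      ctensor_ext₂ fun m n p q => by
        rw [LinearMap.compl₁₂_apply, cmap_apply_tmul, cmap_apply_tmul, cross_tmul, cross_tmul,
          LinearMap.compr₂_apply, LinearMap.compr₂_apply, LinearMap.comp_apply, cm_tmul]
        rfl
    rw [convR_tmul, this, LinearMap.compl₁₂_apply, ← hF, ← hG, LinearMap.comp_apply, cm_tmul,
      convR_tmul]

lemma convL_comp {ω : B →ₗ[K⟦X⟧] B →ₗ[K⟦X⟧] W} {Φ : Module.End K⟦X⟧ (CTensor K B B)}
    (h : Φ ∈ leftOps H ω) (s : CTensor K B B →ₗ[K⟦X⟧] K⟦X⟧) :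
    convL H ω (s ∘ₗ Φ) = convL H ω s ∘ₗ Φ := h s

lemma convR_comp {ω : B →ₗ[K⟦X⟧] B →ₗ[K⟦X⟧] W} {Φ : Module.End K⟦X⟧ (CTensor K B B)}
    (h : Φ ∈ rightOps H ω) (s : CTensor K B B →ₗ[K⟦X⟧] K⟦X⟧) :
    convR H ω (s ∘ₗ Φ) = convR H ω s ∘ₗ Φ := h s

lemma dpow_mem {A : Type*} [Ring A] [Algebra K⟦X⟧ A] {S : Subalgebra K⟦X⟧ A} {x : A} (h : x ∈ S)
    (k : ℕ) : dpow K x k ∈ S :=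
  S.smul_mem (S.pow_mem (S.smul_mem h _) _) _

end Conv

end FoMp
end

noncomputable section
namespace FoMp
variable {K : Type*} [Field K]

/-! ### The completed symmetric algebra -/

section Sym

variable {M : Type*} [AddCommGroup M] [Module K⟦X⟧ M]

lemma symProj_ι_mul {R : Type*} [CommRing R] {M : Type*} [AddCommGroup M] [Module R M] (m : M)
    (x : SymmetricAlgebra R M) :
    symProj R M (SymmetricAlgebra.ι R M m * x) = SymmetricAlgebra.algebraMapInv x • m := by
  let _ : Module Rᵐᵒᵖ M := Module.compHom M ((RingHom.id R).fromOpposite mul_comm)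
  have _ : IsCentralScalar R M := ⟨fun _ _ => rfl⟩
  have h : (TrivSqZeroExt.fstHom R R M).comp (SymmetricAlgebra.lift (TrivSqZeroExt.inrHom R M)) =
      SymmetricAlgebra.algebraMapInv := SymmetricAlgebra.algHom_ext (LinearMap.ext fun m => by
    simp [SymmetricAlgebra.algebraMapInv])
  have h2 : (SymmetricAlgebra.lift (TrivSqZeroExt.inrHom R M) x).fst =
      SymmetricAlgebra.algebraMapInv x := congrArg (fun g => g x) h
  change (SymmetricAlgebra.lift (TrivSqZeroExt.inrHom R M) (SymmetricAlgebra.ι R M m * x)).snd = _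
  rw [map_mul, SymmetricAlgebra.lift_ι_apply, TrivSqZeroExt.inrHom_apply, TrivSqZeroExt.snd_mul,
    TrivSqZeroExt.fst_inr, TrivSqZeroExt.snd_inr, zero_smul, zero_add, h2]
  rfl

namespace SymHat

lemma counit_of (x : SymmetricAlgebra K⟦X⟧ M) :
    counit M (HComp.of K _ x) = SymmetricAlgebra.algebraMapInv x :=
  ext₁_of (M := SymmetricAlgebra K⟦X⟧ M) _ x

lemma counit_one : counit (K := K) M 1 = 1 := (counit_of 1).trans (map_one _)

lemma counit_ι_mul (m : M) (w : SymHat K M) : counit M (ι M m * w) = 0 := by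
  have : counit M ∘ₗ LinearMap.mulLeft K⟦X⟧ (ι M m) = 0 := HComp.hom_ext fun x => by
    rw [LinearMap.comp_apply, LinearMap.mulLeft_apply, ι, LinearMap.comp_apply, ← HComp.of_mul,
      counit_of, map_mul]
    simp [SymmetricAlgebra.algebraMapInv]
  exact LinearMap.congr_fun this w

/-- The extension of a functional on `M` to `Ŝ(M)`, by zero in degrees other than one. -/
def hat : Module.Dual K⟦X⟧ M →ₗ[K⟦X⟧] Module.Dual K⟦X⟧ (SymHat K M) :=
  ext₁ (M := SymmetricAlgebra K⟦X⟧ M) (N := K⟦X⟧) ∘ₗ (symProj K⟦X⟧ M).dualMap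

lemma hat_of (η : Module.Dual K⟦X⟧ M) (x : SymmetricAlgebra K⟦X⟧ M) :
    hat η (HComp.of K _ x) = η (symProj K⟦X⟧ M x) :=
  ext₁_of (M := SymmetricAlgebra K⟦X⟧ M) _ x

lemma hat_one (η : Module.Dual K⟦X⟧ M) : hat η 1 = 0 :=
  (hat_of η 1).trans (by rw [symProj_one, map_zero])

lemma hat_ι_mul (η : Module.Dual K⟦X⟧ M) (m : M) (w : SymHat K M) :
    hat η (ι M m * w) = η m * counit M w := by
  have : hat η ∘ₗ LinearMap.mulLeft K⟦X⟧ (ι M m) = η m • counit M := HComp.hom_ext fun x => by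
    rw [LinearMap.comp_apply, LinearMap.mulLeft_apply, ι, LinearMap.comp_apply, ← HComp.of_mul,
      hat_of, symProj_ι_mul, map_smul, LinearMap.smul_apply, counit_of, smul_eq_mul, smul_eq_mul,
      mul_comm]
  exact LinearMap.congr_fun this w

lemma chiTilde_eq {β : M →ₗ[K⟦X⟧] M →ₗ[K⟦X⟧] K⟦X⟧} {m : ℕ} {ξ θ : Fin m → Module.Dual K⟦X⟧ M}
    (h : ∀ x, ∑ s, ξ s x • θ s = β x) (x y : SymHat K M) :
    chiTilde β x y = ∑ s, hat (ξ s) x * hat (θ s) y := by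
  have : chiTilde β = ∑ s, (LinearMap.mul K⟦X⟧ K⟦X⟧).compl₁₂ (hat (ξ s)) (hat (θ s)) :=
    HComp.hom_ext fun x => HComp.hom_ext fun y => by
      refine (ext₂_of _ x y).trans ?_
      simp only [LinearMap.compl₁₂_apply, LinearMap.sum_apply, hat_of, ← h, LinearMap.smul_apply,
        smul_eq_mul, LinearMap.mul_apply']
  rw [this]
  simp only [LinearMap.sum_apply, LinearMap.compl₁₂_apply, LinearMap.mul_apply']


section Extension

variable {S : Type*} [Ring S] [Algebra K⟦X⟧ S] (δ : S →ₐ[K⟦X⟧] S ⊗[K⟦X⟧] S)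

/-- Left multiplication on a completed algebra. -/
def mulL (a : HComp K S) : HComp K S →ₗ[K⟦X⟧] HComp K S := LinearMap.mulLeft K⟦X⟧ a

lemma mulL_apply (a w : HComp K S) : mulL a w = a * w := rfl

/-- The continuous extension of a coproduct. -/
def extComul : HComp K S →ₗ[K⟦X⟧] CTensor K (HComp K S) (HComp K S) :=
  (AdicCompletion.map (hId K) (TensorProduct.map (HComp.of K S) (HComp.of K S) ∘ₗ
    δ.toLinearMap)).restrictScalars K⟦X⟧

lemma extComul_of (x : S) : extComul δ (HComp.of K S x) =
    AdicCompletion.of (hId K) _ (TensorProduct.map (HComp.of K S) (HComp.of K S) (δ x)) :=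
  AdicCompletion.map_of _ _ _

lemma of_map_mul (a b : S) (z : S ⊗[K⟦X⟧] S) :
    AdicCompletion.of (hId K) _ (TensorProduct.map (HComp.of K S) (HComp.of K S) (a ⊗ₜ b * z)) =
      cmap K (mulL (HComp.of K S a)) (mulL (HComp.of K S b))
      (AdicCompletion.of (hId K) _ (TensorProduct.map (HComp.of K S) (HComp.of K S) z)) := by
  induction z with
  | zero => simp only [mul_zero, map_zero]
  | add z z' h h' => simp only [mul_add, map_add, h, h']
  | tmul c c' =>
    rw [Algebra.TensorProduct.tmul_mul_tmul, TensorProduct.map_tmul, TensorProduct.map_tmul,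
      HComp.of_mul, HComp.of_mul]
    exact (cmap_apply_tmul _ _ _ _).symm

lemma extComul_mul {a : S} (h : δ a = a ⊗ₜ 1 + 1 ⊗ₜ a) (w : HComp K S) :
    extComul δ (mulL (HComp.of K S a) w) =
      cmap K (mulL (HComp.of K S a)) .id (extComul δ w) +
        cmap K .id (mulL (HComp.of K S a)) (extComul δ w) := by
  have : extComul δ ∘ₗ mulL (HComp.of K S a) =
      cmap K (mulL (HComp.of K S a)) .id ∘ₗ extComul δ +
      cmap K .id (mulL (HComp.of K S a)) ∘ₗ extComul δ := HComp.hom_ext fun x => by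
    have h1 : mulL (HComp.of K S 1) = .id := LinearMap.ext fun x => one_mul x
    rw [LinearMap.comp_apply, mulL_apply, ← HComp.of_mul, LinearMap.add_apply,
      LinearMap.comp_apply, LinearMap.comp_apply, extComul_of, extComul_of, map_mul, h, add_mul, map_add,
      map_add, of_map_mul, of_map_mul, h1]
  exact LinearMap.congr_fun this w

lemma extComul_one : extComul δ 1 = tmul K 1 1 := by
  rw [HComp.one_def, extComul_of, map_one, Algebra.TensorProduct.one_def, TensorProduct.map_tmul]
  rfl

end Extension

variable (K M) in
/-- The coproduct of `S(M)`. -/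
def comul₀ : SymmetricAlgebra K⟦X⟧ M →ₐ[K⟦X⟧]
    SymmetricAlgebra K⟦X⟧ M ⊗[K⟦X⟧] SymmetricAlgebra K⟦X⟧ M :=
  SymmetricAlgebra.lift (R := K⟦X⟧) (M := M)
    (A := SymmetricAlgebra K⟦X⟧ M ⊗[K⟦X⟧] SymmetricAlgebra K⟦X⟧ M)
    ((TensorProduct.mk K⟦X⟧ _ _).flip 1 ∘ₗ SymmetricAlgebra.ι K⟦X⟧ M +
      TensorProduct.mk K⟦X⟧ _ _ 1 ∘ₗ SymmetricAlgebra.ι K⟦X⟧ M)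

lemma comul₀_ι (m : M) : comul₀ K M (SymmetricAlgebra.ι K⟦X⟧ M m) =
    SymmetricAlgebra.ι K⟦X⟧ M m ⊗ₜ 1 + 1 ⊗ₜ SymmetricAlgebra.ι K⟦X⟧ M m :=
  SymmetricAlgebra.lift_ι_apply _ m

lemma ι_apply (m : M) : ι M m = HComp.of K _ (SymmetricAlgebra.ι K⟦X⟧ M m) := rfl

lemma comul_eq : comul (K := K) M = extComul (comul₀ K M) := rfl

lemma comul_ι_mul (m : M) (w : SymHat K M) : comul M (mulL (ι M m) w) =
    cmap K (mulL (ι M m)) .id (comul M w) +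
      cmap K .id (mulL (ι M m)) (comul M w) := by
  rw [comul_eq]
  exact extComul_mul (comul₀ K M) (comul₀_ι m) w

lemma comul_one : comul (K := K) M 1 = tmul K 1 1 := by
  rw [comul_eq, extComul_one]

end SymHat
end Sym
end FoMp
end

noncomputable section
namespace FoMp
variable {K : Type*} [Field K]

/-! ### Contractions of the coproduct -/

section Contraction

variable {V W : Type*} [AddCommGroup V] [Module K⟦X⟧ V] [AddCommGroup W] [Module K⟦X⟧ W]
  [IsAdicComplete (hId K) W]

/-- `a ⊗ b ↦ φ(a) b`. -/
def ctrL (η : Module.Dual K⟦X⟧ V) : CTensor K V W →ₗ[K⟦X⟧] W :=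
  fold ((LinearMap.lsmul K⟦X⟧ W).comp η)

/-- `a ⊗ b ↦ φ(b) a`. -/
def ctrR (η : Module.Dual K⟦X⟧ V) : CTensor K W V →ₗ[K⟦X⟧] W :=
  fold ((LinearMap.lsmul K⟦X⟧ W).comp η).flip

lemma ctrL_tmul (η : Module.Dual K⟦X⟧ V) (a : V) (b : W) : ctrL η (tmul K a b) = η a • b :=
  fold_tmul K _ a b

lemma ctrR_tmul (η : Module.Dual K⟦X⟧ V) (a : W) (b : V) : ctrR η (tmul K a b) = η b • a :=
  fold_tmul K _ a b

lemma ctrL_add (η θ : Module.Dual K⟦X⟧ V) : (ctrL (η + θ) : CTensor K V W →ₗ[K⟦X⟧] W) =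
    ctrL η + ctrL θ := ctensor_ext fun a b => by
  simp only [LinearMap.add_apply, ctrL_tmul, add_smul]

lemma ctrR_add (η θ : Module.Dual K⟦X⟧ V) : (ctrR (η + θ) : CTensor K W V →ₗ[K⟦X⟧] W) =
    ctrR η + ctrR θ := ctensor_ext fun a b => by
  simp only [LinearMap.add_apply, ctrR_tmul, add_smul]

lemma ctrL_smul (c : K⟦X⟧) (η : Module.Dual K⟦X⟧ V) :
    (ctrL (c • η) : CTensor K V W →ₗ[K⟦X⟧] W) = c • ctrL η := ctensor_ext fun a b => by
  simp only [LinearMap.smul_apply, ctrL_tmul, smul_assoc]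

lemma ctrR_smul (c : K⟦X⟧) (η : Module.Dual K⟦X⟧ V) :
    (ctrR (c • η) : CTensor K W V →ₗ[K⟦X⟧] W) = c • ctrR η := ctensor_ext fun a b => by
  simp only [LinearMap.smul_apply, ctrR_tmul, smul_assoc]

lemma ctrL_zero : (ctrL (0 : Module.Dual K⟦X⟧ V) : CTensor K V W →ₗ[K⟦X⟧] W) = 0 :=
  ctensor_ext fun a b => by rw [ctrL_tmul, LinearMap.zero_apply, zero_smul, LinearMap.zero_apply]

lemma ctrR_zero : (ctrR (0 : Module.Dual K⟦X⟧ V) : CTensor K W V →ₗ[K⟦X⟧] W) = 0 :=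
  ctensor_ext fun a b => by rw [ctrR_tmul, LinearMap.zero_apply, zero_smul, LinearMap.zero_apply]

variable {W' : Type*} [AddCommGroup W'] [Module K⟦X⟧ W'] [IsAdicComplete (hId K) W']

lemma map_ctrL (η : Module.Dual K⟦X⟧ V) (g : W →ₗ[K⟦X⟧] W') (w : CTensor K V W) :
    g (ctrL η w) = ctrL η (cmap K .id g w) := by
  have : g ∘ₗ ctrL η = ctrL η ∘ₗ cmap K .id g := ctensor_ext fun a b => by
    rw [LinearMap.comp_apply, LinearMap.comp_apply, cmap_apply_tmul, ctrL_tmul, ctrL_tmul, map_smul]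
    rfl
  exact LinearMap.congr_fun this w

lemma map_ctrR (η : Module.Dual K⟦X⟧ V) (g : W →ₗ[K⟦X⟧] W') (w : CTensor K W V) :
    g (ctrR η w) = ctrR η (cmap K g .id w) := by
  have : g ∘ₗ ctrR η = ctrR η ∘ₗ cmap K g .id := ctensor_ext fun a b => by
    rw [LinearMap.comp_apply, LinearMap.comp_apply, cmap_apply_tmul, ctrR_tmul, ctrR_tmul, map_smul]
    rfl
  exact LinearMap.congr_fun this w

omit [IsAdicComplete (hId K) W'] in
lemma ctrL_cassoc (η : Module.Dual K⟦X⟧ V) (z : CTensor K (CTensor K V W) W') :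
    ctrL η (cassoc K z) = cmap K (ctrL η) .id z := by
  have : (ctrL η : CTensor K V (CTensor K W W') →ₗ[K⟦X⟧] CTensor K W W') ∘ₗ cassoc K =
      cmap K (ctrL η) .id := ctensor_ext_left fun a b c => by
    rw [LinearMap.comp_apply, cassoc_tmul, ctrL_tmul, cmap_apply_tmul, ctrL_tmul, (tmul K).map_smul,
      LinearMap.id_apply, LinearMap.smul_apply]
  exact LinearMap.congr_fun this z

omit [IsAdicComplete (hId K) W] in
lemma ctrR_eq_cassoc (η : Module.Dual K⟦X⟧ V) (z : CTensor K (CTensor K W W') V) :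
    ctrR η z = cmap K .id (ctrR η) (cassoc K z) := by
  have : (ctrR η : CTensor K (CTensor K W W') V →ₗ[K⟦X⟧] CTensor K W W') =
      cmap K .id (ctrR η) ∘ₗ cassoc K := ctensor_ext_left fun a b c => by
    rw [LinearMap.comp_apply, cassoc_tmul, ctrR_tmul, cmap_apply_tmul, ctrR_tmul, (tmul K _).map_smul,
      LinearMap.id_apply]
  exact LinearMap.congr_fun this z

lemma ctrL_ctrR (η θ : Module.Dual K⟦X⟧ W) (w : CTensor K W W) : η (ctrL θ w) = θ (ctrR η w) := by
  have : η ∘ₗ ctrL θ = θ ∘ₗ ctrR η := ctensor_ext fun a b => by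
    rw [LinearMap.comp_apply, LinearMap.comp_apply, ctrL_tmul, ctrR_tmul, map_smul, map_smul,
      smul_eq_mul, smul_eq_mul, mul_comm]
  exact LinearMap.congr_fun this w

end Contraction

section ContractComul

variable {B : Type*} [Ring B] [Algebra K⟦X⟧ B] [IsAdicComplete (hId K) B]

lemma ctrL_mul (η : Module.Dual K⟦X⟧ B) (x y : B) (w : CTensor K B B) :
    ctrL η (tmul K x y * w) = y * ctrL (η ∘ₗ LinearMap.mulLeft K⟦X⟧ x) w := by
  have : ctrL η ∘ₗ cmap K (LinearMap.mulLeft K⟦X⟧ x) (LinearMap.mulLeft K⟦X⟧ y) =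
      LinearMap.mulLeft K⟦X⟧ y ∘ₗ ctrL (η ∘ₗ LinearMap.mulLeft K⟦X⟧ x) := ctensor_ext fun a b => by
    rw [LinearMap.comp_apply, LinearMap.comp_apply, cmap_apply_tmul, ctrL_tmul, ctrL_tmul, map_smul]
    rfl
  rw [tmul_mul_eq_cmap]
  exact LinearMap.congr_fun this w

lemma ctrR_mul (η : Module.Dual K⟦X⟧ B) (x y : B) (w : CTensor K B B) :
    ctrR η (tmul K x y * w) = x * ctrR (η ∘ₗ LinearMap.mulLeft K⟦X⟧ y) w := by
  have : ctrR η ∘ₗ cmap K (LinearMap.mulLeft K⟦X⟧ x) (LinearMap.mulLeft K⟦X⟧ y) =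
      LinearMap.mulLeft K⟦X⟧ x ∘ₗ ctrR (η ∘ₗ LinearMap.mulLeft K⟦X⟧ y) := ctensor_ext fun a b => by
    rw [LinearMap.comp_apply, LinearMap.comp_apply, cmap_apply_tmul, ctrR_tmul, ctrR_tmul, map_smul]
    rfl
  rw [tmul_mul_eq_cmap]
  exact LinearMap.congr_fun this w

variable (H : HopfStr K B)

/-- `b ↦ φ(b₁) b₂`. -/
def HopfStr.actL (η : Module.Dual K⟦X⟧ B) : Module.End K⟦X⟧ B := ctrL η ∘ₗ H.comul

/-- `b ↦ b₁ φ(b₂)`. -/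
def HopfStr.actR (η : Module.Dual K⟦X⟧ B) : Module.End K⟦X⟧ B := ctrR η ∘ₗ H.comul

lemma HopfStr.ctrL_counit (b : B) : ctrL H.counit (H.comul b) = b := H.counit_comul b

lemma HopfStr.ctrR_counit (b : B) : ctrR H.counit (H.comul b) = b := H.comul_counit b

lemma HopfStr.counit_actL (η : Module.Dual K⟦X⟧ B) (b : B) : H.counit (H.actL η b) = η b :=
  (ctrL_ctrR _ _ _).trans (congrArg η (H.ctrR_counit b))

lemma HopfStr.counit_actR (η : Module.Dual K⟦X⟧ B) (b : B) : H.counit (H.actR η b) = η b :=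
  (ctrL_ctrR _ _ _).symm.trans (congrArg η (H.ctrL_counit b))

lemma HopfStr.comul_actL (η : Module.Dual K⟦X⟧ B) (b : B) :
    H.comul (H.actL η b) = cmap K (H.actL η) .id (H.comul b) := by
  rw [HopfStr.actL, LinearMap.comp_apply, map_ctrL, ← H.coassoc, ctrL_cassoc, cmap_comp,
    LinearMap.id_comp]

lemma HopfStr.comul_actR (η : Module.Dual K⟦X⟧ B) (b : B) :
    H.comul (H.actR η b) = cmap K .id (H.actR η) (H.comul b) := by
  rw [HopfStr.actR, LinearMap.comp_apply, map_ctrR, ctrR_eq_cassoc, H.coassoc, cmap_comp,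
    LinearMap.id_comp]

end ContractComul

namespace Realization

variable {n : ℕ} {P : Matrix (Fin n) (Fin n) K⟦X⟧} {𝔥 : Type*} [AddCommGroup 𝔥]
  [Module K⟦X⟧ 𝔥] {B : Type*} [Ring B] [Algebra K⟦X⟧ B] [IsAdicComplete (hId K) B]
  {t : 𝔥 →ₗ[K⟦X⟧] B} {e f : Fin n → B} {H : HopfStr K B}

variable (t e f H) in
/-- `φ` is an infinitesimal character of `B` with values `c` on the toral part, and it vanishes on
the ideal generated by the other generators. -/
structure IsInfChar (η : Module.Dual K⟦X⟧ B) (c : 𝔥 → K⟦X⟧) : Prop where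
  one : η 1 = 0
  t : ∀ x b, η (t x * b) = c x * H.counit b
  e : ∀ i b, η (e i * b) = 0
  f : ∀ i b, η (f i * b) = 0

variable {η : Module.Dual K⟦X⟧ B} {c : 𝔥 → K⟦X⟧} (h : IsInfChar t e f H η c) (hT : StdT H t)

include hT in
lemma functional_hexp {y : B} {r : K⟦X⟧}
    (hy : ∀ b, η (y * b) = r * H.counit b) (hc : H.counit y = 0) :
    η ∘ₗ LinearMap.mulLeft K⟦X⟧ (hexp K y) = η + (X * r) • H.counit := by
  have hm : ∀ a b, H.counit (a * b) = H.counit a * H.counit b := fun a b => by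
    rw [← hT.1, H.counit_mul]
  refine LinearMap.ext fun b => ?_
  have h1 : (η ∘ₗ LinearMap.mulRight K⟦X⟧ b) (FoMp.hexp K y) = _ := map_hsum _ _
  refine h1.trans ?_
  rw [hsum_succ, hsum_succ]
  have h2 : hsum K (fun k => (η ∘ₗ LinearMap.mulRight K⟦X⟧ b)
      ((C (((k + 1 + 1) ! : K)⁻¹) : K⟦X⟧) • y ^ (k + 1 + 1))) = 0 := by
    refine Eq.trans ?_ (map_hsum (0 : K⟦X⟧ →ₗ[K⟦X⟧] K⟦X⟧) (fun _ => 0)).symm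
    congr 1
    funext k
    rw [map_smul, LinearMap.comp_apply, LinearMap.mulRight_apply, pow_succ', mul_assoc, hy, hm,
      pow_succ', hm, hc]
    simp
  rw [h2]
  simp [hy, mul_assoc]

namespace IsInfChar

include h hT in
lemma actL_one : H.actL η 1 = 0 := by
  have h1 : H.comul 1 = tmul K 1 1 := by rw [← hT.2.1, H.comul_one]
  rw [HopfStr.actL, LinearMap.comp_apply, h1, ctrL_tmul, h.one, zero_smul]

include h hT in
lemma actR_one : H.actR η 1 = 0 := by
  have h1 : H.comul 1 = tmul K 1 1 := by rw [← hT.2.1, H.comul_one]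
  rw [HopfStr.actR, LinearMap.comp_apply, h1, ctrR_tmul, h.one, zero_smul]

include hT in
lemma comul_mul (a b : B) : H.comul (a * b) = H.comul a * H.comul b :=
  map_mul (H.comulHom hT.1 hT.2.1) a b

omit [IsAdicComplete (hId K) B] in
lemma comp_mulLeft_one (η : Module.Dual K⟦X⟧ B) : η ∘ₗ LinearMap.mulLeft K⟦X⟧ 1 = η :=
  LinearMap.ext fun b => congrArg η (one_mul b)

include h in
lemma comp_t (x : 𝔥) : η ∘ₗ LinearMap.mulLeft K⟦X⟧ (t x) = c x • H.counit :=
  LinearMap.ext (h.t x)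

include h in
lemma comp_e (i : Fin n) : η ∘ₗ LinearMap.mulLeft K⟦X⟧ (e i) = 0 := LinearMap.ext (h.e i)

include h in
lemma comp_f (i : Fin n) : η ∘ₗ LinearMap.mulLeft K⟦X⟧ (f i) = 0 := LinearMap.ext (h.f i)

include h hT in
lemma actL_t (x : 𝔥) (b : B) : H.actL η (t x * b) = t x * H.actL η b + c x • b := by
  rw [HopfStr.actL, LinearMap.comp_apply, comul_mul hT, (hT.2.2 x).1, add_mul, map_add, ctrL_mul,
    ctrL_mul, comp_mulLeft_one, h.comp_t, ctrL_smul, one_mul, LinearMap.smul_apply, H.ctrL_counit, add_comm]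
  rfl

include h hT in
lemma actR_t (x : 𝔥) (b : B) : H.actR η (t x * b) = t x * H.actR η b + c x • b := by
  rw [HopfStr.actR, LinearMap.comp_apply, comul_mul hT, (hT.2.2 x).1, add_mul, map_add, ctrR_mul,
    ctrR_mul, comp_mulLeft_one, h.comp_t, ctrR_smul, one_mul, LinearMap.smul_apply, H.ctrR_counit]
  rfl

variable [Module.Free K⟦X⟧ 𝔥] [Module.Finite K⟦X⟧ 𝔥] {R : Realization P 𝔥}
  (hE : R.StdE H t e) (hF : R.StdF H t f)

include h hT hE in
lemma actL_e (i : Fin n) (b : B) :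
    H.actL η (e i * b) = e i * (H.actL η b + (X * c (R.Tp i)) • b) := by
  rw [HopfStr.actL, LinearMap.comp_apply, comul_mul hT, (hE i).1, add_mul, map_add, ctrL_mul,
    ctrL_mul, functional_hexp hT (h.t _) (hT.2.2 _).2.1, h.comp_e, ctrL_zero, LinearMap.zero_apply, mul_zero,
    zero_add, ctrL_add, ctrL_smul, LinearMap.add_apply, LinearMap.smul_apply,
    H.ctrL_counit]
  rfl

include h hT hE in
lemma actR_e (i : Fin n) (b : B) : H.actR η (e i * b) = e i * H.actR η b := by
  rw [HopfStr.actR, LinearMap.comp_apply, comul_mul hT, (hE i).1, add_mul, map_add, ctrR_mul,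
    ctrR_mul, h.comp_e, ctrR_zero, LinearMap.zero_apply, mul_zero, add_zero, comp_mulLeft_one]
  rfl

include h hT hF in
lemma actL_f (i : Fin n) (b : B) : H.actL η (f i * b) = f i * H.actL η b := by
  rw [HopfStr.actL, LinearMap.comp_apply, comul_mul hT, (hF i).1, add_mul, map_add, ctrL_mul,
    ctrL_mul, h.comp_f, ctrL_zero, LinearMap.zero_apply, mul_zero, zero_add, comp_mulLeft_one]
  rfl

include h hT hF in
lemma actR_f (hc : ∀ i, c (R.Tp i) = c (-R.Tm i)) (i : Fin n) (b : B) :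
    H.actR η (f i * b) = f i * (H.actR η b + (X * c (R.Tp i)) • b) := by
  rw [HopfStr.actR, LinearMap.comp_apply, comul_mul hT, (hF i).1, add_mul, map_add, ctrR_mul,
    ctrR_mul, ← map_neg t, functional_hexp hT (h.t _) (hT.2.2 _).2.1, h.comp_f, ctrR_zero,
    LinearMap.zero_apply, mul_zero, add_zero, ctrR_add, ctrR_smul, LinearMap.add_apply,
    LinearMap.smul_apply, H.ctrR_counit, hc]
  rfl

end IsInfChar

variable [Module.Free K⟦X⟧ 𝔥] [Module.Finite K⟦X⟧ 𝔥] {R : Realization P 𝔥}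

/-- The toral derivations attached to a linear family of infinitesimal characters. -/
def ToralDer.ofInfChar [CharZero K]
    (η : Module.Dual K⟦X⟧ (𝔥 ⧸ R.sSpan) →ₗ[K⟦X⟧] Module.Dual K⟦X⟧ B)
    (h : ∀ ξ, IsInfChar t e f H (η ξ) fun x => ξ (Submodule.Quotient.mk x))
    (hT : StdT H t) (hE : R.StdE H t e) (hF : R.StdF H t f) : R.ToralDer t e f where
  dl :=
    { toFun := fun ξ => H.actL (η ξ)
      map_add' := fun ξ θ => by rw [map_add, HopfStr.actL, ctrL_add, LinearMap.add_comp]; rfl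
      map_smul' := fun r ξ => by
        rw [map_smul, HopfStr.actL, ctrL_smul, LinearMap.smul_comp]; rfl }
  dl_one ξ := (h ξ).actL_one hT
  dl_t ξ := (h ξ).actL_t hT
  dl_e ξ := (h ξ).actL_e hT hE
  dl_f ξ := (h ξ).actL_f hT hF
  dr :=
    { toFun := fun ξ => H.actR (η ξ)
      map_add' := fun ξ θ => by rw [map_add, HopfStr.actR, ctrR_add, LinearMap.add_comp]; rfl
      map_smul' := fun r ξ => by
        rw [map_smul, HopfStr.actR, ctrR_smul, LinearMap.smul_comp]; rfl }
  dr_one ξ := (h ξ).actR_one hT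
  dr_t ξ := (h ξ).actR_t hT
  dr_e ξ := (h ξ).actR_e hT hE
  dr_f ξ := (h ξ).actR_f hT hF fun i => by
    have h1 := (R.liftDual ξ).2 i
    rw [liftDual_apply, liftDual_apply] at h1
    rw [Submodule.Quotient.mk_neg, map_neg, h1, neg_neg]

end Realization

end FoMp
end

noncomputable section
namespace FoMp
variable {K : Type*} [Field K]

/-! ### The terms of the deformed product -/

section DeformCoeff

variable {B : Type*} [Ring B] [Algebra K⟦X⟧ B] [IsAdicComplete (hId K) B] {H : HopfStr K B}
  {M : Type*} [AddCommGroup M] [Module K⟦X⟧ M] {π : B →ₐ[K⟦X⟧] SymHat K M}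

variable (H) in
/-- The sum of the left actions. -/
def sumL {m : ℕ} (η ζ : Fin m → Module.Dual K⟦X⟧ B) : Module.End K⟦X⟧ (CTensor K B B) :=
  ∑ s, cm K B (H.actL (η s)) (H.actL (ζ s))

variable (H) in
/-- The sum of the right actions. -/
def sumR {m : ℕ} (η ζ : Fin m → Module.Dual K⟦X⟧ B) : Module.End K⟦X⟧ (CTensor K B B) :=
  ∑ s, cm K B (H.actR (η s)) (H.actR (ζ s))

section

variable {m : ℕ} (η ζ : Fin m → Module.Dual K⟦X⟧ B) {τ : B →ₗ[K⟦X⟧] B →ₗ[K⟦X⟧] K⟦X⟧}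
  (hτ : ∀ a b, τ a b = ∑ s, η s a * ζ s b)

include hτ in
lemma fold_eq_epsT_sumL : fold τ = epsT H ∘ₗ sumL H η ζ := ctensor_ext fun a b => by
  rw [fold_tmul, LinearMap.comp_apply, sumL, LinearMap.sum_apply, map_sum, hτ]
  refine Finset.sum_congr rfl fun s _ => ?_
  rw [cm_tmul, epsT_tmul, H.counit_actL, H.counit_actL]

include hτ in
lemma fold_eq_epsT_sumR : fold τ = epsT H ∘ₗ sumR H η ζ := ctensor_ext fun a b => by
  rw [fold_tmul, LinearMap.comp_apply, sumR, LinearMap.sum_apply, map_sum, hτ]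
  refine Finset.sum_congr rfl fun s _ => ?_
  rw [cm_tmul, epsT_tmul, H.counit_actR, H.counit_actR]

lemma sumL_mem {W : Type*} [AddCommGroup W] [Module K⟦X⟧ W] [IsAdicComplete (hId K) W]
    (ω : B →ₗ[K⟦X⟧] B →ₗ[K⟦X⟧] W) : sumL H η ζ ∈ leftOps H ω :=
  Subalgebra.sum_mem _ fun _ _ => cm_mem_leftOps ω (H.comul_actL _) (H.comul_actL _)

lemma sumR_mem {W : Type*} [AddCommGroup W] [Module K⟦X⟧ W] [IsAdicComplete (hId K) W]
    (ω : B →ₗ[K⟦X⟧] B →ₗ[K⟦X⟧] W) : sumR H η ζ ∈ rightOps H ω :=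
  Subalgebra.sum_mem _ fun _ _ => cm_mem_rightOps ω (H.comul_actR _) (H.comul_actR _)

end

omit [IsAdicComplete (hId K) B] in
lemma compr₂_fold {W : Type*} [AddCommGroup W] [Module K⟦X⟧ W] [IsAdicComplete (hId K) W]
    (ω : B →ₗ[K⟦X⟧] B →ₗ[K⟦X⟧] W) : (tmul K).compr₂ (fold ω) = ω :=
  LinearMap.ext₂ fun a b => fold_tmul K ω a b

lemma fold_conv_left {W : Type*} [AddCommGroup W] [Module K⟦X⟧ W] [IsAdicComplete (hId K) W]
    (τ : B →ₗ[K⟦X⟧] B →ₗ[K⟦X⟧] K⟦X⟧) (ω : B →ₗ[K⟦X⟧] B →ₗ[K⟦X⟧] W) :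
    fold (conv H.comul (LinearMap.lsmul K⟦X⟧ W) τ ω) = convL H ω (fold τ) := by
  refine (fold_ext fun a b => ?_).symm
  rw [convL_tmul, compr₂_fold]
  rfl

lemma fold_conv_right {W : Type*} [AddCommGroup W] [Module K⟦X⟧ W] [IsAdicComplete (hId K) W]
    (τ : B →ₗ[K⟦X⟧] B →ₗ[K⟦X⟧] K⟦X⟧) (ω : B →ₗ[K⟦X⟧] B →ₗ[K⟦X⟧] W) :
    fold (conv H.comul (LinearMap.lsmul K⟦X⟧ W).flip ω τ) = convR H ω (fold τ) := by
  refine (fold_ext fun a b => ?_).symm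
  rw [convR_tmul, compr₂_fold]
  rfl

lemma compl₁₂_conv {Δ : SymHat K M →ₗ[K⟦X⟧] CTensor K (SymHat K M) (SymHat K M)}
    (hπ : ∀ b, Δ (π b) = cmap K π.toLinearMap π.toLinearMap (H.comul b))
    {c : K⟦X⟧ →ₗ[K⟦X⟧] K⟦X⟧ →ₗ[K⟦X⟧] K⟦X⟧} (σ τ : SymHat K M →ₗ[K⟦X⟧] SymHat K M →ₗ[K⟦X⟧] K⟦X⟧) :
    (conv Δ c σ τ).compl₁₂ π.toLinearMap π.toLinearMap =
      conv H.comul c (σ.compl₁₂ π.toLinearMap π.toLinearMap)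
        (τ.compl₁₂ π.toLinearMap π.toLinearMap) := by
  have : (cross c σ τ).compl₁₂ (cmap K π.toLinearMap π.toLinearMap)
      (cmap K π.toLinearMap π.toLinearMap) = cross c (σ.compl₁₂ π.toLinearMap π.toLinearMap)
        (τ.compl₁₂ π.toLinearMap π.toLinearMap) := ctensor_ext₂ fun m n p q => by
    rw [LinearMap.compl₁₂_apply, cmap_apply_tmul, cmap_apply_tmul, cross_tmul, cross_tmul]
    rfl
  rw [conv, conv, ← this]
  refine LinearMap.ext₂ fun a b => ?_
  simp only [LinearMap.compl₁₂_apply, AlgHom.toLinearMap_apply, hπ]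

variable (hc : ∀ b, SymHat.counit M (π b) = H.counit b)
  (hΔ : ∀ b, SymHat.comul M (π b) = cmap K π.toLinearMap π.toLinearMap (H.comul b))

variable (π) in
/-- The infinitesimal characters of `B` which factor through `Ŝ(M)`. -/
def pullHat : Module.Dual K⟦X⟧ M →ₗ[K⟦X⟧] Module.Dual K⟦X⟧ B :=
  π.toLinearMap.dualMap ∘ₗ SymHat.hat

omit [IsAdicComplete (hId K) B] in
lemma pullHat_apply (ξ : Module.Dual K⟦X⟧ M) (b : B) : pullHat π ξ b = SymHat.hat ξ (π b) := rfl

variable {m : ℕ} {ξ θ : Fin m → Module.Dual K⟦X⟧ M} {β : M →ₗ[K⟦X⟧] M →ₗ[K⟦X⟧] K⟦X⟧}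
  (hβ : ∀ x, ∑ s, ξ s x • θ s = β x)

include hβ in
omit [IsAdicComplete (hId K) B] in
lemma chiTilde_pull (a b : B) : (chiTilde β).compl₁₂ π.toLinearMap π.toLinearMap a b =
    ∑ s, pullHat π (ξ s) a * pullHat π (θ s) b :=
  SymHat.chiTilde_eq hβ _ _

include hc hΔ hβ in
lemma fold_chiTildePow (k : ℕ) :
    fold ((chiTildePow β k).compl₁₂ π.toLinearMap π.toLinearMap) =
      epsT H ∘ₗ (sumL H (fun s => pullHat π (ξ s)) fun s => pullHat π (θ s)) ^ k := by
  induction k with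
  | zero =>
    refine (fold_ext fun a b => ?_).symm
    rw [pow_zero, LinearMap.comp_apply, Module.End.one_apply, epsT_tmul, chiTildePow,
      LinearMap.compl₁₂_apply, LinearMap.compl₁₂_apply, AlgHom.toLinearMap_apply,
      AlgHom.toLinearMap_apply, hc, hc, LinearMap.mul_apply']
  | succ k ih =>
    rw [chiTildePow, compl₁₂_conv hΔ, show LinearMap.mul K⟦X⟧ K⟦X⟧ = LinearMap.lsmul K⟦X⟧ K⟦X⟧ from rfl,
      fold_conv_left, ih, convL_comp (Subalgebra.pow_mem _ (sumL_mem _ _ _) k), convL_epsT,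
      fold_eq_epsT_sumL (H := H) _ _ (chiTilde_pull hβ), pow_succ', Module.End.mul_eq_comp,
      LinearMap.comp_assoc]

variable {L Q : Module.End K⟦X⟧ (CTensor K B B)}

lemma epsT_pow (h : epsT H ∘ₗ L = epsT H ∘ₗ Q) (hLQ : Commute L Q) (k : ℕ) :
    epsT H ∘ₗ L ^ k = epsT H ∘ₗ Q ^ k := by
  induction k with
  | zero => rfl
  | succ k ih =>
    calc epsT H ∘ₗ L ^ (k + 1) = (epsT H ∘ₗ L) ∘ₗ L ^ k := by rw [pow_succ']; rfl
      _ = epsT H ∘ₗ (Q * L ^ k) := by rw [h]; rfl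
      _ = (epsT H ∘ₗ L ^ k) ∘ₗ Q := by rw [(hLQ.pow_left k).symm.eq]; rfl
      _ = epsT H ∘ₗ Q ^ (k + 1) := by rw [ih, pow_succ]; rfl

lemma dpow_add {A : Type*} [Ring A] [Algebra K⟦X⟧ A] [IsAdicComplete (hId K) A] [CharZero K] {x y : A} (h : Commute x y) (n : ℕ) :
    dpow K (x + y) n =
      ∑ p ∈ Finset.HasAntidiagonal.antidiagonal n, dpow K x p.1 * dpow K y p.2 := by
  simp only [dpow, smul_add]
  exact expTerm_add ((h.smul_left _).smul_right _) n

lemma dpow_smul {A : Type*} [Ring A] [Algebra K⟦X⟧ A] (r : K⟦X⟧) (x : A) (n : ℕ) :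
    dpow K (r • x) n = r ^ n • dpow K x n := by
  rw [dpow, dpow, smul_comm _ r x, smul_pow, smul_comm]

variable [CharZero K] (hmul : ∀ a b, H.mul a b = a * b)
  (hLR : Commute (sumL H (fun s => pullHat π (ξ s)) fun s => pullHat π (θ s))
    (sumR H (fun s => pullHat π (ξ s)) fun s => pullHat π (θ s)))

include hc hΔ hβ in
omit [CharZero K] in
lemma fold_sigma (s : ℤ) (k : ℕ) : fold (sigma π β s k) = epsT H ∘ₗ dpow K
    ((s : K⟦X⟧) • sumL H (fun s => pullHat π (ξ s)) fun s => pullHat π (θ s)) k := by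
  rw [dpow_smul, LinearMap.comp_smul, dpow, smul_pow, smul_smul,
    LinearMap.comp_smul, ← fold_chiTildePow hc hΔ hβ, smul_smul]
  refine (fold_ext fun a b => ?_).symm
  rw [LinearMap.smul_apply, fold_tmul, sigma, chiU, LinearMap.compl₁₂_apply]
  change _ = (C ((s : K) ^ k / (2 ^ k * k !)) : K⟦X⟧) • chiTildePow β k _ _
  congr 1
  rw [Realization.half, ← map_pow, ← map_mul, ← map_intCast (C (R := K)), ← map_pow,
    ← map_mul]
  congr 1
  rw [div_eq_mul_inv, mul_inv, inv_pow, mul_comm (k ! : K)⁻¹]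

include hc hΔ hβ hmul hLR in
/-- The terms of the deformed product in terms of the actions of the infinitesimal characters. -/
theorem deformCoeff_apply (N : ℕ) (a b : B) : deformCoeff H π β N a b =
    starTerm (sumL H (fun s => pullHat π (ξ s)) (fun s => pullHat π (θ s)) -
      sumR H (fun s => pullHat π (ξ s)) fun s => pullHat π (θ s)) N a b := by
  set L := sumL H (fun s => pullHat π (ξ s)) fun s => pullHat π (θ s) with hL
  set Q := sumR H (fun s => pullHat π (ξ s)) fun s => pullHat π (θ s) with hQ
  have h1 : epsT H ∘ₗ L = epsT H ∘ₗ Q := by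
    rw [← fold_eq_epsT_sumL (H := H) _ _ (chiTilde_pull hβ), ← fold_eq_epsT_sumR (H := H) _ _ (chiTilde_pull hβ)]
  have h2 : fold H.mul = mulT K B := (fold_ext fun a b => by rw [mulT_tmul, hmul]).symm
  have h3 : ∀ k, epsT H ∘ₗ dpow K (((-1 : ℤ) : K⟦X⟧) • L) k = epsT H ∘ₗ dpow K (-Q) k := fun k => by
    have e : (((-1 : ℤ) : K⟦X⟧) • Q) = -Q := by rw [Int.cast_neg, Int.cast_one, neg_one_smul]
    rw [← e, dpow_smul, dpow_smul, LinearMap.comp_smul, LinearMap.comp_smul, dpow, dpow,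
      LinearMap.comp_smul, LinearMap.comp_smul, smul_pow, smul_pow, LinearMap.comp_smul,
      LinearMap.comp_smul, epsT_pow h1 hLR]
  have h4 : ∀ k l, fold (conv H.comul (LinearMap.lsmul K⟦X⟧ B).flip
      (conv H.comul (LinearMap.lsmul K⟦X⟧ B) (sigma π β 1 k) H.mul) (sigma π β (-1) l)) =
      mulT K B ∘ₗ (dpow K L k * dpow K (-Q) l) := fun k l => by
    have e1 : fold (conv H.comul (LinearMap.lsmul K⟦X⟧ B) (sigma π β 1 k) H.mul) =
        mulT K B ∘ₗ dpow K L k := by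
      rw [fold_conv_left, fold_sigma hc hΔ hβ, Int.cast_one, one_smul,
        convL_comp (dpow_mem (sumL_mem _ _ _) k), convL_epsT, h2]
    rw [fold_conv_right, fold_sigma hc hΔ hβ, h3,
      convR_comp (dpow_mem (Subalgebra.neg_mem _ (sumR_mem _ _ _)) l), convR_epsT, e1]
    rfl
  rw [starTerm_apply, sub_eq_add_neg, dpow_add hLR.neg_right, LinearMap.sum_apply, map_sum, deformCoeff,
    LinearMap.sum_apply, LinearMap.sum_apply]
  refine Finset.sum_congr rfl fun p _ => ?_
  rw [← fold_tmul K (conv _ _ _ _), h4]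
  rfl

end DeformCoeff

end FoMp
end

noncomputable section
namespace FoMp
variable {K : Type*} [Field K]

namespace Realization

variable {n : ℕ} {P P' : Matrix (Fin n) (Fin n) K⟦X⟧} {𝔥 𝔥' : Type*} [AddCommGroup 𝔥]
  [Module K⟦X⟧ 𝔥] [Module.Free K⟦X⟧ 𝔥] [Module.Finite K⟦X⟧ 𝔥] [AddCommGroup 𝔥']
  [Module K⟦X⟧ 𝔥'] [Module.Free K⟦X⟧ 𝔥'] [Module.Finite K⟦X⟧ 𝔥'] {R : Realization P 𝔥}
  {R' : Realization P' 𝔥'} {B B' : Type*} [Ring B] [Algebra K⟦X⟧ B] [IsAdicComplete (hId K) B]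
  [Ring B'] [Algebra K⟦X⟧ B'] [IsAdicComplete (hId K) B']
  {t : 𝔥 →ₗ[K⟦X⟧] B} {e f : Fin n → B} {t' : 𝔥' →ₗ[K⟦X⟧] B'} {e' f' : Fin n → B'}
  (O : R.TorusOps t e f) (O' : R'.TorusOps t' e' f') {D : Twist R' R}
  {Ψ : B' →ₐ[K⟦X⟧] Module.End K⟦X⟧ B} {H : HopfStr K B}
  (hT : StdT H t) (hE : R.StdE H t e) (hF : R.StdF H t f)

variable {S : Type*} [Ring S] [Algebra K⟦X⟧ S] [IsAdicComplete (hId K) S] {ϖ : B →ₐ[K⟦X⟧] S}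
  {s : 𝔥 → S} {L : 𝔥 → Module.End K⟦X⟧ S} {Δ : S →ₗ[K⟦X⟧] CTensor K S S}

include O hT hE hF in
omit [IsAdicComplete (hId K) S] in
lemma comul_algHom (hL : ∀ x w, L x w = s x * w) (ϖt : ∀ x, ϖ (t x) = s x) (ϖe : ∀ i, ϖ (e i) = 0)
    (ϖf : ∀ i, ϖ (f i) = 0) (h0 : Δ 1 = tmul K 1 1)
    (hΔ : ∀ x w, Δ (L x w) = cmap K (L x) .id (Δ w) + cmap K .id (L x) (Δ w)) (b : B) :
    Δ (ϖ b) = cmap K ϖ.toLinearMap ϖ.toLinearMap (H.comul b) := by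
  have hz : ∀ (x y : B), ϖ x = 0 → ∀ w, cmap K ϖ.toLinearMap ϖ.toLinearMap (tmul K x y * w) = 0 :=
    fun x y h w => by
      have : ϖ.toLinearMap ∘ₗ LinearMap.mulLeft K⟦X⟧ x = 0 := LinearMap.ext fun b => by
        rw [LinearMap.comp_apply, LinearMap.mulLeft_apply, AlgHom.toLinearMap_apply, map_mul ϖ, h,
          zero_mul, LinearMap.zero_apply]
      rw [tmul_mul_eq_cmap, cmap_comp, this, ← cmapₗ_apply, map_zero, LinearMap.zero_apply,
        LinearMap.zero_apply]
  have hz' : ∀ (x y : B), ϖ y = 0 → ∀ w, cmap K ϖ.toLinearMap ϖ.toLinearMap (tmul K x y * w) = 0 :=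
    fun x y h w => by
      have : ϖ.toLinearMap ∘ₗ LinearMap.mulLeft K⟦X⟧ y = 0 := LinearMap.ext fun b => by
        rw [LinearMap.comp_apply, LinearMap.mulLeft_apply, AlgHom.toLinearMap_apply, map_mul ϖ, h,
          zero_mul, LinearMap.zero_apply]
      rw [tmul_mul_eq_cmap, cmap_comp, this, ← cmapₗ_apply, map_zero, LinearMap.zero_apply]
  have hm : ∀ x, ϖ.toLinearMap ∘ₗ LinearMap.mulLeft K⟦X⟧ (t x) =
      L x ∘ₗ ϖ.toLinearMap := fun x =>
    LinearMap.ext fun b => by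
      rw [LinearMap.comp_apply, LinearMap.comp_apply, LinearMap.mulLeft_apply,
        AlgHom.toLinearMap_apply, AlgHom.toLinearMap_apply, map_mul ϖ, ϖt, hL]
  have h1 : LinearMap.mulLeft K⟦X⟧ (1 : B) = .id := LinearMap.ext one_mul
  refine O.linearMap_ext (F := Δ ∘ₗ ϖ.toLinearMap)
    (G := cmap K ϖ.toLinearMap ϖ.toLinearMap ∘ₗ H.comul) ?_
    (fun x b h => ?_) (fun i b _ => ?_) (fun i b _ => ?_) b <;>
    rw [LinearMap.comp_apply, LinearMap.comp_apply, AlgHom.toLinearMap_apply]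
  · rw [map_one ϖ, h0, ← hT.2.1, H.comul_one, cmap_apply_tmul, hT.2.1,
      AlgHom.toLinearMap_apply, map_one ϖ]
  · rw [LinearMap.comp_apply, LinearMap.comp_apply, AlgHom.toLinearMap_apply] at h
    rw [map_mul ϖ, ϖt, ← hL, hΔ, IsInfChar.comul_mul hT, (hT.2.2 x).1,
      add_mul, map_add, tmul_mul_eq_cmap, tmul_mul_eq_cmap, h1, cmap_comp, cmap_comp, hm, h, cmap_comp,
      cmap_comp]
    rfl
  · rw [map_mul ϖ, ϖe, zero_mul, map_zero, IsInfChar.comul_mul hT, (hE i).1, add_mul, map_add,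
      hz _ _ (ϖe i), hz' _ _ (ϖe i), add_zero]
  · rw [map_mul ϖ, ϖf, zero_mul, map_zero, IsInfChar.comul_mul hT, (hF i).1, add_mul, map_add,
      hz _ _ (ϖf i), hz' _ _ (ϖf i), add_zero]

variable {π : B →ₐ[K⟦X⟧] SymHat K (𝔥 ⧸ R.sSpan)}
  (πt : ∀ x, π (t x) = SymHat.ι _ (Submodule.Quotient.mk x)) (πe : ∀ i, π (e i) = 0)
  (πf : ∀ i, π (f i) = 0)

include O hT hE hF πt πe πf

lemma counit_pi (b : B) : SymHat.counit _ (π b) = H.counit b := by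
  have hm : ∀ a b, H.counit (a * b) = H.counit a * H.counit b := fun a b => by
    rw [← hT.1, H.counit_mul]
  refine O.linearMap_ext (F := SymHat.counit _ ∘ₗ π.toLinearMap) (G := H.counit) ?_
    (fun x b _ => ?_) (fun i b _ => ?_) (fun i b _ => ?_) b <;>
    rw [LinearMap.comp_apply, AlgHom.toLinearMap_apply]
  · rw [map_one π, SymHat.counit_one, ← hT.2.1, H.counit_one]
  · rw [map_mul π, πt, SymHat.counit_ι_mul, hm, (hT.2.2 x).2.1, zero_mul]
  · rw [map_mul π, πe, zero_mul, map_zero, hm, (hE i).2.1, zero_mul]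
  · rw [map_mul π, πf, zero_mul, map_zero, hm, (hF i).2.1, zero_mul]

lemma comul_pi (b : B) :
    SymHat.comul _ (π b) = cmap K π.toLinearMap π.toLinearMap (H.comul b) :=
  comul_algHom O hT hE hF (fun _ => SymHat.mulL_apply _) πt πe πf SymHat.comul_one
    (fun _ => SymHat.comul_ι_mul _) b

lemma isInfChar_pullHat (ξ : Module.Dual K⟦X⟧ (𝔥 ⧸ R.sSpan)) :
    IsInfChar t e f H (pullHat π ξ) fun x => ξ (Submodule.Quotient.mk x) where
  one := by rw [pullHat_apply, map_one π, SymHat.hat_one]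
  t x b := by
    rw [pullHat_apply, map_mul π, πt, SymHat.hat_ι_mul, counit_pi O hT hE hF πt πe πf]
  e i b := by rw [pullHat_apply, map_mul π, πe, zero_mul, map_zero]
  f i b := by rw [pullHat_apply, map_mul π, πf, zero_mul, map_zero]

variable [CharZero K]

include O' in
/-- The deformed products converge to the twisted representation. -/
theorem deformCoeff_limit (hΨ : O.IsTwRep D t' e' f' Ψ) (x : B') (c : B) (m : ℕ) :
    ∃ N₀ : ℕ, ∀ N ≥ N₀, ∃ u : B, (X : K⟦X⟧) ^ N • Ψ x c -
        ∑ k ∈ Finset.range (N + 1), (X : K⟦X⟧) ^ (N - k) • deformCoeff H π D.χ.bar k (orbit Ψ x) c =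
      (X : K⟦X⟧) ^ (N + m) • u := by
  obtain ⟨r, ξ, θ, hβ⟩ := exists_decomposition D.χ.bar
  let T := ToralDer.ofInfChar (pullHat π) (isInfChar_pullHat O hT hE hF πt πe πf) hT hE hF
  have hLR : Commute (sumL H (fun s => pullHat π (ξ s)) fun s => pullHat π (θ s))
      (sumR H (fun s => pullHat π (ξ s)) fun s => pullHat π (θ s)) :=
    Commute.sum_left _ _ _ fun i _ => Commute.sum_right _ _ _ fun j _ =>
      cm_commute (LinearMap.ext (T.dl_dr O _ _)) (LinearMap.ext (T.dl_dr O _ _))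
  have h1 : ∀ k a b, deformCoeff H π D.χ.bar k a b =
      (X : K⟦X⟧) ^ k • starTerm (T.casimir O ξ θ) k a b := fun k a b => by
    rw [deformCoeff_apply (counit_pi O hT hE hF πt πe πf) (comul_pi O hT hE hF πt πe πf) hβ hT.1 hLR,
      starTerm_apply, starTerm_apply, ← map_smul, ← LinearMap.smul_apply, ← dpow_smul,
      T.X_smul_casimir O ξ θ]
    rfl
  obtain ⟨N₀, h⟩ := T.sums_starTerm O O' hΨ hβ x c m
  refine ⟨N₀, fun N hN => ?_⟩
  obtain ⟨u, hu⟩ := h (N + 1) (hN.trans (Nat.le_succ N))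
  refine ⟨u, ?_⟩
  have h2 : ∑ k ∈ Finset.range (N + 1),
      (X : K⟦X⟧) ^ (N - k) • deformCoeff H π D.χ.bar k (orbit Ψ x) c =
      (X : K⟦X⟧) ^ N • ∑ k ∈ Finset.range (N + 1), starTerm (T.casimir O ξ θ) k (orbit Ψ x) c := by
    rw [Finset.smul_sum]
    refine Finset.sum_congr rfl fun k hk => ?_
    rw [h1, smul_smul, ← pow_add, Nat.sub_add_cancel (Nat.lt_succ_iff.1 (Finset.mem_range.1 hk))]
  rw [h2, ← smul_sub, ← hu, pow_add, LinearMap.lsmul_apply, smul_smul]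

end Realization

end FoMp
end

noncomputable section
namespace FoMp
variable {K : Type*} [Field K]

/-! ### Stability of closed subalgebras -/

section Stability

variable {B B' : Type*} [Ring B] [Algebra K⟦X⟧ B] [Ring B'] [Algebra K⟦X⟧ B'] {s : Set B}
  {s' : Set B'}

lemma map_mem_adicClosure {F : B' →ₗ[K⟦X⟧] B}
    (h : ∀ x ∈ Algebra.adjoin K⟦X⟧ s', F x ∈ adicClosure (Algebra.adjoin K⟦X⟧ s)) {x : B'}
    (hx : x ∈ adicClosure (Algebra.adjoin K⟦X⟧ s')) :
    F x ∈ adicClosure (Algebra.adjoin K⟦X⟧ s) :=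
  mem_adicClosure_of_approx fun n => by
    obtain ⟨y, hy, z, rfl⟩ := hx n
    exact ⟨F y, h y hy, F z, by rw [map_add, map_smul]⟩

lemma algHom_mem_adicClosure {g : B' →ₐ[K⟦X⟧] B}
    (h : ∀ x ∈ s', g x ∈ adicClosure (Algebra.adjoin K⟦X⟧ s)) {x : B'}
    (hx : x ∈ adicClosure (Algebra.adjoin K⟦X⟧ s')) :
    g x ∈ adicClosure (Algebra.adjoin K⟦X⟧ s) :=
  map_mem_adicClosure (F := g.toLinearMap)
    (fun _ hx => (Algebra.adjoin_le (S := (adicClosure (Algebra.adjoin K⟦X⟧ s)).comap g) h) hx) hx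

lemma rep_mem_adicClosure {Ψ : B' →ₐ[K⟦X⟧] Module.End K⟦X⟧ B}
    (h : ∀ x ∈ s', ∀ b ∈ adicClosure (Algebra.adjoin K⟦X⟧ s),
      Ψ x b ∈ adicClosure (Algebra.adjoin K⟦X⟧ s)) {x : B'}
    (hx : x ∈ adicClosure (Algebra.adjoin K⟦X⟧ s')) {b : B}
    (hb : b ∈ adicClosure (Algebra.adjoin K⟦X⟧ s)) :
    Ψ x b ∈ adicClosure (Algebra.adjoin K⟦X⟧ s) := by
  refine map_mem_adicClosure (F := LinearMap.applyₗ b ∘ₗ Ψ.toLinearMap) (fun y hy => ?_) hx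
  change Ψ y b ∈ _
  induction hy using Algebra.adjoin_induction generalizing b with
  | mem y hy => exact h y hy b hb
  | algebraMap r =>
    rw [AlgHom.commutes, Module.algebraMap_end_apply]
    exact Subalgebra.smul_mem _ hb r
  | add y z _ _ hy hz =>
    rw [map_add, LinearMap.add_apply]
    exact add_mem (hy hb) (hz hb)
  | mul y z _ _ hy hz =>
    rw [map_mul, Module.End.mul_apply]
    exact hy (hz hb)

lemma derivation_mem_adicClosure {F : Module.End K⟦X⟧ B}
    (hF : ∀ a b, F (a * b) = F a * b + a * F b)
    (h : ∀ x ∈ s, F x ∈ adicClosure (Algebra.adjoin K⟦X⟧ s)) {x : B}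
    (hx : x ∈ adicClosure (Algebra.adjoin K⟦X⟧ s)) :
    F x ∈ adicClosure (Algebra.adjoin K⟦X⟧ s) := by
  have h1 : F 1 = 0 := by simpa using hF 1 1
  refine map_mem_adicClosure (fun y hy => ?_) hx
  induction hy using Algebra.adjoin_induction with
  | mem y hy => exact h y hy
  | algebraMap r =>
    rw [Algebra.algebraMap_eq_smul_one, map_smul, h1, smul_zero]
    exact zero_mem _
  | add y z _ _ hy hz =>
    rw [map_add]
    exact add_mem hy hz
  | mul y z hy' hz' hy hz =>
    rw [hF]
    exact add_mem (mul_mem hy (le_adicClosure _ hz')) (mul_mem (le_adicClosure _ hy') hz)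

end Stability

namespace Realization

variable {n : ℕ} {A : Matrix (Fin n) (Fin n) ℤ} {d : Fin n → ℕ} {P P' : Matrix (Fin n) (Fin n) K⟦X⟧}
  {𝔥 𝔥' : Type*} [AddCommGroup 𝔥]
  [Module K⟦X⟧ 𝔥] [Module.Free K⟦X⟧ 𝔥] [Module.Finite K⟦X⟧ 𝔥] [AddCommGroup 𝔥']
  [Module K⟦X⟧ 𝔥'] [Module.Free K⟦X⟧ 𝔥'] [Module.Finite K⟦X⟧ 𝔥'] {R : Realization P 𝔥}
  {R' : Realization P' 𝔥'} {B B' : Type*} [Ring B] [Algebra K⟦X⟧ B] [IsAdicComplete (hId K) B]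
  [Ring B'] [Algebra K⟦X⟧ B'] [IsAdicComplete (hId K) B']
  {t : 𝔥 →ₗ[K⟦X⟧] B} {e f : Fin n → B} {t' : 𝔥' →ₗ[K⟦X⟧] B'} {e' f' : Fin n → B'}

section Borel

variable {O : R.TorusOps t e f} {s : Set B}
  (hs : ∀ g ∈ s, (∃ x, t x = g) ∨ (∃ i, e i = g) ∨ ∃ i, f i = g)

include hs

lemma TorusOps.Θ_mem (ξ : Module.Dual K⟦X⟧ 𝔥) {b : B}
    (hb : b ∈ adicClosure (Algebra.adjoin K⟦X⟧ s)) :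
    O.Θ ξ b ∈ adicClosure (Algebra.adjoin K⟦X⟧ s) := by
  refine derivation_mem_adicClosure (O.Θ_mul ξ) (fun g hg => ?_) hb
  have hm : g ∈ adicClosure (Algebra.adjoin K⟦X⟧ s) := le_adicClosure _ (Algebra.subset_adjoin hg)
  rw [← mul_one g]
  obtain ⟨x, rfl⟩ | ⟨i, rfl⟩ | ⟨i, rfl⟩ := hs g hg
  · rw [O.Θ_t, O.Θ_one, mul_zero]
    exact zero_mem _
  · rw [O.Θ_e, O.Θ_one, zero_add, mul_smul_comm, mul_one]
    exact Subalgebra.smul_mem _ hm _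
  · rw [O.Θ_f, O.Θ_one, zero_sub, mul_neg, mul_smul_comm, mul_one]
    exact neg_mem (Subalgebra.smul_mem _ hm _)

lemma TorusOps.lam_mem (ξ : R.antiDual) {b : B} (hb : b ∈ adicClosure (Algebra.adjoin K⟦X⟧ s)) :
    O.lam ξ b ∈ adicClosure (Algebra.adjoin K⟦X⟧ s) := by
  refine algHom_mem_adicClosure (fun g hg => ?_) hb
  have hm : g ∈ adicClosure (Algebra.adjoin K⟦X⟧ s) := le_adicClosure _ (Algebra.subset_adjoin hg)
  obtain ⟨x, rfl⟩ | ⟨i, rfl⟩ | ⟨i, rfl⟩ := hs g hg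
  · rw [O.lam_t]
    exact add_mem hm (Subalgebra.smul_mem _ (one_mem _) _)
  · rw [O.lam_e]
    exact Subalgebra.smul_mem _ hm _
  · rwa [O.lam_f]

lemma TorusOps.rho_mem (ξ : R.antiDual) {b : B} (hb : b ∈ adicClosure (Algebra.adjoin K⟦X⟧ s)) :
    O.rho ξ b ∈ adicClosure (Algebra.adjoin K⟦X⟧ s) := by
  refine algHom_mem_adicClosure (fun g hg => ?_) hb
  have hm : g ∈ adicClosure (Algebra.adjoin K⟦X⟧ s) := le_adicClosure _ (Algebra.subset_adjoin hg)
  obtain ⟨x, rfl⟩ | ⟨i, rfl⟩ | ⟨i, rfl⟩ := hs g hg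
  · rw [O.rho_t]
    exact add_mem hm (Subalgebra.smul_mem _ (one_mem _) _)
  · rwa [O.rho_e]
  · rw [O.rho_f]
    exact Subalgebra.smul_mem _ hm _

end Borel

variable [CharZero K] {O : R.TorusOps t e f} {D : Twist R' R}
  {Ψ : B' →ₐ[K⟦X⟧] Module.End K⟦X⟧ B} (hΨ : O.IsTwRep D t' e' f' Ψ)

include hΨ

omit [IsAdicComplete (hId K) B'] in
lemma orbit_mem_pos {x : B'}
    (hx : x ∈ adicClosure (Algebra.adjoin K⟦X⟧ (Set.range t' ∪ Set.range e'))) :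
    orbit Ψ x ∈ adicClosure (Algebra.adjoin K⟦X⟧ (Set.range t ∪ Set.range e)) := by
  have hs : ∀ g ∈ Set.range t ∪ Set.range e, (∃ x, t x = g) ∨ (∃ i, e i = g) ∨ ∃ i, f i = g :=
    fun g hg => hg.imp id Or.inl
  refine rep_mem_adicClosure ?_ hx (one_mem _)
  rintro _ (⟨y, rfl⟩ | ⟨i, rfl⟩) b hb
  · rw [hΨ.T]
    exact add_mem (mul_mem (le_adicClosure _ (Algebra.subset_adjoin (Or.inl ⟨_, rfl⟩))) hb)
      (Subalgebra.smul_mem _ (TorusOps.Θ_mem hs _ hb) _)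
  · rw [hΨ.E]
    exact mul_mem (le_adicClosure _ (Algebra.subset_adjoin (Or.inr ⟨_, rfl⟩)))
      (TorusOps.lam_mem hs _ hb)

omit [IsAdicComplete (hId K) B'] in
lemma orbit_mem_neg {x : B'}
    (hx : x ∈ adicClosure (Algebra.adjoin K⟦X⟧ (Set.range t' ∪ Set.range f'))) :
    orbit Ψ x ∈ adicClosure (Algebra.adjoin K⟦X⟧ (Set.range t ∪ Set.range f)) := by
  have hs : ∀ g ∈ Set.range t ∪ Set.range f, (∃ x, t x = g) ∨ (∃ i, e i = g) ∨ ∃ i, f i = g :=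
    fun g hg => hg.imp id Or.inr
  refine rep_mem_adicClosure ?_ hx (one_mem _)
  rintro _ (⟨y, rfl⟩ | ⟨i, rfl⟩) b hb
  · rw [hΨ.T]
    exact add_mem (mul_mem (le_adicClosure _ (Algebra.subset_adjoin (Or.inl ⟨_, rfl⟩))) hb)
      (Subalgebra.smul_mem _ (TorusOps.Θ_mem hs _ hb) _)
  · rw [hΨ.F]
    exact mul_mem (le_adicClosure _ (Algebra.subset_adjoin (Or.inr ⟨_, rfl⟩)))
      (TorusOps.rho_mem hs _ hb)

end Realization

end FoMp
end

noncomputable section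
namespace FoMp
variable {K : Type*} [Field K]

/-! ### Deformed products of Hopf subalgebras -/

section Embed

variable {U V : Type*} [Ring U] [Algebra K⟦X⟧ U] [IsAdicComplete (hId K) U] [Ring V]
  [Algebra K⟦X⟧ V] [IsAdicComplete (hId K) V] {H : HopfStr K U} {H' : HopfStr K V}
  {ι : V →ₗ[K⟦X⟧] U} {ρ : U →ₗ[K⟦X⟧] V}

lemma conv_embeds (hE : H'.Embeds H ι ρ) {P P' Q Q' : Type*} [AddCommGroup P] [Module K⟦X⟧ P]
    [AddCommGroup P'] [Module K⟦X⟧ P'] [AddCommGroup Q] [Module K⟦X⟧ Q] [AddCommGroup Q']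
    [Module K⟦X⟧ Q'] {p : P' →ₗ[K⟦X⟧] P} {q : Q' →ₗ[K⟦X⟧] Q} {c : P →ₗ[K⟦X⟧] Q →ₗ[K⟦X⟧] U}
    {c' : P' →ₗ[K⟦X⟧] Q' →ₗ[K⟦X⟧] V} (hc : ∀ x y, ι (c' x y) = c (p x) (q y))
    {η : U →ₗ[K⟦X⟧] U →ₗ[K⟦X⟧] P} {η' : V →ₗ[K⟦X⟧] V →ₗ[K⟦X⟧] P'}
    (hη : ∀ a b, p (η' a b) = η (ι a) (ι b)) {ϑ : U →ₗ[K⟦X⟧] U →ₗ[K⟦X⟧] Q}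
    {ϑ' : V →ₗ[K⟦X⟧] V →ₗ[K⟦X⟧] Q'} (hϑ : ∀ a b, q (ϑ' a b) = ϑ (ι a) (ι b)) (a b : V) :
    ι (conv H'.comul c' η' ϑ' a b) = conv H.comul c η ϑ (ι a) (ι b) := by
  have : (cross c' η' ϑ').compr₂ ι = (cross c η ϑ).compl₁₂ (cmap K ι ι) (cmap K ι ι) :=
    ctensor_ext₂ fun m n m' n' => by
      rw [LinearMap.compr₂_apply, LinearMap.compl₁₂_apply, cmap_apply_tmul, cmap_apply_tmul, cross_tmul,
        cross_tmul, hc, hη, hϑ]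
  have h := LinearMap.congr_fun₂ this (H'.comul a) (H'.comul b)
  rw [LinearMap.compr₂_apply, LinearMap.compl₁₂_apply, hE.comul, hE.comul] at h
  exact h

lemma deformCoeff_embeds {ι : V →ₐ[K⟦X⟧] U} (hE : H'.Embeds H ι.toLinearMap ρ) {M : Type*}
    [AddCommGroup M] [Module K⟦X⟧ M] (π : U →ₐ[K⟦X⟧] SymHat K M)
    (β : M →ₗ[K⟦X⟧] M →ₗ[K⟦X⟧] K⟦X⟧) (N : ℕ) (a b : V) :
    ι (deformCoeff H' (π.comp ι) β N a b) = deformCoeff H π β N (ι a) (ι b) := by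
  rw [deformCoeff, deformCoeff, LinearMap.sum_apply, LinearMap.sum_apply, LinearMap.sum_apply,
    LinearMap.sum_apply, map_sum]
  refine Finset.sum_congr rfl fun p _ => ?_
  refine conv_embeds hE (p := ι.toLinearMap) (q := .id) (fun x y => ?_)
    (fun a b => conv_embeds hE (p := .id) (q := ι.toLinearMap) (fun x y => ?_) (fun a b => ?_)
      (fun a b => hE.mul a b) a b) (fun a b => ?_) a b
  · exact map_smul ι y x
  · exact map_smul ι x y
  · rfl
  · rfl

end Embed

namespace Realization

variable {n : ℕ} {A : Matrix (Fin n) (Fin n) ℤ} {d : Fin n → ℕ} {P P' : Matrix (Fin n) (Fin n) K⟦X⟧}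
  {𝔥 𝔥' : Type*} [AddCommGroup 𝔥]
  [Module K⟦X⟧ 𝔥] [Module.Free K⟦X⟧ 𝔥] [Module.Finite K⟦X⟧ 𝔥] [AddCommGroup 𝔥']
  [Module K⟦X⟧ 𝔥'] [Module.Free K⟦X⟧ 𝔥'] [Module.Finite K⟦X⟧ 𝔥'] {R : Realization P 𝔥}
  {R' : Realization P' 𝔥'} {B B' : Type*} [Ring B] [Algebra K⟦X⟧ B] [IsAdicComplete (hId K) B]
  [Ring B'] [Algebra K⟦X⟧ B'] [IsAdicComplete (hId K) B']
  {t : 𝔥 →ₗ[K⟦X⟧] B} {e f : Fin n → B} {t' : 𝔥' →ₗ[K⟦X⟧] B'} {e' f' : Fin n → B'}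

/-- The inverse of a twist. -/
def Twist.symm (D : Twist R' R) : Twist R R' where
  f := D.f.symm
  χ :=
    { form := -(D.χ.form.compl₁₂ D.f.toLinearMap D.f.toLinearMap)
      antisymm := fun x y => congrArg Neg.neg (D.χ.antisymm _ _)
      S_left := fun i x => by
        have h := D.χ.S_left i (D.f x)
        rw [S, ← D.Tp, ← D.Tm, ← map_add, ← map_smul] at h
        exact neg_eq_zero.2 h
      S_right := fun i x => by
        have h := D.χ.S_right i (D.f x)
        rw [S, ← D.Tp, ← D.Tm, ← map_add, ← map_smul] at h
        exact neg_eq_zero.2 h }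
  Tp i := by rw [← D.Tp, LinearEquiv.symm_apply_apply]
  Tm i := by rw [← D.Tm, LinearEquiv.symm_apply_apply]
  α j x := by
    rw [D.α]
    change _ = _ + -D.χ.form (D.f _) (D.f _)
    rw [D.Tp, LinearEquiv.apply_symm_apply]
    abel

lemma sat_zero {S : Type*} [Ring S] [Algebra K⟦X⟧ S] [IsAdicComplete (hId K) S] {s : 𝔥 →ₗ[K⟦X⟧] S}
    (hs : ∀ x y, Commute (s x) (s y)) (h : ∀ i, s (R.Tm i) = -s (R.Tp i)) :
    R.Sat A d s 0 0 where
  pos := ⟨fun x j => by simp, hs, fun i j _ => by simp [serL_succ]⟩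
  neg := ⟨fun x j => by simp, fun x y => (hs x y).neg_left.neg_right, fun i j _ => by simp [serL_succ]⟩
  EF i := by simp [h, hdiff_self_neg]
  EF_ne i j _ := Commute.zero_left _

lemma _root_.FoMp.SymHat.commute_ι {M : Type*} [AddCommGroup M] [Module K⟦X⟧ M] (x y : M) :
    Commute (SymHat.ι (K := K) M x) (SymHat.ι M y) := by
  rw [Commute, SemiconjBy, SymHat.ι_apply, SymHat.ι_apply, ← HComp.of_mul, ← HComp.of_mul]
  exact congrArg (HComp.of K _) (mul_comm _ _)

lemma exists_pi [CharZero K] (hA : IsSymmetrizedCartan A d) (hP : IsCartanType A d P) :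
    ∃ π : R.U A d →ₐ[K⟦X⟧] SymHat K (𝔥 ⧸ R.sSpan),
      (∀ x, π (R.T A d x) = SymHat.ι _ (Submodule.Quotient.mk x)) ∧ (∀ i, π (R.E A d i) = 0) ∧
      ∀ i, π (R.F A d i) = 0 := by
  have h : R.Sat A d (SymHat.ι (𝔥 ⧸ R.sSpan) ∘ₗ R.sSpan.mkQ) 0 0 :=
    sat_zero (fun x y => SymHat.commute_ι _ _) fun i => by
      rw [LinearMap.comp_apply, LinearMap.comp_apply, ← map_neg, ← map_neg]
      congr 1
      rw [← sub_eq_zero, ← map_sub, sub_neg_eq_add, Submodule.mkQ_apply, Submodule.Quotient.mk_eq_zero]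
      have h1 : R.Tm i + R.Tp i = (2 : K⟦X⟧) • R.S i := by
        have h2 : (2 : K⟦X⟧) * C (2⁻¹ : K) = 1 := by
          rw [← map_ofNat (C (R := K)) 2, ← map_mul, mul_inv_cancel₀ two_ne_zero, map_one]
        rw [S, smul_smul, h2, one_smul, add_comm]
      rw [h1]
      exact Submodule.smul_mem _ _ (Submodule.subset_span ⟨i, rfl⟩)
  exact ⟨lift hA hP h, lift_T hA hP h, lift_E hA hP h, lift_F hA hP h⟩

variable [CharZero K] (O : R.TorusOps t e f) (O' : R'.TorusOps t' e' f') {D : Twist R' R}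
  {Ψ : B' →ₐ[K⟦X⟧] Module.End K⟦X⟧ B} {H : HopfStr K B} {H' : HopfStr K B'}
  (hT : StdT H t) (hE : R.StdE H t e) (hF : R.StdF H t f)
  (hT' : StdT H' t') (hE' : R'.StdE H' t' e') (hF' : R'.StdF H' t' f')
  {π : B →ₐ[K⟦X⟧] SymHat K (𝔥 ⧸ R.sSpan)}
  (πt : ∀ x, π (t x) = SymHat.ι _ (Submodule.Quotient.mk x)) (πe : ∀ i, π (e i) = 0)
  (πf : ∀ i, π (f i) = 0)
  {V V' : Type*} [Ring V] [Algebra K⟦X⟧ V] [IsAdicComplete (hId K) V] [Ring V'] [Algebra K⟦X⟧ V']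
  [IsAdicComplete (hId K) V'] {HV : HopfStr K V} {HV' : HopfStr K V'}
  {ι : V →ₐ[K⟦X⟧] B} {ρ : B →ₗ[K⟦X⟧] V} {ι' : V' →ₐ[K⟦X⟧] B'} {ρ' : B' →ₗ[K⟦X⟧] V'}

include O O' hT hE hF hT' hE' hF' πt πe πf in
/-- The Hopf structure transported along the orbit map is a toral deformation. -/
theorem isToralDeformation_transport (hΨ : O.IsTwRep D t' e' f' Ψ)
    (hι : HV.Embeds H ι.toLinearMap ρ) (hι' : HV'.Embeds H' ι'.toLinearMap ρ') (ψ : V' ≃ₗ[K⟦X⟧] V)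
    (hψ : ∀ x, ι (ψ x) = orbit Ψ (ι' x)) {tV : 𝔥 →ₗ[K⟦X⟧] V} (ht : ∀ x, ι (tV x) = t x)
    {gens : Set V} (hg : ∀ g ∈ gens, π (ι g) = 0) :
    R.IsToralDeformation D.χ tV gens HV (HV'.transport ψ) := by
  have inj : Function.Injective ι := Function.LeftInverse.injective hι.left_inv
  have I := HV'.transportIso ψ
  have hc := comul_orbit (O' := O') hT hE hF hT' hE' hF' hΨ
  have hn := counit_orbit (O' := O') hT hE hF hT' hE' hF' hΨ
  have hψ' : ∀ a, ι a = orbit Ψ (ι' (ψ.symm a)) := fun a => by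
    rw [← hψ, LinearEquiv.apply_symm_apply]
  have hl : ι.toLinearMap ∘ₗ ψ.toLinearMap = orbit Ψ ∘ₗ ι'.toLinearMap := LinearMap.ext hψ
  refine ⟨π.comp ι, fun x => ?_, hg, inj ?_, LinearMap.ext fun a => ?_, LinearMap.ext fun a => ?_,
    fun a b m => ?_⟩
  · rw [AlgHom.comp_apply, ht, πt]
  · have h1 : (HV'.transport ψ).one = ψ HV'.one := rfl
    have h2 : ι' HV'.one = 1 := hι'.one.trans hT'.2.1
    have h3 : ι HV.one = 1 := hι.one.trans hT.2.1
    rw [h1, hψ, h2, h3, orbit_one]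
  · have h1 : (HV'.transport ψ).comul a =
        cmap K ψ.toLinearMap ψ.toLinearMap (HV'.comul (ψ.symm a)) := rfl
    refine Function.LeftInverse.injective hι.cmap_left_inv ?_
    rw [h1, hι.comul, cmap_comp, hl, ← cmap_comp, hι'.comul, ← hc]
    exact congrArg H.comul (hψ' a).symm
  · have h1 : (HV'.transport ψ).counit a = HV'.counit (ψ.symm a) := rfl
    rw [h1, hι.counit, hι'.counit, AlgHom.toLinearMap_apply, AlgHom.toLinearMap_apply, hψ', hn]
  · obtain ⟨N₀, h⟩ := deformCoeff_limit O O' hT hE hF πt πe πf hΨ (ι' (ψ.symm a)) (ι b) m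
    refine ⟨N₀, fun N hN => ?_⟩
    obtain ⟨u, hu⟩ := h N hN
    have h1 : ι ((HV'.transport ψ).mul a b) = Ψ (ι' (ψ.symm a)) (ι b) := by
      have h2 : (HV'.transport ψ).mul a b = ψ (HV'.mul (ψ.symm a) (ψ.symm b)) := rfl
      have h3 : ι' (HV'.mul (ψ.symm a) (ψ.symm b)) = ι' (ψ.symm a) * ι' (ψ.symm b) :=
        (hι'.mul _ _).trans (hT'.1 _ _)
      rw [h2, hψ, h3, orbit_mul, ← hψ']
    refine ⟨ρ u, ?_⟩
    rw [← hψ', ← h1] at hu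
    have h4 := congrArg ρ hu
    have h5 : ∀ x, ρ (ι x) = x := hι.left_inv
    simp only [← deformCoeff_embeds hι] at h4
    rw [map_sub, map_smul, map_sum, map_smul, h5] at h4
    simp only [map_smul, h5] at h4
    exact h4

end Realization

end FoMp
end

noncomputable section
namespace FoMp
variable {K : Type*} [Field K]

/-! ### Twists of realizations and toral deformations -/

/-- A linear equivalence restricts to submodules which correspond to each other. -/
lemma exists_restrict_equiv {S U V : Type*} [CommRing S] [Ring U] [Algebra S U] [Ring V] [Algebra S V]
    {a : V →ₗ[S] U} {b : U →ₗ[S] V} (hba : ∀ x, b (a x) = x) (hab : ∀ x, a (b x) = x)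
    (p : Subalgebra S V) (q : Subalgebra S U) (ha : ∀ x ∈ p, a x ∈ q) (hb : ∀ x ∈ q, b x ∈ p) :
    ∃ ψ : p ≃ₗ[S] q, ∀ x, q.val (ψ x) = a (p.val x) :=
  ⟨{ toFun x := ⟨a x.1, ha _ x.2⟩
     map_add' _ _ := Subtype.ext (map_add a _ _)
     map_smul' c _ := Subtype.ext (map_smul a c _)
     invFun x := ⟨b x.1, hb _ x.2⟩
     left_inv _ := Subtype.ext (hba _)
     right_inv _ := Subtype.ext (hab _) }, fun _ => rfl⟩

lemma HopfStr.embeds_id {U : Type*} [Ring U] [Algebra K⟦X⟧ U] [IsAdicComplete (hId K) U]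
    (H : HopfStr K U) : H.Embeds H (AlgHom.id K⟦X⟧ U).toLinearMap LinearMap.id :=
  ⟨fun _ => rfl, fun _ _ => rfl, rfl, fun _ => cmap_id _, fun _ => rfl, fun _ => rfl⟩

namespace Realization

variable {n : ℕ} {A : Matrix (Fin n) (Fin n) ℤ} {d : Fin n → ℕ} {P P' : Matrix (Fin n) (Fin n) K⟦X⟧}
  {𝔥 𝔥' : Type*} [AddCommGroup 𝔥]
  [Module K⟦X⟧ 𝔥] [Module.Free K⟦X⟧ 𝔥] [Module.Finite K⟦X⟧ 𝔥] [AddCommGroup 𝔥']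
  [Module K⟦X⟧ 𝔥'] [Module.Free K⟦X⟧ 𝔥'] [Module.Finite K⟦X⟧ 𝔥'] {R : Realization P 𝔥}
  {R' : Realization P' 𝔥'} [CharZero K]

lemma exists_isTwRep (hA : IsSymmetrizedCartan A d) (hP : IsCartanType A d P)
    (hP' : IsCartanType A d P') (D : Twist R' R) (O : R.TorusOps (R.T A d) (R.E A d) (R.F A d)) :
    ∃ Ψ, O.IsTwRep D (R'.T A d) (R'.E A d) (R'.F A d) Ψ :=
  have h := O.sat_tw D (sat_U hA hP)
  ⟨lift hA hP' h, fun x => LinearMap.congr_fun (lift_T hA hP' h x),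
    fun i => LinearMap.congr_fun (lift_E hA hP' h i), fun i => LinearMap.congr_fun (lift_F hA hP' h i)⟩

theorem Twist.isoDeform (hA : IsSymmetrizedCartan A d) (hP : IsCartanType A d P)
    (hP' : IsCartanType A d P') (D : Twist R' R) :
    IsoDeformG A d R' R D.χ ∧ IsoDeformP A d R' R D.χ ∧ IsoDeformM A d R' R D.χ := by
  obtain ⟨O⟩ := nonempty_torusOps (R := R) hA hP
  obtain ⟨O'⟩ := nonempty_torusOps (R := R') hA hP'
  obtain ⟨Ψ, hΨ⟩ := exists_isTwRep hA hP hP' D O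
  obtain ⟨Ψ', hΨ'⟩ := exists_isTwRep hA hP' hP D.symm O'
  have h1 : ∀ x, orbit Ψ' (orbit Ψ x) = x :=
    orbit_orbit (O' := O') hΨ hΨ' D.f.symm_apply_apply fun _ _ => rfl
  have h2 : ∀ x, orbit Ψ (orbit Ψ' x) = x :=
    orbit_orbit (O' := O) hΨ' hΨ D.f.apply_symm_apply fun x y => by
      change _ = - -D.χ.form (D.f (D.f.symm x)) (D.f (D.f.symm y))
      rw [neg_neg, LinearEquiv.apply_symm_apply, LinearEquiv.apply_symm_apply]
  have hT := stdT_hopfU (R := R) hA hP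
  have hE := stdE_hopfU (R := R) hA hP
  have hF := stdF_hopfU (R := R) hA hP
  have hT' := stdT_hopfU (R := R') hA hP'
  have hE' := stdE_hopfU (R := R') hA hP'
  have hF' := stdF_hopfU (R := R') hA hP'
  obtain ⟨π, πt, πe, πf⟩ := exists_pi (R := R) hA hP
  refine ⟨?_, ?_, ?_⟩
  · let ψ : R'.U A d ≃ₗ[K⟦X⟧] R.U A d :=
      LinearEquiv.ofLinearMap (orbit Ψ) (orbit Ψ') (LinearMap.ext h2) (LinearMap.ext h1)
    refine ⟨R.hopfU hA hP, (R'.hopfU hA hP').transport ψ, R'.hopfU hA hP', hT, hE, hF, hT', hE', hF',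
      ?_, ⟨HopfStr.transportIso _ ψ⟩⟩
    refine isToralDeformation_transport O O' hT hE hF hT' hE' hF' πt πe πf hΨ (HopfStr.embeds_id _)
      (HopfStr.embeds_id _) ψ (fun _ => rfl) (fun _ => rfl) ?_
    rintro _ (⟨i, rfl⟩ | ⟨i, rfl⟩)
    exacts [πe i, πf i]
  · obtain ⟨HV, ρ, hι⟩ := exists_hopfP (R := R) hA hP
    obtain ⟨HV', ρ', hι'⟩ := exists_hopfP (R := R') hA hP'
    obtain ⟨ψ, hψ⟩ := exists_restrict_equiv h1 h2 (R'.BorelP A d) (R.BorelP A d)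
      (fun _ hx => orbit_mem_pos hΨ hx) (fun _ hx => orbit_mem_pos hΨ' hx)
    refine ⟨HV, HV'.transport ψ, HV', hT.of_embeds hι fun _ => rfl,
      hE.of_embeds hι (fun _ => rfl) fun _ => rfl, hT'.of_embeds hι' fun _ => rfl,
      hE'.of_embeds hι' (fun _ => rfl) fun _ => rfl, ?_, ⟨HopfStr.transportIso _ ψ⟩⟩
    refine isToralDeformation_transport O O' hT hE hF hT' hE' hF' πt πe πf hΨ hι hι' ψ hψ
      (fun _ => rfl) ?_
    rintro _ ⟨i, rfl⟩
    exact πe i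
  · obtain ⟨HV, ρ, hι⟩ := exists_hopfM (R := R) hA hP
    obtain ⟨HV', ρ', hι'⟩ := exists_hopfM (R := R') hA hP'
    obtain ⟨ψ, hψ⟩ := exists_restrict_equiv h1 h2 (R'.BorelM A d) (R.BorelM A d)
      (fun _ hx => orbit_mem_neg hΨ hx) (fun _ hx => orbit_mem_neg hΨ' hx)
    refine ⟨HV, HV'.transport ψ, HV', hT.of_embeds hι fun _ => rfl,
      hF.of_embeds hι (fun _ => rfl) fun _ => rfl, hT'.of_embeds hι' fun _ => rfl,
      hF'.of_embeds hι' (fun _ => rfl) fun _ => rfl, ?_, ⟨HopfStr.transportIso _ ψ⟩⟩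
    refine isToralDeformation_transport O O' hT hE hF hT' hE' hF' πt πe πf hΨ hι hι' ψ hψ
      (fun _ => rfl) ?_
    rintro _ ⟨i, rfl⟩
    exact πf i

end Realization

end FoMp
end

noncomputable section
namespace FoMp
variable {K : Type*} [Field K]

/-! ### Existence of twists -/

/-- A family which is independent modulo `ħ` has a dual family of functionals. -/
lemma LinIndepModH.exists_dual {ι M : Type*} [Fintype ι] [DecidableEq ι] [AddCommGroup M]
    [Module K⟦X⟧ M] [Module.Free K⟦X⟧ M] [Module.Finite K⟦X⟧ M] {v : ι → M} (h : LinIndepModH K v) :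
    ∃ g : M →ₗ[K⟦X⟧] ι → K⟦X⟧, ∀ i, g (v i) = Pi.single i 1 := by
  classical
  let b := Module.Free.chooseBasis K⟦X⟧ M
  let m : Matrix (Module.Free.ChooseBasisIndex K⟦X⟧ M) ι K⟦X⟧ := Matrix.of fun k i => b.repr (v i) k
  have inj : Function.Injective (Matrix.toLin' (m.map constantCoeff)) := by
    rw [injective_iff_map_eq_zero]
    intro c hc
    refine funext (h c ?_)
    have h1 : ∀ k, ∃ r, b.repr (∑ i, (C (c i) : K⟦X⟧) • v i) k = X * r := fun k => by
      refine X_dvd_iff.2 ?_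
      have := congrFun hc k
      simpa [Matrix.mulVec, dotProduct, m, mul_comm] using this
    choose r hr using h1
    refine ⟨b.equivFun.symm r, b.equivFun.injective ?_⟩
    rw [map_smul, LinearEquiv.apply_symm_apply]
    exact funext hr
  obtain ⟨g₀, hg₀⟩ := LinearMap.exists_leftInverse_of_injective _ (LinearMap.ker_eq_bot.2 inj)
  let N := LinearMap.toMatrix' g₀
  have hN : N * m.map constantCoeff = 1 := by
    have := congrArg LinearMap.toMatrix' hg₀
    rwa [LinearMap.toMatrix'_comp, LinearMap.toMatrix'_toLin', LinearMap.toMatrix'_id] at this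
  let Q := N.map (C (R := K)) * m
  have hQ : Q.map constantCoeff = 1 := by
    rw [Matrix.map_mul, Matrix.map_map, ← hN]
    congr 1
  have hdet : IsUnit Q.det := by
    rw [PowerSeries.isUnit_iff_constantCoeff, RingHom.map_det, RingHom.mapMatrix_apply, hQ, Matrix.det_one]
    exact isUnit_one
  refine ⟨Matrix.toLin' (Q⁻¹ * N.map C) ∘ₗ b.equivFun.toLinearMap, fun i => ?_⟩
  have h2 : b.equivFun (v i) = m.mulVec (Pi.single i 1) := by
    ext k
    simp [m]
  rw [LinearMap.comp_apply, LinearEquiv.coe_coe, h2, Matrix.toLin'_apply, Matrix.mulVec_mulVec,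
    Matrix.mul_assoc, Matrix.nonsing_inv_mul _ hdet, Matrix.one_mulVec]

variable {n : ℕ} {A : Matrix (Fin n) (Fin n) ℤ} {d : Fin n → ℕ} {P P' : Matrix (Fin n) (Fin n) K⟦X⟧}

lemma isCartanType_DA [CharZero K] (hA : IsSymmetrizedCartan A d) : IsCartanType A d (DA K A d) := by
  ext1 i j
  have h : DA K A d j i = DA K A d i j := congrArg (Int.cast (R := K⟦X⟧)) (hA.symm j i)
  rw [Matrix.smul_apply, Matrix.add_apply, Matrix.transpose_apply, h, ← two_mul, smul_eq_mul, ← mul_assoc,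
    ← map_ofNat (C (R := K)) 2, ← map_mul, inv_mul_cancel₀ two_ne_zero, map_one, one_mul]

lemma IsCartanType.transpose_sub [CharZero K] (hP : IsCartanType A d P) (hP' : IsCartanType A d P') :
    (P' - P).transpose = -(P' - P) := by
  ext1 i j
  simp only [Matrix.transpose_apply, Matrix.sub_apply, Matrix.neg_apply]
  linear_combination hP'.add_eq i j - hP.add_eq i j

namespace Realization

variable {𝔥 : Type*} [AddCommGroup 𝔥] [Module K⟦X⟧ 𝔥] [Module.Free K⟦X⟧ 𝔥] [Module.Finite K⟦X⟧ 𝔥]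
  {R : Realization P 𝔥}

/-- The form of `Alt^S(𝔥)` with prescribed values on the `T_i^+`. -/
def AltS.ofMatrix (γ : 𝔥 →ₗ[K⟦X⟧] Fin n → K⟦X⟧) (hγ : ∀ i, γ (R.Tm i) = -γ (R.Tp i))
    (Q : Matrix (Fin n) (Fin n) K⟦X⟧) (hQ : Q.transpose = -Q) : R.AltS where
  form := (Matrix.toLinearMap₂' K⟦X⟧ Q).compl₁₂ γ γ
  antisymm x y := by
    simp only [LinearMap.compl₁₂_apply, Matrix.toLinearMap₂'_apply']
    rw [Matrix.dotProduct_mulVec, ← Matrix.mulVec_transpose, hQ, Matrix.neg_mulVec, neg_dotProduct,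
      dotProduct_comm]
  S_left i x := by
    have h : γ (R.S i) = 0 := by rw [S, map_smul, map_add, hγ, add_neg_cancel, smul_zero]
    simp [h]
  S_right i x := by
    have h : γ (R.S i) = 0 := by rw [S, map_smul, map_add, hγ, add_neg_cancel, smul_zero]
    simp [h]

lemma AltS.ofMatrix_Tp {γ : 𝔥 →ₗ[K⟦X⟧] Fin n → K⟦X⟧} (hγ : ∀ i, γ (R.Tm i) = -γ (R.Tp i))
    (Q : Matrix (Fin n) (Fin n) K⟦X⟧) (hQ : Q.transpose = -Q) (h : ∀ i, γ (R.Tp i) = Pi.single i 1)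
    (i j : Fin n) : (AltS.ofMatrix γ hγ Q hQ).form (R.Tp i) (R.Tp j) = Q i j := by
  have h1 : (AltS.ofMatrix γ hγ Q hQ).form (R.Tp i) (R.Tp j) =
      Matrix.toLinearMap₂' K⟦X⟧ Q (γ (R.Tp i)) (γ (R.Tp j)) := rfl
  rw [h1, h, h, Matrix.toLinearMap₂'_apply']
  simp

/-- The difference of two coordinates of the `T_i^±`. -/
lemma exists_antidual {g : 𝔥 →ₗ[K⟦X⟧] Fin n ⊕ Fin n → K⟦X⟧}
    (hg : ∀ i, g (Sum.elim R.Tp R.Tm i) = Pi.single i 1) :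
    ∃ γ : 𝔥 →ₗ[K⟦X⟧] Fin n → K⟦X⟧, (∀ i, γ (R.Tm i) = -γ (R.Tp i)) ∧
      ∀ i, γ (R.Tp i) = Pi.single i 1 := by
  have hp : ∀ i, g (R.Tp i) = Pi.single (Sum.inl i) 1 := fun i => hg (Sum.inl i)
  have hm : ∀ i, g (R.Tm i) = Pi.single (Sum.inr i) 1 := fun i => hg (Sum.inr i)
  refine ⟨(LinearMap.funLeft _ _ Sum.inl - LinearMap.funLeft _ _ Sum.inr) ∘ₗ g, fun i => ?_, fun i => ?_⟩ <;>
    ext j <;> simp [hp, hm, LinearMap.funLeft_apply, Pi.single_apply]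

variable [CharZero K]

/-- The deformation of a realization by a form. -/
def AltS.deform (χ : R.AltS) (h : ∀ i j, P' i j = P i j + χ.form (R.Tp i) (R.Tp j)) :
    Realization P' 𝔥 where
  Tp := R.Tp
  Tm := R.Tm
  α j := R.α j + χ.form.flip (R.Tp j)
  α_Tp i j := by rw [LinearMap.add_apply, R.α_Tp, LinearMap.flip_apply, h]
  α_Tm i j := by rw [LinearMap.add_apply, R.α_Tm, LinearMap.flip_apply, χ.Tm_left, ← χ.antisymm, h]
  indep_S := R.indep_S

/-- The twist between a realization and its deformation. -/
def AltS.twist (χ : R.AltS) (h : ∀ i j, P' i j = P i j + χ.form (R.Tp i) (R.Tp j)) :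
    Twist (χ.deform h) R where
  f := .refl _ _
  χ := χ
  Tp _ := rfl
  Tm _ := rfl
  α _ _ := rfl

/-- A split minimal realization is a twist of the standard one. -/
lemma exists_twist_drinfeld (hA : IsSymmetrizedCartan A d) (hP : IsCartanType A d P) (hs : R.IsSplit)
    (hm : R.IsMinimal) : Nonempty (Twist R (drinfeldRealization K A d)) := by
  obtain ⟨g, hg⟩ := hs.exists_dual
  have hp : ∀ i, g (R.Tp i) = (drinfeldRealization K A d).Tp i := fun i => hg (Sum.inl i)
  have hn : ∀ i, g (R.Tm i) = (drinfeldRealization K A d).Tm i := fun i => hg (Sum.inr i)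
  let s := Fintype.linearCombination K⟦X⟧ (Sum.elim R.Tp R.Tm)
  have h1 : g ∘ₗ s = .id := by
    refine LinearMap.pi_ext' fun i => LinearMap.ext_ring ?_
    simpa [s] using hg i
  have h2 : Submodule.span K⟦X⟧ (Set.range (Sum.elim R.Tp R.Tm)) = ⊤ := by
    rw [Set.Sum.elim_range]
    exact hm
  have h3 : s ∘ₗ g = .id := by
    refine LinearMap.ext_on_range h2 fun i => ?_
    rw [LinearMap.comp_apply, hg]
    simp [s]
  obtain ⟨γ, hγ, hγ'⟩ := exists_antidual (R := drinfeldRealization K A d) (g := .id)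
    (by rintro (i | i) <;> rfl)
  have hQ := (isCartanType_DA hA).transpose_sub hP
  let χ := AltS.ofMatrix γ hγ (P - DA K A d) hQ
  have hχ : ∀ i j, χ.form ((drinfeldRealization K A d).Tp i) ((drinfeldRealization K A d).Tp j) =
      P i j - DA K A d i j := AltS.ofMatrix_Tp hγ _ hQ hγ'
  refine ⟨⟨LinearEquiv.ofLinearMap g s h1 h3, χ, hp, hn, fun j => ?_⟩⟩
  suffices h : R.α j = ((drinfeldRealization K A d).α j + χ.form.flip ((drinfeldRealization K A d).Tp j)) ∘ₗ g
    from LinearMap.congr_fun h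
  refine LinearMap.ext_on_range h2 ?_
  rintro (i | i)
  · simp only [Sum.elim_inl, LinearMap.comp_apply, LinearMap.add_apply, LinearMap.flip_apply, hp, R.α_Tp,
      Realization.α_Tp, hχ]
    abel
  · simp only [Sum.elim_inr, LinearMap.comp_apply, LinearMap.add_apply, LinearMap.flip_apply, hn, R.α_Tm,
      Realization.α_Tm, χ.Tm_left, χ.antisymm (Tp _ i), hχ]
    abel

end Realization
end FoMp
end

open FoMp in
theorem mainTheorem7 {K : Type*} [Field K] [CharZero K] {n : ℕ}
    (A : Matrix (Fin n) (Fin n) ℤ) (d : Fin n → ℕ) (hA : IsSymmetrizedCartan A d)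
    (P P' : Matrix (Fin n) (Fin n) K⟦X⟧) (hP : IsCartanType A d P) (hP' : IsCartanType A d P')
    {𝔥 : Type*} [AddCommGroup 𝔥] [Module K⟦X⟧ 𝔥] [Module.Free K⟦X⟧ 𝔥] [Module.Finite K⟦X⟧ 𝔥]
    (R : Realization P 𝔥) :
    -- deforming to a split realization `R'` of `P'` of the same rank (on the same `𝔥`)
    (R.IsSplit →
      ∃ (R' : Realization P' 𝔥) (Xo : Matrix (Fin n) (Fin n) K⟦X⟧) (χ : R.AltS),
        R'.IsSplit ∧ Xo.transpose = -Xo ∧ (∀ i j, Xo i j = χ.form (R.Tp i) (R.Tp j)) ∧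
        P' = P + Xo ∧
        IsoDeformG A d R' R χ ∧ IsoDeformP A d R' R χ ∧ IsoDeformM A d R' R χ) ∧
    -- split minimal realizations: deformations of Drinfeld's standard double
    (R.IsSplit → R.IsMinimal →
      ∃ χ : (drinfeldRealization K A d).AltS,
        IsoDeformG A d R (drinfeldRealization K A d) χ ∧
        IsoDeformP A d R (drinfeldRealization K A d) χ ∧
        IsoDeformM A d R (drinfeldRealization K A d) χ) := by
  constructor
  · intro hs
    obtain ⟨g, hg⟩ := hs.exists_dual
    obtain ⟨γ, hγ, hγ'⟩ := Realization.exists_antidual hg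
    have hQ := hP.transpose_sub hP'
    have hχ := Realization.AltS.ofMatrix_Tp hγ (P' - P) hQ hγ'
    have h : ∀ i j, P' i j =
        P i j + (Realization.AltS.ofMatrix γ hγ (P' - P) hQ).form (R.Tp i) (R.Tp j) := fun i j => by
      rw [hχ, Matrix.sub_apply, add_sub_cancel]
    exact ⟨Realization.AltS.deform _ h, P' - P, _, hs, hQ, fun i j => (hχ i j).symm,
      (add_sub_cancel _ _).symm, (Realization.AltS.twist _ h).isoDeform hA hP hP'⟩
  · intro hs hm
    obtain ⟨D⟩ := Realization.exists_twist_drinfeld hA hP hs hm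
    exact ⟨D.χ, D.isoDeform hA (isCartanType_DA hA) hP⟩
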